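/- **Setting.** Let $q\in\mathbb C\setminus\{0,\pm1\}$ (generic or a root of unity), fix a square root of $q$, and let $\mathcal A=\mathcal U_q(sl_2)$ with coproduct $\Delta$, antipode $S$ and universal $R$-matrix $R=q^{H\otimes H/2}\sum_n \frac{q^{n(n-1)/2}(q-q^{-1})^n}{[n]!}E^n\otimes F^n=\sum_i a_i\otimes b_i$. $Phys(\mathcal A)$ is the set of (classes of) finite-dimensional irreducible spin (type 1) representations $\alpha$ such that the trivial representation $0$ is a direct summand of $\alpha\otimes\bar\alpha$, where $\bar\alpha={}^t\alpha\circ S$. For $\alpha,\beta,\gamma\in Phys(\mathcal A)$ let $N_{\alpha\beta}^\gamma$ be the multiplicity of $\gamma$ as a direct summand of $\alpha\otimes\beta$. Let $\phi^{\alpha\beta}_\gamma:\gamma\to\alpha\otimes\beta$, $\psi_{\alpha\beta}^\gamma:\alpha\otimes\beta\to\gamma$ be intertwiners, zero if $N_{\alpha\beta}^\gamma=0$, with $\psi_{\alpha\beta}^\gamma\phi^{\alpha\beta}_\gamma=\mathrm{id}_\gamma$ otherwise, equal to the canonical identifications if $\alpha$ or $\beta$ is $0$. The truncated tensor product is the image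 of ${\bf 1}^{\alpha\otimes\beta}=\sum_{\gamma\in Phys}\phi^{\alpha\beta}_\gamma\psi_{\alpha\beta}^\gamma$ (extended to the $\bar\alpha$ by $\bar\alpha\simeq\alpha$ and iterated along parenthesized words); an element $\xi$ acts on it by $\xi^{\alpha\otimes\beta}=\sum_\gamma\phi^{\alpha\beta}_\gamma\xi^\gamma\psi_{\alpha\beta}^\gamma$. $\Theta$ denotes the intertwiners between different parenthesings of the same word (built from the $6j$-symbols), in particular $\Theta^{\alpha\beta\gamma}:(\alpha\otimes\beta)\otimes\gamma\to\alpha\otimes(\beta\otimes\gamma)$, $\Theta^{-1}$ its quasi-inverse, and $R^{\alpha\beta}$ the truncated $R$-matrix. Let $u=\sum_iS(b_i)a_i$, let $v$ be central with $v^2=uS(u)$, and $\mu=uv^{-1}$; square roots $v_\alpha^{1/2}$ are chosen, and $v$, the roots and the intertwiners are normalized by $$P_{12}R^{\alpha\beta}=\sum_\gamma \lambda_{\alpha\beta\gamma}^{1/2}\,\phi^{\beta\alpha}_\gamma\psi_{\alpha\beta}^\gamma,\qquad \lambda_{\alpha\beta\gamma}^{1/2}=v_\alpha^{1/2}v_\beta^{1/2}v_\gamma^{-1/2}.$$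 $A$ and $B$ are matrices such that $\langle\cdot,A\,\cdot\rangle:\bar\alpha\otimes\alpha\to0$ and $1\mapsto\sum_iBe_i\otimes e^i\in\alpha\otimes\bar\alpha$ are intertwiners, normalized by $\sum\theta^{(1)}BS(\theta^{(2)})A\theta^{(3)}=1$, $\sum S(\theta^{-1(1)})A\theta^{-1(2)}BS(\theta^{-1(3)})=1$ and $A=B=1$ for $\alpha=0$. Let $G^{\alpha\beta}=\sum (S(\theta^{-1(12)}_i)\otimes S(\theta^{-1(11)}_i))(S(\theta^{(2)}_j)\otimes S(\theta_j^{(1)}))(A\otimes A)(\theta^{(3)}_j\otimes1)(\theta^{-1(2)}_i\otimes\theta^{-1(3)}_i)$, $f^{\alpha\beta}=\sum_i(S(\theta^{-1(12)}_i)\otimes S(\theta^{-1(11)}_i))\,G^{\alpha\beta}\,(\theta^{-1(2)}_iBS(\theta^{-1(3)}_i))^{\alpha\otimes\beta}$, and $f^{-1}$ its quasi-inverse. $\Gamma$ is the (non-associative) algebra with basis the matrix elements $g^\alpha_{ij}$, $\alpha\in Phys(\mathcal A)$, product $g^\alpha_1g^\beta_2=\sum_\gamma\phi^{\alpha\beta}_\gamma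 g^\gamma\psi^\gamma_{\alpha\beta}$ and $S(g^\alpha_{ij})=g^{\bar\alpha}_{ji}$. Let $\Sigma$ be a compact connected oriented surface, possibly with boundary, with a ciliated triangulation with vertex set $\mathcal V$. Interior edges are taken with both orientations and boundary edges with one; $xy$ is the link from $y$ to $x$, and $<_c$ is the cilium order of the edges at a vertex. $\Lambda$ is the unital non-associative $\mathbb C$-algebra generated by the $u^\alpha(l)^i_j$ ($l$ an oriented link, $\alpha\in Phys(\mathcal A)$) with the relations * $R_{12}u^\alpha(yx)_1u^\beta(yz)_2=u^\beta(yz)_2u^\alpha(yx)_1$ if $yx<_cyz$, and the same with $(S\otimes id)$, $(id\otimes S)$, $(S\otimes S)$ applied to $R$ on the side of $y$ if $y$ is the departure point of the first, the second or both links; * links without a common vertex commute; * $u^\alpha(l)Au^\alpha(-l)=B$ for interior links $l$; * $u^\alpha(l)_1u^\beta(l)_2=\sum_\gamma\phi^{\alpha\beta}_\gamma u^\gamma(l)\psi_{\beta\alpha}^\gamma(f^{\beta\alpha})^{-1}P_{12}$ and $u^0(l)=1$; * $(\prod_{x\in\mathcal V}\Theta_x)\mathcal M_{P_1}=\mathcal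 M_{P_2}$ for two parenthesings of a monomial, where at the vertex $x$ the letter $u^\alpha(l)$ carries $\alpha$, $\bar\alpha$ or $0$ according as $x$ is the end point, the departure point or not a vertex of $l$. The gauge coaction is the unital algebra morphism $\Omega:\Lambda\to\Lambda\otimes\bigotimes_{z\in\mathcal V}\Gamma_z$ with $\Omega(u^\alpha(xy))=g^\alpha_xu^\alpha(xy)S(g^\alpha_y)$. Along a path put $\epsilon(x_i)=-1$ if $x_{i-1}x_i<_cx_ix_{i+1}$ and $\epsilon(x_i)=1$ if $x_ix_{i+1}<_cx_{i-1}x_i$. For a simple open path $P=[x_n,\dots,x_0]$ let $$u^\alpha_P=v_\alpha^{\frac12\sum_{i=1}^{n-1}\epsilon(x_i)}\,u^\alpha(x_nx_{n-1})A\,u^\alpha(x_{n-1}x_{n-2})A\cdots A\,u^\alpha(x_1x_0),$$ and for a simple loop $C=[x_{n+1}=x_0,x_n,\dots,x_0]$, $n\ge2$, let $$u^\alpha_C=v_\alpha^{\frac12(\sum_{i=1}^n\epsilon(x_i)-\epsilon(x_0))}\,u^\alpha(x_0x_n)A\,u^\alpha(x_nx_{n-1})A\cdots A\,u^\alpha(x_1x_0),\qquad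 W^\alpha_C=tr_\alpha(S(A)\,\mu\,u^\alpha_C).$$ **Proposition.** For every simple loop $C$ and all $\alpha,\beta\in Phys(\mathcal A)$: 1. $\Omega$ exists, is unique, and $W^\alpha_C$ is gauge invariant: $\Omega(W^\alpha_C)=W^\alpha_C\otimes1$. 2. $W^\alpha_C$ does not depend on the departure point of $C$. 3. $W^\alpha_CW^\beta_C=\sum_{\gamma\in Phys(\mathcal A)}N_{\alpha\beta}^\gamma W^\gamma_C$ (a finite sum). 4. For every simple open path $P$: $(u^\alpha_P)_1(u^\beta_P)_2=\sum_\gamma\phi^{\alpha\beta}_\gamma\,u^\gamma_P\,\psi^\gamma_{\beta\alpha}(f^{\beta\alpha})^{-1}P_{12}$. -/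

import Mathlib

open scoped Kronecker TensorProduct

noncomputable section

namespace QGauge

/-! ### Spin representations of `U_q(sl₂)`

Generators `E, F, K^{±1}`, with `K E = q² E K`, `K F = q⁻² F K`, `E F - F E = (K - K⁻¹)/(q - q⁻¹)`,
`Δ E = 1 ⊗ E + E ⊗ K`, `Δ F = K⁻¹ ⊗ F + F ⊗ 1`, `Δ K = K ⊗ K`, `S E = -E K⁻¹`, `S F = -K F`,
`S K = K⁻¹`; representations are given by the matrices of the generators in a weight basis. -/

/-- The `q`-integer `[n] = (qⁿ - q⁻ⁿ)/(q - q⁻¹)`. -/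
def qInt (q : ℂ) (n : ℕ) : ℂ := (q ^ n - q⁻¹ ^ n) / (q - q⁻¹)

/-- The `q`-factorial `[n]!`. -/
def qFact (q : ℂ) (n : ℕ) : ℂ := ∏ k ∈ Finset.range n, qInt q (k + 1)

/-- The matrices of the generators on a space with basis `ι`: the basis vector `i` has weight
`wt i`, so that `K` acts on it by `q ^ wt i`. -/
structure WeightModule (ι : Type) where
  wt : ι → ℤ
  E : Matrix ι ι ℂ
  F : Matrix ι ι ℂ

namespace WeightModule

variable {ι κ : Type} [Fintype ι] [DecidableEq ι] [Fintype κ] [DecidableEq κ]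

/-- The matrix of `K`. -/
def K (q : ℂ) (X : WeightModule ι) : Matrix ι ι ℂ := Matrix.diagonal fun i => q ^ X.wt i

/-- The matrix of `K⁻¹`. -/
def Kinv (q : ℂ) (X : WeightModule ι) : Matrix ι ι ℂ := Matrix.diagonal fun i => q ^ (-X.wt i)

/-- The tensor product of two representations, through the coproduct. -/
def tensor (q : ℂ) (X : WeightModule ι) (Y : WeightModule κ) : WeightModule (ι × κ) where
  wt p := X.wt p.1 + Y.wt p.2
  E := (1 : Matrix ι ι ℂ) ⊗ₖ Y.E + X.E ⊗ₖ Y.K q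
  F := X.Kinv q ⊗ₖ Y.F + X.F ⊗ₖ (1 : Matrix κ κ ℂ)

/-- The contragredient representation `ξ ↦ ᵗ(S ξ)`, in the dual basis. -/
def dual (q : ℂ) (X : WeightModule ι) : WeightModule ι where
  wt i := -X.wt i
  E := (-(X.E * X.Kinv q)).transpose
  F := (-(X.K q * X.F)).transpose

/-- `T : X → Y` commutes with the action of the generators. -/
def IsIntertwiner (q : ℂ) (X : WeightModule ι) (Y : WeightModule κ) (T : Matrix κ ι ℂ) : Prop :=
  T * X.E = Y.E * T ∧ T * X.F = Y.F * T ∧ T * X.K q = Y.K q * T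

/-- Irreducibility: the only stable subspaces are `0` and the whole (nonzero) space. -/
def IsIrreducible (q : ℂ) (X : WeightModule ι) : Prop :=
  Nonempty ι ∧ ∀ W : Submodule ℂ (ι → ℂ),
    (∀ w ∈ W, X.E.mulVec w ∈ W ∧ X.F.mulVec w ∈ W ∧ (X.K q).mulVec w ∈ W) → W = ⊥ ∨ W = ⊤

/-- The universal `R`-matrix
`q^{H ⊗ H / 2} ∑ₙ q^{n(n-1)/2} (q - q⁻¹)ⁿ / [n]! Eⁿ ⊗ Fⁿ` on `X ⊗ Y`, where `s` is a square root
of `q`. The operator `E` is nilpotent on a weight module, and the sum stops at its dimension. -/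
def univR (q s : ℂ) (X : WeightModule ι) (Y : WeightModule κ) : Matrix (ι × κ) (ι × κ) ℂ :=
  (Matrix.diagonal fun p : ι × κ => s ^ (X.wt p.1 * Y.wt p.2)) *
    ∑ n ∈ Finset.range (Fintype.card ι),
      (q ^ (n * (n - 1) / 2) * (q - q⁻¹) ^ n / qFact q n) • ((X.E ^ n) ⊗ₖ (Y.F ^ n))

end WeightModule

open WeightModule

/-- The representation of highest weight `a` (spin `a / 2`), of dimension `a + 1`:
`K eᵢ = q^{a-2i} eᵢ`, `F eᵢ = eᵢ₊₁`, `E eᵢ = [i][a+1-i] eᵢ₋₁`. -/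
def spin (q : ℂ) (a : ℕ) : WeightModule (Fin (a + 1)) where
  wt i := (a : ℤ) - 2 * (i : ℤ)
  E := Matrix.of fun i j => if (i : ℕ) + 1 = j then qInt q j * qInt q (a + 1 - j) else 0
  F := Matrix.of fun i j => if (i : ℕ) = j + 1 then 1 else 0

/-- `spin q a` is physical: it is irreducible, and the trivial representation `0` is a direct
summand of `α ⊗ ᾱ`, i.e. the composite of some `0 → α ⊗ ᾱ → 0` is not zero. -/
def IsPhys (q : ℂ) (a : ℕ) : Prop :=
  IsIrreducible q (spin q a) ∧
    ∃ (f : Matrix (Fin (a + 1) × Fin (a + 1)) (Fin 1) ℂ)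
      (g : Matrix (Fin 1) (Fin (a + 1) × Fin (a + 1)) ℂ),
      IsIntertwiner q (spin q 0) (tensor q (spin q a) (dual q (spin q a))) f ∧
      IsIntertwiner q (tensor q (spin q a) (dual q (spin q a))) (spin q 0) g ∧ g * f ≠ 0

/-- The physical representations. -/
def Phys (q : ℂ) : Type := {a : ℕ // IsPhys q a}

/-- The dimension of a physical representation. -/
abbrev Phys.dim {q : ℂ} (α : Phys q) : ℕ := α.1 + 1

/-- The representation with a given label. -/
abbrev Phys.rep {q : ℂ} (α : Phys q) : WeightModule (Fin α.dim) := spin q α.1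

theorem isPhys_zero (q : ℂ) : IsPhys q 0 := by
  have hE : (spin q 0).E = 0 := by
    ext i j; fin_cases i; fin_cases j; simp [spin]
  have hF : (spin q 0).F = 0 := by
    ext i j; fin_cases i; fin_cases j; simp [spin]
  have hw : (spin q 0).wt = 0 := by
    ext i; fin_cases i; simp [spin]
  have hK : (spin q 0).K q = 1 := by simp [WeightModule.K, hw]
  have hKi : (spin q 0).Kinv q = 1 := by simp [WeightModule.Kinv, hw]
  have hdE : (dual q (spin q 0)).E = 0 := by simp [WeightModule.dual, hE]
  have hdF : (dual q (spin q 0)).F = 0 := by simp [WeightModule.dual, hF]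
  have htE : (tensor q (spin q 0) (dual q (spin q 0))).E = 0 := by
    simp [WeightModule.tensor, hE, hdE]
  have htF : (tensor q (spin q 0) (dual q (spin q 0))).F = 0 := by
    simp [WeightModule.tensor, hF, hdF]
  have htK : (tensor q (spin q 0) (dual q (spin q 0))).K q = 1 := by
    simp [WeightModule.K, WeightModule.tensor, WeightModule.dual, hw]
  refine ⟨⟨⟨0⟩, fun W _ => ?_⟩, Matrix.of fun _ _ => 1, Matrix.of fun _ _ => 1,
    ⟨?_, ?_, ?_⟩, ⟨?_, ?_, ?_⟩, ?_⟩
  · by_cases h : W = ⊥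
    · exact Or.inl h
    · right
      obtain ⟨w, hw, hne⟩ := (Submodule.ne_bot_iff W).1 h
      rw [Submodule.eq_top_iff']
      intro x
      have h0 : w 0 ≠ 0 := fun h0 => hne (by ext i; fin_cases i; simpa using h0)
      have hx : x = (x 0 / w 0) • w := by
        ext i; fin_cases i; simp [h0]
      rw [hx]; exact W.smul_mem _ hw
  · rw [hE, htE]; simp
  · rw [hF, htF]; simp
  · rw [hK, htK]; simp
  · rw [hE, htE]; simp
  · rw [hF, htF]; simp
  · rw [hK, htK]; simp
  · intro h
    have := congrFun (congrFun h 0) 0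
    simp [Matrix.mul_apply] at this

/-- The trivial representation. -/
def Phys.zero (q : ℂ) : Phys q := ⟨0, isPhys_zero q⟩

/-- The fusion coefficient `N_{αβ}^γ`: the multiplicity of `γ` as a direct summand of `α ⊗ β`. -/
def fusion {q : ℂ} (α β γ : Phys q) : ℕ :=
  sSup {n | ∃ (f : Fin n → Matrix (Fin α.dim × Fin β.dim) (Fin γ.dim) ℂ)
    (g : Fin n → Matrix (Fin γ.dim) (Fin α.dim × Fin β.dim) ℂ),
    (∀ i, IsIntertwiner q γ.rep (tensor q α.rep β.rep) (f i)) ∧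
    (∀ i, IsIntertwiner q (tensor q α.rep β.rep) γ.rep (g i)) ∧
    ∀ i j, g i * f j = if i = j then 1 else 0}

/-- The isomorphism `α ≃ ᾱ`, `eᵢ ↦ (-1)ⁱ q^{-i(a-i+1)} e^{a-i}`. -/
def dualIso {q : ℂ} (α : Phys q) : Matrix (Fin α.dim) (Fin α.dim) ℂ :=
  Matrix.of fun i j => if (i : ℕ) + j = α.1 then (-1) ^ (j : ℕ) * q⁻¹ ^ ((j : ℕ) * (α.1 - j + 1)) else 0

/-- The inverse of `dualIso`. -/
def dualIsoInv {q : ℂ} (α : Phys q) : Matrix (Fin α.dim) (Fin α.dim) ℂ :=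
  Matrix.of fun i j => if (i : ℕ) + j = α.1 then (-1) ^ (i : ℕ) * q ^ ((i : ℕ) * (α.1 - i + 1)) else 0

/-- `S(M)` in the representation `α`, i.e. `ᵗM` in `ᾱ`, where `M` acts on `α` by the given matrix
and on `ᾱ ≃ α` accordingly. -/
def antipode {q : ℂ} (α : Phys q) (M : Matrix (Fin α.dim) (Fin α.dim) ℂ) :
    Matrix (Fin α.dim) (Fin α.dim) ℂ := (dualIso α * M * dualIsoInv α).transpose

/-- The element `u = ∑ S(bᵢ) aᵢ`, where `R = ∑ aᵢ ⊗ bᵢ`, in the representation `α`. -/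
def drinfeldU {q : ℂ} (s : ℂ) (α : Phys q) : Matrix (Fin α.dim) (Fin α.dim) ℂ :=
  Matrix.of fun i j => ∑ k, univR q s α.rep (dual q α.rep) (k, k) (j, i)

/-! ### Truncated tensor products -/

/-- A signed label: `(true, α)` stands for `α` and `(false, α)` for `ᾱ`. -/
abbrev SLabel (q : ℂ) : Type := Bool × Phys q

/-- The label `α`. -/
abbrev posL {q : ℂ} (α : Phys q) : SLabel q := (true, α)

/-- The label `ᾱ`. -/
abbrev negL {q : ℂ} (α : Phys q) : SLabel q := (false, α)

/-- The representation with a given signed label. -/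
def SLabel.rep {q : ℂ} (X : SLabel q) : WeightModule (Fin X.2.dim) :=
  if X.1 then X.2.rep else dual q X.2.rep

/-- The isomorphism from the underlying physical representation. -/
def SLabel.iso {q : ℂ} (X : SLabel q) : Matrix (Fin X.2.dim) (Fin X.2.dim) ℂ :=
  if X.1 then 1 else dualIso X.2

/-- The inverse isomorphism. -/
def SLabel.isoInv {q : ℂ} (X : SLabel q) : Matrix (Fin X.2.dim) (Fin X.2.dim) ℂ :=
  if X.1 then 1 else dualIsoInv X.2

/-- Matrices for the inclusions `φ^{αβ}_γ : γ → α ⊗ β` and the projections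
`ψ_{αβ}^γ : α ⊗ β → γ`. -/
structure CGMatrices (q : ℂ) where
  phi : ∀ α β γ : Phys q, Matrix (Fin α.dim × Fin β.dim) (Fin γ.dim) ℂ
  psi : ∀ α β γ : Phys q, Matrix (Fin γ.dim) (Fin α.dim × Fin β.dim) ℂ

/-- Multi-indices for a word of signed labels. -/
abbrev Idx {q : ℂ} {n : ℕ} (w : Fin n → SLabel q) : Type := ∀ k, Fin (w k).2.dim

namespace CGMatrices

variable {q : ℂ} (D : CGMatrices q)

/-- For a parenthesized word `t`, the sum `∑_c φ_c(I, m) ψ_c(m', J)` over the channels `c` of `t`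
that end in `γ`; `φ_c : γ → t` and `ψ_c : t → γ` are the iterated inclusions and projections along
`t`. An element `ξ` acts on the truncated tensor product `t` by
`∑_γ ∑_{m m'} block γ I J m m' * ξ^γ_{m m'}`. -/
def block {n : ℕ} (w : Fin n → SLabel q) :
    FreeMagma (Fin n) → (γ : Phys q) → Idx w → Idx w → Matrix (Fin γ.dim) (Fin γ.dim) ℂ
  | .of k, γ, I, J => Matrix.of fun m m' =>
      open Classical in
      if h : γ = (w k).2 then
        (w k).iso (I k) (Fin.cast (congrArg Phys.dim h) m) *
          (w k).isoInv (Fin.cast (congrArg Phys.dim h) m') (J k)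
      else 0
  | .mul t₁ t₂, γ, I, J => Matrix.of fun m m' =>
      ∑ᶠ c : Phys q × Phys q, ∑ a, ∑ a', ∑ b, ∑ b',
        D.phi c.1 c.2 γ (a, b) m * block w t₁ c.1 I J a a' * block w t₂ c.2 I J b b' *
          D.psi c.1 c.2 γ m' (a', b')

/-- The projector `1_t` on the truncated tensor product of a parenthesized word `t`. -/
def proj {n : ℕ} (w : Fin n → SLabel q) (t : FreeMagma (Fin n)) : Matrix (Idx w) (Idx w) ℂ :=
  Matrix.of fun I J => ∑ᶠ γ, (D.block w t γ I J).trace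

/-- The intertwiner `Θ` from the parenthesing `t` to the parenthesing `t'` of the same word: the
sum over all channels `c` of `t` and `c'` of `t'` of `φ_{c'} (ψ_{c'} φ_c) ψ_c`. The composites
`ψ_{c'} φ_c` of irreducible representations are scalars: for `t = (αβ)γ` and `t' = α(βγ)` they
are the `6j`-symbols, and this is `∑ {6j} φ_δ^{βγ} φ_ν^{αδ} ψ^{μγ}_ν ψ^{αβ}_μ`. -/
def theta {n : ℕ} (w : Fin n → SLabel q) (t t' : FreeMagma (Fin n)) : Matrix (Idx w) (Idx w) ℂ :=
  D.proj w t' * D.proj w t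

/-- The projector `1^{X ⊗ Y}` on the truncated tensor product of two signed labels. -/
def pairProj (X Y : SLabel q) :
    Matrix (Fin X.2.dim × Fin Y.2.dim) (Fin X.2.dim × Fin Y.2.dim) ℂ :=
  Matrix.of fun I J => ∑ᶠ γ : Phys q,
    ((X.iso ⊗ₖ Y.iso) * D.phi X.2 Y.2 γ * D.psi X.2 Y.2 γ * (X.isoInv ⊗ₖ Y.isoInv)) I J

/-- The truncated `R`-matrix of two signed labels. As `S(ξ)` in `α` is `ᵗξ` in `ᾱ`, this is
`R^{αβ}`, `(S ⊗ id)(R^{αβ})`, `(id ⊗ S)(R^{αβ})`, `(S ⊗ S)(R^{αβ})`, according to the signs and up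
to transposition of the dual legs. -/
def truncR (s : ℂ) (X Y : SLabel q) :
    Matrix (Fin X.2.dim × Fin Y.2.dim) (Fin X.2.dim × Fin Y.2.dim) ℂ :=
  univR q s X.rep Y.rep * D.pairProj X Y

end CGMatrices

/-- A word of three signed labels. -/
def word3 {q : ℂ} (X Y Z : SLabel q) : Fin 3 → SLabel q
  | 0 => X | 1 => Y | 2 => Z

/-- A word of four signed labels. -/
def word4 {q : ℂ} (X Y Z W : SLabel q) : Fin 4 → SLabel q
  | 0 => X | 1 => Y | 2 => Z | 3 => W

/-- Multi-indices for a word of three labels. -/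
def idx3 {q : ℂ} {X Y Z : SLabel q} (x : Fin X.2.dim) (y : Fin Y.2.dim) (z : Fin Z.2.dim) :
    Idx (word3 X Y Z)
  | 0 => x | 1 => y | 2 => z

/-- Multi-indices for a word of four labels. -/
def idx4 {q : ℂ} {X Y Z W : SLabel q} (x : Fin X.2.dim) (y : Fin Y.2.dim) (z : Fin Z.2.dim)
    (w : Fin W.2.dim) : Idx (word4 X Y Z W)
  | 0 => x | 1 => y | 2 => z | 3 => w

namespace CGMatrices

variable {q : ℂ} (D : CGMatrices q)

/-- The associator `Θ^{XYZ} : (X ⊗ Y) ⊗ Z → X ⊗ (Y ⊗ Z)`. -/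
def assoc3 (X Y Z : SLabel q) : Matrix (Idx (word3 X Y Z)) (Idx (word3 X Y Z)) ℂ :=
  D.theta _ ((.of 0 * .of 1) * .of 2) (.of 0 * (.of 1 * .of 2))

/-- Its quasi-inverse `X ⊗ (Y ⊗ Z) → (X ⊗ Y) ⊗ Z`. -/
def assoc3Inv (X Y Z : SLabel q) : Matrix (Idx (word3 X Y Z)) (Idx (word3 X Y Z)) ℂ :=
  D.theta _ (.of 0 * (.of 1 * .of 2)) ((.of 0 * .of 1) * .of 2)

/-- The quasi-inverse associator `Θ⁻¹^{(X ⊗ Y) Z W}`. -/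
def assoc4Inv (X Y Z W : SLabel q) : Matrix (Idx (word4 X Y Z W)) (Idx (word4 X Y Z W)) ℂ :=
  D.theta _ ((.of 0 * .of 1) * (.of 2 * .of 3)) (((.of 0 * .of 1) * .of 2) * .of 3)

/-- The matrix
`G^{αβ} = ∑ (S(θ'¹²) ⊗ S(θ'¹¹)) (S(θ²) ⊗ S(θ¹)) (A ⊗ A) (θ³ ⊗ 1) (θ'² ⊗ θ'³)`, where
`θ` are the components of `Θ` and `θ'` those of `Θ⁻¹`. -/
def gMat (A : ∀ α : Phys q, Matrix (Fin α.dim) (Fin α.dim) ℂ) (α β : Phys q) :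
    Matrix (Fin α.dim × Fin β.dim) (Fin α.dim × Fin β.dim) ℂ :=
  Matrix.of fun I J => ∑ r, ∑ r', ∑ t, ∑ t', ∑ c, ∑ d, ∑ e,
    A α r r' * A β t t' *
      D.assoc3 (negL β) (negL α) (posL α) (idx3 t r r') (idx3 c d e) *
      D.assoc4Inv (negL β) (negL α) (posL α) (posL β) (idx4 c d e t') (idx4 I.2 I.1 J.1 J.2)

/-- The matrix `f^{αβ} = ∑ (S(θ'¹²) ⊗ S(θ'¹¹)) G^{αβ} (θ'² B S(θ'³))^{α ⊗ β}`, where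
`ξ^{α ⊗ β} = ∑_γ φ^{αβ}_γ ξ^γ ψ_{αβ}^γ`. -/
def fMat (A B : ∀ α : Phys q, Matrix (Fin α.dim) (Fin α.dim) ℂ) (α β : Phys q) :
    Matrix (Fin α.dim × Fin β.dim) (Fin α.dim × Fin β.dim) ℂ :=
  Matrix.of fun I J => ∑ᶠ γ : Phys q, ∑ b, ∑ a, ∑ m, ∑ n, ∑ n', ∑ r,
    D.assoc4Inv (negL β) (negL α) (posL γ) (negL γ) (idx4 b a m r) (idx4 I.2 I.1 n n') *
      (D.gMat A α β * D.phi α β γ) (a, b) m * B γ n n' * D.psi α β γ r J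

end CGMatrices

/-- A choice of normalized intertwiners for `U_q(sl₂)`, of the square roots `κ_α = v_α^{1/2}`, and
the matrices `A`, `B`, `f⁻¹` that come with it. -/
structure QuantumData (q s : ℂ) extends CGMatrices q where
  phi_intertwiner : ∀ α β γ, IsIntertwiner q γ.rep (tensor q α.rep β.rep) (phi α β γ)
  psi_intertwiner : ∀ α β γ, IsIntertwiner q (tensor q α.rep β.rep) γ.rep (psi α β γ)
  psi_mul_phi : ∀ α β γ, fusion α β γ ≠ 0 → psi α β γ * phi α β γ = 1
  phi_eq_zero : ∀ α β γ, fusion α β γ = 0 → phi α β γ = 0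
  psi_eq_zero : ∀ α β γ, fusion α β γ = 0 → psi α β γ = 0
  phi_zero_right : ∀ α, phi α (Phys.zero q) α = Matrix.of fun p i => if p.1 = i then 1 else 0
  phi_zero_left : ∀ α, phi (Phys.zero q) α α = Matrix.of fun p i => if p.2 = i then 1 else 0
  psi_zero_right : ∀ α, psi α (Phys.zero q) α = Matrix.of fun i p => if p.1 = i then 1 else 0
  psi_zero_left : ∀ α, psi (Phys.zero q) α α = Matrix.of fun i p => if p.2 = i then 1 else 0
  /-- `κ_α = v_α^{1/2}`, where the ribbon element `v` satisfies `v² = u S(u)`. -/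
  kappa : Phys q → ℂ
  kappa_pow : ∀ α, (kappa α ^ 4) • (1 : Matrix (Fin α.dim) (Fin α.dim) ℂ) =
    drinfeldU s α * antipode α (drinfeldU s α)
  /-- `P₁₂ R^{αβ} = ∑_γ λ_{αβγ}^{1/2} φ^{βα}_γ ψ_{αβ}^γ`, with
  `λ_{αβγ}^{1/2} = v_α^{1/2} v_β^{1/2} v_γ^{-1/2}`. -/
  braiding : ∀ α β, (toCGMatrices.truncR s (posL α) (posL β)).submatrix Prod.swap id =
    Matrix.of fun I J => ∑ᶠ γ : Phys q,
      kappa α * kappa β / kappa γ * (phi β α γ * psi α β γ) I J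
  /-- `ψ^0_{ᾱα} = ⟨·, A ·⟩`. -/
  A : ∀ α : Phys q, Matrix (Fin α.dim) (Fin α.dim) ℂ
  A_intertwiner : ∀ α, IsIntertwiner q (tensor q (dual q α.rep) α.rep) (spin q 0)
    (Matrix.of fun _ p => A α p.1 p.2)
  /-- `φ_0^{αᾱ} = ∑ᵢ B eᵢ ⊗ eⁱ`. -/
  B : ∀ α : Phys q, Matrix (Fin α.dim) (Fin α.dim) ℂ
  B_intertwiner : ∀ α, IsIntertwiner q (spin q 0) (tensor q α.rep (dual q α.rep))
    (Matrix.of fun p _ => B α p.1 p.2)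
  A_zero : A (Phys.zero q) = 1
  B_zero : B (Phys.zero q) = 1
  /-- `∑ θ¹ B S(θ²) A θ³ = 1`. -/
  isotopy : ∀ α, (Matrix.of fun i j => ∑ k, ∑ k', ∑ l, ∑ l',
    toCGMatrices.assoc3 (posL α) (negL α) (posL α) (idx3 i l l') (idx3 k k' j) *
      B α k k' * A α l l') = 1
  /-- `∑ S(θ'¹) A θ'² B S(θ'³) = 1`, with the components `θ'` of `Θ⁻¹`. -/
  isotopy_inv : ∀ α, (Matrix.of fun i j => ∑ k, ∑ k', ∑ l, ∑ l',
    toCGMatrices.assoc3Inv (negL α) (posL α) (negL α) (idx3 k k' j) (idx3 i l l') *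
      A α k k' * B α l l') = 1
  /-- The quasi-inverse of `f`. -/
  fInv : ∀ α β : Phys q, Matrix (Fin α.dim × Fin β.dim) (Fin α.dim × Fin β.dim) ℂ
  fInv_mul : ∀ α β, fInv α β * toCGMatrices.fMat A B α β = toCGMatrices.pairProj (posL α) (posL β)
  mul_fInv : ∀ α β, toCGMatrices.fMat A B α β * fInv α β = toCGMatrices.pairProj (posL α) (posL β)
  proj_fInv : ∀ α β, toCGMatrices.pairProj (posL α) (posL β) * fInv α β = fInv α β

/-- The matrix `μ = u v⁻¹`. -/
def QuantumData.mu {q s : ℂ} (D : QuantumData q s) (α : Phys q) :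
    Matrix (Fin α.dim) (Fin α.dim) ℂ := (D.kappa α ^ 2)⁻¹ • drinfeldU s α

/-! ### The quantum group `Γ` in the dual version -/

/-- The vector space with basis the matrix elements `g^α_{ij}`. -/
def DualQG {q : ℂ} (_ : CGMatrices q) : Type :=
  (Σ α : Phys q, Fin α.dim × Fin α.dim) →₀ ℂ

namespace DualQG

variable {q : ℂ} (D : CGMatrices q)

instance : AddCommGroup (DualQG D) :=
  inferInstanceAs (AddCommGroup ((Σ α : Phys q, Fin α.dim × Fin α.dim) →₀ ℂ))

instance : Module ℂ (DualQG D) :=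
  inferInstanceAs (Module ℂ ((Σ α : Phys q, Fin α.dim × Fin α.dim) →₀ ℂ))

/-- The generator `g^α_{ij}`. -/
def g (α : Phys q) (i j : Fin α.dim) : DualQG D :=
  (Finsupp.single ⟨α, (i, j)⟩ 1 : (Σ α : Phys q, Fin α.dim × Fin α.dim) →₀ ℂ)

/-- The product `g^α₁ g^β₂ = ∑_γ φ^{αβ}_γ g^γ ψ_{αβ}^γ`. -/
def mulMap : DualQG D →ₗ[ℂ] DualQG D →ₗ[ℂ] DualQG D :=
  Finsupp.linearCombination ℂ fun a : Σ α : Phys q, Fin α.dim × Fin α.dim =>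
    (Finsupp.linearCombination ℂ fun b : Σ α : Phys q, Fin α.dim × Fin α.dim =>
      ∑ᶠ γ : Phys q, ∑ m, ∑ n,
        (D.phi a.1 b.1 γ (a.2.1, b.2.1) m * D.psi a.1 b.1 γ n (a.2.2, b.2.2)) • g D γ m n :
      DualQG D →ₗ[ℂ] DualQG D)

instance : Mul (DualQG D) := ⟨fun x y => mulMap D x y⟩

instance : NonUnitalNonAssocSemiring (DualQG D) where
  left_distrib x y z := (mulMap D x).map_add y z
  right_distrib x y z := by
    change mulMap D (x + y) z = mulMap D x z + mulMap D y z
    simp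
  zero_mul x := by
    change mulMap D 0 x = 0
    simp
  mul_zero x := (mulMap D x).map_zero

instance : IsScalarTower ℂ (DualQG D) (DualQG D) where
  smul_assoc c x y := by
    change mulMap D (c • x) y = c • mulMap D x y
    simp

instance : SMulCommClass ℂ (DualQG D) (DualQG D) where
  smul_comm c x y := by
    change c • mulMap D x y = mulMap D x (c • y)
    simp

/-- The unit `g^0`. -/
def unit : DualQG D := g D (Phys.zero q) 0 0

/-- The antipode on generators, `S(g^α_{ij}) = g^ᾱ_{ji}`, where `ᾱ` is identified with `α`. -/
def antipodeG (α : Phys q) (i j : Fin α.dim) : DualQG D :=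
  ∑ m, ∑ n, (dualIso α j m * dualIsoInv α n i) • g D α m n

end DualQG

/-! ### Ciliated triangulations -/

/-- A triangulation of a compact connected oriented surface, possibly with boundary, with vertex
set `V`, together with a choice of the oriented links and a ciliation. -/
structure CiliatedSurface (V : Type) where
  /-- `face x y z`: there is a face with vertices `x, y, z`, in the cyclic order given by the
  orientation. -/
  face : V → V → V → Prop
  face_rot : ∀ {x y z}, face x y z → face y z x
  face_ne : ∀ {x y z}, face x y z → x ≠ y
  face_unique : ∀ {x y z z'}, face x y z → face x y z' → z = z'
  face_simplicial : ∀ {x y z}, face x y z → ¬ face y x z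
  /-- Every vertex is in a face. -/
  vertex_mem : ∀ x, ∃ y z, face x y z
  /-- The faces around a vertex form a single fan or disc. -/
  star_connected : ∀ {z a b}, (∃ c, face z a c ∨ face a z c) → (∃ c, face z b c ∨ face b z c) →
    Relation.ReflTransGen (fun a b => face z a b ∨ face z b a) a b
  nonempty : Nonempty V
  connected : ∀ a b, Relation.ReflTransGen (fun x y => ∃ c, face x y c ∨ face y x c) a b
  /-- `link x y`: the edge `xy` oriented from `y` to `x` is one of the oriented links. -/
  link : V → V → Prop
  link_edge : ∀ {x y}, link x y → ∃ c, face x y c ∨ face y x c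
  /-- Interior edges occur with both orientations. -/
  link_interior : ∀ {x y c d}, face x y c → face y x d → link x y
  /-- Boundary edges occur with exactly one orientation. -/
  link_boundary : ∀ {x y c}, face x y c → (∀ d, ¬ face y x d) → (link x y ↔ ¬ link y x)
  /-- `cil z x y`: the edge `zx` precedes the edge `zy` in the cilium order at `z`. -/
  cil : V → V → V → Prop
  cil_irrefl : ∀ z x, ¬ cil z x x
  cil_trans : ∀ {z a b c}, cil z a b → cil z b c → cil z a c
  cil_edge : ∀ {z a b}, cil z a b → (∃ c, face z a c ∨ face a z c) ∧ ∃ c, face z b c ∨ face b z c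
  cil_total : ∀ {z a b}, (∃ c, face z a c ∨ face a z c) → (∃ c, face z b c ∨ face b z c) →
    a ≠ b → cil z a b ∨ cil z b a
  /-- The cilium order comes from the cyclic order of the edges at `z`, cut at the cilium: of two
  cyclically consecutive edges the second is the successor of the first, unless the cilium lies
  between them, in which case the first is the last and the second is the first edge. -/
  cil_cyclic : ∀ {z a b}, face z a b →
    (cil z a b ∧ ∀ c, ¬ (cil z a c ∧ cil z c b)) ∨ ((∀ c, ¬ cil z a c) ∧ ∀ c, ¬ cil z c b)

variable {V : Type}

/-- The oriented links, with end point `tgt` and departure point `src`. -/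
structure Link (T : CiliatedSurface V) where
  tgt : V
  src : V
  isLink : T.link tgt src

/-! ### The algebra of gauge fields -/

/-- The symbols `u^α(l)^i_j`. -/
structure Gen (T : CiliatedSurface V) (q : ℂ) where
  link : Link T
  lab : Phys q
  row : Fin lab.dim
  col : Fin lab.dim

/-- The free unital non-associative algebra on the symbols `u^α(l)^i_j`. -/
abbrev FreeGauge (T : CiliatedSurface V) (q : ℂ) : Type :=
  MonoidAlgebra ℂ (WithOne (FreeMagma (Gen T q)))

/-- The generator `u^α(l)^i_j` of the free algebra. -/
def gen {T : CiliatedSurface V} {q : ℂ} (l : Link T) (α : Phys q) (i j : Fin α.dim) :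
    FreeGauge T q :=
  MonoidAlgebra.of ℂ _ ((FreeMagma.of ⟨l, α, i, j⟩ : FreeMagma (Gen T q)) :
    WithOne (FreeMagma (Gen T q)))

/-- The order of the letters of a parenthesized word. -/
def leaves {n : ℕ} : FreeMagma (Fin n) → List (Fin n)
  | .of k => [k]
  | .mul t₁ t₂ => leaves t₁ ++ leaves t₂

section Vertex

variable [DecidableEq V] {T : CiliatedSurface V} {q : ℂ}

/-- The representation attached to the vertex `x` by the letter `u^α(l)`: it is `α` if `x` is the
end point of `l`, `ᾱ` if `x` is its departure point, and `0` otherwise. -/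
def vertexLabel (x : V) (l : Link T) (α : Phys q) : SLabel q :=
  if x = l.tgt then posL α else if x = l.src then negL α else posL (Phys.zero q)

/-- The index of `u^α(l)^i_j` that belongs to the vertex `x`. -/
def vertexIndex (x : V) (l : Link T) (α : Phys q) (i j : Fin α.dim) :
    Fin (vertexLabel x l α).2.dim :=
  if h : x = l.tgt then Fin.cast (by simp [vertexLabel, h]) i
  else if h' : x = l.src then Fin.cast (by subst h'; simp [vertexLabel, h]) j
  else Fin.cast (by simp [vertexLabel, h, h', Phys.zero]) (0 : Fin 1)

end Vertex

/-- The monomial `u^{α₁}(l₁)^{i₁}_{j₁} ⋯ u^{αₙ}(lₙ)^{iₙ}_{jₙ}` with the parenthesing `t`. -/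
def monomial {T : CiliatedSurface V} {q : ℂ} {n : ℕ} (l : Fin n → Link T) (α : Fin n → Phys q)
    (t : FreeMagma (Fin n)) (i j : ∀ k, Fin (α k).dim) : FreeGauge T q :=
  FreeMagma.lift (fun k => gen (l k) (α k) (i k) (j k)) t

/-- The defining relations of the algebra of gauge fields. -/
inductive GaugeRel [Fintype V] [DecidableEq V] (T : CiliatedSurface V) {q s : ℂ}
    (D : QuantumData q s) : FreeGauge T q → FreeGauge T q → Prop
  /-- `R₁₂ u^α(yx)₁ u^β(yz)₂ = u^β(yz)₂ u^α(yx)₁` if `yx <_c yz`. -/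
  | exchange_end_end (l l' : Link T) (α β : Phys q) (i j : Fin α.dim) (k m : Fin β.dim) :
      l.tgt = l'.tgt → T.cil l.tgt l.src l'.src →
      GaugeRel T D (gen l' β k m * gen l α i j)
        (∑ i', ∑ k', D.truncR s (posL α) (posL β) (i, k) (i', k') •
          (gen l α i' j * gen l' β k' m))
  /-- `u^α(xy)₁ (S ⊗ id)(R₁₂) u^β(yz)₂ = u^β(yz)₂ u^α(xy)₁` if `xy <_c yz`. -/
  | exchange_start_end (l l' : Link T) (α β : Phys q) (i j : Fin α.dim) (k m : Fin β.dim) :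
      l.src = l'.tgt → T.cil l.src l.tgt l'.src →
      GaugeRel T D (gen l' β k m * gen l α i j)
        (∑ j', ∑ k', D.truncR s (negL α) (posL β) (j, k) (j', k') •
          (gen l α i j' * gen l' β k' m))
  /-- `u^α(yx)₁` and `u^β(zy)₂` if `yx <_c zy`, with `(id ⊗ S)(R₁₂)`. -/
  | exchange_end_start (l l' : Link T) (α β : Phys q) (i j : Fin α.dim) (k m : Fin β.dim) :
      l.tgt = l'.src → T.cil l.tgt l.src l'.tgt →
      GaugeRel T D (gen l' β k m * gen l α i j)
        (∑ i', ∑ m', D.truncR s (posL α) (negL β) (i, m) (i', m') •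
          (gen l α i' j * gen l' β k m'))
  /-- `u^α(xy)₁ u^β(zy)₂ (S ⊗ S)(R₁₂) = u^β(zy)₂ u^α(xy)₁` if `xy <_c zy`. -/
  | exchange_start_start (l l' : Link T) (α β : Phys q) (i j : Fin α.dim) (k m : Fin β.dim) :
      l.src = l'.src → T.cil l.src l.tgt l'.tgt →
      GaugeRel T D (gen l' β k m * gen l α i j)
        (∑ j', ∑ m', D.truncR s (negL α) (negL β) (j, m) (j', m') •
          (gen l α i j' * gen l' β k m'))
  /-- `u^α(l) A u^α(-l) = B` for interior links. -/
  | inverse (l l' : Link T) (α : Phys q) (i j : Fin α.dim) :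
      l'.tgt = l.src → l'.src = l.tgt →
      GaugeRel T D (∑ k, ∑ k', D.A α k k' • (gen l α i k * gen l' α k' j)) (D.B α i j • 1)
  /-- Links without a common vertex commute. -/
  | disjoint (l l' : Link T) (α β : Phys q) (i j : Fin α.dim) (k m : Fin β.dim) :
      l.tgt ≠ l'.tgt → l.tgt ≠ l'.src → l.src ≠ l'.tgt → l.src ≠ l'.src →
      GaugeRel T D (gen l α i j * gen l' β k m) (gen l' β k m * gen l α i j)
  /-- `u^α(l)₁ u^β(l)₂ = ∑_γ φ^{αβ}_γ u^γ(l) ψ_{βα}^γ f⁻¹ P₁₂`. -/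
  | decomposition (l : Link T) (α β : Phys q) (i j : Fin α.dim) (k m : Fin β.dim) :
      GaugeRel T D (gen l α i j * gen l β k m)
        (∑ᶠ γ : Phys q, ∑ a, ∑ b,
          (D.phi α β γ (i, k) a * (D.psi β α γ * D.fInv β α) b (m, j)) • gen l γ a b)
  /-- `u^0(l) = 1`. -/
  | trivial (l : Link T) : GaugeRel T D (gen l (Phys.zero q) 0 0) 1
  /-- `(∏_x Θ_x) M_t = M_{t'}` for two parenthesings `t`, `t'` of the same monomial. -/
  | quasiAssoc {n : ℕ} (l : Fin n → Link T) (α : Fin n → Phys q) (t t' : FreeMagma (Fin n))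
      (i j : ∀ k, Fin (α k).dim) :
      leaves t = List.finRange n → leaves t' = List.finRange n →
      GaugeRel T D
        (∑ i' : ∀ k, Fin (α k).dim, ∑ j' : ∀ k, Fin (α k).dim,
          (∏ x : V, D.theta (fun k => vertexLabel x (l k) (α k)) t t'
            (fun k => vertexIndex x (l k) (α k) (i k) (j k))
            (fun k => vertexIndex x (l k) (α k) (i' k) (j' k))) • monomial l α t i' j')
        (monomial l α t' i j)

section Paths

variable (T : CiliatedSurface V)

open Classical in
/-- The sign at the vertex `y` of a path passing through `x, y, z` in this order: `-1` if
`xy <_c yz`, and `1` if `yz <_c xy`. -/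
def sgn (x y z : V) : ℤ := if T.cil y x z then -1 else 1

/-- `[x_{n+1}, …, x_0]` is a simple open path (with `n + 1` links). -/
def IsSimplePath (n : ℕ) (x : ℕ → V) : Prop :=
  (∀ i ≤ n, T.link (x (i + 1)) (x i)) ∧ Set.InjOn x (Set.Iic (n + 1))

/-- `[x_{n+1} = x_0, x_n, …, x_0]` is a simple loop, with departure point `x_0`; the sequence `x`
is extended with period `n + 1`. -/
def IsSimpleLoop (n : ℕ) (x : ℕ → V) : Prop :=
  2 ≤ n ∧ (∀ i, x (i + (n + 1)) = x i) ∧ (∀ i, T.link (x (i + 1)) (x i)) ∧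
    Set.InjOn x (Set.Iic n)

end Paths

/-- The quotient of a complex non-associative algebra by a congruence is a complex vector space. -/
instance {R : Type} [NonAssocRing R] [Module ℂ R] [IsScalarTower ℂ R R] (c : RingCon R) :
    Module ℂ c.Quotient where
  add_smul := by
    rintro a b ⟨x⟩
    exact congrArg (Quot.mk _) (add_smul a b x)
  zero_smul := by
    rintro ⟨x⟩
    exact congrArg (Quot.mk _) (zero_smul ℂ x)

instance {ι : Type} {A : Type} [NonUnitalNonAssocSemiring A] [Module ℂ A]
    [SMulCommClass ℂ A A] [IsScalarTower ℂ A A] :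
    IsScalarTower ℂ (⨂[ℂ] _i : ι, A) (⨂[ℂ] _i : ι, A) where
  smul_assoc c x y := by
    change PiTensorProduct.mul (c • x) y = c • PiTensorProduct.mul x y
    simp

instance {ι : Type} {A : Type} [NonUnitalNonAssocSemiring A] [Module ℂ A]
    [SMulCommClass ℂ A A] [IsScalarTower ℂ A A] :
    SMulCommClass ℂ (⨂[ℂ] _i : ι, A) (⨂[ℂ] _i : ι, A) where
  smul_comm c x y := by
    change c • PiTensorProduct.mul x y = PiTensorProduct.mul x (c • y)
    simp

section Algebra

variable [Fintype V] [DecidableEq V] (T : CiliatedSurface V) {q s : ℂ} (D : QuantumData q s)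

/-- The algebra `Λ` of gauge fields. -/
abbrev GaugeAlg : Type := (ringConGen (GaugeRel T D)).Quotient

/-- The element `u^α(l)^i_j` of `Λ`. -/
def uEl (l : Link T) (α : Phys q) (i j : Fin α.dim) : GaugeAlg T D :=
  ((gen l α i j : FreeGauge T q) : (ringConGen (GaugeRel T D)).Quotient)

/-- The gauge symmetry algebra `⨂_z Γ_z`. -/
abbrev GaugeSym (V : Type) {q : ℂ} (D : CGMatrices q) : Type := ⨂[ℂ] _z : V, DualQG D

/-- The embedding of `Γ_x`-elements: `a` at the vertex `x`, `b` at the vertex `y`, and the unit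
elsewhere, i.e. the product `a_x b_y` for `x ≠ y`. -/
def atVertices (x y : V) (a b : DualQG D.toCGMatrices) : GaugeSym V D.toCGMatrices :=
  PiTensorProduct.tprod ℂ fun z => if z = x then a else if z = y then b
    else DualQG.unit D.toCGMatrices

/-- The unit of the gauge symmetry algebra. -/
def symUnit : GaugeSym V D.toCGMatrices :=
  PiTensorProduct.tprod ℂ fun _ => DualQG.unit D.toCGMatrices

/-- `Ω` is the coaction `Ω(u^α(xy)) = g^α_x u^α(xy) S(g^α_y)`, a morphism of unital algebras. -/
def IsGaugeCoaction
    (Ω : GaugeAlg T D →ₙₐ[ℂ] (GaugeAlg T D ⊗[ℂ] GaugeSym V D.toCGMatrices)) : Prop :=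
  Ω 1 = (1 : GaugeAlg T D) ⊗ₜ[ℂ] symUnit D ∧
  ∀ (l : Link T) (α : Phys q) (i j : Fin α.dim),
    Ω (uEl T D l α i j) = ∑ k, ∑ m, uEl T D l α k m ⊗ₜ[ℂ]
      atVertices D l.tgt l.src (DualQG.g _ α i k) (DualQG.antipodeG _ α m j)

/-! ### Holonomies and Wilson loops -/

open Classical in
/-- The matrix `u^α(xy)` (and `0` if `xy` is not an oriented link). -/
def uMat (α : Phys q) (x y : V) : Matrix (Fin α.dim) (Fin α.dim) (GaugeAlg T D) :=
  Matrix.of fun i j => if h : T.link x y then uEl T D ⟨x, y, h⟩ α i j else 0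

/-- The product of a scalar matrix and a matrix over `Λ`. -/
def scalMul {α : Phys q} (M : Matrix (Fin α.dim) (Fin α.dim) ℂ)
    (N : Matrix (Fin α.dim) (Fin α.dim) (GaugeAlg T D)) :
    Matrix (Fin α.dim) (Fin α.dim) (GaugeAlg T D) :=
  Matrix.of fun i j => ∑ k, M i k • N k j

/-- `u(x_{n+1} x_n) A u(x_n x_{n-1}) A ⋯ A u(x_1 x_0)`. -/
def chain (α : Phys q) (x : ℕ → V) : ℕ → Matrix (Fin α.dim) (Fin α.dim) (GaugeAlg T D)
  | 0 => uMat T D α (x 1) (x 0)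
  | n + 1 => uMat T D α (x (n + 2)) (x (n + 1)) * scalMul T D (D.A α) (chain α x n)

/-- The holonomy `u^α_P` along the path `P = [x_{n+1}, …, x_0]`. -/
def pathHol (α : Phys q) (n : ℕ) (x : ℕ → V) : Matrix (Fin α.dim) (Fin α.dim) (GaugeAlg T D) :=
  D.kappa α ^ (∑ i ∈ Finset.range n, sgn T (x i) (x (i + 1)) (x (i + 2))) • chain T D α x n

/-- The holonomy `u^α_C` along the loop `C = [x_{n+1} = x_0, x_n, …, x_0]`. -/
def loopHol (α : Phys q) (n : ℕ) (x : ℕ → V) : Matrix (Fin α.dim) (Fin α.dim) (GaugeAlg T D) :=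
  D.kappa α ^ ((∑ i ∈ Finset.range n, sgn T (x i) (x (i + 1)) (x (i + 2))) -
    sgn T (x n) (x 0) (x 1)) • chain T D α x n

/-- The Wilson loop `W^α_C = tr_α (S(A) μ u^α_C)`. -/
def wilson (α : Phys q) (n : ℕ) (x : ℕ → V) : GaugeAlg T D :=
  (scalMul T D (antipode α (D.A α) * D.mu α) (loopHol T D α n x)).trace

end Algebra

end QGauge

end

noncomputable section

set_option linter.unusedSectionVars false
set_option linter.unusedSimpArgs false

namespace QGauge

open Finset (sum_congr sum_comm smul_sum mul_sum sum_eq_single mem_univ sum_eq_zero sum_ite_irrel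
  sum_mul sum_ite_eq sum_mul_sum sum_const_zero sum_smul sum_eq_single_of_mem mem_erase univ_unique
  sum_singleton sum_sub_distrib sum_add_distrib sum_ite_eq' range)
open Fintype (sum_prod_type sum_bijective card)
open Matrix (of_apply of vecMul mul_kronecker_mul smul_mul kroneckerMap_apply one_kronecker_one
  diagonal_mul diagonal_apply mul_diagonal submatrix_mul_equiv submatrix_apply transpose_apply
  transpose_mul transpose_smul transpose_transpose one_apply_eq submatrix_add mulVec_mulVec
  transpose_one trace mulVec)
open Prod (swap swap_bijective)
open Equiv (prodAssoc prodComm)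
open Function (Bijective Injective)
open FreeMagma (recOnMul)
open List (finRange)
open TensorProduct (tmul_smul add_tmul tmul_add sum_tmul tmul_sum)

instance {q : ℂ} : CoeSort (Phys q) Type := ⟨fun α => Fin α.dim⟩

local postfix:max "ᵒ" => QuantumData.toCGMatrices

open WeightModule DualQG
open Matrix renaming mul_assoc → mmul_assoc, mul_apply → mmul_apply, one_mul → mone_mul, one_apply →
  mone_apply, mul_one → mmul_one, smul_apply → msmul_apply, mul_smul → mmul_smul, mul_sum →
  mmul_sum, mul_add → mmul_add, mul_zero → mmul_zero, add_mul → madd_mul, zero_mul → mzero_mul,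
  sum_mul → msum_mul, add_apply → madd_apply, sum_apply → msum_apply, sub_apply → msub_apply,
  mul_sub → mmul_sub, sub_mul → msub_mul, neg_apply → mneg_apply, zero_apply → mzero_apply

/-- `q` is neither `0` nor `±1`. -/
class Admissible (q : ℂ) : Prop where
  ne_zero : q ≠ 0
  sub_ne_zero : q - q⁻¹ ≠ 0

lemma q0 {q : ℂ} [Admissible q] : q ≠ 0 := Admissible.ne_zero

lemma q_sub_ne_zero {q : ℂ} [Admissible q] : q - q⁻¹ ≠ 0 := Admissible.sub_ne_zero

lemma admissible_of_ne {q : ℂ} (h0 : q ≠ 0) (h1 : q ≠ 1) (h2 : q ≠ -1) : Admissible q := by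
  refine ⟨h0, fun h => ?_⟩
  have h3 : q * q = 1 := by
    have := congrArg (q * ·) h
    simp only [mul_sub, mul_inv_cancel₀ h0, mul_zero] at this
    linear_combination this
  rcases mul_self_eq_one_iff.1 h3 with h | h
  · exact h1 h
  · exact h2 h

variable {ι κ τ ι' κ' V : Type} [Fintype ι] [DecidableEq ι] [Fintype κ] [DecidableEq κ] [Fintype τ]
  [DecidableEq τ] [Fintype ι'] [DecidableEq ι'] [Fintype κ'] [DecidableEq κ'] [Fintype V]
  [DecidableEq V] {q s : ℂ} [Admissible q] {X : WeightModule ι} {Y : WeightModule κ}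
  {Z : WeightModule τ} {X' : WeightModule ι'} {Y' : WeightModule κ'} {T : CiliatedSurface V}
  {D : QuantumData q s} {hs : s ^ 2 = q} {α β γ δ : Phys q}

local notation "M[" a "," b "]" => Matrix a b ℂ
local notation "I[" a "]" => (1 : Matrix a a ℂ)
local infixl:72 " ⊠ " => WeightModule.tensor q
local notation "IsHom" => WeightModule.IsIntertwiner q

/-! ### Intertwiners of weight modules -/

lemma WeightModule.IsIntertwiner.comp {T : M[κ, ι]} {S : M[τ, κ]} (hS : IsHom Y Z S) (hT : IsHom X Y
    T) : IsHom X Z (S * T) := by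
  refine ⟨?_, ?_, ?_⟩
  · rw [mmul_assoc, hT.1, ← mmul_assoc, hS.1, mmul_assoc]
  · rw [mmul_assoc, hT.2.1, ← mmul_assoc, hS.2.1, mmul_assoc]
  · rw [mmul_assoc, hT.2.2, ← mmul_assoc, hS.2.2, mmul_assoc]

lemma WeightModule.IsIntertwiner.add {T S : M[κ, ι]} (hS : IsHom X Y S) (hT : IsHom X Y T) : IsHom X
    Y (S + T) := by
  refine ⟨?_, ?_, ?_⟩ <;> rw [madd_mul, mmul_add]
  · rw [hS.1, hT.1]
  · rw [hS.2.1, hT.2.1]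
  · rw [hS.2.2, hT.2.2]

lemma WeightModule.IsIntertwiner.smul {T : M[κ, ι]} (c : ℂ) (hT : IsHom X Y T) : IsHom X Y (c •
    T) := by
  refine ⟨?_, ?_, ?_⟩ <;> rw [smul_mul, mmul_smul]
  · rw [hT.1]
  · rw [hT.2.1]
  · rw [hT.2.2]

lemma WeightModule.IsIntertwiner.sub {T S : M[κ, ι]} (hS : IsHom X Y S) (hT : IsHom X Y T) : IsHom X
    Y (S - T) := by
  have := hS.add (hT.smul (-1))
  simpa [sub_eq_add_neg] using this

lemma isIntertwiner_zero : IsHom X Y (0 : M[κ, ι]) := by simp [IsIntertwiner]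

lemma isIntertwiner_one : IsHom X X I[ι] := by simp [IsIntertwiner]

lemma isIntertwiner_sum {C : Type} (s : Finset C) (T : C → M[κ, ι]) (h : ∀ c ∈ s, IsHom X Y (T c)) :
    IsHom X Y (∑ c ∈ s, T c) := by
  classical
  induction s using Finset.induction_on with
  | empty => simpa using isIntertwiner_zero
  | insert a s ha ih =>
    rw [Finset.sum_insert ha]
    exact (h a (by simp)).add (ih fun c hc => h c (by simp [hc]))

lemma WeightModule.K_mul_Kinv (X : WeightModule ι) : X.K q * X.Kinv q = 1 := by
  simp only [K, Kinv, Matrix.diagonal_mul_diagonal]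
  rw [← Matrix.diagonal_one]
  congr 1; ext i
  rw [← zpow_add₀ q0]; simp

lemma WeightModule.Kinv_mul_K (X : WeightModule ι) : X.Kinv q * X.K q = 1 := by
  simp only [K, Kinv, Matrix.diagonal_mul_diagonal]
  rw [← Matrix.diagonal_one]
  congr 1; ext i
  rw [← zpow_add₀ q0]; simp

lemma WeightModule.IsIntertwiner.kinv {T : M[κ, ι]} (hT : IsHom X Y T) : T * X.Kinv q = Y.Kinv q *
    T := by
  calc T * X.Kinv q = (Y.Kinv q * Y.K q) * (T * X.Kinv q) := by rw [Y.Kinv_mul_K, mone_mul]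
    _ = Y.Kinv q * ((Y.K q * T) * X.Kinv q) := by simp only [mmul_assoc]
    _ = Y.Kinv q * T := by rw [← hT.2.2, mmul_assoc T, X.K_mul_Kinv, mmul_one]

lemma WeightModule.tensor_K (X : WeightModule ι) (Y : WeightModule κ) : (X ⊠ Y).K q = X.K q ⊗ₖ Y.K
    q := by
  simp only [K, Matrix.diagonal_kronecker_diagonal]
  congr 1; ext p
  simp [tensor, zpow_add₀ q0]

lemma WeightModule.tensor_Kinv (X : WeightModule ι) (Y : WeightModule κ) : (X ⊠ Y).Kinv q = X.Kinv q
    ⊗ₖ Y.Kinv q := by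
  simp only [Kinv, Matrix.diagonal_kronecker_diagonal]
  congr 1; ext p
  simp only [tensor, neg_add]
  rw [zpow_add₀ q0]

lemma WeightModule.IsIntertwiner.kron {T : M[ι', ι]} {S : M[κ', κ]} (hT : IsHom X X' T) (hS : IsHom
    Y Y' S) : IsHom (X ⊠ Y) (X' ⊠ Y') (T ⊗ₖ S) := by
  refine ⟨?_, ?_, ?_⟩
  · simp only [tensor, mmul_add, madd_mul, ← mul_kronecker_mul, mmul_one, mone_mul, hS.1, hS.2.2,
      hT.1]
  · simp only [tensor, mmul_add, madd_mul, ← mul_kronecker_mul, mmul_one, mone_mul, hS.2.1, hT.2.1,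
      hT.kinv]
  · simp only [tensor_K, ← mul_kronecker_mul, hS.2.2, hT.2.2]

/-- The module with `E` and `F` interchanged and the weights negated. -/
def WeightModule.flip (X : WeightModule ι) : WeightModule ι := ⟨fun i => -X.wt i, X.F, X.E⟩

lemma WeightModule.flip_K (X : WeightModule ι) : X.flip.K q = X.Kinv q := rfl

lemma WeightModule.flip_Kinv (X : WeightModule ι) : X.flip.Kinv q = X.K q := by
  simp [WeightModule.flip, K, Kinv]

lemma WeightModule.IsIntertwiner.flip {T : M[κ, ι]} (hT : IsHom X Y T) : IsHom X.flip Y.flip T :=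
  ⟨hT.2.1, hT.1, hT.kinv⟩

lemma WeightModule.flip_flip (X : WeightModule ι) : X.flip.flip = X := by simp [WeightModule.flip]

lemma kronecker_submatrix_swap (A : M[ι, ι']) (B : M[κ, κ']) : (A ⊗ₖ B).submatrix swap swap = B ⊗ₖ
    A := by
  ext ⟨i, j⟩ ⟨k, l⟩; simp [mul_comm]

lemma WeightModule.tensor_flip (X : WeightModule ι) (Y : WeightModule κ) : Y.flip ⊠ X.flip = ⟨fun p
    => (X ⊠ Y).flip.wt p.swap, (X ⊠ Y).flip.E.submatrix swap swap, (X ⊠ Y).flip.F.submatrix swap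
    swap⟩ := by
  simp only [tensor, flip_K, flip_Kinv]
  simp only [WeightModule.flip, submatrix_add, Pi.add_apply, kronecker_submatrix_swap]
  congr 1
  · ext p; simp
  · rw [add_comm]
  · rw [add_comm]

/-- Transport of an endomorphism of `X ⊗ Y` to the flipped modules. -/
lemma WeightModule.IsIntertwiner.flip_tensor {T : M[ι' × κ', ι × κ]} (hT : IsHom (X ⊠ Y) (X' ⊠ Y')
    T) : IsHom (Y.flip ⊠ X.flip) (Y'.flip ⊠ X'.flip) (T.submatrix swap swap) := by
  have h := hT.flip
  rw [tensor_flip, tensor_flip]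
  have key : ∀ (A : M[ι' × κ', ι × κ]) (B : M[ι × κ, ι × κ]), A.submatrix swap (swap : κ × ι → ι ×
    κ) * B.submatrix swap (swap : κ × ι → ι × κ) = (A * B).submatrix swap swap := fun A B =>
    submatrix_mul_equiv A B _ (prodComm κ ι) _
  have key' : ∀ (B : M[ι' × κ', ι' × κ']) (A : M[ι' × κ', ι × κ]), B.submatrix swap (swap : κ' × ι'
    → ι' × κ') * A.submatrix swap (swap : κ × ι → ι × κ) = (B * A).submatrix swap swap := fun A B =>
    submatrix_mul_equiv A B _ (prodComm κ' ι') _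
  refine ⟨?_, ?_, ?_⟩
  · dsimp only; rw [key, key', h.1]
  · dsimp only; rw [key, key', h.2.1]
  · have e1 : ∀ {α β : Type} [Fintype α] [DecidableEq α] [Fintype β] [DecidableEq β] (W :
      WeightModule (α × β)) (E F : M[β × α, β × α]), (mk (fun p : β × α => W.wt p.swap) E F).K q =
      (W.K q).submatrix swap swap := by
      intro α β _ _ _ _ W E F
      simp only [K]
      exact (Matrix.submatrix_diagonal (fun p => q ^ W.wt p) (swap : β × α → α × β)
        Prod.swap_injective).symm
    rw [e1, e1, key, key', h.2.2]

/-- The change of parenthesing. -/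
lemma WeightModule.tensor_assoc (X : WeightModule ι) (Y : WeightModule κ) (Z : WeightModule τ) : X ⊠
    (Y ⊠ Z) = ⟨fun p => ((X ⊠ Y) ⊠ Z).wt ((p.1, p.2.1), p.2.2), ((X ⊠ Y) ⊠ Z).E.submatrix (prodAssoc
    ι κ τ).symm (prodAssoc ι κ τ).symm, ((X ⊠ Y) ⊠ Z).F.submatrix (prodAssoc ι κ τ).symm (prodAssoc
    ι κ τ).symm⟩ := by
  have e : ∀ {a b c d e f : Type} (A : M[a, b]) (B : M[c, d]) (C : M[e, f]), A ⊗ₖ (B ⊗ₖ C) = ((A ⊗ₖ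
    B) ⊗ₖ C).submatrix (prodAssoc _ _ _).symm (prodAssoc _ _ _).symm := by
    intro a b c d e f A B C; ext ⟨i, j, k⟩ ⟨l, m, n⟩; simp [mul_assoc]
  have hK := tensor_K (q := q) Y Z
  have hK' := tensor_Kinv (q := q) X Y
  have o1 : I[κ × τ] = I[κ] ⊗ₖ I[τ] := (one_kronecker_one).symm
  have o2 : I[ι × κ] = I[ι] ⊗ₖ I[κ] := (one_kronecker_one).symm
  rw [tensor, tensor.eq_1 q (X ⊠ Y) Z, hK, hK', o1, o2]
  congr 1
  · ext p; simp [tensor, add_assoc]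
  · simp only [tensor, submatrix_add, Pi.add_apply, Matrix.kronecker_add, Matrix.add_kronecker, e,
      add_assoc]
  · simp only [tensor, submatrix_add, Pi.add_apply, Matrix.kronecker_add, Matrix.add_kronecker, e,
      add_assoc]

lemma isIntertwiner_assoc {W : WeightModule ι'} {T : M[ι', (ι × κ) × τ]} : IsHom (X ⊠ (Y ⊠ Z)) W
    (T.submatrix id (prodAssoc ι κ τ).symm) ↔ IsHom ((X ⊠ Y) ⊠ Z) W T := by
  have key : ∀ (A : M[ι', (ι × κ) × τ]) (B : M[(ι × κ) × τ, (ι × κ) × τ]), A.submatrix id (prodAssoc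
    ι κ τ).symm * B.submatrix (prodAssoc ι κ τ).symm (prodAssoc ι κ τ).symm = (A * B).submatrix id
    (prodAssoc ι κ τ).symm := fun A B => submatrix_mul_equiv A B _ _ _
  have key' : ∀ (B : M[ι', ι']) (A : M[ι', (ι × κ) × τ]), B * A.submatrix id (prodAssoc ι κ τ).symm
    = (B * A).submatrix id (prodAssoc ι κ τ).symm := fun A B => by
    ext; simp [mmul_apply]
  have inj : Injective (fun A : M[ι', (ι × κ) × τ] => A.submatrix id (prodAssoc ι κ τ).symm) := by
    intro A B h
    ext i j
    have := congr_fun₂ h i (prodAssoc ι κ τ j)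
    simpa using this
  have hk : (X ⊠ (Y ⊠ Z)).K q = (((X ⊠ Y) ⊠ Z).K q).submatrix (prodAssoc ι κ τ).symm (prodAssoc ι κ
    τ).symm := by
    rw [tensor_assoc]
    exact (Matrix.submatrix_diagonal (fun p => q ^ ((X ⊠ Y) ⊠ Z).wt p) (prodAssoc ι κ τ).symm
      (prodAssoc ι κ τ).symm.injective).symm
  unfold IsIntertwiner
  rw [hk, tensor_assoc]
  dsimp only
  rw [key, key', key, key', key, key']
  exact and_congr inj.eq_iff (and_congr inj.eq_iff inj.eq_iff)

/-- The relations of `U_q(sl₂)`, with an honest grading by the weights. -/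
structure WeightModule.IsRep (q : ℂ) (X : WeightModule ι) : Prop where
  gE : ∀ i j, X.E i j ≠ 0 → X.wt i = X.wt j + 2
  gF : ∀ i j, X.F i j ≠ 0 → X.wt i = X.wt j - 2
  comm : (q - q⁻¹) • (X.E * X.F - X.F * X.E) = X.K q - X.Kinv q

lemma WeightModule.IsRep.flip (hX : X.IsRep q) : X.flip.IsRep q := by
  refine ⟨fun i j h => ?_, fun i j h => ?_, ?_⟩
  · have := hX.gF i j h; simp only [WeightModule.flip]; omega
  · have := hX.gE i j h; simp only [WeightModule.flip]; omega
  · rw [flip_K, flip_Kinv]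
    have := congrArg Neg.neg hX.comm
    simp only [← smul_neg, neg_sub] at this
    exact this

lemma WeightModule.IsRep.KE (hX : X.IsRep q) : X.K q * X.E = q ^ 2 • (X.E * X.K q) := by
  ext i j
  simp only [K, diagonal_mul, msmul_apply, mul_diagonal, smul_eq_mul]
  by_cases h : X.E i j = 0
  · simp [h]
  · rw [hX.gE i j h, zpow_add₀ q0]; norm_cast; ring

lemma WeightModule.IsRep.FK (hX : X.IsRep q) : X.F * X.K q = q ^ 2 • (X.K q * X.F) := by
  ext i j
  simp only [K, diagonal_mul, msmul_apply, mul_diagonal, smul_eq_mul]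
  by_cases h : X.F i j = 0
  · simp [h]
  · have : X.wt j = X.wt i + 2 := by rw [hX.gF i j h]; ring
    rw [this, zpow_add₀ q0]; norm_cast; ring

lemma WeightModule.IsRep.KinvF (hX : X.IsRep q) : X.Kinv q * X.F = q ^ 2 • (X.F * X.Kinv q) := by
  have := hX.flip.KE
  rw [flip_K] at this
  exact this

lemma WeightModule.IsRep.EKinv (hX : X.IsRep q) : X.E * X.Kinv q = q ^ 2 • (X.Kinv q * X.E) := by
  have := hX.flip.FK
  rw [flip_K] at this
  exact this

/-! ### Partial traces -/

/-- The partial trace over the second factor. -/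
def tr₂ (M : M[ι × κ, ι × κ]) : M[ι, ι] := of fun i j => ∑ k, M (i, k) (j, k)

lemma tr₂_add (M N : M[ι × κ, ι × κ]) : tr₂ (M + N) = tr₂ M + tr₂ N := by
  ext; simp [tr₂, sum_add_distrib]

lemma tr₂_sub (M N : M[ι × κ, ι × κ]) : tr₂ (M - N) = tr₂ M - tr₂ N := by ext; simp [tr₂]

lemma kron_one_mul_apply (A : M[ι, ι]) (M : M[ι × κ, ι × κ]) (p p' : ι × κ) : ((A ⊗ₖ I[κ]) * M) p p'
    = ∑ i, A p.1 i * M (i, p.2) p' := by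
  simp [mmul_apply, sum_prod_type, mone_apply]

lemma one_kron_mul_apply (B : M[κ, κ]) (M : M[ι × κ, ι × κ]) (p p' : ι × κ) : ((I[ι] ⊗ₖ B) * M) p p'
    = ∑ k, B p.2 k * M (p.1, k) p' := by
  simp [mmul_apply, sum_prod_type, mone_apply]

lemma mul_kron_one_apply (A : M[ι, ι]) (M : M[ι × κ, ι × κ]) (p p' : ι × κ) : (M * (A ⊗ₖ I[κ])) p p'
    = ∑ i, M p (i, p'.2) * A i p'.1 := by
  simp [mmul_apply, sum_prod_type, mone_apply]

lemma mul_one_kron_apply (B : M[κ, κ]) (M : M[ι × κ, ι × κ]) (p p' : ι × κ) : (M * (I[ι] ⊗ₖ B)) p p'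
    = ∑ k, M p (p'.1, k) * B k p'.2 := by
  simp [mmul_apply, sum_prod_type, mone_apply]

lemma tr₂_kron_mul (A : M[ι, ι]) (M : M[ι × κ, ι × κ]) : tr₂ ((A ⊗ₖ I[κ]) * M) = A * tr₂ M := by
  ext i j
  simp only [tr₂, of_apply, kron_one_mul_apply]
  simp only [mmul_apply, of_apply, mul_sum]
  rw [sum_comm]

lemma tr₂_mul_kron (A : M[ι, ι]) (M : M[ι × κ, ι × κ]) : tr₂ (M * (A ⊗ₖ I[κ])) = tr₂ M * A := by
  ext i j
  simp only [tr₂, of_apply, mul_kron_one_apply]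
  simp only [mmul_apply, of_apply, sum_mul]
  rw [sum_comm]

lemma tr₂_cyc (B : M[κ, κ]) (M : M[ι × κ, ι × κ]) : tr₂ ((I[ι] ⊗ₖ B) * M) = tr₂ (M * (I[ι] ⊗ₖ
    B)) := by
  ext i j
  simp only [tr₂, of_apply, one_kron_mul_apply, mul_one_kron_apply]
  rw [sum_comm]
  simp only [mul_comm]

lemma trace_tr₂ (M : M[ι × κ, ι × κ]) : (tr₂ M).trace = M.trace := by
  simp [tr₂, trace, sum_prod_type]

/-- The quantum partial trace over the second factor. -/
def ptr (q : ℂ) (Y : WeightModule κ) (g : M[ι × κ, ι × κ]) : M[ι, ι] := tr₂ ((I[ι] ⊗ₖ Y.K q) * g)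

lemma ptr_isIntertwiner {g : M[ι × κ, ι × κ]} (hg : IsHom (X ⊠ Y) (X ⊠ Y) g) : IsHom X X (ptr q Y
    g) := by
  have hK : g * (X.K q ⊗ₖ Y.K q) = (X.K q ⊗ₖ Y.K q) * g := by have := hg.2.2; rwa [tensor_K] at this
  have hKi : g * (X.Kinv q ⊗ₖ Y.Kinv q) = (X.Kinv q ⊗ₖ Y.Kinv q) * g := by
    have := hg.kinv; rwa [tensor_Kinv] at this
  have hE : g * (I[ι] ⊗ₖ Y.E) + g * (X.E ⊗ₖ Y.K q) = (1 ⊗ₖ Y.E) * g + (X.E ⊗ₖ Y.K q) * g := by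
    have := hg.1; simpa only [tensor, mmul_add, madd_mul] using this
  have hF : g * (X.Kinv q ⊗ₖ Y.F) + g * (X.F ⊗ₖ I[κ]) = (X.Kinv q ⊗ₖ Y.F) * g + (X.F ⊗ₖ I[κ]) *
    g := by
    have := hg.2.1; simpa only [tensor, mmul_add, madd_mul] using this
  have split : ∀ (A : M[ι, ι]) (B : M[κ, κ]), A ⊗ₖ B = (A ⊗ₖ 1) * (1 ⊗ₖ B) := by
    intro A B; rw [← mul_kronecker_mul, mmul_one, mone_mul]
  have split' : ∀ (A : M[ι, ι]) (B : M[κ, κ]), A ⊗ₖ B = (1 ⊗ₖ B) * (A ⊗ₖ 1) := by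
    intro A B; rw [← mul_kronecker_mul, mmul_one, mone_mul]
  have kk : ∀ A B : M[κ, κ], (I[ι] ⊗ₖ A) * (1 ⊗ₖ B) = 1 ⊗ₖ (A * B) := by
    intro A B; rw [← mul_kronecker_mul, mmul_one]
  have KKi := Y.K_mul_Kinv (q := q)
  have KiK := Y.Kinv_mul_K (q := q)
  refine ⟨?_, ?_, ?_⟩
  · have h1 : g * (X.E ⊗ₖ I[κ]) = (X.E ⊗ₖ Y.K q) * g * (1 ⊗ₖ Y.Kinv q) + (1 ⊗ₖ Y.E) * g * (1 ⊗ₖ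
      Y.Kinv q) - g * (1 ⊗ₖ (Y.E * Y.Kinv q)) := by
      have : g * (X.E ⊗ₖ I[κ]) = (g * (X.E ⊗ₖ Y.K q)) * (1 ⊗ₖ Y.Kinv q) := by
        rw [mmul_assoc, ← mul_kronecker_mul, mmul_one, KKi]
      rw [this, eq_sub_of_add_eq' hE, msub_mul, madd_mul, mmul_assoc g, kk]
      abel
    unfold ptr
    rw [← tr₂_mul_kron, mmul_assoc, h1, mmul_sub, mmul_add, tr₂_sub, tr₂_add]
    have t1 : tr₂ ((I[ι] ⊗ₖ Y.K q) * ((X.E ⊗ₖ Y.K q) * g * (1 ⊗ₖ Y.Kinv q))) = X.E * tr₂ ((1 ⊗ₖ Y.K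
      q) * g) := by
      rw [← tr₂_kron_mul, ← mmul_assoc, ← tr₂_cyc]
      congr 1
      simp only [← mmul_assoc]
      congr 1
      simp only [← mul_kronecker_mul, mone_mul, mmul_one]
      rw [KiK, mone_mul]
    have t2 : tr₂ ((I[ι] ⊗ₖ Y.K q) * ((1 ⊗ₖ Y.E) * g * (1 ⊗ₖ Y.Kinv q))) = tr₂ ((1 ⊗ₖ Y.E) *
      g) := by
      rw [← mmul_assoc, ← tr₂_cyc]
      congr 1
      simp only [← mmul_assoc]
      congr 1
      rw [kk, kk, KiK, mone_mul]
    have t3 : tr₂ ((I[ι] ⊗ₖ Y.K q) * (g * (1 ⊗ₖ (Y.E * Y.Kinv q)))) = tr₂ ((1 ⊗ₖ Y.E) * g) := by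
      rw [← mmul_assoc, ← tr₂_cyc]
      congr 1
      simp only [← mmul_assoc]
      congr 1
      rw [kk, mmul_assoc, KiK, mmul_one]
    rw [t1, t2, t3]; abel
  · have h1 : g * (X.F ⊗ₖ I[κ]) = (X.F ⊗ₖ 1) * g + (X.Kinv q ⊗ₖ Y.F) * g - g * (X.Kinv q ⊗ₖ
      Y.F) := by
      rw [eq_sub_of_add_eq' hF]; abel
    unfold ptr
    rw [← tr₂_mul_kron, mmul_assoc, h1, mmul_sub, mmul_add, tr₂_sub, tr₂_add]
    have t1 : tr₂ ((I[ι] ⊗ₖ Y.K q) * ((X.F ⊗ₖ 1) * g)) = X.F * tr₂ ((1 ⊗ₖ Y.K q) * g) := by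
      rw [← tr₂_kron_mul]
      congr 1
      rw [← mmul_assoc, ← split', split, mmul_assoc]
    have t2 : tr₂ ((I[ι] ⊗ₖ Y.K q) * ((X.Kinv q ⊗ₖ Y.F) * g)) = tr₂ ((I[ι] ⊗ₖ Y.K q) * (g * (X.Kinv
      q ⊗ₖ Y.F))) := by
      have a1 : g * (X.Kinv q ⊗ₖ Y.F) = (X.Kinv q ⊗ₖ Y.Kinv q) * g * (1 ⊗ₖ (Y.K q * Y.F)) := by
        rw [← hKi, mmul_assoc, ← mul_kronecker_mul, mmul_one, ← mmul_assoc, KiK, mone_mul]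
      rw [a1, ← mmul_assoc _ _ (1 ⊗ₖ (Y.K q * Y.F)), ← tr₂_cyc]
      congr 1
      simp only [← mmul_assoc]
      congr 1
      simp only [← mul_kronecker_mul, mone_mul, mmul_one]
      rw [mmul_assoc, KKi, mmul_one]
    rw [t1, t2]; abel
  · unfold ptr
    rw [← tr₂_mul_kron, ← tr₂_kron_mul]
    have a1 : (1 ⊗ₖ Y.K q) * g * (X.K q ⊗ₖ I[κ]) = ((1 ⊗ₖ Y.K q) * (X.K q ⊗ₖ Y.K q) * g) * (1 ⊗ₖ
      Y.Kinv q) := by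
      have : X.K q ⊗ₖ I[κ] = (X.K q ⊗ₖ Y.K q) * (1 ⊗ₖ Y.Kinv q) := by
        rw [← mul_kronecker_mul, mmul_one, KKi]
      rw [this, mmul_assoc, ← mmul_assoc g, hK]
      simp only [mmul_assoc]
    rw [a1, ← tr₂_cyc]
    congr 1
    simp only [← mmul_assoc]
    congr 1
    simp only [← mul_kronecker_mul, mone_mul, mmul_one]
    rw [KiK, mone_mul]

/-- The quantum partial trace over the first factor. -/
def ptl (q : ℂ) (X : WeightModule ι) (g : M[ι × κ, ι × κ]) : M[κ, κ] := ptr q X.flip (g.submatrix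
  swap swap)

lemma ptl_isIntertwiner {g : M[ι × κ, ι × κ]} (hg : IsHom (X ⊠ Y) (X ⊠ Y) g) : IsHom Y Y (ptl q X
    g) := by
  have := (ptr_isIntertwiner (hg.flip_tensor)).flip
  rwa [WeightModule.flip_flip] at this

lemma trace_mul_ptr (A : M[ι, ι]) (g : M[ι × κ, ι × κ]) : (A * ptr q Y g).trace = ((A ⊗ₖ Y.K q) *
    g).trace := by
  rw [ptr, ← tr₂_kron_mul, trace_tr₂, ← mmul_assoc, ← mul_kronecker_mul, mmul_one, mone_mul]

lemma trace_submatrix_swap (M : M[ι × κ, ι × κ]) : (M.submatrix swap swap : M[κ × ι, κ × ι]).trace =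
    M.trace := by
  simp only [trace, Matrix.diag, submatrix_apply]
  exact Fintype.sum_equiv (prodComm κ ι) _ _ fun _ => rfl

lemma trace_mul_ptl (B : M[κ, κ]) (g : M[ι × κ, ι × κ]) : (B * ptl q X g).trace = ((X.Kinv q ⊗ₖ B) *
    g).trace := by
  rw [ptl, trace_mul_ptr, flip_K, ← kronecker_submatrix_swap]
  erw [submatrix_mul_equiv _ _ _ (prodComm κ ι) _]
  exact trace_submatrix_swap _

lemma ptr_mul_kron_one (g : M[ι × κ, ι × κ]) (n : M[ι, ι]) : ptr q Y (g * (n ⊗ₖ 1)) = ptr q Y g *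
    n := by
  rw [ptr, ← mmul_assoc, tr₂_mul_kron, ptr]

/-! ### `q`-integers and the spin representations -/

@[simp] theorem qInt_zero : qInt q 0 = 0 := by simp [qInt]

lemma qInt_one : qInt q 1 = 1 := by simp [qInt, div_self q_sub_ne_zero]

lemma sub_mul_qInt (n : ℕ) : (q - q⁻¹) * qInt q n = q ^ n - q⁻¹ ^ n := by
  rw [qInt, mul_div_cancel₀ _ q_sub_ne_zero]

lemma qInt_add (m n : ℕ) : qInt q (m + n) = q ^ m * qInt q n + q⁻¹ ^ n * qInt q m := by
  simp only [qInt, pow_add]; ring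

lemma qInt_add' (m n : ℕ) : qInt q (m + n) = q⁻¹ ^ m * qInt q n + q ^ n * qInt q m := by
  simp only [qInt, pow_add]; ring

lemma qInt_eq_zero_of_pow {n : ℕ} (h : q ^ n = 1) : qInt q n = 0 := by simp [qInt, h]

lemma qInt_mul_sub {a i : ℕ} (hi : i ≤ a) : (q - q⁻¹) * (qInt q (i + 1) * qInt q (a - i) - qInt q i
    * qInt q (a + 1 - i)) = q ^ ((a : ℤ) - 2 * i) - q ^ (-((a : ℤ) - 2 * i)) := by
  obtain ⟨m, rfl⟩ := Nat.exists_eq_add_of_le hi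
  have e1 : i + m - i = m := by omega
  have e2 : i + m + 1 - i = m + 1 := by omega
  have e3 : q ^ (((i + m : ℕ) : ℤ) - 2 * i) = q ^ m * q⁻¹ ^ i := by
    rw [show ((i + m : ℕ) : ℤ) - 2 * i = (m : ℤ) - i by push_cast; ring, zpow_sub₀ q0]
    simp [div_eq_mul_inv]
  have e4 : q ^ (-(((i + m : ℕ) : ℤ) - 2 * i)) = q ^ i * q⁻¹ ^ m := by
    rw [show -(((i + m : ℕ) : ℤ) - 2 * i) = (i : ℤ) - m by push_cast; ring, zpow_sub₀ q0]
    simp [div_eq_mul_inv]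
  rw [e1, e2, e3, e4, qInt_add i 1, qInt_add m 1, qInt_one]
  linear_combination q ^ i * (sub_mul_qInt (q := q) m) - q ^ m * (sub_mul_qInt (q := q) i)

lemma spin_E_mul (a : ℕ) (M : M[Fin (a + 1), τ]) (i : Fin (a + 1)) (j : τ) : ((spin q a).E * M) i j
    = if h : (i : ℕ) + 1 < a + 1 then
      qInt q (i + 1) * qInt q (a - i) * M ⟨i + 1, h⟩ j else 0 := by
  rw [mmul_apply]
  split_ifs with h
  · rw [sum_eq_single (⟨i + 1, h⟩ : Fin (a + 1))]
    · simp [spin]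
    · intro b _ hb
      have : (i : ℕ) + 1 ≠ b := fun e => hb (Fin.ext e.symm)
      simp [spin, this]
    · simp
  · refine sum_eq_zero fun b _ => ?_
    have : (i : ℕ) + 1 ≠ b := by omega
    simp [spin, this]

lemma spin_F_mul (a : ℕ) (M : M[Fin (a + 1), τ]) (i : Fin (a + 1)) (j : τ) : ((spin q a).F * M) i j
    = if 0 < (i : ℕ) then
      M ⟨i - 1, by omega⟩ j else 0 := by
  rw [mmul_apply]
  split_ifs with h
  · rw [sum_eq_single (⟨i - 1, by omega⟩ : Fin (a + 1))]
    · have : (i : ℕ) = i - 1 + 1 := by omega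
      simp [spin, ← this]
    · intro b _ hb
      have : (i : ℕ) ≠ b + 1 := fun e => hb (Fin.ext (by simp; omega))
      simp [spin, this]
    · simp
  · refine sum_eq_zero fun b _ => ?_
    have : (i : ℕ) ≠ b + 1 := by omega
    simp [spin, this]

lemma mul_spin_E (a : ℕ) (M : M[τ, Fin (a + 1)]) (i : τ) (j : Fin (a + 1)) : (M * (spin q a).E) i j
    = if 0 < (j : ℕ) then
      M i ⟨j - 1, by omega⟩ * (qInt q j * qInt q (a + 1 - j)) else 0 := by
  rw [mmul_apply]
  split_ifs with h
  · rw [sum_eq_single (⟨j - 1, by omega⟩ : Fin (a + 1))]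
    · have : (j : ℕ) - 1 + 1 = j := by omega
      simp [spin, this]
    · intro b _ hb
      have : (b : ℕ) + 1 ≠ j := fun e => hb (Fin.ext (by simp; omega))
      simp [spin, this]
    · simp
  · refine sum_eq_zero fun b _ => ?_
    have : (b : ℕ) + 1 ≠ j := by omega
    simp [spin, this]

lemma mul_spin_F (a : ℕ) (M : M[τ, Fin (a + 1)]) (i : τ) (j : Fin (a + 1)) : (M * (spin q a).F) i j
    = if h : (j : ℕ) + 1 < a + 1 then M i ⟨j + 1, h⟩ else 0 := by
  rw [mmul_apply]
  split_ifs with h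
  · rw [sum_eq_single (⟨j + 1, h⟩ : Fin (a + 1))]
    · simp [spin]
    · intro b _ hb
      have : (b : ℕ) ≠ j + 1 := fun e => hb (Fin.ext e)
      simp [spin, this]
    · simp
  · refine sum_eq_zero fun b _ => ?_
    have : (b : ℕ) ≠ j + 1 := by omega
    simp [spin, this]

lemma spin_isRep (a : ℕ) : (spin q a).IsRep q := by
  refine ⟨fun i j h => ?_, fun i j h => ?_, ?_⟩
  · have : (i : ℕ) + 1 = j := by by_contra hne; exact h (by simp [spin, hne])
    simp only [spin]; omega
  · have : (i : ℕ) = j + 1 := by by_contra hne; exact h (by simp [spin, hne])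
    simp only [spin]; omega
  · ext i j
    rw [msmul_apply, msub_apply, spin_E_mul, spin_F_mul, msub_apply]
    simp only [K, Kinv, diagonal_apply]
    by_cases hij : i = j
    · subst hij
      have key := qInt_mul_sub (q := q) (Nat.lt_succ_iff.1 i.2)
      simp only [if_true, smul_eq_mul]
      have e0 : (spin q a).wt i = (a : ℤ) - 2 * (i : ℕ) := rfl
      rw [e0, ← key]
      congr 1
      have h1 : (if h : (i : ℕ) + 1 < a + 1 then
          qInt q (i + 1) * qInt q (a - i) * (spin q a).F ⟨i + 1, h⟩ i else 0) = qInt q (i + 1) *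
          qInt q (a - i) := by
        split_ifs with h
        · simp [spin]
        · have : a - (i : ℕ) = 0 := by omega
          simp [this]
      have h2 : (if 0 < (i : ℕ) then (spin q a).E ⟨i - 1, by omega⟩ i else 0) =
          qInt q i * qInt q (a + 1 - i) := by
        split_ifs with h
        · have : (i : ℕ) - 1 + 1 = i := by omega
          simp [spin, this]
        · have : (i : ℕ) = 0 := by omega
          simp [this]
      rw [h1, h2]
    · have hne : (i : ℕ) ≠ j := fun e => hij (Fin.ext e)
      have h1 : (if h : (i : ℕ) + 1 < a + 1 then
          qInt q (i + 1) * qInt q (a - i) * (spin q a).F ⟨i + 1, h⟩ j else 0) = 0 := by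
        split_ifs with h
        · simp [spin, hne]
        · rfl
      have h2 : (if 0 < (i : ℕ) then (spin q a).E ⟨i - 1, by omega⟩ j else 0) = 0 := by
        split_ifs with h
        · have : (i : ℕ) - 1 + 1 ≠ j := by omega
          simp [spin, this]
        · rfl
      rw [h1, h2]; simp [hij]

lemma spin_zero_E : (spin q 0).E = 0 := by ext i j; fin_cases i; fin_cases j; simp [spin]

lemma spin_zero_F : (spin q 0).F = 0 := by ext i j; fin_cases i; fin_cases j; simp [spin]

lemma spin_zero_wt (i : Fin 1) : (spin q 0).wt i = 0 := by fin_cases i; simp [spin]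

lemma spin_zero_K : (spin q 0).K q = 1 := by ext i j; fin_cases i; fin_cases j; simp [K, spin]

/-! ### Schur's lemma -/

lemma WeightModule.IsIntertwiner.eq_zero_or_bijective (hX : IsIrreducible q X) (hY : IsIrreducible q
    Y) {T : M[κ, ι]} (hT : IsHom X Y T) : T = 0 ∨ Bijective T.mulVecLin := by
  by_cases h0 : T = 0
  · exact Or.inl h0
  right
  have hne : T.mulVecLin ≠ 0 := by
    intro h; apply h0
    ext i j
    have := congrFun (LinearMap.congr_fun h (Pi.single j 1)) i
    simpa using this
  constructor
  · rcases hX.2 (LinearMap.ker T.mulVecLin) (fun w hw => by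
      simp only [LinearMap.mem_ker, Matrix.mulVecLin_apply] at hw ⊢
      refine ⟨?_, ?_, ?_⟩ <;> rw [mulVec_mulVec]
      · rw [hT.1, ← mulVec_mulVec, hw, Matrix.mulVec_zero]
      · rw [hT.2.1, ← mulVec_mulVec, hw, Matrix.mulVec_zero]
      · rw [hT.2.2, ← mulVec_mulVec, hw, Matrix.mulVec_zero]) with h | h
    · exact LinearMap.ker_eq_bot.1 h
    · exact absurd (LinearMap.ker_eq_top.1 h) hne
  · rcases hY.2 (LinearMap.range T.mulVecLin) (fun w hw => by
      obtain ⟨u, rfl⟩ := hw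
      simp only [Matrix.mulVecLin_apply, mulVec_mulVec]
      rw [← hT.1, ← hT.2.1, ← hT.2.2]
      refine ⟨⟨X.E.mulVec u, ?_⟩, ⟨X.F.mulVec u, ?_⟩, ⟨(X.K q).mulVec u, ?_⟩⟩ <;>
        simp [mulVec_mulVec]) with h | h
    · exact absurd (LinearMap.range_eq_bot.1 h) hne
    · exact LinearMap.range_eq_top.1 h

lemma WeightModule.IsIntertwiner.eq_smul_one (hX : IsIrreducible q X) {T : M[ι, ι]} (hT : IsHom X X
    T) : ∃ c : ℂ, T = c • I[ι] := by
  have := hX.1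
  obtain ⟨c, hc⟩ := Module.End.exists_eigenvalue T.mulVecLin
  refine ⟨c, ?_⟩
  have h1 : IsHom X X (T - c • I[ι]) := hT.sub (isIntertwiner_one.smul c)
  rcases h1.eq_zero_or_bijective hX hX with h | h
  · exact sub_eq_zero.1 h
  · exfalso
    obtain ⟨w, hw⟩ := hc.exists_hasEigenvector
    apply hw.2
    apply h.1
    have := hw.apply_eq_smul
    simp only [Matrix.mulVecLin_apply] at this
    simp [this]

lemma intertwiner_eq_zero_of_ne {γ γ' : Phys q} (h : γ ≠ γ') {T : M[γ', γ]} (hT : IsHom γ.rep γ'.rep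
    T) : T = 0 := by
  rcases hT.eq_zero_or_bijective γ.2.1 γ'.2.1 with h0 | hb
  · exact h0
  · exfalso
    have := (LinearEquiv.ofBijective _ hb).finrank_eq
    simp at this
    exact h (Subtype.ext this)

lemma intertwiner_phys_scalar {T : M[γ, γ]} (hT : IsHom γ.rep γ.rep T) : ∃ c : ℂ, T = c • I[_] :=
  hT.eq_smul_one γ.2.1

lemma spin_isIrreducible {a : ℕ} (h : ∀ k, 1 ≤ k → k ≤ a → qInt q k ≠ 0) : IsIrreducible q (spin q
    a) := by
  refine ⟨⟨0⟩, fun W hW => ?_⟩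
  by_cases hb : W = ⊥
  · exact Or.inl hb
  right
  have hE : ∀ w ∈ W, (spin q a).E.mulVec w ∈ W := fun w hw => (hW w hw).1
  have hF : ∀ w ∈ W, (spin q a).F.mulVec w ∈ W := fun w hw => (hW w hw).2.1
  have Eapp : ∀ (w : Fin (a + 1) → ℂ) i, (spin q a).E.mulVec w i = if h : (i : ℕ) + 1 < a + 1 then
    qInt q (i + 1) * qInt q (a - i) * w ⟨i + 1, h⟩ else 0 := by
    intro w i
    have := spin_E_mul (q := q) a (of fun i (_ : Unit) => w i) i ()
    simpa [mmul_apply, mulVec, dotProduct] using this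
  have Fapp : ∀ (w : Fin (a + 1) → ℂ) i, (spin q a).F.mulVec w i =
      if 0 < (i : ℕ) then w ⟨i - 1, by omega⟩ else 0 := by
    intro w i
    have := spin_F_mul (q := q) a (of fun i (_ : Unit) => w i) i ()
    simpa [mmul_apply, mulVec, dotProduct] using this
  have main : ∀ m, ∀ hm : m < a + 1, ∀ w ∈ W, w ⟨m, hm⟩ ≠ 0 → (∀ i : Fin (a + 1), m < i → w i = 0) →
    (Pi.single 0 1 : Fin (a + 1) → ℂ) ∈ W := by
    intro m
    induction m with
    | zero =>
      intro hm w hw h0 hz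
      have : (Pi.single 0 1 : Fin (a + 1) → ℂ) = (w ⟨0, hm⟩)⁻¹ • w := by
        ext i
        by_cases hi : i = 0
        · subst hi
          have e : (⟨0, hm⟩ : Fin (a + 1)) = 0 := rfl
          rw [e] at h0 ⊢
          simp [h0]
        · have : 0 < (i : ℕ) := Nat.pos_of_ne_zero fun e => hi (Fin.ext e)
          simp [hi, hz i this]
      rw [this]
      exact W.smul_mem _ hw
    | succ m ih =>
      intro hm w hw h0 hz
      refine ih (by omega) _ (hE w hw) ?_ ?_
      · rw [Eapp, dif_pos hm]
        exact mul_ne_zero (mul_ne_zero (h _ (by omega) (by simp; omega))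
          (h _ (by simp; omega) (by simp))) h0
      · intro i hi
        rw [Eapp]
        split_ifs with h'
        · rw [hz ⟨i + 1, h'⟩ (by simp; omega), mul_zero]
        · rfl
  obtain ⟨w, hw, hne⟩ := (Submodule.ne_bot_iff W).1 hb
  have h0 : (Pi.single 0 1 : Fin (a + 1) → ℂ) ∈ W := by
    have hex : ∃ i, w i ≠ 0 := by by_contra hcon; push Not at hcon; exact hne (funext hcon)
    classical
    let s := Finset.univ.filter fun i => w i ≠ 0
    have hs : s.Nonempty := by obtain ⟨i, hi⟩ := hex; exact ⟨i, by simp [s, hi]⟩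
    have hm := Finset.max'_mem s hs
    refine main (s.max' hs) (s.max' hs).2 w hw (by simpa [s] using hm) fun i hi => ?_
    by_contra hcon
    have := Finset.le_max' s i (by simp [s, hcon])
    exact absurd this (not_le.2 hi)
  have hk : ∀ k, ∀ hk : k < a + 1, (Pi.single ⟨k, hk⟩ 1 : Fin (a + 1) → ℂ) ∈ W := by
    intro k
    induction k with
    | zero => intro _; exact h0
    | succ k ih =>
      intro hk
      have := hF _ (ih (by omega))
      convert this using 1
      ext i
      rw [Fapp]
      split_ifs with h'
      · by_cases hi : i = ⟨k + 1, hk⟩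
        · subst hi; simp
        · have : (⟨i - 1, by omega⟩ : Fin (a + 1)) ≠ ⟨k, by omega⟩ := by
            intro e; apply hi; ext; have := congrArg Fin.val e; simp at this ⊢; omega
          rw [Pi.single_eq_of_ne hi, Pi.single_eq_of_ne this]
      · have hi : i ≠ ⟨k + 1, hk⟩ := by rintro rfl; simp at h'
        simp [hi]
  rw [Submodule.eq_top_iff']
  intro x
  rw [← Finset.univ_sum_single x]
  refine W.sum_mem fun i _ => ?_
  have : Pi.single i (x i) = x i • (Pi.single i 1 : Fin (a + 1) → ℂ) := by
    ext j; simp [Pi.single_apply]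
  rw [this]
  exact W.smul_mem _ (hk i i.2)

lemma qInt_ne_zero_of_isIrreducible {a : ℕ} (h : IsIrreducible q (spin q a)) (k : ℕ) (h1 : 1 ≤ k)
    (hk : k ≤ a) : qInt q k ≠ 0 := by
  intro h0
  have Eapp : ∀ (w : Fin (a + 1) → ℂ) i, (spin q a).E.mulVec w i = if h : (i : ℕ) + 1 < a + 1 then
    qInt q (i + 1) * qInt q (a - i) * w ⟨i + 1, h⟩ else 0 := by
    intro w i
    have := spin_E_mul (q := q) a (of fun i (_ : Unit) => w i) i ()
    simpa [mmul_apply, mulVec, dotProduct] using this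
  have Fapp : ∀ (w : Fin (a + 1) → ℂ) i, (spin q a).F.mulVec w i =
      if 0 < (i : ℕ) then w ⟨i - 1, by omega⟩ else 0 := by
    intro w i
    have := spin_F_mul (q := q) a (of fun i (_ : Unit) => w i) i ()
    simpa [mmul_apply, mulVec, dotProduct] using this
  let W : Submodule ℂ (Fin (a + 1) → ℂ) :=
    { carrier := {w | ∀ i : Fin (a + 1), (i : ℕ) < k → w i = 0}
      add_mem' := fun {x y} hx hy i hi => by simp [hx i hi, hy i hi]
      zero_mem' := fun i _ => rfl
      smul_mem' := fun c x hx i hi => by simp [hx i hi] }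
  have hst : ∀ w ∈ W, (spin q a).E.mulVec w ∈ W ∧ (spin q a).F.mulVec w ∈ W ∧ ((spin q a).K
    q).mulVec w ∈ W := by
    intro w hw
    refine ⟨fun i hi => ?_, fun i hi => ?_, fun i hi => ?_⟩
    · rw [Eapp]
      split_ifs with h'
      · by_cases e : (i : ℕ) + 1 = k
        · rw [show qInt q (i + 1) = 0 by rw [e, h0]]; ring
        · rw [hw ⟨i + 1, h'⟩ (by simp; omega), mul_zero]
      · rfl
    · rw [Fapp]
      split_ifs with h'
      · exact hw _ (by simp; omega)
      · rfl
    · have : (spin q a).K q = Matrix.diagonal fun i => q ^ (spin q a).wt i := rfl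
      rw [this, Matrix.mulVec_diagonal, hw i hi, mul_zero]
  rcases h.2 W hst with hW | hW
  · have : (Pi.single (Fin.last a) 1 : Fin (a + 1) → ℂ) ∈ W := by
      intro i hi
      have : i ≠ Fin.last a := by rintro rfl; simp at hi; omega
      simp [this]
    rw [hW, Submodule.mem_bot] at this
    have := congrFun this (Fin.last a)
    simp at this
  · have : (Pi.single 0 1 : Fin (a + 1) → ℂ) ∈ W := by rw [hW]; trivial
    have := this 0 (by simp; omega)
    simp at this

/-! ### Pairings -/

/-- A bilinear form as a matrix with one row. -/
def rowM (a : M[ι, κ]) : M[Fin 1, ι × κ] := of fun _ p => a p.1 p.2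

/-- A tensor as a matrix with one column. -/
def colM (b : M[ι, κ]) : M[ι × κ, Fin 1] := of fun p _ => b p.1 p.2

lemma rowM_mul_kron (a : M[ι, κ]) (A : M[ι, ι']) (B : M[κ, κ']) : rowM a * (A ⊗ₖ B) = rowM
    (A.transpose * a * B) := by
  ext i ⟨j, k⟩
  simp only [rowM, mmul_apply, sum_prod_type, of_apply, kroneckerMap_apply, transpose_apply,
    sum_mul]
  rw [sum_comm]
  exact sum_congr rfl fun _ _ => sum_congr rfl fun _ _ => by ring

lemma kron_mul_colM (b : M[ι, κ]) (A : M[ι', ι]) (B : M[κ', κ]) : (A ⊗ₖ B) * colM b = colM (A * b *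
    B.transpose) := by
  ext ⟨j, k⟩ i
  simp only [colM, mmul_apply, sum_prod_type, of_apply, kroneckerMap_apply, transpose_apply,
    sum_mul]
  rw [sum_comm]
  exact sum_congr rfl fun _ _ => sum_congr rfl fun _ _ => by ring

lemma rowM_injective : Injective (rowM : M[ι, κ] → _) := by
  intro a b h; ext i j
  exact congr_fun₂ h 0 (i, j)

lemma colM_injective : Injective (colM : M[ι, κ] → _) := by
  intro a b h; ext i j
  exact congr_fun₂ h (i, j) 0

lemma rowM_add (a b : M[ι, κ]) : rowM a + rowM b = rowM (a + b) := rfl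

lemma colM_add (a b : M[ι, κ]) : colM a + colM b = colM (a + b) := rfl

lemma rowM_zero : rowM (0 : M[ι, κ]) = 0 := rfl

lemma colM_zero : colM (0 : M[ι, κ]) = 0 := rfl

lemma dual_K (X : WeightModule ι) : (dual q X).K q = X.Kinv q := rfl

lemma dual_Kinv (X : WeightModule ι) : (dual q X).Kinv q = X.K q := by simp [dual, K, Kinv]

lemma K_transpose (X : WeightModule ι) : (X.K q).transpose = X.K q := by simp [K]

lemma Kinv_transpose (X : WeightModule ι) : (X.Kinv q).transpose = X.Kinv q := by simp [Kinv]

lemma isIntertwiner_rowM_dual_left {a : M[ι, κ]} : IsHom (dual q X ⊠ Y) (spin q 0) (rowM a) ↔ IsHom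
    Y X a := by
  have E1 : rowM a * (dual q X ⊠ Y).E = rowM (a * Y.E - X.E * X.Kinv q * a * Y.K q) := by
    simp only [tensor, mmul_add, rowM_mul_kron, rowM_add]
    congr 1
    simp [dual, sub_eq_add_neg]
  have F1 : rowM a * (dual q X ⊠ Y).F = rowM (X.K q * a * Y.F - X.K q * X.F * a) := by
    simp only [tensor, mmul_add, rowM_mul_kron, rowM_add, dual_Kinv]
    congr 1
    simp [dual, sub_eq_add_neg, K_transpose]
  have K1 : rowM a * (dual q X ⊠ Y).K q = rowM (X.Kinv q * a * Y.K q) := by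
    rw [tensor_K, rowM_mul_kron, dual_K, Kinv_transpose]
  unfold IsIntertwiner
  rw [E1, F1, K1, spin_zero_E, spin_zero_F, spin_zero_K, mzero_mul, mone_mul, ← rowM_zero,
    rowM_injective.eq_iff, rowM_injective.eq_iff, rowM_injective.eq_iff]
  have kk : X.Kinv q * a * Y.K q = a ↔ a * Y.K q = X.K q * a := by
    constructor
    · intro h
      conv_rhs => rw [← h]
      rw [← mmul_assoc, ← mmul_assoc, K_mul_Kinv, mone_mul]
    · intro h
      rw [mmul_assoc, h, ← mmul_assoc, Kinv_mul_K, mone_mul]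
  rw [kk]
  constructor
  · rintro ⟨h1, h2, h3⟩
    refine ⟨?_, ?_, h3⟩
    · have := sub_eq_zero.1 h1
      rw [this, mmul_assoc, mmul_assoc, h3, ← mmul_assoc (X.Kinv q), Kinv_mul_K, mone_mul]
    · have := congrArg (X.Kinv q * ·) (sub_eq_zero.1 h2)
      simpa only [← mmul_assoc, Kinv_mul_K, mone_mul] using this
  · rintro ⟨h1, h2, h3⟩
    refine ⟨?_, ?_, h3⟩
    · rw [sub_eq_zero, h1, mmul_assoc, mmul_assoc, h3, ← mmul_assoc (X.Kinv q), Kinv_mul_K,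
        mone_mul]
    · rw [sub_eq_zero, mmul_assoc, h2, mmul_assoc]

lemma isIntertwiner_colM_dual_right {b : M[ι, κ]} : IsHom (spin q 0) (X ⊠ dual q Y) (colM b) ↔ IsHom
    Y X b := by
  have E1 : (X ⊠ dual q Y).E * colM b = colM (X.E * b * Y.Kinv q - b * (Y.E * Y.Kinv q)) := by
    simp only [tensor, madd_mul, kron_mul_colM, colM_add]
    congr 1
    simp [dual, sub_eq_add_neg, add_comm, K, Kinv]
  have F1 : (X ⊠ dual q Y).F * colM b = colM (X.F * b - X.Kinv q * b * (Y.K q * Y.F)) := by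
    simp only [tensor, madd_mul, kron_mul_colM, colM_add]
    congr 1
    simp [dual, sub_eq_add_neg, add_comm]
  have K1 : (X ⊠ dual q Y).K q * colM b = colM (X.K q * b * Y.Kinv q) := by
    rw [tensor_K, kron_mul_colM, dual_K, Kinv_transpose]
  unfold IsIntertwiner
  rw [E1, F1, K1, spin_zero_E, spin_zero_F, spin_zero_K, mmul_zero, mmul_one, ← colM_zero,
    colM_injective.eq_iff, colM_injective.eq_iff, colM_injective.eq_iff]
  have kk : b = X.K q * b * Y.Kinv q ↔ b * Y.K q = X.K q * b := by
    constructor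
    · intro h
      conv_lhs => rw [h]
      rw [mmul_assoc, Kinv_mul_K, mmul_one]
    · intro h
      rw [← h, mmul_assoc, K_mul_Kinv, mmul_one]
  rw [kk]
  constructor
  · rintro ⟨h1, h2, h3⟩
    refine ⟨?_, ?_, h3⟩
    · have := congrArg (· * Y.K q) (sub_eq_zero.1 h1.symm)
      simp only [mmul_assoc, Kinv_mul_K, mmul_one] at this
      exact this.symm
    · have := sub_eq_zero.1 h2.symm
      rw [this, ← mmul_assoc, mmul_assoc (X.Kinv q), h3, ← mmul_assoc, Kinv_mul_K, mone_mul]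
  · rintro ⟨h1, h2, h3⟩
    refine ⟨?_, ?_, h3⟩
    · rw [eq_comm, sub_eq_zero, ← h1, mmul_assoc]
    · rw [eq_comm, sub_eq_zero, ← mmul_assoc, mmul_assoc (X.Kinv q), h3, ← mmul_assoc, Kinv_mul_K,
        mone_mul, h2]

lemma isIntertwiner_rowM_dual_right {m : M[ι, κ]} : IsHom (X ⊠ dual q Y) (spin q 0) (rowM m) ↔ IsHom
    X Y (Y.Kinv q * m.transpose) := by
  obtain ⟨h, rfl⟩ : ∃ h : M[κ, ι], m = (Y.K q * h).transpose :=
    ⟨Y.Kinv q * m.transpose, by rw [← mmul_assoc, K_mul_Kinv]; simp⟩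
  rw [transpose_transpose, ← mmul_assoc, Kinv_mul_K, mone_mul]
  have tr : ∀ {a b : Type} (M N : M[a, b]), M = N ↔ M.transpose = N.transpose := fun M N =>
    Matrix.transpose_injective.eq_iff.symm
  have E1 : rowM (Y.K q * h).transpose * (X ⊠ dual q Y).E = rowM (Y.Kinv q * (Y.K q * h) * X.E - Y.E
    * h).transpose := by
    simp only [tensor, mmul_add, rowM_mul_kron, rowM_add]
    congr 1
    rw [tr]
    have e : Y.E * Y.Kinv q * (Y.K q * h) = Y.E * h := by
      rw [mmul_assoc, ← mmul_assoc (Y.Kinv q), Kinv_mul_K, mone_mul]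
    have e2 : Y.Kinv q * (Y.K q * h) = h := by rw [← mmul_assoc, Kinv_mul_K, mone_mul]
    simp only [dual_K, Matrix.transpose_add, transpose_mul, transpose_transpose, Kinv_transpose,
      K_transpose, transpose_one, mone_mul, e2]
    simp only [dual, Matrix.transpose_neg, transpose_transpose, transpose_mul, Matrix.neg_mul]
    rw [← mmul_assoc] at e
    simp only [mmul_assoc] at e ⊢
    simp only [e]
    rw [← sub_eq_neg_add, ← mmul_assoc, ← mmul_assoc, Kinv_mul_K, mone_mul]
  have F1 : rowM (Y.K q * h).transpose * (X ⊠ dual q Y).F = rowM (Y.K q * h * X.F - Y.K q * Y.F *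
    (Y.K q * h * X.Kinv q)).transpose := by
    simp only [tensor, mmul_add, rowM_mul_kron, rowM_add]
    congr 1
    rw [tr]
    simp [dual, sub_eq_add_neg, add_comm, Matrix.transpose_add, Kinv_transpose, mmul_assoc]
  have K1 : rowM (Y.K q * h).transpose * (X ⊠ dual q Y).K q = rowM (h * X.K q).transpose := by
    rw [tensor_K, rowM_mul_kron, dual_K]
    congr 1
    rw [tr]
    simp only [transpose_mul, transpose_transpose, K_transpose, Kinv_transpose]
    rw [← mmul_assoc, ← mmul_assoc, Kinv_mul_K, mone_mul]
  unfold IsIntertwiner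
  rw [E1, F1, K1, spin_zero_E, spin_zero_F, spin_zero_K, mzero_mul, mone_mul, ← rowM_zero,
    rowM_injective.eq_iff, rowM_injective.eq_iff, rowM_injective.eq_iff, ← tr,
    Matrix.transpose_eq_zero, Matrix.transpose_eq_zero, ← mmul_assoc, Kinv_mul_K, mone_mul,
    sub_eq_zero, sub_eq_zero]
  refine and_congr Iff.rfl ⟨?_, ?_⟩
  · rintro ⟨h2, h3⟩
    refine ⟨?_, h3⟩
    rw [← h3, mmul_assoc h (X.K q) (X.Kinv q), K_mul_Kinv, mmul_one, h3] at h2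
    have := congrArg (Y.Kinv q * ·) h2
    simpa only [← mmul_assoc, Kinv_mul_K, mone_mul] using this
  · rintro ⟨h2, h3⟩
    refine ⟨?_, h3⟩
    rw [← h3, mmul_assoc h (X.K q) (X.Kinv q), K_mul_Kinv, mmul_one, h3, mmul_assoc, h2, mmul_assoc]

/-- The evaluation pairing. -/
def evM (ι : Type) [DecidableEq ι] : M[Fin 1, ι × ι] := rowM 1

/-- The coevaluation. -/
def coevM (ι : Type) [DecidableEq ι] : M[ι × ι, Fin 1] := colM 1

lemma evM_isIntertwiner (X : WeightModule ι) : IsHom (dual q X ⊠ X) (spin q 0) (evM ι) :=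
  (isIntertwiner_rowM_dual_left).2 isIntertwiner_one

lemma coevM_isIntertwiner (X : WeightModule ι) : IsHom (spin q 0) (X ⊠ dual q X) (coevM ι) :=
  (isIntertwiner_colM_dual_right).2 isIntertwiner_one

lemma rowM_K_isIntertwiner (X : WeightModule ι) : IsHom (X ⊠ dual q X) (spin q 0) (rowM (X.K
    q)) := by
  rw [isIntertwiner_rowM_dual_right, K_transpose, Kinv_mul_K]
  exact isIntertwiner_one

lemma colM_Kinv_isIntertwiner (hX : X.IsRep q) : IsHom (spin q 0) (dual q X ⊠ X) (colM (X.Kinv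
    q)) := by
  unfold IsIntertwiner
  rw [spin_zero_E, spin_zero_F, spin_zero_K, mmul_zero, mmul_one, tensor_K, kron_mul_colM]
  simp only [tensor, madd_mul, kron_mul_colM, colM_add]
  rw [← colM_zero, colM_injective.eq_iff, colM_injective.eq_iff, colM_injective.eq_iff]
  have h1 := hX.EKinv
  have h2 := hX.KinvF
  refine ⟨?_, ?_, ?_⟩
  · rw [mone_mul, K_transpose, mmul_assoc, Kinv_mul_K, mmul_one]
    simp [dual, transpose_mul, Kinv_transpose]
  · rw [dual_Kinv, K_mul_Kinv, mone_mul, transpose_one, mmul_one]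
    simp [dual, transpose_mul, K_transpose, mmul_assoc, K_mul_Kinv]
  · rw [dual_K, K_transpose, mmul_assoc, Kinv_mul_K, mmul_one]

/-! ### Physical representations -/

lemma trace_spin_K (a : ℕ) : ((spin q a).K q).trace = qInt q (a + 1) := by
  have h : (q - q⁻¹) * ((spin q a).K q).trace = (q - q⁻¹) * qInt q (a + 1) := by
    rw [sub_mul_qInt]
    have e : ((spin q a).K q).trace = ∑ i ∈ range (a + 1), q ^ ((a : ℤ) - 2 * (i : ℤ)) := by
      rw [Finset.sum_range]; simp [K, Matrix.trace_diagonal, spin]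
    rw [e, mul_sum]
    have := Finset.sum_range_sub' (fun i : ℕ => q ^ ((a : ℤ) + 1 - 2 * (i : ℤ))) (a + 1)
    have e2 : ∀ i : ℕ, (q - q⁻¹) * q ^ ((a : ℤ) - 2 * (i : ℤ)) = q ^ ((a : ℤ) + 1 - 2 * (i : ℤ)) - q
      ^ ((a : ℤ) + 1 - 2 * ((i + 1 : ℕ) : ℤ)) := by
      intro i
      rw [show (a : ℤ) + 1 - 2 * (i : ℤ) = ((a : ℤ) - 2 * (i : ℤ)) + 1 by ring,
        show (a : ℤ) + 1 - 2 * ((i + 1 : ℕ) : ℤ) = ((a : ℤ) - 2 * (i : ℤ)) - 1 by push_cast; ring,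
        zpow_add_one₀ q0, zpow_sub_one₀ q0]
      ring
    rw [sum_congr rfl fun i _ => e2 i, this]
    rw [show (a : ℤ) + 1 - 2 * ((0 : ℕ) : ℤ) = ((a + 1 : ℕ) : ℤ) by push_cast; ring,
      show (a : ℤ) + 1 - 2 * ((a + 1 : ℕ) : ℤ) = -((a + 1 : ℕ) : ℤ) by push_cast; ring,
      zpow_neg, zpow_natCast, inv_pow]
  exact mul_left_cancel₀ q_sub_ne_zero h

lemma rowM_mul_colM (m b : M[ι, κ]) : rowM m * colM b = (m.transpose * b).trace • I[Fin 1] := by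
  ext i j
  fin_cases i; fin_cases j
  simp only [rowM, colM, mmul_apply, sum_prod_type, of_apply, trace, Matrix.diag, transpose_apply,
    msmul_apply, mone_apply, smul_eq_mul]
  rw [sum_comm]; simp

lemma isPhys_iff (a : ℕ) : IsPhys q a ↔ ∀ k, 1 ≤ k → k ≤ a + 1 → qInt q k ≠ 0 := by
  constructor
  · rintro ⟨hirr, f, g, hf, hg, hne⟩ k h1 hk
    rcases Nat.lt_or_ge a k with hlt | hle
    · obtain rfl : k = a + 1 := by omega
      rw [← trace_spin_K]
      intro h0
      apply hne
      obtain ⟨b, rfl⟩ : ∃ b, f = colM b := ⟨of fun i j => f (i, j) 0, by ext p i; fin_cases i; rfl⟩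
      obtain ⟨m, rfl⟩ : ∃ m, g = rowM m := ⟨of fun i j => g 0 (i, j), by ext i p; fin_cases i; rfl⟩
      obtain ⟨x, hx⟩ := ((isIntertwiner_colM_dual_right).1 hf).eq_smul_one hirr
      obtain ⟨y, hy⟩ := ((isIntertwiner_rowM_dual_right).1 hg).eq_smul_one hirr
      have hm : m.transpose = y • (spin q a).K q := by
        have := congrArg ((spin q a).K q * ·) hy
        simpa [← mmul_assoc, K_mul_Kinv] using this
      rw [rowM_mul_colM, hx, hm]
      simp [h0]
    · exact qInt_ne_zero_of_isIrreducible hirr k h1 hle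
  · intro h
    refine ⟨spin_isIrreducible fun k h1 h2 => h k h1 (by omega), colM 1, rowM ((spin q a).K q),
      coevM_isIntertwiner _, rowM_K_isIntertwiner _, ?_⟩
    rw [rowM_mul_colM, K_transpose, mmul_one, trace_spin_K]
    intro h0
    have := congr_fun₂ h0 0 0
    simp at this
    exact h (a + 1) (by omega) le_rfl this

lemma Phys.qInt_ne_zero (α : Phys q) (k : ℕ) (h1 : 1 ≤ k) (h2 : k ≤ α.dim) : qInt q k ≠ 0 :=
    (isPhys_iff α.1).1 α.2 k h1 h2

lemma Phys.trace_K_ne_zero (α : Phys q) : (α.rep.K q).trace ≠ 0 := by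
  rw [trace_spin_K]
  exact α.qInt_ne_zero _ (by omega) le_rfl

/-! ### Highest weight vectors in tensor products -/

lemma tensor_spin_E_mul (a b : ℕ) (f : M[Fin (a + 1) × Fin (b + 1), τ]) (i : Fin (a + 1)) (j : Fin
    (b + 1)) (k : τ) : ((spin q a ⊠ spin q b).E * f) (i, j) k = (if h : (j : ℕ) + 1 < b + 1 then
        qInt q (j + 1) * qInt q (b - j) * f (i, ⟨j + 1, h⟩) k else 0) + (if h : (i : ℕ) + 1 < a + 1
      then
        qInt q (i + 1) * qInt q (a - i) * (q ^ ((b : ℤ) - 2 * j) * f (⟨i + 1, h⟩, j) k) else 0) := by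
  have h1 := spin_E_mul (q := q) b (of fun j (_ : Unit) => f (i, j) k) j ()
  have h2 := spin_E_mul (q := q) a (of fun i (_ : Unit) => q ^ ((b : ℤ) - 2 * j) * f (i, j) k) i ()
  simp only [of_apply] at h1 h2
  rw [← h1, ← h2]
  simp only [tensor, madd_mul, madd_apply]
  congr 1
  · simp [mmul_apply, sum_prod_type, mone_apply]
  · simp [mmul_apply, sum_prod_type, K, diagonal_apply]
    exact sum_congr rfl fun x _ => by simp [spin]; ring_nf

lemma diagonal_kron_mul_apply (d : ι → ℂ) (B : M[κ, κ]) (f : M[ι × κ, τ]) (i : ι) (j : κ) (k : τ) :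
    ((Matrix.diagonal d ⊗ₖ B) * f) (i, j) k = (B * of fun j (_ : Unit) => d i * f (i, j) k) j
    () := by
  simp only [mmul_apply, sum_prod_type, kroneckerMap_apply, diagonal_apply, of_apply, ite_mul,
    zero_mul]
  rw [sum_comm]
  simp only [sum_ite_eq, mem_univ, if_true]
  exact sum_congr rfl fun x _ => by ring

lemma tensor_spin_F_mul (a b : ℕ)
    (f : M[Fin (a + 1) × Fin (b + 1), τ]) (i : Fin (a + 1)) (j : Fin (b + 1)) (k : τ) :
    ((spin q a ⊠ spin q b).F * f) (i, j) k =
      (if 0 < (j : ℕ) then q ^ (-((a : ℤ) - 2 * i)) * f (i, ⟨j - 1, by omega⟩) k else 0) +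
      (if 0 < (i : ℕ) then f (⟨i - 1, by omega⟩, j) k else 0) := by
  have h1 := spin_F_mul (q := q) b (of fun j (_ : Unit) => q ^ (-((a : ℤ) - 2 * i)) * f (i, j) k) j
    ()
  have h2 := spin_F_mul (q := q) a (of fun i (_ : Unit) => f (i, j) k) i ()
  simp only [of_apply] at h1 h2
  rw [← h1, ← h2]
  simp only [tensor, madd_mul, madd_apply]
  congr 1
  · exact diagonal_kron_mul_apply _ _ f i j k
  · simp [mmul_apply, sum_prod_type, mone_apply]

/-- The highest weight equation. -/
lemma highest_rel {a b c : ℕ} {f : M[Fin (a + 1) × Fin (b + 1), Fin (c + 1)]} (hf : IsHom (spin q c)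
    (spin q a ⊠ spin q b) f) (i : Fin (a + 1)) (j : Fin (b + 1)) : (if h : (j : ℕ) + 1 < b + 1 then
        qInt q (j + 1) * qInt q (b - j) * f (i, ⟨j + 1, h⟩) 0 else 0) + (if h : (i : ℕ) + 1 < a + 1
      then
        qInt q (i + 1) * qInt q (a - i) * (q ^ ((b : ℤ) - 2 * j) * f (⟨i + 1, h⟩, j) 0) else 0) =
      0 := by
  rw [← tensor_spin_E_mul, ← hf.1, mul_spin_E]
  simp

lemma highest_zero {a b c : ℕ} (ha : ∀ k, 1 ≤ k → k ≤ a → qInt q k ≠ 0) {f : M[Fin (a + 1) × Fin (b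
    + 1), Fin (c + 1)]} (hf : IsHom (spin q c) (spin q a ⊠ spin q b) f) {N : ℕ} (h0 : ∀ j : Fin (b +
    1), (j : ℕ) = N → f (0, j) 0 = 0) : ∀ i : ℕ, ∀ hi : i < a + 1, ∀ j : Fin (b + 1), i + (j : ℕ) =
    N → f (⟨i, hi⟩, j) 0 = 0 := by
  intro i
  induction i with
  | zero => intro hi j hj; exact h0 j (by omega)
  | succ i ih =>
    intro hi j hj
    have := highest_rel hf ⟨i, by omega⟩ j
    rw [dif_pos (show ((⟨i, by omega⟩ : Fin (a + 1)) : ℕ) + 1 < a + 1 from hi)] at this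
    have hz : (if h : (j : ℕ) + 1 < b + 1 then
        qInt q (j + 1) * qInt q (b - j) * f (⟨i, by omega⟩, ⟨j + 1, h⟩) 0 else 0) = 0 := by
      split_ifs with h
      · rw [ih (by omega) ⟨j + 1, h⟩ (by simp; omega), mul_zero]
      · rfl
    rw [hz, zero_add] at this
    have n1 := ha (i + 1) (by omega) (by omega)
    have n2 := ha (a - i) (by omega) (by omega)
    simp only [mul_eq_zero, n1, n2, zpow_ne_zero _ q0, false_or] at this
    exact this

lemma highest_zero' {a b c : ℕ} (hb : ∀ k, 1 ≤ k → k ≤ b → qInt q k ≠ 0) {f : M[Fin (a + 1) × Fin (b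
    + 1), Fin (c + 1)]} (hf : IsHom (spin q c) (spin q a ⊠ spin q b) f) {N : ℕ} (h0 : ∀ i : Fin (a +
    1), (i : ℕ) = N → f (i, 0) 0 = 0) : ∀ j : ℕ, ∀ hj : j < b + 1, ∀ i : Fin (a + 1), (i : ℕ) + j =
    N → f (i, ⟨j, hj⟩) 0 = 0 := by
  intro j
  induction j with
  | zero => intro hj i hi; exact h0 i (by omega)
  | succ j ih =>
    intro hj i hi
    have := highest_rel hf i ⟨j, by omega⟩
    rw [dif_pos (show ((⟨j, by omega⟩ : Fin (b + 1)) : ℕ) + 1 < b + 1 from hj)] at this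
    have hz : (if h : (i : ℕ) + 1 < a + 1 then
        qInt q (i + 1) * qInt q (a - i) * (q ^ ((b : ℤ) - 2 * j) *
          f (⟨i + 1, h⟩, ⟨j, by omega⟩) 0) else 0) = 0 := by
      split_ifs with h
      · rw [ih (by omega) ⟨i + 1, h⟩ (by simp; omega)]; ring
      · rfl
    simp only at this
    rw [hz, add_zero] at this
    have n1 := hb (j + 1) (by omega) (by omega)
    have n2 := hb (b - j) (by omega) (by omega)
    simp only [mul_eq_zero, n1, n2, false_or] at this
    exact this

lemma highest_col {a b c : ℕ} {f : M[Fin (a + 1) × Fin (b + 1), Fin (c + 1)]}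
    (hf : IsHom (spin q c) (spin q a ⊠ spin q b) f) {N : ℕ}
    (hN : N + c + 1 ≤ b) : f (0, ⟨N, by omega⟩) 0 = 0 := by
  have step : ∀ (j : ℕ) (hj : j + 1 < b + 1) (k : Fin (c + 1)),
      (f * (spin q c).F) (0, ⟨j + 1, hj⟩) k = q ^ (-(a : ℤ)) * f (0, ⟨j, by omega⟩) k := by
    intro j hj k
    rw [hf.2.1, tensor_spin_F_mul]; simp
  have main : ∀ k : ℕ, ∀ hk : k < c + 1, f (0, ⟨N + k, by omega⟩) ⟨k, hk⟩ =
      (q ^ (-(a : ℤ))) ^ k * f (0, ⟨N, by omega⟩) 0 := by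
    intro k
    induction k with
    | zero => intro hk; simp
    | succ k ih =>
      intro hk
      have := step (N + k) (by omega) ⟨k, by omega⟩
      rw [mul_spin_F, dif_pos (show ((⟨k, by omega⟩ : Fin (c + 1)) : ℕ) + 1 < c + 1 from hk)] at this
      rw [ih (by omega)] at this
      rw [pow_succ', mul_assoc, ← this]; rfl
  have h := step (N + c) (by omega) ⟨c, by omega⟩
  rw [mul_spin_F, dif_neg (by simp), main c (by omega)] at h
  have hne := zpow_ne_zero (-(a : ℤ)) (q0 (q := q))
  have := h.symm
  simpa [q0] using this

lemma highest_row {a b c : ℕ} {f : M[Fin (a + 1) × Fin (b + 1), Fin (c + 1)]}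
    (hf : IsHom (spin q c) (spin q a ⊠ spin q b) f) {N : ℕ}
    (hN : N + c + 1 ≤ a) : f (⟨N, by omega⟩, 0) 0 = 0 := by
  have step : ∀ (j : ℕ) (hj : j + 1 < a + 1) (k : Fin (c + 1)),
      (f * (spin q c).F) (⟨j + 1, hj⟩, 0) k = f (⟨j, by omega⟩, 0) k := by
    intro j hj k
    rw [hf.2.1, tensor_spin_F_mul]; simp
  have main : ∀ k : ℕ, ∀ hk : k < c + 1, f (⟨N + k, by omega⟩, 0) ⟨k, hk⟩ =
      f (⟨N, by omega⟩, 0) 0 := by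
    intro k
    induction k with
    | zero => intro hk; simp
    | succ k ih =>
      intro hk
      have := step (N + k) (by omega) ⟨k, by omega⟩
      rw [mul_spin_F, dif_pos (show ((⟨k, by omega⟩ : Fin (c + 1)) : ℕ) + 1 < c + 1 from hk)] at this
      rw [ih (by omega)] at this
      rw [← this]; rfl
  have h := step (N + c) (by omega) ⟨c, by omega⟩
  rw [mul_spin_F, dif_neg (by simp), main c (by omega)] at h
  exact h.symm

lemma highest_weight {f : M[α × β, γ]} (hf : IsHom γ.rep (α.rep ⊠ β.rep) f) {i : α} {j : β} (h : f
    (i, j) 0 ≠ 0) : α.1 + β.1 = γ.1 + 2 * (i + j) := by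
  have ha : ∀ k, 1 ≤ k → k ≤ α.1 → qInt q k ≠ 0 := fun k h1 h2 => α.qInt_ne_zero k h1 (Nat.le_succ_of_le h2)
  have hb : ∀ k, 1 ≤ k → k ≤ β.1 → qInt q k ≠ 0 := fun k h1 h2 => β.qInt_ne_zero k h1 (Nat.le_succ_of_le h2)
  have hc : ∀ k, 1 ≤ k → k ≤ γ.1 → qInt q k ≠ 0 := fun k h1 h2 => γ.qInt_ne_zero k h1 (Nat.le_succ_of_le h2)
  have e1 : ∃ j' : β, (j' : ℕ) = i + j ∧ f (0, j') 0 ≠ 0 := by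
    by_contra hcon
    push Not at hcon
    exact h (highest_zero ha hf hcon i i.2 j rfl)
  have e2 : ∃ i' : α, (i' : ℕ) = i + j ∧ f (i', 0) 0 ≠ 0 := by
    by_contra hcon
    push Not at hcon
    exact h (highest_zero' hb hf hcon j j.2 i rfl)
  obtain ⟨j', hj', hj0⟩ := e1
  obtain ⟨i', hi', hi0⟩ := e2
  have b1 : β.1 < (i + j : ℕ) + γ.1 + 1 := by
    by_contra hcon
    apply hj0
    have := highest_col hf (N := i + j) (by omega)
    rwa [show j' = ⟨i + j, by omega⟩ from Fin.ext hj']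
  have b2 : α.1 < (i + j : ℕ) + γ.1 + 1 := by
    by_contra hcon
    apply hi0
    have := highest_row hf (N := i + j) (by omega)
    rwa [show i' = ⟨i + j, by omega⟩ from Fin.ext hi']
  have wK := congr_fun₂ hf.2.2 (i, j) 0
  rw [K, K, mul_diagonal, diagonal_mul, mul_comm] at wK
  have wK' := mul_right_cancel₀ h wK
  have w1 : γ.rep.wt 0 = (γ.1 : ℤ) := by simp [spin]
  have w2 : (α.rep ⊠ β.rep).wt (i, j) = (α.1 : ℤ) + β.1 - 2 * (i + j) := by
    simp [tensor, spin]; ring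
  rw [w1, w2] at wK'
  have i'2 : (i' : ℕ) < α.1 + 1 := i'.2
  have j'2 : (j' : ℕ) < β.1 + 1 := j'.2
  rcases lt_trichotomy (α.1 + β.1) (γ.1 + 2 * (i + j)) with hlt | heq | hgt
  · exfalso
    refine hc (γ.1 + 2 * (i + j) - (α.1 + β.1)) (by omega) (by omega) (qInt_eq_zero_of_pow ?_)
    rw [← zpow_natCast, Nat.cast_sub hlt.le]
    push_cast
    rw [show (γ.1 : ℤ) + 2 * (i + j) - (α.1 + β.1) = γ.1 - (α.1 + β.1 - 2 * (i + j)) by ring,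
      zpow_sub₀ q0, wK', div_self (zpow_ne_zero _ q0)]
  · exact heq
  · exfalso
    refine ha (α.1 + β.1 - (γ.1 + 2 * (i + j))) (by omega) (by omega) (qInt_eq_zero_of_pow ?_)
    rw [← zpow_natCast, Nat.cast_sub hgt.le]
    push_cast
    rw [show (α.1 : ℤ) + β.1 - (γ.1 + 2 * (i + j)) = (α.1 + β.1 - 2 * (i + j)) - γ.1 by ring,
      zpow_sub₀ q0, wK', div_self (zpow_ne_zero _ q0)]

lemma intertwiner_eq_zero_of_highest {a b c : ℕ} {f : M[Fin (a + 1) × Fin (b + 1), Fin (c + 1)]} (hf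
    : IsHom (spin q c) (spin q a ⊠ spin q b) f) (h : ∀ p, f p 0 = 0) : f = 0 := by
  have : ∀ k : ℕ, ∀ hk : k < c + 1, ∀ p, f p ⟨k, hk⟩ = 0 := by
    intro k
    induction k with
    | zero => intro hk p; exact h p
    | succ k ih =>
      intro hk p
      have e := congr_fun₂ hf.2.1 p ⟨k, by omega⟩
      rw [mul_spin_F, dif_pos (show ((⟨k, by omega⟩ : Fin (c + 1)) : ℕ) + 1 < c + 1 from hk),
        mmul_apply] at e
      rw [e]
      exact sum_eq_zero fun p' _ => by rw [ih, mul_zero]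
  ext p k
  exact this k k.2 p

lemma hom_one_dim {f f' : M[α × β, γ]} (hf : IsHom γ.rep (α.rep ⊠ β.rep) f) (hf' : IsHom γ.rep
    (α.rep ⊠ β.rep) f') (h0 : f ≠ 0) : ∃ x : ℂ, f' = x • f := by
  have ha : ∀ k, 1 ≤ k → k ≤ α.1 → qInt q k ≠ 0 := fun k h1 h2 => α.qInt_ne_zero k h1 (Nat.le_succ_of_le h2)
  have e1 : ∃ p, f p 0 ≠ 0 := by
    by_contra hcon
    push Not at hcon
    exact h0 (intertwiner_eq_zero_of_highest hf hcon)
  obtain ⟨⟨i, j⟩, hp⟩ := e1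
  have hw := highest_weight hf hp
  have e2 : ∃ j' : β, (j' : ℕ) = i + j ∧ f (0, j') 0 ≠ 0 := by
    by_contra hcon
    push Not at hcon
    exact hp (highest_zero ha hf hcon i i.2 j rfl)
  obtain ⟨j', hj', hj0⟩ := e2
  refine ⟨f' (0, j') 0 / f (0, j') 0, ?_⟩
  have hd : IsHom γ.rep (α.rep ⊠ β.rep) (f' - (f' (0, j') 0 / f (0, j') 0) • f) := hf'.sub (hf.smul
    _)
  refine sub_eq_zero.1 (intertwiner_eq_zero_of_highest hd fun p => ?_)
  obtain ⟨k, l⟩ := p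
  by_contra hne
  have hw' := highest_weight hd hne
  refine hne (highest_zero ha hd (N := k + l) (fun m hm => ?_) k k.2 l rfl)
  have : m = j' := Fin.ext (by omega)
  subst this
  simp [hj0]

lemma hom_grading {f : M[α × β, γ]} (hf : IsHom γ.rep (α.rep ⊠ β.rep) f) (h0 : f ≠ 0) : γ.1 ≤ α.1 +
    β.1 ∧ (-1 : ℂ) ^ γ.1 = (-1) ^ α.1 * (-1) ^ β.1 := by
  have e1 : ∃ p, f p 0 ≠ 0 := by
    by_contra hcon
    push Not at hcon
    exact h0 (intertwiner_eq_zero_of_highest hf hcon)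
  obtain ⟨⟨i, j⟩, hp⟩ := e1
  have hw := highest_weight hf hp
  refine ⟨by omega, ?_⟩
  rw [← pow_add, hw, pow_add, pow_mul]; simp

/-! ### Fusion coefficients -/

lemma fusion_le_one_aux {n : ℕ} {f : Fin n → M[α × β, γ]} {g : Fin n → M[γ, α × β]} (hf : ∀ i, IsHom
    γ.rep (α.rep ⊠ β.rep) (f i)) (hfg : ∀ i j, g i * f j = if i = j then 1 else 0) : n ≤ 1 := by
  by_contra hn
  push Not at hn
  have h00 := hfg ⟨0, by omega⟩ ⟨0, by omega⟩
  have h11 := hfg ⟨1, by omega⟩ ⟨1, by omega⟩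
  have h01 := hfg ⟨0, by omega⟩ ⟨1, by omega⟩
  have h10 := hfg ⟨1, by omega⟩ ⟨0, by omega⟩
  simp only [if_true, Fin.mk.injEq, zero_ne_one, one_ne_zero, if_false] at h00 h11 h01 h10
  have hne : f ⟨0, by omega⟩ ≠ 0 := by intro h; rw [h, mmul_zero] at h00; exact zero_ne_one h00
  obtain ⟨x, hx⟩ := hom_one_dim (hf ⟨0, by omega⟩) (hf ⟨1, by omega⟩) hne
  rw [hx, mmul_smul, h10, smul_zero] at h11
  exact zero_ne_one h11

lemma fusion_le_one (α β γ : Phys q) : fusion α β γ ≤ 1 := by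
  unfold fusion
  refine csSup_le' ?_
  rintro n ⟨f, g, hf, _, hfg⟩
  exact fusion_le_one_aux hf hfg

lemma fusion_eq_one {f : M[α × β, γ]} {g : M[γ, α × β]} (hf : IsHom γ.rep (α.rep ⊠ β.rep) f) (hg :
    IsHom (α.rep ⊠ β.rep) γ.rep g) (h : g * f ≠ 0) : fusion α β γ = 1 := by
  refine le_antisymm (fusion_le_one α β γ) ?_
  obtain ⟨c, hc⟩ := intertwiner_phys_scalar (hg.comp hf)
  have hc0 : c ≠ 0 := by rintro rfl; exact h (by rw [hc, zero_smul])
  unfold fusion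
  refine le_csSup ⟨1, ?_⟩ ⟨fun _ => f, fun _ => c⁻¹ • g, fun _ => hf, fun _ => hg.smul _, ?_⟩
  · rintro n ⟨f, g, hf, _, hfg⟩
    exact fusion_le_one_aux hf hfg
  · intro i j
    rw [if_pos (Subsingleton.elim _ _), smul_mul, hc, smul_smul, inv_mul_cancel₀ hc0, one_smul]

lemma exists_of_fusion_ne_zero (h : fusion α β γ ≠ 0) : ∃ (f : M[α × β, γ]) (g : M[γ, α × β]), IsHom
    γ.rep (α.rep ⊠ β.rep) f ∧ IsHom (α.rep ⊠ β.rep) γ.rep g ∧ g * f = 1 := by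
  have h1 : fusion α β γ = 1 := le_antisymm (fusion_le_one α β γ) (Nat.one_le_iff_ne_zero.2 h)
  have hne : {n | ∃ (f : Fin n → M[α × β, γ]) (g : Fin n → M[γ, α × β]),
    (∀ i, IsHom γ.rep (α.rep ⊠ β.rep) (f i)) ∧ (∀ i, IsHom (α.rep ⊠ β.rep) γ.rep (g i)) ∧
    ∀ i j, g i * f j = if i = j then 1 else 0}.Nonempty :=
    ⟨0, fun i => i.elim0, fun i => i.elim0, fun i => i.elim0, fun i => i.elim0, fun i => i.elim0⟩
  have hmem := Nat.sSup_mem hne ⟨1, by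
    rintro n ⟨f, g, hf, _, hfg⟩
    exact fusion_le_one_aux hf hfg⟩
  obtain ⟨f, g, hf, hg, hfg⟩ := hmem
  have hn : 0 < fusion α β γ := by omega
  exact ⟨f ⟨0, hn⟩, g ⟨0, hn⟩, hf _, hg _, by simpa using hfg ⟨0, hn⟩ ⟨0, hn⟩⟩

lemma fusion_ne_zero_bound (h : fusion α β γ ≠ 0) : γ.1 ≤ α.1 + β.1 ∧ (-1 : ℂ) ^ γ.1 = (-1) ^ α.1 *
    (-1) ^ β.1 := by
  obtain ⟨f, g, hf, _, hfg⟩ := exists_of_fusion_ne_zero h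
  refine hom_grading hf ?_
  rintro rfl
  rw [mmul_zero] at hfg
  exact zero_ne_one hfg

lemma fusion_finite (α β : Phys q) : {γ : Phys q | fusion α β γ ≠ 0}.Finite := by
  refine Set.Finite.subset (s := Subtype.val ⁻¹' Set.Iic (α.1 + β.1)) ((Set.finite_Iic _).preimage
    Subtype.val_injective.injOn) fun γ h => ?_
  exact (fusion_ne_zero_bound h).1

/-! ### Negligible endomorphisms -/

/-- The matrix `n` is orthogonal to all endomorphisms with respect to the quantum trace. -/
def Negligible (q : ℂ) (X : WeightModule ι) (n : M[ι, ι]) : Prop := ∀ g, IsIntertwiner q X X g →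
  (X.K q * g * n).trace = 0

/-- The two quantum traces of any endomorphism agree. -/
def Spherical (q : ℂ) (X : WeightModule ι) : Prop := ∀ h, IsIntertwiner q X X h → (X.K q * h).trace
  = (X.Kinv q * h).trace

lemma negligible_zero : Negligible q X 0 := fun g _ => by simp

lemma Negligible.add {n m : M[ι, ι]} (hn : Negligible q X n) (hm : Negligible q X m) : Negligible q
    X (n + m) := fun g hg => by
  rw [mmul_add, Matrix.trace_add, hn g hg, hm g hg, add_zero]

lemma negligible_sum {C : Type} (s : Finset C) (n : C → M[ι, ι]) (h : ∀ c ∈ s, Negligible q X (n c))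
    : Negligible q X (∑ c ∈ s, n c) := fun g hg => by
  rw [mmul_sum, Matrix.trace_sum]
  exact sum_eq_zero fun c hc => h c hc g hg

lemma Negligible.conj {n : M[ι, ι]} (hn : Negligible q X n) {a : M[κ, ι]} {b : M[ι, κ]} (ha : IsHom
    X Y a) (hb : IsHom Y X b) : Negligible q Y (a * n * b) := fun g hg => by
  have := hn (b * g * a) ((hb.comp hg).comp ha)
  rw [← this, ← mmul_assoc, Matrix.trace_mul_comm]
  congr 1
  simp only [← mmul_assoc]
  rw [hb.2.2]

lemma Negligible.mul_left {n : M[ι, ι]} (hn : Negligible q X n) {a : M[ι, ι]} (ha : IsHom X X a) :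
    Negligible q X (a * n) := by
  simpa using hn.conj ha isIntertwiner_one

/-- A factorization through an object with vanishing composites is negligible. -/
lemma negligible_of_factor {f : M[ι, κ]} {g : M[κ, ι]} (hf : IsHom Y X f) (h : ∀ e, IsHom X X e →
    (Y.K q * (g * e * f)).trace = 0) : Negligible q X (f * g) := fun e he => by
  rw [← h e he, Matrix.trace_mul_comm (Y.K q)]
  rw [← mmul_assoc, Matrix.trace_mul_comm _ g]
  congr 1
  rw [← he.2.2]
  simp only [mmul_assoc]
  rw [hf.2.2]

lemma Negligible.kron_one {n : M[ι, ι]} (hn : Negligible q X n) : Negligible q (X ⊠ Y) (n ⊗ₖ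
    I[κ]) := fun g hg => by
  rw [tensor_K, mmul_assoc, ← trace_mul_ptr, ptr_mul_kron_one, ← mmul_assoc]
  exact hn _ (ptr_isIntertwiner hg)

lemma ptl_mul_one_kron (g : M[ι × κ, ι × κ]) (n : M[κ, κ]) : ptl q X (g * (I[ι] ⊗ₖ n)) = ptl q X g *
    n := by
  have h := submatrix_mul_equiv g (I[ι] ⊗ₖ n) swap (prodComm κ ι) (swap : κ × ι → ι × κ)
  have e : (I[ι] ⊗ₖ n).submatrix (prodComm κ ι) (swap : κ × ι → ι × κ) = n ⊗ₖ I[ι] :=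
    kronecker_submatrix_swap _ _
  rw [e] at h
  rw [ptl, ptl, ← ptr_mul_kron_one, ← h]
  rfl

lemma spherical_of_scalar (h : ∀ h, IsHom X X h → ∃ c : ℂ, h = c • I[ι]) (ht : (X.K q).trace =
    (X.Kinv q).trace) : Spherical q X := fun g hg => by
  obtain ⟨c, rfl⟩ := h g hg
  simp [ht]

lemma Spherical.tensor (hX : Spherical q X) (hY : Spherical q Y) : Spherical q (X ⊠ Y) := fun h hh
    => by
  have h1 := hX _ (ptr_isIntertwiner hh)
  have h2 := hY _ (ptl_isIntertwiner hh)
  rw [trace_mul_ptr, trace_mul_ptr] at h1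
  rw [trace_mul_ptl, trace_mul_ptl] at h2
  rw [tensor_K, tensor_Kinv, h1, h2]

lemma Spherical.of_iso (hX : Spherical q X) {a : M[κ, ι]} {b : M[ι, κ]} (ha : IsHom X Y a) (hb :
    IsHom Y X b) (hab : a * b = 1) : Spherical q Y := fun h hh => by
  have := hX _ ((hb.comp hh).comp ha)
  have e1 : (Y.K q * h).trace = (X.K q * (b * h * a)).trace := by
    rw [← mmul_assoc, Matrix.trace_mul_comm _ a, ← mmul_assoc, ← mmul_assoc, ha.2.2, mmul_assoc (Y.K
      q), hab, mmul_one]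
  have e2 : (Y.Kinv q * h).trace = (X.Kinv q * (b * h * a)).trace := by
    rw [← mmul_assoc, Matrix.trace_mul_comm _ a, ← mmul_assoc, ← mmul_assoc, ha.kinv, mmul_assoc
      (Y.Kinv q), hab, mmul_one]
  rw [e1, e2, this]

lemma Negligible.one_kron (hX : Spherical q X) (hY : Spherical q Y) {n : M[κ, κ]} (hni : IsHom Y Y
    n) (hn : Negligible q Y n) : Negligible q (X ⊠ Y) (I[ι] ⊗ₖ n) := fun g hg => by
  rw [mmul_assoc, (hX.tensor hY) _ (hg.comp (isIntertwiner_one.kron hni)), tensor_Kinv, ←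
    trace_mul_ptl, ptl_mul_one_kron, ← hY _ ((ptl_isIntertwiner hg).comp hni), ← mmul_assoc]
  exact hn _ (ptl_isIntertwiner hg)

/-- Negligible endomorphisms vanish between physical representations. -/
lemma Negligible.between {n : M[ι, ι]} (hn : Negligible q X n) (hni : IsHom X X n) {γ γ' : Phys q}
    {f : M[ι, γ]} {g : M[γ', ι]} (hf : IsHom γ.rep X f) (hg : IsHom X γ'.rep g) : g * n * f =
    0 := by
  by_cases h : γ = γ'
  · subst h
    obtain ⟨c, hc⟩ := intertwiner_phys_scalar ((hg.comp hni).comp hf)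
    have := hn.conj hg hf 1 isIntertwiner_one
    rw [hc, mmul_one, mmul_smul, mmul_one, Matrix.trace_smul, smul_eq_mul] at this
    rcases mul_eq_zero.1 this with h0 | h0
    · rw [hc, h0, zero_smul]
    · exact absurd h0 (γ.trace_K_ne_zero)
  · exact intertwiner_eq_zero_of_ne h ((hg.comp hni).comp hf)

/-- `X` is a direct sum of physical representations up to a negligible summand. -/
def Decomposable (q : ℂ) (X : WeightModule ι) : Prop := ∃ (C : Type) (_ : Fintype C) (γ : C → Phys
  q) (f : ∀ c, M[ι, (γ c)]) (g : ∀ c, M[(γ c), ι]), (∀ c, IsIntertwiner q (γ c).rep X (f c)) ∧ (∀ c,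
  IsIntertwiner q X (γ c).rep (g c)) ∧ Negligible q X (1 - ∑ c, f c * g c)

lemma Decomposable.retract (hX : Decomposable q X) {p : M[κ, ι]} {i : M[ι, κ]} (hp : IsHom X Y p)
    (hi : IsHom Y X i) (hpi : p * i = 1) : Decomposable q Y := by
  obtain ⟨C, _, γ, f, g, hf, hg, hn⟩ := hX
  refine ⟨C, inferInstance, γ, fun c => p * f c, fun c => g c * i, fun c => hp.comp (hf c), fun c =>
    (hg c).comp hi, ?_⟩
  have := hn.conj hp hi
  rw [mmul_sub, msub_mul, mmul_one, hpi, mmul_sum, msum_mul] at this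
  simpa only [mmul_assoc] using this

lemma decomposable_phys (γ : Phys q) : Decomposable q γ.rep :=
  ⟨Unit, inferInstance, fun _ => γ, fun _ => 1, fun _ => 1, fun _ => isIntertwiner_one,
    fun _ => isIntertwiner_one, by simpa using negligible_zero⟩

/-- Gluing of decompositions. -/
lemma decomposable_glue {C : Type} [Fintype C] {κ : C → Type} [∀ c, Fintype (κ c)] [∀ c, DecidableEq
    (κ c)] {Y : ∀ c, WeightModule (κ c)} {f : ∀ c, M[ι, κ c]} {g : ∀ c, M[κ c, ι]} (hY : ∀ c,
    Decomposable q (Y c)) (hf : ∀ c, IsHom (Y c) X (f c)) (hg : ∀ c, IsHom X (Y c) (g c)) (hn :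
    Negligible q X (1 - ∑ c, f c * g c)) : Decomposable q X := by
  choose D iD γ f' g' hf' hg' hn' using hY
  refine ⟨Σ c, D c, inferInstance, fun c => γ c.1 c.2, fun c => f c.1 * f' c.1 c.2, fun c => g' c.1
    c.2 * g c.1, fun c => (hf c.1).comp (hf' _ _), fun c => (hg' _ _).comp (hg c.1), ?_⟩
  have e : I[ι] - ∑ c : Σ c, D c, f c.1 * f' c.1 c.2 * (g' c.1 c.2 * g c.1) = (1 - ∑ c, f c * g c) +
    ∑ c, f c * (1 - ∑ d, f' c d * g' c d) * g c := by
    rw [Fintype.sum_sigma]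
    simp only [mmul_sub, msub_mul, mmul_one, sum_sub_distrib, mmul_sum, msum_mul, mmul_assoc]
    abel
  rw [e]
  exact hn.add (negligible_sum _ _ fun c _ => (hn' c).conj (hf c) (hg c))

lemma Decomposable.kron_right (hX : Decomposable q X) (hY : ∀ γ : Phys q, Decomposable q (γ.rep ⊠
    Y)) : Decomposable q (X ⊠ Y) := by
  obtain ⟨C, _, γ, f, g, hf, hg, hn⟩ := hX
  refine decomposable_glue (fun c => hY (γ c)) (f := fun c => f c ⊗ₖ 1) (g := fun c => g c ⊗ₖ 1)
    (fun c => (hf c).kron isIntertwiner_one) (fun c => (hg c).kron isIntertwiner_one) ?_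
  have := hn.kron_one (Y := Y)
  convert this using 1
  rw [← one_kronecker_one]
  simp only [← mul_kronecker_mul, mmul_one]
  ext ⟨i, j⟩ ⟨k, l⟩
  simp only [msub_apply, msum_apply, kroneckerMap_apply, sub_mul, sum_mul]

/-! ### Tensor products with the fundamental representation -/

lemma spherical_spin {a : ℕ} (h : IsIrreducible q (spin q a)) : Spherical q (spin q a) := by
  refine spherical_of_scalar (fun g hg => hg.eq_smul_one h) ?_
  simp only [K, Kinv, Matrix.trace_diagonal]
  refine Fintype.sum_equiv Fin.revPerm _ _ fun i => ?_
  congr 1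
  simp only [spin, Fin.revPerm_apply, Fin.val_rev]
  have := i.2
  omega

lemma isIntertwiner_snd (Y : WeightModule (Fin 1)) (X : WeightModule κ) (hE : Y.E = 0) (hF : Y.F =
    0) (hw : Y.wt 0 = 0) : IsHom (Y ⊠ X) X (of fun i p => if p.2 = i then 1 else 0) := by
  have hKi : Y.Kinv q = 1 := by ext i j; fin_cases i; fin_cases j; simp [Kinv, hw]
  refine ⟨?_, ?_, ?_⟩
  · ext i ⟨x, j⟩
    fin_cases x
    simp [tensor, hE, mmul_apply, sum_prod_type]
  · ext i ⟨x, j⟩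
    fin_cases x
    simp [tensor, hF, hKi, mmul_apply, sum_prod_type]
  · ext i ⟨x, j⟩
    fin_cases x
    simp only [K, mul_diagonal, diagonal_mul, of_apply, tensor, Fin.zero_eta, hw, zero_add]
    by_cases h : j = i
    · subst h; simp
    · simp [h]

lemma isIntertwiner_snd_transpose (Y : WeightModule (Fin 1)) (X : WeightModule κ) (hE : Y.E = 0) (hF
    : Y.F = 0) (hw : Y.wt 0 = 0) : IsHom X (Y ⊠ X) (of fun p i => if p.2 = i then 1 else 0) := by
  have hKi : Y.Kinv q = 1 := by ext i j; fin_cases i; fin_cases j; simp [Kinv, hw]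
  refine ⟨?_, ?_, ?_⟩
  · ext ⟨x, j⟩ i
    fin_cases x
    simp [tensor, hE, mmul_apply, sum_prod_type]
  · ext ⟨x, j⟩ i
    fin_cases x
    simp [tensor, hF, hKi, mmul_apply, sum_prod_type]
  · ext ⟨x, j⟩ i
    fin_cases x
    simp only [K, mul_diagonal, diagonal_mul, of_apply, tensor, Fin.zero_eta, hw, zero_add]
    by_cases h : j = i
    · subst h; simp
    · simp [h]

lemma isIntertwiner_fst (X : WeightModule κ) (Y : WeightModule (Fin 1)) (hE : Y.E = 0) (hF : Y.F =
    0) (hw : Y.wt 0 = 0) : IsHom (X ⊠ Y) X (of fun i p => if p.1 = i then 1 else 0) := by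
  have hK : Y.K q = 1 := by ext i j; fin_cases i; fin_cases j; simp [K, hw]
  refine ⟨?_, ?_, ?_⟩
  · ext i ⟨j, x⟩
    fin_cases x
    simp [tensor, hE, hK, mmul_apply, sum_prod_type]
  · ext i ⟨j, x⟩
    fin_cases x
    simp [tensor, hF, mmul_apply, sum_prod_type]
  · ext i ⟨j, x⟩
    fin_cases x
    simp only [K, mul_diagonal, diagonal_mul, of_apply, tensor, Fin.zero_eta, hw, add_zero]
    by_cases h : j = i
    · subst h; simp
    · simp [h]

lemma isIntertwiner_fst_transpose (X : WeightModule κ) (Y : WeightModule (Fin 1)) (hE : Y.E = 0) (hF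
    : Y.F = 0) (hw : Y.wt 0 = 0) : IsHom X (X ⊠ Y) (of fun p i => if p.1 = i then 1 else 0) := by
  have hK : Y.K q = 1 := by ext i j; fin_cases i; fin_cases j; simp [K, hw]
  refine ⟨?_, ?_, ?_⟩
  · ext ⟨j, x⟩ i
    fin_cases x
    simp [tensor, hE, hK, mmul_apply, sum_prod_type]
  · ext ⟨j, x⟩ i
    fin_cases x
    simp [tensor, hF, mmul_apply, sum_prod_type]
  · ext ⟨j, x⟩ i
    fin_cases x
    simp only [K, mul_diagonal, diagonal_mul, of_apply, tensor, Fin.zero_eta, hw, add_zero]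
    by_cases h : j = i
    · subst h; simp
    · simp [h]

/-- A map into `X ⊗ V`, `V` the fundamental representation, from its two components. -/
def pairV (f₀ f₁ : M[ι, κ]) : M[ι × Fin 2, κ] := of fun p k => if p.2 = 0 then f₀ p.1 k else f₁ p.1
  k

lemma pairV_isIntertwiner {f₀ f₁ : M[ι, κ]} (hE₀ : f₀ * Y.E = f₁ + q • (X.E * f₀)) (hE₁ : f₁ * Y.E =
    q⁻¹ • (X.E * f₁)) (hF₀ : f₀ * Y.F = X.F * f₀) (hF₁ : f₁ * Y.F = X.Kinv q * f₀ + X.F * f₁) (hK₀ :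
    f₀ * Y.K q = q • (X.K q * f₀)) (hK₁ : f₁ * Y.K q = q⁻¹ • (X.K q * f₁)) : IsHom Y (X ⊠ spin q 1)
    (pairV f₀ f₁) := by
  have h01 : (1 : Fin 2) ≠ 0 := by decide
  have m : ∀ (M : M[κ, κ]) (i : ι) (x : Fin 2) (k : κ), (pairV f₀ f₁ * M) (i, x) k = if x = 0 then
    (f₀ * M) i k else (f₁ * M) i k := by
    intro M i x k
    fin_cases x <;> simp [pairV, mmul_apply]
  have kr : ∀ (A : M[ι, ι]) (B : M[Fin 2, Fin 2]) (i : ι) (x : Fin 2) (k : κ), ((A ⊗ₖ B) * pairV f₀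
    f₁) (i, x) k = B x 0 * (A * f₀) i k + B x 1 * (A * f₁) i k := by
    intro A B i x k
    simp only [mmul_apply, sum_prod_type, Fin.sum_univ_two, pairV, kroneckerMap_apply, of_apply,
      if_true, h01, if_false, mul_sum, sum_add_distrib]
    congr 1 <;> exact sum_congr rfl fun _ _ => by ring
  have q1 := qInt_one (q := q)
  refine ⟨?_, ?_, ?_⟩
  · ext ⟨i, x⟩ k
    rw [m]
    simp only [tensor, madd_mul, madd_apply, kr, hE₀, hE₁]
    fin_cases x <;> simp [spin, K, q1]
  · ext ⟨i, x⟩ k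
    rw [m]
    simp only [tensor, madd_mul, madd_apply, kr, hF₀, hF₁]
    fin_cases x
    · simp only [spin]; simp
      exact (one_mul _).symm
    · simp [spin]
      exact (one_mul _).symm
  · ext ⟨i, x⟩ k
    rw [m, tensor_K, kr, hK₀, hK₁]
    fin_cases x <;> simp [spin, K]

lemma spin_wt (a : ℕ) (i : Fin (a + 1)) : (spin q a).wt i = (a : ℤ) - 2 * (i : ℕ) := rfl

lemma spin_K_mul (a : ℕ) (M : M[Fin (a + 1), τ]) (i : Fin (a + 1)) (j : τ) : ((spin q a).K q * M) i
    j = q ^ ((a : ℤ) - 2 * (i : ℕ)) * M i j := by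
  rw [K, diagonal_mul, spin_wt]

lemma spin_Kinv_mul (a : ℕ) (M : M[Fin (a + 1), τ]) (i : Fin (a + 1)) (j : τ) : ((spin q a).Kinv q *
    M) i j = q ^ (-((a : ℤ) - 2 * (i : ℕ))) * M i j := by
  rw [Kinv, diagonal_mul, spin_wt]

lemma mul_spin_K (a : ℕ) (M : M[τ, Fin (a + 1)]) (i : τ) (j : Fin (a + 1)) : (M * (spin q a).K q) i
    j = M i j * q ^ ((a : ℤ) - 2 * (j : ℕ)) := by
  rw [K, mul_diagonal, spin_wt]

/-- The inclusion of the representation of highest weight `c + 1` into `c ⊗ V`. -/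
def upper (q : ℂ) (c : ℕ) : M[Fin (c + 1) × Fin 2, Fin (c + 2)] := pairV (of fun i k => if (i : ℕ) =
  k then 1 else 0) (of fun i k => if (i : ℕ) + 1 = k then q⁻¹ ^ (c - (i : ℕ)) * qInt q (i + 1) else
  0)

/-- The inclusion of the representation of highest weight `c` into `(c + 1) ⊗ V`. -/
def lower (q : ℂ) (c : ℕ) : M[Fin (c + 2) × Fin 2, Fin (c + 1)] := pairV (of fun i k => if (i : ℕ) =
  k + 1 then -q⁻¹ else 0) (of fun i k => if (i : ℕ) = k then q ^ (k : ℕ) * qInt q (c + 1 - k) else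
  0)

lemma upper_isIntertwiner (c : ℕ) :
    IsHom (spin q (c + 1)) (spin q c ⊠ spin q 1) (upper q c) := by
  refine pairV_isIntertwiner ?_ ?_ ?_ ?_ ?_ ?_ <;> ext i k <;>
    obtain ⟨m, hm⟩ : ∃ m, c = i + m := ⟨c - i, by omega⟩ <;>
    have em : c - (i : ℕ) = m := by omega
  · rw [mul_spin_E, madd_apply, msmul_apply, spin_E_mul]
    simp only [of_apply, smul_eq_mul]
    by_cases h : (i : ℕ) + 1 = k
    · have h1 : 0 < (k : ℕ) := by omega
      have h2 : (i : ℕ) = (k : ℕ) - 1 := by omega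
      have e2 : c + 1 + 1 - (k : ℕ) = m + 1 := by omega
      rw [if_pos h1, if_pos h2, if_pos h, e2, em, ← h, qInt_add' m 1, qInt_one]
      split_ifs <;> first
        | (exfalso; omega)
        | ring1
        | (have : m = 0 := by omega
           rw [this]; simp)
    · have h2 : 0 < (k : ℕ) → ¬ (i : ℕ) = (k : ℕ) - 1 := by omega
      rw [if_neg h]
      split_ifs <;> first | (exfalso; omega) | simp
  · rw [mul_spin_E, msmul_apply, spin_E_mul]
    simp only [of_apply, smul_eq_mul]
    by_cases h : (i : ℕ) + 2 = k
    · have h1 : 0 < (k : ℕ) := by omega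
      have h2 : (i : ℕ) + 1 = (k : ℕ) - 1 := by omega
      have h3 : (i : ℕ) + 1 < c + 1 := by omega
      have e2 : c + 1 + 1 - (k : ℕ) = m := by omega
      obtain ⟨m', rfl⟩ : ∃ m', m = m' + 1 := ⟨m - 1, by omega⟩
      have e3 : c - ((i : ℕ) + 1) = m' := by omega
      rw [if_pos h1, if_pos h2, dif_pos h3, if_pos (by omega), em, e2, e3, ← h]
      ring
    · have h2 : 0 < (k : ℕ) → ¬ (i : ℕ) + 1 = (k : ℕ) - 1 := by omega
      have h3 : ¬ (i : ℕ) + 1 + 1 = k := by omega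
      split_ifs <;> first | (exfalso; omega) | simp
  · rw [mul_spin_F, spin_F_mul]
    simp only [of_apply]
    split_ifs <;> first | rfl | (exfalso; omega)
  · rw [mul_spin_F, madd_apply, spin_Kinv_mul, spin_F_mul]
    simp only [of_apply]
    by_cases h : (i : ℕ) = k
    · have h1 : (k : ℕ) + 1 < c + 1 + 1 := by omega
      have e1 : q ^ (-((c : ℤ) - 2 * (i : ℕ))) = q ^ (i : ℕ) * q⁻¹ ^ m := by
        rw [show -((c : ℤ) - 2 * (i : ℕ)) = ((i : ℕ) : ℤ) - m by omega,
          zpow_sub₀ q0]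
        simp [div_eq_mul_inv]
      rw [dif_pos h1, if_pos (by omega), if_pos h, em, e1, qInt_add i 1, qInt_one]
      split_ifs with h3 h4
      · have e5 : c - ((i : ℕ) - 1) = m + 1 := by omega
        have e6 : (i : ℕ) - 1 + 1 = i := by omega
        rw [e5, e6]; ring
      · exfalso; omega
      · have : (i : ℕ) = 0 := by omega
        rw [this]; simp
    · rw [if_neg h]
      split_ifs <;> first | (exfalso; omega) | simp
  · rw [mul_spin_K, msmul_apply, spin_K_mul]
    simp only [of_apply, smul_eq_mul]
    split_ifs with h
    · rw [h, show ((c + 1 : ℕ) : ℤ) - 2 * (k : ℕ) = ((c : ℤ) - 2 * (k : ℕ)) + 1 by push_cast; ring,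
        zpow_add_one₀ q0]; ring
    · simp
  · rw [mul_spin_K, msmul_apply, spin_K_mul]
    simp only [of_apply, smul_eq_mul]
    split_ifs with h
    · rw [← h, show ((c + 1 : ℕ) : ℤ) - 2 * ((i : ℕ) + 1 : ℕ) = ((c : ℤ) - 2 * (i : ℕ)) - 1 by
        push_cast; ring, zpow_sub_one₀ q0]; ring
    · simp

lemma lower_isIntertwiner (c : ℕ) :
    IsHom (spin q c) (spin q (c + 1) ⊠ spin q 1) (lower q c) := by
  have q0 := q0 (q := q)
  refine pairV_isIntertwiner ?_ ?_ ?_ ?_ ?_ ?_ <;> ext i k <;>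
    obtain ⟨m, hm⟩ : ∃ m, c = k + m := ⟨c - k, by omega⟩ <;>
    have em : c + 1 - (k : ℕ) = m + 1 := by omega
  · rw [mul_spin_E, madd_apply, msmul_apply, spin_E_mul]
    simp only [of_apply, smul_eq_mul]
    by_cases h : (i : ℕ) = k
    · have h3 : (i : ℕ) + 1 < c + 1 + 1 := by omega
      rw [dif_pos h3, if_pos h]
      simp only [h, em, if_true]
      rw [qInt_add k 1, qInt_one]
      split_ifs <;> first
        | (exfalso; omega)
        | (field_simp; ring1)
        | (have : (k : ℕ) = 0 := by omega
           rw [this]; simp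
           linear_combination qInt q (m + 1) * (mul_inv_cancel₀ q0))
    · rw [if_neg h]
      split_ifs <;> first | (exfalso; omega) | simp
  · rw [mul_spin_E, msmul_apply, spin_E_mul]
    simp only [of_apply, smul_eq_mul]
    by_cases h : (i : ℕ) + 1 = k
    · have h1 : 0 < (k : ℕ) := by omega
      have h3 : (i : ℕ) + 1 < c + 1 + 1 := by omega
      have e1 : c + 1 - ((k : ℕ) - 1) = m + 2 := by omega
      have e2 : c + 1 - (i : ℕ) = m + 2 := by omega
      have e3 : (k : ℕ) - 1 = i := by omega
      rw [if_pos h1, if_pos (by omega), dif_pos h3, if_pos h, em, e1, e2, e3, ← h, pow_succ]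
      field_simp
    · split_ifs <;> first | (exfalso; omega) | simp
  · rw [mul_spin_F, spin_F_mul]
    simp only [of_apply]
    split_ifs <;> first | rfl | (exfalso; omega)
  · rw [mul_spin_F, madd_apply, spin_Kinv_mul, spin_F_mul]
    simp only [of_apply]
    by_cases h : (i : ℕ) = k + 1
    · have e1 : q ^ (-(((c + 1 : ℕ) : ℤ) - 2 * (i : ℕ))) = q ^ (k : ℕ) * q * q⁻¹ ^ m := by
        rw [show -(((c + 1 : ℕ) : ℤ) - 2 * (i : ℕ)) = ((k : ℕ) : ℤ) + 1 - m by omega, zpow_sub₀ q0, zpow_add_one₀ q0]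
        simp [div_eq_mul_inv]
      have e2 : c + 1 - ((k : ℕ) + 1) = m := by omega
      rw [if_pos h, if_pos (show 0 < (i : ℕ) by omega), if_pos (show (i : ℕ) - 1 = k by omega), em,
        e1, qInt_add' m 1, qInt_one]
      split_ifs with h3
      · rw [e2]; field_simp; ring
      · have : m = 0 := by omega
        rw [this]; simp; field_simp; ring
    · rw [if_neg h]
      split_ifs <;> first | (exfalso; omega) | simp
  · rw [mul_spin_K, msmul_apply, spin_K_mul]
    simp only [of_apply, smul_eq_mul]
    split_ifs with h
    · rw [h, show ((c + 1 : ℕ) : ℤ) - 2 * (((k : ℕ) + 1 : ℕ) : ℤ) = ((c : ℤ) - 2 * (k : ℕ)) - 1 by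
        push_cast; ring, zpow_sub_one₀ q0]; field_simp
    · simp
  · rw [mul_spin_K, msmul_apply, spin_K_mul]
    simp only [of_apply, smul_eq_mul]
    split_ifs with h
    · rw [h, show ((c + 1 : ℕ) : ℤ) - 2 * (k : ℕ) = ((c : ℤ) - 2 * (k : ℕ)) + 1 by
        push_cast; ring, zpow_add_one₀ q0]; field_simp
    · simp

lemma sum_fin_delta {n : ℕ} (i : ℕ) (F G : Fin n → ℂ) : ∑ k : Fin n, (if i = (k : ℕ) then F k else
    0) * G k = if h : i < n then F ⟨i, h⟩ * G ⟨i, h⟩ else 0 := by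
  split_ifs with h
  · rw [sum_eq_single (⟨i, h⟩ : Fin n)]
    · simp
    · intro b _ hb
      rw [if_neg (fun e => hb (Fin.ext e.symm)), zero_mul]
    · simp
  · refine sum_eq_zero fun k _ => ?_
    rw [if_neg (by omega), zero_mul]

/-- The projections that go with `upper` and `lower`. -/
def upperInv (q : ℂ) (c : ℕ) : M[Fin (c + 2), Fin (c + 1) × Fin 2] := of fun k p => if p.2 = 0 then
    if (p.1 : ℕ) = k then q ^ (p.1 : ℕ) * qInt q (c + 1 - p.1) / qInt q (c + 1) else 0 else if (p.1
  : ℕ) + 1 = k then (qInt q (c + 1))⁻¹ else 0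

def lowerInv (q : ℂ) (c : ℕ) : M[Fin (c + 1), Fin (c + 2) × Fin 2] := of fun k p => if p.2 = 0 then
    if (p.1 : ℕ) = k + 1 then -q⁻¹ ^ (c - (k : ℕ)) * qInt q (k + 1) / qInt q (c + 2) else 0 else if
  (p.1 : ℕ) = k then q / qInt q (c + 2) else 0

lemma upper_lower_complete (c : ℕ) (h : qInt q (c + 2) ≠ 0) : upper q (c + 1) * upperInv q (c + 1) +
    lower q c * lowerInv q c = 1 := by
  have q0 := q0 (q := q)
  have hle : ∀ k : Fin (c + 1), ∀ i : Fin (c + 2), ((i : ℕ) = k + 1) = (0 < (i : ℕ) ∧ (i : ℕ) - 1 = k) := by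
    intro k i; simp only [eq_iff_iff]; omega
  have e01 : (1 : Fin 2) ≠ 0 := by decide
  have e10 : (0 : Fin 2) ≠ 1 := by decide
  ext ⟨i, x⟩ ⟨j, y⟩
  obtain ⟨m, hm⟩ : ∃ m, c + 1 = i + m := ⟨c + 1 - i, by omega⟩
  have em : c + 1 - (i : ℕ) = m := by omega
  have em1 : c + 1 + 1 - (i : ℕ) = m + 1 := by omega
  have hs : qInt q (c + 2) = q ^ (i : ℕ) * qInt q (m + 1) + q⁻¹ ^ (m + 1) * qInt q i := by
    rw [← qInt_add]; congr 1; omega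
  have hs' : qInt q (c + 2) = q ^ ((i : ℕ) + 1) * qInt q m + q⁻¹ ^ m * qInt q (i + 1) := by
    rw [← qInt_add]; congr 1; omega
  rw [madd_apply, mmul_apply, mmul_apply, mone_apply]
  obtain rfl | rfl : x = 0 ∨ x = 1 := by fin_cases x <;> simp
  · simp only [upper, lower, pairV, of_apply, if_true, hle, ite_and]
    by_cases hi : 0 < (i : ℕ)
    · simp only [if_pos hi]
      rw [sum_fin_delta, sum_fin_delta, dif_pos (by omega), dif_pos (by omega)]
      simp only [upperInv, lowerInv, of_apply]
      obtain rfl | rfl : y = 0 ∨ y = 1 := by fin_cases y <;> simp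
      · simp only [if_true]
        by_cases hij : (i : ℕ) = j
        · have : i = j := Fin.ext hij
          subst this
          have e1 : (i : ℕ) - 1 + 1 = i := by omega
          have e2 : c - ((i : ℕ) - 1) = m := by omega
          rw [if_pos rfl, if_pos e1.symm, if_pos rfl, e1, e2, em1, ← mul_div_assoc, ← mul_div_assoc,
            ← add_div, div_eq_one_iff_eq h, hs]
          ring
        · have : ¬ (i, (0 : Fin 2)) = (j, 0) := by
            simp only [Prod.mk.injEq, and_true]; exact fun e => hij (congrArg Fin.val e)
          rw [if_neg (by omega), if_neg (by omega), if_neg this]; ring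
      · simp only [if_neg e01, Prod.mk.injEq, e10, and_false, if_false]
        by_cases hij : (i : ℕ) = j + 1
        · rw [if_pos (by omega), if_pos (by omega)]
          field_simp; ring
        · rw [if_neg (by omega), if_neg (by omega)]; ring
    · simp only [if_neg hi]
      have hi0 : (i : ℕ) = 0 := by omega
      rw [sum_fin_delta, dif_pos (by omega)]
      simp only [upperInv, lowerInv, of_apply, zero_mul, sum_const_zero, add_zero]
      obtain rfl | rfl : y = 0 ∨ y = 1 := by fin_cases y <;> simp
      · simp only [if_true]
        by_cases hij : (i : ℕ) = j
        · have : i = j := Fin.ext hij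
          subst this
          rw [if_pos rfl, if_pos rfl, em1, one_mul, div_eq_one_iff_eq h, hs, hi0]
          simp
        · have : ¬ (i, (0 : Fin 2)) = (j, 0) := by
            simp only [Prod.mk.injEq, and_true]; exact fun e => hij (congrArg Fin.val e)
          rw [if_neg (by omega), if_neg this]; ring
      · simp only [if_neg e01, Prod.mk.injEq, e10, and_false, if_false]
        rw [if_neg (by omega)]; ring
  · simp only [upper, lower, pairV, of_apply, if_neg e01]
    rw [sum_fin_delta, sum_fin_delta, dif_pos (by omega)]
    simp only [upperInv, lowerInv, of_apply]
    obtain rfl | rfl : y = 0 ∨ y = 1 := by fin_cases y <;> simp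
    · simp only [if_true, Prod.mk.injEq, e01, and_false, if_false]
      by_cases hij : (j : ℕ) = i + 1
      · have e3 : c - (i : ℕ) = m - 1 := by omega
        have e4 : c + 1 + 1 - (j : ℕ) = m := by omega
        obtain ⟨m', rfl⟩ : ∃ m', m = m' + 1 := ⟨m - 1, by omega⟩
        have e5 : q⁻¹ ^ (m' + 1) * q ^ ((i : ℕ) + 1) = q⁻¹ ^ m' * q ^ (i : ℕ) := by
          rw [pow_succ, pow_succ]; field_simp
        rw [dif_pos (by omega), if_pos hij, if_pos hij, em, e3, e4, hij, Nat.add_sub_cancel]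
        linear_combination (qInt q (i + 1) * qInt q (m' + 1) / qInt q (c + 2)) * e5
      · rw [if_neg hij, if_neg (by omega)]
        split_ifs <;> ring
    · simp only [if_neg e01]
      by_cases hij : (i : ℕ) = j
      · have : i = j := Fin.ext hij
        subst this
        simp only [if_true, em]
        have e : (if h : (i : ℕ) < c + 1 then q ^ (i : ℕ) * qInt q m * (q / qInt q (c + 2)) else 0)
          = q ^ (i : ℕ) * qInt q m * (q / qInt q (c + 2)) := by
          split_ifs with h1
          · rfl
          · have : m = 0 := by omega
            simp [this]
        rw [e, ← mul_div_assoc, ← div_eq_mul_inv, ← add_div, div_eq_one_iff_eq h, hs']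
        ring
      · have : ¬ (i, (1 : Fin 2)) = (j, 1) := by
          simp only [Prod.mk.injEq, and_true]; exact fun e => hij (congrArg Fin.val e)
        rw [if_neg this, if_neg (by omega)]
        split_ifs <;> first | (exfalso; omega) | ring

/-- The inverse of a direct sum decomposition consists of intertwiners. -/
lemma complete_isIntertwiner {f : M[ι, κ]} {f' : M[ι, τ]} {g : M[κ, ι]} {g' : M[τ, ι]} (hf : IsHom Y
    X f) (hf' : IsHom Z X f') (h : f * g + f' * g' = 1) (hc : card ι = card κ + card τ) : IsHom X Y
    g ∧ IsHom X Z g' ∧ g * f = 1 ∧ g' * f' = 1 := by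
  have h1 : Matrix.fromCols f f' * Matrix.fromRows g g' = 1 := by
    rw [Matrix.fromCols_mul_fromRows, h]
  have h2 : Matrix.fromRows g g' * Matrix.fromCols f f' = 1 :=
    (Matrix.mul_eq_one_comm_of_card_eq _ _ ℂ (by simp [hc])).1 h1
  rw [Matrix.fromRows_mul_fromCols, ← Matrix.fromBlocks_one, Matrix.fromBlocks_inj] at h2
  obtain ⟨a, b, c, d⟩ := h2
  have key : ∀ (M : M[ι, ι]) (N : M[κ, κ]) (N' : M[τ, τ]), f * N = M * f → f' * N' = M * f' → g * M
    = N * g ∧ g' * M = N' * g' := by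
    intro M N N' hN hN'
    have e : M = f * N * g + f' * N' * g' := by
      rw [hN, hN', mmul_assoc, mmul_assoc, ← mmul_add, h, mmul_one]
    constructor
    · rw [e, mmul_add]
      simp only [← mmul_assoc, a, b, mone_mul, mzero_mul, add_zero]
    · rw [e, mmul_add]
      simp only [← mmul_assoc, c, d, mone_mul, mzero_mul, zero_add]
  have k1 := key _ _ _ hf.1 hf'.1
  have k2 := key _ _ _ hf.2.1 hf'.2.1
  have k3 := key _ _ _ hf.2.2 hf'.2.2
  exact ⟨⟨k1.1, k2.1, k3.1⟩, ⟨k1.2, k2.2, k3.2⟩, a, d⟩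

lemma upperInv_isIntertwiner (c : ℕ) (h : qInt q (c + 2) ≠ 0) :
    IsHom (spin q (c + 1) ⊠ spin q 1) (spin q (c + 2)) (upperInv q (c + 1)) ∧
    IsHom (spin q (c + 1) ⊠ spin q 1) (spin q c) (lowerInv q c) ∧
    upperInv q (c + 1) * upper q (c + 1) = 1 ∧ lowerInv q c * lower q c = 1 :=
  complete_isIntertwiner (upper_isIntertwiner _) (lower_isIntertwiner _)
    (upper_lower_complete c h) (by simp; ring)

/-- The representation of highest weight `c` is decomposable if its predecessors are physical. -/
lemma decomposable_spin {c : ℕ} (h : ∀ k, 1 ≤ k → k ≤ c → qInt q k ≠ 0) : Decomposable q (spin q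
    c) := by
  by_cases hc : qInt q (c + 1) = 0
  · refine ⟨Empty, inferInstance, fun e => e.elim, fun e => e.elim, fun e => e.elim, fun e =>
      e.elim, fun e => e.elim, fun g hg => ?_⟩
    obtain ⟨x, rfl⟩ := hg.eq_smul_one (spin_isIrreducible h)
    simp [trace_spin_K, hc]
  · exact decomposable_phys ⟨c, (isPhys_iff c).2 fun k h1 h2 => by
      rcases Nat.lt_or_ge k (c + 1) with h3 | h3
      · exact h k h1 (by omega)
      · obtain rfl : k = c + 1 := by omega
        exact hc⟩

lemma decomposable_tensor_V (γ : Phys q) : Decomposable q (γ.rep ⊠ spin q 1) := by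
  have hγ := (isPhys_iff γ.1).1 γ.2
  obtain ⟨c, hc⟩ := γ
  cases c with
  | zero =>
    refine (decomposable_spin (c := 1) fun k h1 h2 => ?_).retract (isIntertwiner_snd_transpose (spin
      q 0) (spin q 1) spin_zero_E spin_zero_F (spin_zero_wt 0)) (isIntertwiner_snd (spin q 0) (spin
      q 1) spin_zero_E spin_zero_F (spin_zero_wt 0)) ?_
    · exact hγ k h1 (by simpa using h2)
    · ext ⟨x, i⟩ ⟨y, j⟩
      have hxy : x = y := Subsingleton.elim (α := Fin 1) x y
      subst hxy
      simp [mmul_apply, mone_apply, eq_comm]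
  | succ c =>
    have h2 : qInt q (c + 2) ≠ 0 := hγ _ (by omega) le_rfl
    obtain ⟨h3, h4, _, _⟩ := upperInv_isIntertwiner c h2
    have d1 : Decomposable q (spin q (c + 2)) := decomposable_spin fun k hk hk' => hγ k hk hk'
    have d2 : Decomposable q (spin q c) :=
      decomposable_spin fun k hk hk' => hγ k hk (by simp only; omega)
    refine decomposable_glue (C := Bool) (Y := fun b => spin q (bif b then c + 2 else c)) (f := fun
      b => match b with
        | true => upper q (c + 1)
        | false => lower q c) (g := fun b => match b with
        | true => upperInv q (c + 1)
        | false => lowerInv q c) ?_ ?_ ?_ ?_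
    · rintro (_ | _)
      · exact d2
      · exact d1
    · rintro (_ | _)
      · exact lower_isIntertwiner _
      · exact upper_isIntertwiner _
    · rintro (_ | _)
      · exact h4
      · exact h3
    · rw [Fintype.sum_bool, ← upper_lower_complete c h2]
      erw [sub_self]
      exact negligible_zero

/-- Tensor products of physical representations are decomposable. -/
lemma decomposable_tensor (α : Phys q) : ∀ b : ℕ, (∀ k, 1 ≤ k → k ≤ b → qInt q k ≠ 0) → Decomposable
    q (α.rep ⊠ spin q b) := by
  intro b
  induction b with
  | zero =>
    intro _
    refine (decomposable_phys α).retract (isIntertwiner_fst_transpose α.rep (spin q 0) spin_zero_E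
      spin_zero_F (spin_zero_wt 0)) (isIntertwiner_fst α.rep (spin q 0) spin_zero_E spin_zero_F
      (spin_zero_wt 0)) ?_
    ext ⟨i, x⟩ ⟨j, y⟩
    have hxy : x = y := Subsingleton.elim (α := Fin 1) x y
    subst hxy
    simp [mmul_apply, mone_apply, eq_comm]
  | succ b ih =>
    intro hb
    cases b with
    | zero => exact decomposable_tensor_V α
    | succ b =>
      have h2 : qInt q (b + 2) ≠ 0 := hb _ (by omega) le_rfl
      obtain ⟨h3, _, h5, _⟩ := upperInv_isIntertwiner b h2
      have hX : Decomposable q ((α.rep ⊠ spin q (b + 1)) ⊠ spin q 1) :=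
        (ih fun k h1 h2 => hb k h1 (by omega)).kron_right (decomposable_tensor_V)
      have a1 : IsHom ((α.rep ⊠ spin q (b + 1)) ⊠ spin q 1) (α.rep ⊠ (spin q (b + 1) ⊠ spin q 1))
        (I[_].submatrix id (prodAssoc _ _ _)) := by
        have := (isIntertwiner_assoc (q := q) (X := α.rep) (Y := spin q (b + 1)) (Z := spin q 1)
          (W := α.rep ⊠ (spin q (b + 1) ⊠ spin q 1)) (T := I[_].submatrix id (prodAssoc _ _ _))).1
        refine this ?_
        rw [Matrix.submatrix_submatrix]
        simpa using isIntertwiner_one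
      have a2 : IsHom (α.rep ⊠ (spin q (b + 1) ⊠ spin q 1)) ((α.rep ⊠ spin q (b + 1)) ⊠ spin q 1)
        (I[_].submatrix id (prodAssoc _ _ _).symm) := (isIntertwiner_assoc).2 isIntertwiner_one
      refine hX.retract (((isIntertwiner_one (X := α.rep)).kron h3).comp a1) (a2.comp
        ((isIntertwiner_one (X := α.rep)).kron (upper_isIntertwiner _))) ?_
      have e : ((1 : M[α × Fin (b + 2) × Fin 2, _]).submatrix id (prodAssoc α (Fin (b + 2)) (Fin
        2))) * ((1 : M[(α × Fin (b + 2)) × Fin 2, _]).submatrix id (prodAssoc α (Fin (b + 2)) (Fin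
        2)).symm) = 1 := by
        ext p p'
        simp [mmul_apply, mone_apply]
      rw [mmul_assoc, ← mmul_assoc _ _ (_ ⊗ₖ upper q (b + 1))]
      erw [e]
      rw [mone_mul, ← mul_kronecker_mul, h5, mmul_one, one_kronecker_one]

/-! ### Duals of physical representations -/

lemma dualIso_isIntertwiner (α : Phys q) : IsHom α.rep (dual q α.rep) (dualIso α) := by
  obtain ⟨a, ha⟩ := α
  refine ⟨?_, ?_, ?_⟩
  · ext (i : Fin (a + 1)) (j : Fin (a + 1))
    rw [mul_spin_E, mmul_apply]
    simp only [dual, transpose_apply, mneg_apply, neg_mul, Kinv, mul_diagonal, spin_wt,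
      Finset.sum_neg_distrib]
    by_cases h : (i : ℕ) + j = a + 1
    · obtain ⟨i', hi'⟩ : ∃ i', (i : ℕ) = i' + 1 := ⟨i - 1, by omega⟩
      obtain ⟨j', hj'⟩ : ∃ j', (j : ℕ) = j' + 1 := ⟨j - 1, by omega⟩
      rw [sum_eq_single (⟨i', by omega⟩ : Fin (a + 1))]
      · have e1 : a - j' + 1 = i' + 2 := by omega
        have e2 : a - (j' + 1) + 1 = i' + 1 := by omega
        have e3 : a + 1 - (j' + 1) = i' + 1 := by omega
        have e4 : a + 1 - (i' + 1) = j' + 1 := by omega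
        have e5 : a - i' = j' + 1 := by omega
        have e6 : q ^ (-((a : ℤ) - 2 * ((i : ℕ) : ℤ))) = q ^ (i' + 1) * q⁻¹ ^ j' := by
          rw [show -((a : ℤ) - 2 * ((i : ℕ) : ℤ)) = ((i' + 1 : ℕ) : ℤ) - j' by omega,
            zpow_sub₀ q0, zpow_natCast]
          simp [div_eq_mul_inv]
        rw [e6]
        have e7 : q⁻¹ ^ (j' * (i' + 2)) = q ^ (i' + 1) * q⁻¹ ^ j' * q⁻¹ ^ ((j' + 1) * (i' +
          1)) := by
          rw [show (j' + 1) * (i' + 1) = (i' + 1) + j' * (i' + 1) by ring,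
            show j' * (i' + 2) = j' + j' * (i' + 1) by ring, pow_add q⁻¹ j', pow_add q⁻¹ (i' + 1)]
          have hc : q ^ (i' + 1) * q⁻¹ ^ (i' + 1) = 1 := by
            rw [← mul_pow, mul_inv_cancel₀ q0, one_pow]
          linear_combination (-(q⁻¹ ^ j' * q⁻¹ ^ (j' * (i' + 1)))) * hc
        have d1 : (i : ℕ) + j' = a := by omega
        have d2 : i' + (j : ℕ) = a := by omega
        have d3 : 0 < j' + 1 := by omega
        simp only [dualIso, spin, of_apply, hi', hj', Nat.add_sub_cancel, if_true, d3,
          e1, e2, e3, e4, show i' + 1 + j' = a by omega, show i' + (j' + 1) = a by omega, e7]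
        ring
      · intro b _ hb
        have : (b : ℕ) + 1 ≠ i := fun e => hb (Fin.ext (by simp; omega))
        simp [spin, this]
      · simp
    · rw [sum_eq_zero]
      · split_ifs with h1
        · have : ¬ (i : ℕ) + ((j : ℕ) - 1) = a := by omega
          simp [dualIso, this]
        · simp
      · intro b _
        by_cases hb : (b : ℕ) + 1 = i
        · have : ¬ (b : ℕ) + j = a := by omega
          simp [dualIso, this]
        · simp [spin, hb]
  · ext (i : Fin (a + 1)) (j : Fin (a + 1))
    rw [mul_spin_F, mmul_apply]
    simp only [dual, transpose_apply, mneg_apply, neg_mul, spin_K_mul, Finset.sum_neg_distrib]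
    by_cases h : (i : ℕ) + j + 1 = a
    · obtain ⟨i', hi'⟩ : ∃ i', (i : ℕ) = i' := ⟨i, rfl⟩
      obtain ⟨j', hj'⟩ : ∃ j', (j : ℕ) = j' := ⟨j, rfl⟩
      rw [sum_eq_single (⟨i' + 1, by omega⟩ : Fin (a + 1))]
      · have e1 : a - (j' + 1) + 1 = i' + 1 := by omega
        have e2 : a - j' + 1 = i' + 2 := by omega
        have e6 : q ^ ((a : ℤ) - 2 * ((i' + 1 : ℕ) : ℤ)) = q ^ j' * q⁻¹ ^ (i' + 1) := by
          rw [show (a : ℤ) - 2 * ((i' + 1 : ℕ) : ℤ) = (j' : ℤ) - ((i' + 1 : ℕ) : ℤ) by omega,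
            zpow_sub₀ q0, zpow_natCast, zpow_natCast]
          simp [div_eq_mul_inv]
        have e7 : q⁻¹ ^ ((j' + 1) * (i' + 1)) = q ^ j' * q⁻¹ ^ (i' + 1) * q⁻¹ ^ (j' * (i' +
          2)) := by
          rw [show (j' + 1) * (i' + 1) = (i' + 1) + j' * (i' + 1) by ring,
            show j' * (i' + 2) = j' + j' * (i' + 1) by ring, pow_add q⁻¹ j', pow_add q⁻¹ (i' + 1)]
          have hc : q ^ j' * q⁻¹ ^ j' = 1 := by rw [← mul_pow, mul_inv_cancel₀ q0, one_pow]
          linear_combination (-(q⁻¹ ^ (i' + 1) * q⁻¹ ^ (j' * (i' + 1)))) * hc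
        have d3 : (j : ℕ) + 1 < a + 1 := by omega
        rw [dif_pos d3]
        simp only [dualIso, spin, of_apply, hi', hj', if_true,
          e1, e2, show i' + (j' + 1) = a by omega, show i' + 1 + j' = a by omega, e7, e6]
        ring
      · intro b _ hb
        have : ¬ (b : ℕ) = i + 1 := fun e => hb (Fin.ext (by simp; omega))
        simp [spin, this]
      · simp
    · rw [sum_eq_zero]
      · split_ifs with h1
        · have : ¬ (i : ℕ) + ((j : ℕ) + 1) = a := by omega
          simp [dualIso, this]
        · simp
      · intro b _
        by_cases hb : (b : ℕ) = i + 1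
        · have : ¬ (b : ℕ) + j = a := by omega
          simp [dualIso, this]
        · simp [spin, hb]
  · ext i j
    rw [dual_K, mul_spin_K, spin_Kinv_mul]
    simp only [dualIso, of_apply]
    split_ifs with h
    · rw [mul_comm]
      congr 2; omega
    · simp

lemma dualIso_mul_inv (α : Phys q) : dualIso α * dualIsoInv α = 1 := by
  obtain ⟨a, ha⟩ := α
  ext i k
  rw [mmul_apply, sum_eq_single (⟨a - i, by simp only [Phys.dim]; omega⟩ : Fin (a + 1))]
  · have h1 : (i : ℕ) ≤ a := Nat.lt_succ_iff.1 i.2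
    have e : (i : ℕ) + (a - i) = a := by omega
    by_cases hik : i = k
    · subst hik
      simp only [dualIso, dualIsoInv, of_apply, e, show a - (i : ℕ) + i = a by omega, if_true,
        one_apply_eq]
      rw [mul_mul_mul_comm, ← mul_pow, ← mul_pow, inv_mul_cancel₀ q0]
      simp
    · have : ¬ a - (i : ℕ) + k = a := by intro e'; exact hik (Fin.ext (by omega))
      simp [dualIsoInv, this, Matrix.one_apply_ne hik]
  · intro b _ hb
    have : ¬ (i : ℕ) + b = a := fun e => hb (Fin.ext (by simp; omega))
    simp [dualIso, this]
  · simp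

lemma dualIsoInv_mul (α : Phys q) : dualIsoInv α * dualIso α = 1 := mul_eq_one_comm.1
  (dualIso_mul_inv α)

/-- The inverse of an invertible intertwiner. -/
lemma WeightModule.IsIntertwiner.inverse {a : M[κ, ι]} {b : M[ι, κ]} (ha : IsHom X Y a) (hab : a * b
    = 1) (hba : b * a = 1) : IsHom Y X b := by
  have key : ∀ (M : M[ι, ι]) (N : M[κ, κ]), a * M = N * a → b * N = M * b := by
    intro M N h
    calc b * N = b * (N * (a * b)) := by rw [hab, mmul_one]
      _ = b * a * M * b := by rw [← mmul_assoc N, ← h]; simp only [mmul_assoc]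
      _ = M * b := by rw [hba, mone_mul]
  exact ⟨key _ _ ha.1, key _ _ ha.2.1, key _ _ ha.2.2⟩

lemma dualIsoInv_isIntertwiner (α : Phys q) : IsHom (dual q α.rep) α.rep (dualIsoInv α) :=
  (dualIso_isIntertwiner α).inverse (dualIso_mul_inv α) (dualIsoInv_mul α)

lemma SLabel.iso_mul_inv (X : SLabel q) : X.iso * X.isoInv = 1 := by
  unfold SLabel.iso SLabel.isoInv
  split_ifs
  · exact mone_mul _
  · exact dualIso_mul_inv _

lemma SLabel.isoInv_mul (X : SLabel q) : X.isoInv * X.iso = 1 := mul_eq_one_comm.1 (X.iso_mul_inv)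

lemma SLabel.iso_isIntertwiner (X : SLabel q) : IsHom X.2.rep X.rep X.iso := by
  unfold SLabel.iso SLabel.rep
  split_ifs
  · exact isIntertwiner_one
  · exact dualIso_isIntertwiner _

lemma SLabel.isoInv_isIntertwiner (X : SLabel q) : IsHom X.rep X.2.rep X.isoInv :=
  (X.iso_isIntertwiner).inverse (X.iso_mul_inv) (X.isoInv_mul)

lemma SLabel.spherical (X : SLabel q) : Spherical q X.rep := (spherical_spin X.2.2.1).of_iso
  (X.iso_isIntertwiner) (X.isoInv_isIntertwiner) (X.iso_mul_inv)

/-! ### Truncated tensor products of two representations -/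

section PairProj

variable (D)

/-- The physical summands of `α ⊗ β`. -/
def fusionSet (α β : Phys q) : Finset (Phys q) := (fusion_finite α β).toFinset

lemma mem_fusionSet : γ ∈ fusionSet α β ↔ fusion α β γ ≠ 0 := by simp [fusionSet]

lemma finsum_fusion {M : Type} [AddCommMonoid M] (F : Phys q → M) (hF : ∀ γ, fusion α β γ = 0 → F γ
    = 0) : ∑ᶠ γ, F γ = ∑ γ ∈ fusionSet α β, F γ := by
  refine finsum_eq_sum_of_support_subset _ fun γ h => ?_
  simp only [Finset.mem_coe, mem_fusionSet]
  exact fun h0 => h (hF γ h0)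

/-- The projector `∑_γ φ_γ ψ_γ`. -/
def cgProj (α β : Phys q) : M[α × β, α × β] := ∑ γ ∈ fusionSet α β, D.phi α β γ * D.psi α β γ

lemma psi_mul_phi_ne {α β γ γ' : Phys q} (h : γ ≠ γ') : D.psi α β γ * D.phi α β γ' = 0 :=
  intertwiner_eq_zero_of_ne h.symm ((D.psi_intertwiner α β γ).comp (D.phi_intertwiner α β γ'))

lemma cgProj_isIntertwiner (α β : Phys q) : IsHom (α.rep ⊠ β.rep) (α.rep ⊠ β.rep) (cgProj D α β) :=
  isIntertwiner_sum _ _ fun γ _ => (D.phi_intertwiner α β γ).comp (D.psi_intertwiner α β γ)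

lemma cgProj_mul_phi (α β γ : Phys q) : cgProj D α β * D.phi α β γ = D.phi α β γ := by
  rw [cgProj, msum_mul]
  by_cases h : fusion α β γ = 0
  · rw [D.phi_eq_zero _ _ _ h]; simp
  · rw [sum_eq_single γ]
    · rw [mmul_assoc, D.psi_mul_phi _ _ _ h, mmul_one]
    · intro γ' _ hne
      rw [mmul_assoc, psi_mul_phi_ne D hne, mmul_zero]
    · intro h'; exact absurd ((mem_fusionSet).2 h) h'

lemma psi_mul_cgProj (α β γ : Phys q) : D.psi α β γ * cgProj D α β = D.psi α β γ := by
  rw [cgProj, mmul_sum]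
  by_cases h : fusion α β γ = 0
  · rw [D.psi_eq_zero _ _ _ h]; simp
  · rw [sum_eq_single γ]
    · rw [← mmul_assoc, D.psi_mul_phi _ _ _ h, mone_mul]
    · intro γ' _ hne
      rw [← mmul_assoc, psi_mul_phi_ne D hne.symm, mzero_mul]
    · intro h'; exact absurd ((mem_fusionSet).2 h) h'

/-- Any map from a physical representation is a multiple of `φ` if `N ≠ 0`. -/
lemma eq_smul_phi (h : fusion α β γ ≠ 0) {f : M[α × β, γ]} (hf : IsHom γ.rep (α.rep ⊠ β.rep) f) : ∃
    x : ℂ, f = x • D.phi α β γ := by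
  refine hom_one_dim (D.phi_intertwiner α β γ) hf fun h0 => ?_
  have := D.psi_mul_phi _ _ _ h
  rw [h0, mmul_zero] at this
  exact zero_ne_one this

lemma negligible_one_sub_cgProj (α β : Phys q) : Negligible q (α.rep ⊠ β.rep) (1 - cgProj D α
    β) := by
  obtain ⟨C, _, γ, f, g, hf, hg, hn⟩ := decomposable_tensor α β.1 fun k h1 h2 => β.qInt_ne_zero k h1
    (Nat.le_succ_of_le h2)
  have hP : IsHom (α.rep ⊠ β.rep) (α.rep ⊠ β.rep) (1 - cgProj D α β) := isIntertwiner_one.sub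
    (cgProj_isIntertwiner D α β)
  have e : 1 - cgProj D α β = (1 - cgProj D α β) * (1 - ∑ c, f c * g c) + ∑ c, (1 - cgProj D α β) *
    f c * g c := by
    rw [mmul_sub, mmul_one, mmul_sum]
    simp only [mmul_assoc]
    abel
  rw [e]
  refine (hn.mul_left hP).add (negligible_sum _ _ fun c _ => ?_)
  by_cases h : fusion α β (γ c) = 0
  · refine negligible_of_factor (hP.comp (hf c)) fun e he => ?_
    have : g c * e * ((1 - cgProj D α β) * f c) = 0 := by
      by_contra hne
      exact absurd (fusion_eq_one (f := (1 - cgProj D α β) * f c) (g := g c * e)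
        (hP.comp (hf c)) ((hg c).comp he) hne) (by omega)
    rw [this]; simp
  · obtain ⟨x, hx⟩ := eq_smul_phi D h (hf c)
    have : (1 - cgProj D α β) * f c = 0 := by
      rw [hx, mmul_smul, msub_mul, mone_mul, cgProj_mul_phi, sub_self, smul_zero]
    rw [this, mzero_mul]
    exact negligible_zero

lemma pairProj_eq (X Y : SLabel q) : D.pairProj X Y = (X.iso ⊗ₖ Y.iso) * cgProj D X.2 Y.2 *
    (X.isoInv ⊗ₖ Y.isoInv) := by
  ext I J
  rw [CGMatrices.pairProj, of_apply, finsum_fusion (α := X.2) (β := Y.2), cgProj, mmul_sum,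
    msum_mul, msum_apply]
  · simp only [mmul_assoc]
  · intro γ h
    rw [D.phi_eq_zero _ _ _ h]; simp

end PairProj

/-! ### The algebra `Γ` -/

namespace DualQG

section Basic

variable (D : CGMatrices q)

/-- The counit. -/
def counit : DualQG D →ₗ[ℂ] ℂ := Finsupp.linearCombination ℂ fun a : Σ α : Phys q, α × α => if a.2.1
  = a.2.2 then (1 : ℂ) else 0

lemma counit_g (α : Phys q) (i j : α) : counit D (g D α i j) = if i = j then 1 else 0 := by
  simp only [counit, g]
  erw [Finsupp.linearCombination_single]
  simp

lemma g_mul_g (α β : Phys q) (i j : α) (k l : β) : g D α i j * g D β k l = ∑ᶠ γ : Phys q, ∑ m, ∑ n,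
    (D.phi α β γ (i, k) m * D.psi α β γ n (j, l)) • g D γ m n := by
  change mulMap D _ _ = _
  simp only [mulMap, g]
  erw [Finsupp.linearCombination_single, one_smul, Finsupp.linearCombination_single, one_smul]

lemma linearMap_ext {M : Type} [AddCommMonoid M] [Module ℂ M] {f f' : DualQG D →ₗ[ℂ] M} (h : ∀ α i
    j, f (g D α i j) = f' (g D α i j)) : f = f' := by
  refine Finsupp.lhom_ext' fun a => LinearMap.ext_ring ?_
  exact h a.1 a.2.1 a.2.2

end Basic

variable (D)

lemma g_mul_g' (α β : Phys q) (i j : α) (k l : β) : g Dᵒ α i j * g Dᵒ β k l = ∑ γ ∈ fusionSet α β, ∑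
    m, ∑ n, (D.phi α β γ (i, k) m * D.psi α β γ n (j, l)) • g Dᵒ γ m n := by
  rw [g_mul_g, finsum_fusion (α := α) (β := β)]
  intro γ h
  rw [D.phi_eq_zero _ _ _ h]; simp

/-- `Γ`-valued matrices: the product on the left by a scalar matrix. -/
def lmul {M : Type} [AddCommMonoid M] [Module ℂ M] (A : M[ι, κ]) (G : κ → τ → M) : ι → τ → M := fun
    i j => ∑ k, A i k • G k j

/-- `Γ`-valued matrices: the product on the right by a scalar matrix. -/
def rmul {M : Type} [AddCommMonoid M] [Module ℂ M] (G : ι → κ → M) (A : M[κ, τ]) : ι → τ → M := fun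
    i j => ∑ k, A k j • G i k

lemma lmul_lmul {ι κ τ υ : Type} [Fintype κ] [Fintype ι] {M : Type} [AddCommMonoid M] [Module ℂ M]
    (B : M[υ, ι]) (A : M[ι, κ]) (G : κ → τ → M) : lmul B (lmul A G) = lmul (B * A) G := by
  funext i j
  simp only [lmul, mmul_apply, smul_sum, sum_smul, smul_smul]
  rw [sum_comm]

lemma rmul_rmul {ι κ τ υ : Type} [Fintype κ] [Fintype τ] {M : Type} [AddCommMonoid M] [Module ℂ M]
    (G : ι → κ → M) (A : M[κ, τ]) (B : M[τ, υ]) : rmul (rmul G A) B = rmul G (A * B) := by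
  funext i j
  simp only [rmul, mmul_apply, smul_sum, sum_smul, smul_smul]
  rw [sum_comm]
  simp only [mul_comm]

lemma lmul_rmul {ι κ τ υ : Type} [Fintype κ] [Fintype τ] {M : Type} [AddCommMonoid M] [Module ℂ M]
    (A : M[ι, κ]) (G : κ → τ → M) (B : M[τ, υ]) : lmul A (rmul G B) = rmul (lmul A G) B := by
  funext i j
  simp only [lmul, rmul, smul_sum, smul_smul]
  rw [sum_comm]
  simp only [mul_comm]

lemma lmul_sum {ι κ τ C : Type} [Fintype κ] {M : Type} [AddCommMonoid M] [Module ℂ M] (S : Finset C)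
    (A : M[ι, κ]) (G : C → κ → τ → M) : lmul A (∑ c ∈ S, G c) = ∑ c ∈ S, lmul A (G c) := by
  funext i j
  simp only [lmul, Finset.sum_apply, smul_sum]
  rw [sum_comm]

lemma rmul_sum {ι κ τ C : Type} [Fintype κ] {M : Type} [AddCommMonoid M] [Module ℂ M] (S : Finset C)
    (A : M[κ, τ]) (G : C → ι → κ → M) : rmul (∑ c ∈ S, G c) A = ∑ c ∈ S, rmul (G c) A := by
  funext i j
  simp only [rmul, Finset.sum_apply, smul_sum]
  rw [sum_comm]

lemma sum_lmul {ι κ τ C : Type} [Fintype κ] {M : Type} [AddCommMonoid M] [Module ℂ M] (S : Finset C)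
    (A : C → M[ι, κ]) (G : κ → τ → M) : lmul (∑ c ∈ S, A c) G = ∑ c ∈ S, lmul (A c) G := by
  funext i j
  simp only [lmul, Finset.sum_apply, msum_apply, sum_smul]
  rw [sum_comm]

lemma lmul_one {M : Type} [AddCommMonoid M] [Module ℂ M] (G : κ → τ → M) : lmul I[κ] G = G := by
  funext i j; simp [lmul, mone_apply]

lemma rmul_one {M : Type} [AddCommMonoid M] [Module ℂ M] (G : τ → κ → M) : rmul G I[κ] = G := by
  funext i j; simp [rmul, mone_apply]

lemma lmul_zero {M : Type} [AddCommMonoid M] [Module ℂ M] (G : κ → τ → M) : lmul (0 : M[ι, κ]) G =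
    0 := by
  funext i j; simp [lmul]

lemma rmul_zero {M : Type} [AddCommMonoid M] [Module ℂ M] (G : ι → κ → M) : rmul G (0 : M[κ, τ]) =
    0 := by
  funext i j; simp [rmul]

lemma lmul_smul {M : Type} [AddCommMonoid M] [Module ℂ M] (c : ℂ) (A : M[ι, κ]) (G : κ → τ → M) :
    lmul (c • A) G = c • lmul A G := by
  funext i j; simp [lmul, smul_sum, smul_smul]

lemma rmul_smul {M : Type} [AddCommMonoid M] [Module ℂ M] (c : ℂ) (A : M[κ, τ]) (G : ι → κ → M) :
    rmul G (c • A) = c • rmul G A := by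
  funext i j; simp [rmul, smul_sum, smul_smul]

end DualQG

/-! ### Channels -/

lemma DualQG.rmul_matrix_sum {ι κ τ C : Type} [Fintype κ] {M : Type} [AddCommMonoid M] [Module ℂ M]
    (S : Finset C) (A : C → M[κ, τ]) (G : ι → κ → M) : rmul G (∑ c ∈ S, A c) = ∑ c ∈ S, rmul G (A
    c) := by
  funext i j
  simp only [rmul, Finset.sum_apply, msum_apply, sum_smul]
  rw [sum_comm]

/-- Transport of a module along a map of the bases. -/
def WeightModule.pull (X : WeightModule κ) (e : ι → κ) : WeightModule ι := ⟨X.wt ∘ e, X.E.submatrix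
  e e, X.F.submatrix e e⟩

section Pull

variable {e : κ → ι}

lemma submatrix_mul_bijective (he : Bijective e) {α β γ : Type} (A : M[α, ι]) (B : M[ι, β]) (f : γ →
  α) {δ : Type} (g : δ → β) : A.submatrix f e * B.submatrix e g = (A * B).submatrix f g :=
  submatrix_mul_equiv A B _ (Equiv.ofBijective e he) _

lemma WeightModule.pull_K (he : Injective e) : (X.pull e).K q = (X.K q).submatrix e e :=
  (Matrix.submatrix_diagonal (fun i => q ^ X.wt i) e he).symm

lemma WeightModule.pull_Kinv (he : Injective e) : (X.pull e).Kinv q = (X.Kinv q).submatrix e e :=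
  (Matrix.submatrix_diagonal (fun i => q ^ (-X.wt i)) e he).symm

lemma WeightModule.IsIntertwiner.pull_src (he : Bijective e) {T : M[τ, ι]} (hT : IsHom X Z T) :
    IsHom (X.pull e) Z (T.submatrix id e) := by
  obtain ⟨a, b, c⟩ := hT
  have s5 : ∀ (A : M[τ, τ]), A * T.submatrix id e = (A * T).submatrix id e := fun A => rfl
  refine ⟨?_, ?_, ?_⟩
  · rw [s5, pull, submatrix_mul_bijective he, a]
  · rw [s5, pull, submatrix_mul_bijective he, b]
  · rw [s5, pull_K he.1, submatrix_mul_bijective he, c]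

lemma WeightModule.IsIntertwiner.pull_tgt (he : Bijective e) {T : M[ι, τ]} (hT : IsHom Z X T) :
    IsHom Z (X.pull e) (T.submatrix e id) := by
  obtain ⟨a, b, c⟩ := hT
  have s6 : ∀ (A : M[τ, τ]), T.submatrix e id * A = (T * A).submatrix e id := fun A => rfl
  refine ⟨?_, ?_, ?_⟩
  · rw [s6, pull, submatrix_mul_bijective he, a]
  · rw [s6, pull, submatrix_mul_bijective he, b]
  · rw [s6, pull_K he.1, submatrix_mul_bijective he, c]

lemma exists_of_pull (he : Bijective e) {g : M[κ, κ]} (hg : IsHom (X.pull e) (X.pull e) g) : ∃ g' :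
    M[ι, ι], g = g'.submatrix e e ∧ IsHom X X g' := by
  let E := Equiv.ofBijective e he
  obtain ⟨g', rfl⟩ : ∃ g' : M[ι, ι], g = g'.submatrix e e := ⟨g.submatrix E.symm E.symm, by
      ext i j
      simp only [submatrix_apply]
      congr 1 <;> exact (E.symm_apply_apply _).symm⟩
  have inj : Injective fun A : M[ι, ι] => A.submatrix e e := by
    intro A B h
    ext i j
    obtain ⟨i, rfl⟩ := he.2 i
    obtain ⟨j, rfl⟩ := he.2 j
    exact congr_fun₂ h i j
  refine ⟨g', rfl, ?_⟩
  obtain ⟨a, b, c⟩ := hg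
  rw [pull_K he.1] at c
  simp only [pull, submatrix_mul_bijective he] at a b c
  exact ⟨inj a, inj b, inj c⟩

lemma trace_submatrix_bijective (he : Bijective e) (A : M[ι, ι]) : (A.submatrix e e).trace =
  A.trace := Fintype.sum_equiv (Equiv.ofBijective e he) _ _ fun _ => rfl

lemma Negligible.pull (he : Bijective e) {n : M[ι, ι]} (hn : Negligible q X n) : Negligible q
    (X.pull e) (n.submatrix e e) := fun g hg => by
  obtain ⟨g', rfl, hg'⟩ := exists_of_pull he hg
  rw [pull_K he.1, submatrix_mul_bijective he, submatrix_mul_bijective he, trace_submatrix_bijective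
    he]
  exact hn g' hg'

lemma Spherical.pull (he : Bijective e) (hX : Spherical q X) : Spherical q (X.pull e) := fun h hh =>
    by
  obtain ⟨h', rfl, hh'⟩ := exists_of_pull he hh
  rw [pull_K he.1, pull_Kinv he.1, submatrix_mul_bijective he, submatrix_mul_bijective he,
    trace_submatrix_bijective he, trace_submatrix_bijective he]
  exact hX h' hh'

end Pull

section Channels

/-- A matrix of matrix elements of `X`, decomposed along finitely many channels. -/
def Channels (D : QuantumData q s) (X : WeightModule ι) (G : ι → ι → DualQG Dᵒ) : Prop := Spherical
  q X ∧ ∃ (C : Type) (_ : Fintype C) (γ : C → Phys q) (f : ∀ c, M[ι, (γ c)]) (g : ∀ c, M[(γ c), ι]),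
  (∀ c, IsHom (γ c).rep X (f c)) ∧ (∀ c, IsHom X (γ c).rep (g c)) ∧ (∀ c, g c * f c = 1) ∧ (∀ c d, c
  ≠ d → g c * f d = 0) ∧ G = ∑ c, lmul (f c) (rmul (DualQG.g Dᵒ (γ c)) (g c)) ∧ Negligible q X (1 -
  ∑ c, f c * g c)

/-- The truncating projector: the counit of the matrix elements. -/
def coproj (G : ι → κ → DualQG Dᵒ) : M[ι, κ] := of fun p p' => counit Dᵒ (G p p')

lemma coproj_lmul {υ : Type} (A : M[υ, ι]) (G : ι → κ → DualQG Dᵒ) : coproj (lmul A G) = A * coproj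
    G := by
  ext i j; simp [coproj, lmul, mmul_apply]

lemma coproj_rmul {υ : Type} (A : M[κ, υ]) (G : ι → κ → DualQG Dᵒ) : coproj (rmul G A) = coproj G *
    A := by
  ext i j; simp [coproj, rmul, mmul_apply, mul_comm]

lemma coproj_sum {C : Type} (S : Finset C) (G : C → ι → κ → DualQG Dᵒ) : coproj (∑ c ∈ S, G c) = ∑ c
    ∈ S, coproj (G c) := by
  ext i j; simp [coproj, Finset.sum_apply, msum_apply]

lemma coproj_g (γ : Phys q) : coproj (DualQG.g Dᵒ γ) = 1 := by
  ext i j; simp [coproj, counit_g, mone_apply]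

/-- `A` commutes with the coactions. -/
def Coact (A : M[κ, ι]) (G : ι → ι → DualQG Dᵒ) (H : κ → κ → DualQG Dᵒ) : Prop := lmul A G = rmul H
    A

lemma schur_coact {γ γ' : Phys q} {S : M[γ', γ]} (hS : IsHom γ.rep γ'.rep S) : Coact (D := D) S
    (DualQG.g Dᵒ γ) (DualQG.g Dᵒ γ') := by
  unfold Coact
  by_cases h : γ = γ'
  · subst h
    obtain ⟨c, rfl⟩ := intertwiner_phys_scalar hS
    rw [lmul_smul, rmul_smul, lmul_one, rmul_one]
  · rw [intertwiner_eq_zero_of_ne h hS, lmul_zero, rmul_zero]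

variable {G : ι → ι → DualQG Dᵒ} {H : κ → κ → DualQG Dᵒ}

lemma Channels.coproj_isIntertwiner (h : Channels D X G) : IsHom X X (coproj G) := by
  obtain ⟨_, C, _, γ, f, g, hf, hg, _, _, rfl, _⟩ := h
  rw [coproj_sum]
  simp only [coproj_lmul, coproj_rmul, coproj_g, mone_mul]
  exact isIntertwiner_sum _ _ fun c _ => (hf c).comp (hg c)

lemma Channels.negligible (h : Channels D X G) : Negligible q X (1 - coproj G) := by
  obtain ⟨_, C, _, γ, f, g, hf, hg, _, _, rfl, hn⟩ := h
  rw [coproj_sum]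
  simpa only [coproj_lmul, coproj_rmul, coproj_g, mone_mul] using hn

lemma sum_proj_mul {C : Type} [Fintype C] {γ : C → Phys q} {f : ∀ c, M[ι, (γ c)]} {g : ∀ c, M[(γ c),
    ι]} (h1 : ∀ c, g c * f c = 1) (h0 : ∀ c d, c ≠ d → g c * f d = 0) (c : C) : (∑ c, f c * g c) * f
    c = f c := by
  rw [msum_mul, sum_eq_single c]
  · rw [mmul_assoc, h1, mmul_one]
  · intro d _ hd
    rw [mmul_assoc, h0 d c hd, mmul_zero]
  · simp

lemma mul_sum_proj {C : Type} [Fintype C] {γ : C → Phys q} {f : ∀ c, M[ι, (γ c)]} {g : ∀ c, M[(γ c),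
    ι]} (h1 : ∀ c, g c * f c = 1) (h0 : ∀ c d, c ≠ d → g c * f d = 0) (c : C) : g c * (∑ c, f c * g
    c) = g c := by
  rw [mmul_sum, sum_eq_single c]
  · rw [← mmul_assoc, h1, mone_mul]
  · intro d _ hd
    rw [← mmul_assoc, h0 c d hd.symm, mzero_mul]
  · simp

lemma Channels.lmul_coproj (h : Channels D X G) : lmul (coproj G) G = G := by
  obtain ⟨_, C, _, γ, f, g, hf, hg, h1, h0, rfl, hn⟩ := h
  rw [coproj_sum]
  simp only [coproj_lmul, coproj_rmul, coproj_g, mone_mul]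
  rw [lmul_sum]
  refine sum_congr rfl fun c _ => ?_
  rw [lmul_lmul, sum_proj_mul h1 h0]

lemma Channels.rmul_coproj (h : Channels D X G) : rmul G (coproj G) = G := by
  obtain ⟨_, C, _, γ, f, g, hf, hg, h1, h0, rfl, hn⟩ := h
  rw [coproj_sum]
  simp only [coproj_lmul, coproj_rmul, coproj_g, mone_mul]
  rw [rmul_sum]
  refine sum_congr rfl fun c _ => ?_
  rw [← lmul_rmul, rmul_rmul, mul_sum_proj h1 h0]

lemma Channels.coproj_idem (h : Channels D X G) : coproj G * coproj G = coproj G := by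
  rw [← coproj_lmul, h.lmul_coproj]

lemma Channels.coact (hX : Channels D X G) (hY : Channels D Y H) {T : M[κ, ι]} (hT : IsHom X Y T) :
    Coact (coproj H * T * coproj G) G H := by
  unfold Coact
  rw [← lmul_lmul, hX.lmul_coproj, mmul_assoc, ← rmul_rmul, hY.rmul_coproj]
  obtain ⟨_, C, _, γ, f, g, hf, hg, h1, h0, rfl, hn⟩ := hX
  obtain ⟨_, C', _, γ', f', g', hf', hg', h1', h0', rfl, hn'⟩ := hY
  simp only [coproj_sum, coproj_lmul, coproj_rmul, coproj_g, mone_mul]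
  have e1 : (∑ d, f' d * g' d) * T = ∑ d, f' d * (g' d * T) := by
    rw [msum_mul]; simp only [mmul_assoc]
  rw [e1, sum_lmul, rmul_sum]
  refine sum_congr rfl fun d _ => ?_
  rw [← lmul_lmul, ← lmul_rmul, rmul_rmul]
  congr 1
  rw [lmul_sum, mmul_sum, mmul_sum, rmul_matrix_sum]
  refine sum_congr rfl fun c _ => ?_
  have e2 := schur_coact (D := D) (((hg' d).comp hT).comp (hf c))
  unfold Coact at e2
  rw [lmul_lmul, lmul_rmul, e2, rmul_rmul]
  simp only [mmul_assoc]

lemma Channels.pull {e : κ → ι} (he : Bijective e) (hX : Channels D X G) : Channels D (X.pull e) fun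
    p p' => G (e p) (e p') := by
  obtain ⟨hS, C, _, γ, f, g, hf, hg, h1, h0, hG, hn⟩ := hX
  have s3 : ∀ c d, (g c).submatrix id e * (f d).submatrix e id = g c * f d := fun c d =>
    submatrix_mul_bijective he _ _ _ _
  refine ⟨hS.pull he, C, inferInstance, γ, fun c => (f c).submatrix e id,
    fun c => (g c).submatrix id e, fun c => (hf c).pull_tgt he, fun c => (hg c).pull_src he,
    fun c => by rw [s3, h1], fun c d hcd => by rw [s3, h0 c d hcd], ?_, ?_⟩
  · funext p p'
    rw [hG]
    simp only [Finset.sum_apply]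
    rfl
  · have e1 : (1 - ∑ c, (f c).submatrix e id * (g c).submatrix id e) = (1 - ∑ c, f c * g
      c).submatrix e e := by
      ext i j
      simp only [msub_apply, submatrix_apply, msum_apply, mone_apply, he.1.eq_iff]
      rfl
    rw [e1]
    exact hn.pull he

/-- Products of matrices of matrix elements. -/
def tmul (G : ι → ι → DualQG Dᵒ) (H : κ → κ → DualQG Dᵒ) : ι × κ → ι × κ → DualQG Dᵒ := fun p p' =>
    G p.1 p'.1 * H p.2 p'.2

lemma tmul_lmul (A : M[ι', ι]) (B : M[κ', κ]) {ι'' κ'' : Type} (G : ι → ι'' → DualQG Dᵒ) (H : κ →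
    κ'' → DualQG Dᵒ) (p : ι' × κ') (p' : ι'' × κ'') : lmul A G p.1 p'.1 * lmul B H p.2 p'.2 = lmul
    (A ⊗ₖ B) (fun (p : ι × κ) (p' : ι'' × κ'') => G p.1 p'.1 * H p.2 p'.2) p p' := by
  simp only [lmul, sum_mul_sum, sum_prod_type, kroneckerMap_apply, smul_mul_assoc, mul_smul_comm,
    smul_smul]
  simp only [mul_comm]

lemma tmul_rmul (A : M[ι, ι']) (B : M[κ, κ']) {ι'' κ'' : Type} (G : ι'' → ι → DualQG Dᵒ) (H : κ'' →
    κ → DualQG Dᵒ) (p : ι'' × κ'') (p' : ι' × κ') : rmul G A p.1 p'.1 * rmul H B p.2 p'.2 = rmul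
    (fun (p : ι'' × κ'') (p' : ι × κ) => G p.1 p'.1 * H p.2 p'.2) (A ⊗ₖ B) p p' := by
  simp only [rmul, sum_mul_sum, sum_prod_type, kroneckerMap_apply, smul_mul_assoc, mul_smul_comm,
    smul_smul]
  simp only [mul_comm]

lemma Coact.kron {A : M[ι', ι]} {B : M[κ', κ]} {G' : ι' → ι' → DualQG Dᵒ} {H' : κ' → κ' → DualQG Dᵒ}
    (hA : Coact A G G') (hB : Coact B H H') : Coact (A ⊗ₖ B) (tmul G H) (tmul G' H') := by
  unfold Coact at *
  funext p p'
  unfold tmul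
  rw [← tmul_lmul, hA, hB, tmul_rmul]

lemma tmul_g (D : QuantumData q s) (α β : Phys q) : tmul (DualQG.g Dᵒ α) (DualQG.g Dᵒ β) = ∑ γ ∈
    fusionSet α β, lmul (D.phi α β γ) (rmul (DualQG.g Dᵒ γ) (D.psi α β γ)) := by
  funext p p'
  simp only [tmul, g_mul_g', Finset.sum_apply, lmul, rmul, smul_sum, smul_smul]

lemma Channels.tensor (hX : Channels D X G) (hY : Channels D Y H) : Channels D (X ⊠ Y) (tmul G
    H) := by
  obtain ⟨hS, C, _, γ, f, g, hf, hg, h1, h0, rfl, hn⟩ := hX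
  obtain ⟨hS', C', _, γ', f', g', hf', hg', h1', h0', rfl, hn'⟩ := hY
  have hP : ∀ c d, ((f c ⊗ₖ f' d) * cgProj D (γ c) (γ' d) * (g c ⊗ₖ g' d)) = ∑ ν ∈ fusionSet (γ c)
    (γ' d), (f c ⊗ₖ f' d) * D.phi (γ c) (γ' d) ν * (D.psi (γ c) (γ' d) ν * (g c ⊗ₖ g' d)) := by
    intro c d
    rw [cgProj, mmul_sum, msum_mul]
    simp only [mmul_assoc]
  have hk : ∀ c d c' d', (g c ⊗ₖ g' d) * (f c' ⊗ₖ f' d') = (g c * f c') ⊗ₖ (g' d * f' d') := fun c d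
    c' d' => (mul_kronecker_mul _ _ _ _).symm
  refine ⟨hS.tensor hS', Σ x : C × C', fusionSet (γ x.1) (γ' x.2), inferInstance, fun x => x.2.1,
    fun x => (f x.1.1 ⊗ₖ f' x.1.2) * D.phi (γ x.1.1) (γ' x.1.2) x.2.1, fun x => D.psi (γ x.1.1) (γ'
    x.1.2) x.2.1 * (g x.1.1 ⊗ₖ g' x.1.2), fun x => ((hf _).kron (hf' _)).comp (D.phi_intertwiner _ _
    _), fun x => (D.psi_intertwiner _ _ _).comp ((hg _).kron (hg' _)), ?_, ?_, ?_, ?_⟩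
  · rintro ⟨⟨c, d⟩, ν, hν⟩
    dsimp only
    rw [mmul_assoc, ← mmul_assoc (g c ⊗ₖ g' d), hk, h1, h1', one_kronecker_one, mone_mul,
      D.psi_mul_phi _ _ _ ((mem_fusionSet).1 hν)]
  · rintro ⟨⟨c, d⟩, ν, hν⟩ ⟨⟨c', d'⟩, ν', hν'⟩ hne
    dsimp only
    rw [mmul_assoc, ← mmul_assoc (g c ⊗ₖ g' d), hk]
    by_cases hc : c = c'
    · subst hc
      by_cases hd : d = d'
      · subst hd
        have : ν ≠ ν' := by rintro rfl; exact hne rfl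
        rw [h1, h1', one_kronecker_one, mone_mul, psi_mul_phi_ne D this]
      · rw [h0' d d' hd, Matrix.kronecker_zero, mzero_mul, mmul_zero]
    · rw [h0 c c' hc, Matrix.zero_kronecker, mzero_mul, mmul_zero]
  · rw [Fintype.sum_sigma, sum_prod_type]
    funext p p'
    simp only [tmul, Finset.sum_apply, sum_mul_sum]
    refine sum_congr rfl fun c _ => sum_congr rfl fun d _ => ?_
    rw [tmul_lmul, ← Finset.sum_apply, ← Finset.sum_apply]
    have : (fun (p : (γ c) × (γ' d)) (p' : ι × κ) => rmul (DualQG.g Dᵒ (γ c)) (g c) p.1 p'.1 * rmul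
      (DualQG.g Dᵒ (γ' d)) (g' d) p.2 p'.2) = rmul (tmul (DualQG.g Dᵒ (γ c)) (DualQG.g Dᵒ (γ' d)))
      (g c ⊗ₖ g' d) := by
      funext p p'
      exact tmul_rmul _ _ _ _ p p'
    rw [this, tmul_g, rmul_sum, lmul_sum, ← Finset.sum_coe_sort]
    simp only [← lmul_rmul, lmul_lmul, rmul_rmul]
  · have e : I[ι × κ] - ∑ x : Σ x : C × C', fusionSet (γ x.1) (γ' x.2), (f x.1.1 ⊗ₖ f' x.1.2) *
      D.phi (γ x.1.1) (γ' x.1.2) x.2.1 * (D.psi (γ x.1.1) (γ' x.1.2) x.2.1 * (g x.1.1 ⊗ₖ g' x.1.2))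
      = (1 - ∑ c, f c * g c) ⊗ₖ I[κ] + ((∑ c, f c * g c) ⊗ₖ I[κ]) * (I[ι] ⊗ₖ (1 - ∑ c, f' c * g' c))
      + ∑ x : C × C', (f x.1 ⊗ₖ f' x.2) * (1 - cgProj D (γ x.1) (γ' x.2)) * (g x.1 ⊗ₖ g' x.2) := by
      rw [Fintype.sum_sigma]
      simp only [mmul_sub, msub_mul, mmul_one, sum_sub_distrib, hP]
      have e1 : ∑ x : C × C', (f x.1 ⊗ₖ f' x.2) * (g x.1 ⊗ₖ g' x.2) = (∑ c, f c * g c) ⊗ₖ (∑ c, f' c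
        * g' c) := by
        ext ⟨i, j⟩ ⟨k, l⟩
        simp only [← mul_kronecker_mul, msum_apply, kroneckerMap_apply, sum_mul_sum, sum_prod_type]
      have e2 : ∀ x : C × C', ∑ ν ∈ fusionSet (γ x.1) (γ' x.2), (f x.1 ⊗ₖ f' x.2) * D.phi (γ x.1)
        (γ' x.2) ν * (D.psi (γ x.1) (γ' x.2) ν * (g x.1 ⊗ₖ g' x.2)) = ∑ ν : fusionSet (γ x.1) (γ'
        x.2), (f x.1 ⊗ₖ f' x.2) * D.phi (γ x.1) (γ' x.2) ν.1 * (D.psi (γ x.1) (γ' x.2) ν.1 * (g x.1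
        ⊗ₖ g' x.2)) := fun x => (Finset.sum_coe_sort _ _).symm
      rw [e1]
      simp only [e2, ← mul_kronecker_mul, mmul_one, mone_mul]
      ext ⟨i, j⟩ ⟨k, l⟩
      simp only [msub_apply, madd_apply, kroneckerMap_apply, mone_apply, Prod.mk.injEq]
      by_cases h1 : i = k <;> by_cases h2 : j = l <;> simp [h1, h2] <;> ring
    rw [e]
    have hPi : IsHom X X (∑ c, f c * g c) := isIntertwiner_sum _ _ fun c _ => (hf c).comp (hg c)
    have hPi' : IsHom Y Y (∑ c, f' c * g' c) := isIntertwiner_sum _ _ fun c _ => (hf' c).comp (hg'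
      c)
    exact ((hn.kron_one).add ((hn'.one_kron hS hS' (isIntertwiner_one.sub hPi')).mul_left (hPi.kron
      isIntertwiner_one))).add (negligible_sum _ _ fun x _ => (negligible_one_sub_cgProj D _ _).conj
      ((hf _).kron (hf' _)) ((hg _).kron (hg' _)))

lemma channels_phys (D : QuantumData q s) (γ : Phys q) : Channels D γ.rep (DualQG.g Dᵒ γ) :=
  ⟨spherical_spin γ.2.1, Unit, inferInstance, fun _ => γ, fun _ => 1, fun _ => 1, fun _ =>
  isIntertwiner_one, fun _ => isIntertwiner_one, fun _ => mone_mul _, fun c d h => absurd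
  (Subsingleton.elim c d) h, by
      rw [Fintype.sum_unique, lmul_one, rmul_one], by simpa using negligible_zero⟩

/-- The matrix elements of a signed label. -/
def labG (D : QuantumData q s) (X : SLabel q) : X.2 → X.2 → DualQG Dᵒ := lmul X.iso (rmul (DualQG.g
  Dᵒ X.2) X.isoInv)

lemma channels_label (D : QuantumData q s) (X : SLabel q) : Channels D X.rep (labG D X) := by
  refine ⟨X.spherical, Unit, inferInstance, fun _ => X.2, fun _ => X.iso, fun _ => X.isoInv, fun _
    => X.iso_isIntertwiner, fun _ => X.isoInv_isIntertwiner, fun _ => X.isoInv_mul, fun c d h =>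
    absurd (Subsingleton.elim c d) h, by rw [Fintype.sum_unique]; rfl, ?_⟩
  rw [Fintype.sum_unique, X.iso_mul_inv, sub_self]
  exact negligible_zero

end Channels

/-! ### Parenthesized words -/

/-- Multi-indices for the letters of a parenthesized word. -/
def TIx {n : ℕ} (d : Fin n → ℕ) : FreeMagma (Fin n) → Type
  | .of k => Fin (d k)
  | .mul t₁ t₂ => TIx d t₁ × TIx d t₂

namespace TIx

variable {n : ℕ} {d : Fin n → ℕ}

instance fintype : ∀ t, Fintype (TIx d t)
  | .of k => inferInstanceAs (Fintype (Fin (d k)))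
  | .mul t₁ t₂ => @instFintypeProd _ _ (fintype t₁) (fintype t₂)

instance decEq : ∀ t, DecidableEq (TIx d t)
  | .of k => inferInstanceAs (DecidableEq (Fin (d k)))
  | .mul t₁ t₂ => @instDecidableEqProd _ _ (decEq t₁) (decEq t₂)

/-- The letters of a multi-index that occur in a parenthesized word. -/
def restrict (I : ∀ k, Fin (d k)) : ∀ t, TIx d t
  | .of k => I k
  | .mul t₁ t₂ => (restrict I t₁, restrict I t₂)

lemma restrict_eq_iff (I J : ∀ k, Fin (d k)) : ∀ t, restrict I t = restrict J t ↔ ∀ k ∈ leaves t, I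
    k = J k
  | .of k => by
    simp only [restrict, leaves, List.mem_singleton, forall_eq]
    exact Iff.rfl
  | .mul t₁ t₂ => by
    simp only [restrict, leaves, List.mem_append, or_imp, forall_and, ← restrict_eq_iff I J t₁, ←
      restrict_eq_iff I J t₂]
    exact Prod.mk_inj

lemma card_eq : ∀ t, card (TIx d t) = ((leaves t).map d).prod
  | .of k => by
    simp only [leaves, List.map_cons, List.map_nil, List.prod_cons, List.prod_nil, mul_one]
    exact Fintype.card_fin _
  | .mul t₁ t₂ => by
    rw [leaves, List.map_append, List.prod_append, ← card_eq t₁, ← card_eq t₂]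
    exact Fintype.card_prod _ _

lemma restrict_bijective {t : FreeMagma (Fin n)} (ht : leaves t = finRange n) : Bijective fun I : ∀
    k, Fin (d k) => restrict I t := by
  rw [Fintype.bijective_iff_injective_and_card]
  refine ⟨fun I J h => funext fun k => (restrict_eq_iff I J t).1 h k (ht ▸ List.mem_finRange k), ?_⟩
  rw [card_eq, ht, Fintype.card_pi, ← Fin.prod_univ_def]
  simp

end TIx

section Words

variable {n : ℕ} (w : Fin n → SLabel q)

/-- The dimensions of the letters. -/
abbrev wdim : Fin n → ℕ := fun k => (w k).2.dim

/-- The tensor product along a parenthesized word. -/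
def treeMod : ∀ t, WeightModule (TIx (wdim w) t)
  | .of k => (w k).rep
  | .mul t₁ t₂ => (treeMod t₁) ⊠ (treeMod t₂)

/-- The product of matrix elements along a parenthesized word. -/
def treeG (D : QuantumData q s) : ∀ t, TIx (wdim w) t → TIx (wdim w) t → DualQG Dᵒ
  | .of k => labG D (w k)
  | .mul t₁ t₂ => tmul (treeG D t₁) (treeG D t₂)

lemma channels_tree (D : QuantumData q s) : ∀ t, Channels D (treeMod w t) (treeG w D t)
  | .of k => channels_label D (w k)
  | .mul t₁ t₂ => (channels_tree D t₁).tensor (channels_tree D t₂)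

/-- The identity on a list of letters. -/
def listDelta (I J : Idx w) : List (Fin n) → ℂ
  | [] => 1
  | k :: L => (if I k = J k then 1 else 0) * listDelta I J L

/-- The weight of a list of letters. -/
def listWt (I : Idx w) : List (Fin n) → ℤ
  | [] => 0
  | k :: L => (w k).rep.wt (I k) + listWt I L

/-- The action of `E` on a list of letters. -/
def listE (I J : Idx w) : List (Fin n) → ℂ
  | [] => 0
  | k :: L => (if I k = J k then 1 else 0) * listE I J L +
      (w k).rep.E (I k) (J k) * (listDelta w I J L * q ^ listWt w I L)

/-- The action of `F` on a list of letters. -/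
def listF (I J : Idx w) : List (Fin n) → ℂ
  | [] => 0
  | k :: L => (if I k = J k then 1 else 0) * q ^ (-(w k).rep.wt (I k)) * listF I J L +
      (w k).rep.F (I k) (J k) * listDelta w I J L

variable (I J : Idx w)

lemma listDelta_append (L' : List (Fin n)) : ∀ L, listDelta w I J (L ++ L') = listDelta w I J L *
    listDelta w I J L'
  | [] => by simp [listDelta]
  | k :: L => by rw [List.cons_append, listDelta, listDelta_append, listDelta, mul_assoc]

lemma listWt_append (L' : List (Fin n)) : ∀ L, listWt w I (L ++ L') = listWt w I L + listWt w I L'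
  | [] => by simp [listWt]
  | k :: L => by rw [List.cons_append, listWt, listWt_append, listWt, add_assoc]

lemma listE_append (L' : List (Fin n)) : ∀ L, listE w I J (L ++ L') = listDelta w I J L * listE w I
    J L' + listE w I J L * (listDelta w I J L' * q ^ listWt w I L')
  | [] => by simp [listDelta, listE]
  | k :: L => by
    rw [List.cons_append, listE, listE_append, listE, listDelta, listDelta_append, listWt_append,
      zpow_add₀ q0]
    ring

lemma listF_append (L' : List (Fin n)) : ∀ L, listF w I J (L ++ L') = listDelta w I J L * q ^
    (-listWt w I L) * listF w I J L' + listF w I J L * listDelta w I J L'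
  | [] => by simp [listDelta, listF, listWt]
  | k :: L => by
    rw [List.cons_append, listF, listF_append, listF, listDelta, listDelta_append, listWt, neg_add,
      zpow_add₀ q0]
    ring

lemma one_apply_tree : ∀ t, I[TIx (wdim w) t] (TIx.restrict I t) (TIx.restrict J t) = listDelta w I
    J (leaves t)
  | .of k => by
    rw [leaves, listDelta, listDelta, mul_one]
    exact mone_apply
  | .mul t₁ t₂ => by
    rw [leaves, listDelta_append, ← one_apply_tree t₁, ← one_apply_tree t₂]
    have := congr_fun₂ (one_kronecker_one (α := ℂ) (m := TIx (wdim w) t₁) (n := TIx (wdim w) t₂))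
      (TIx.restrict I (t₁.mul t₂)) (TIx.restrict J (t₁.mul t₂))
    exact this.symm

lemma wt_tree : ∀ t, (treeMod w t).wt (TIx.restrict I t) = listWt w I (leaves t)
  | .of k => by rw [leaves, listWt, listWt, add_zero]; rfl
  | .mul t₁ t₂ => by rw [leaves, listWt_append, ← wt_tree t₁, ← wt_tree t₂]; rfl

lemma K_tree (t) : (treeMod w t).K q (TIx.restrict I t) (TIx.restrict J t) = listDelta w I J (leaves
    t) * q ^ listWt w I (leaves t) := by
  rw [← one_apply_tree, ← wt_tree, K, diagonal_apply, mone_apply]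
  split_ifs <;> simp

lemma Kinv_tree (t) : (treeMod w t).Kinv q (TIx.restrict I t) (TIx.restrict J t) = listDelta w I J
    (leaves t) * q ^ (-listWt w I (leaves t)) := by
  rw [← one_apply_tree, ← wt_tree, Kinv, diagonal_apply, mone_apply]
  split_ifs <;> simp

lemma E_tree : ∀ t, (treeMod w t).E (TIx.restrict I t) (TIx.restrict J t) = listE w I J (leaves t)
  | .of k => by
    rw [leaves, listE, listE, mul_zero, listDelta, listWt, zpow_zero, mul_one, mul_one, zero_add]
    rfl
  | .mul t₁ t₂ => by
    rw [leaves, listE_append w I J, ← E_tree t₁, ← E_tree t₂, ← one_apply_tree, ← K_tree]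
    rfl

lemma F_tree : ∀ t, (treeMod w t).F (TIx.restrict I t) (TIx.restrict J t) = listF w I J (leaves t)
  | .of k => by
    rw [leaves, listF, listF, mul_zero, listDelta, mul_one, zero_add]
    rfl
  | .mul t₁ t₂ => by
    rw [leaves, listF_append w I J, ← F_tree t₁, ← F_tree t₂, ← one_apply_tree w I J t₂, ←
      Kinv_tree]
    rfl

/-- The tensor product of the letters of a word. -/
def idxMod : WeightModule (Idx w) := ⟨fun I => listWt w I (finRange n), of fun I J => listE w I J
  (finRange n), of fun I J => listF w I J (finRange n)⟩

/-- The product of matrix elements along a parenthesized word. -/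
def idxG (D : QuantumData q s) (t : FreeMagma (Fin n)) (I J : Idx w) : DualQG Dᵒ := treeG w D t
  (TIx.restrict I t) (TIx.restrict J t)

variable {w}

lemma idxMod_eq {t : FreeMagma (Fin n)} (ht : leaves t = finRange n) : (treeMod w t).pull (fun I =>
    TIx.restrict I t) = idxMod w := by
  rw [pull, idxMod]
  congr 1
  · funext I
    exact (wt_tree w I t).trans (by rw [ht])
  · ext I J
    exact (E_tree w I J t).trans (by rw [ht]; rfl)
  · ext I J
    exact (F_tree w I J t).trans (by rw [ht]; rfl)

lemma channels_idx (D : QuantumData q s) {t : FreeMagma (Fin n)} (ht : leaves t = finRange n) :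
    Channels D (idxMod w) (idxG w D t) := by
  have h := (channels_tree w D t).pull (TIx.restrict_bijective (d := wdim w) ht)
  rw [idxMod_eq ht] at h
  exact h

end Words

/-! ### Coefficients of matrix elements -/

section Coefficients

/-- The coefficient of `g^γ_{mn}`. -/
def DualQG.coef (D : CGMatrices q) (γ : Phys q) (m n : γ) : DualQG D →ₗ[ℂ] ℂ := Finsupp.lapply (⟨γ,
  m, n⟩ : Σ α : Phys q, α × α)

open Classical in
/-- The labels that occur in an element of `Γ`. -/
def DualQG.labels {D : CGMatrices q} (x : DualQG D) : Finset (Phys q) := (Finsupp.support (M := ℂ)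
  x).image Sigma.fst

lemma DualQG.coef_eq_zero {D : CGMatrices q} {x : DualQG D} (h : γ ∉ labels x) (m n : γ) : coef D γ
    m n x = 0 := by
  classical
  by_contra h'
  exact h (Finset.mem_image.2 ⟨⟨γ, m, n⟩, Finsupp.mem_support_iff.2 h', rfl⟩)

lemma DualQG.coef_g (D : CGMatrices q) (γ : Phys q) (m n m' n' : γ) : coef D γ m n (g D γ m' n') =
    if m = m' ∧ n = n' then 1 else 0 := by
  classical
  change Finsupp.single (M := ℂ) (⟨γ, m', n'⟩ : Σ α : Phys q, α × α) 1 ⟨γ, m, n⟩ = _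
  rw [Finsupp.single_apply]
  simp [eq_comm]

lemma DualQG.coef_g_ne (D : CGMatrices q) {γ γ' : Phys q} (h : γ ≠ γ') (m n : γ) (m' n' : γ') : coef
    D γ m n (g D γ' m' n') = 0 := by
  classical
  change Finsupp.single (M := ℂ) (⟨γ', m', n'⟩ : Σ α : Phys q, α × α) 1 ⟨γ, m, n⟩ = _
  rw [Finsupp.single_apply, if_neg]
  intro e
  exact h (congrArg Sigma.fst e).symm

lemma DualQG.eq_sum_coef {D : CGMatrices q} (x : DualQG D) {S : Finset (Phys q)} (hS : labels x ⊆ S)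
    : x = ∑ γ ∈ S, ∑ m, ∑ n, coef D γ m n x • g D γ m n := by
  classical
  have h1 : x = ∑ a ∈ Finsupp.support (M := ℂ) x, coef D a.1 a.2.1 a.2.2 x • g D a.1 a.2.1 a.2.2 := by
    have h := (Finsupp.sum_single (M := ℂ) x).symm
    refine h.trans (sum_congr rfl fun a _ => ?_)
    change Finsupp.single a (Finsupp.toFun (M := ℂ) x a) = Finsupp.toFun (M := ℂ) x a • Finsupp.single (M := ℂ) _ 1
    rw [Finsupp.smul_single, smul_eq_mul, mul_one]
  have h2 : ∑ γ ∈ S, ∑ m, ∑ n, coef D γ m n x • g D γ m n = ∑ a ∈ S.sigma fun γ : Phys q =>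
    (Finset.univ : Finset (γ × γ)), coef D a.1 a.2.1 a.2.2 x • g D a.1 a.2.1 a.2.2 := by
    rw [Finset.sum_sigma]
    simp only [sum_prod_type]
  rw [h2]
  refine h1.trans (Finset.sum_subset ?_ fun a _ ha => ?_)
  · intro a ha
    exact Finset.mem_sigma.2 ⟨hS (Finset.mem_image_of_mem _ ha), mem_univ _⟩
  · have : coef D a.1 a.2.1 a.2.2 x = 0 := Finsupp.notMem_support_iff.1 ha
    rw [this, zero_smul]

lemma DualQG.counit_eq {D : CGMatrices q} (x : DualQG D) : counit D x = ∑ᶠ γ : Phys q, ∑ m, coef D γ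
    m m x := by
  classical
  rw [finsum_eq_sum_of_support_subset (s := labels x)]
  · conv_lhs => rw [eq_sum_coef x subset_rfl]
    simp [counit_g]
  · intro γ h
    by_contra h'
    exact h (sum_eq_zero fun m _ => coef_eq_zero h' m m)

lemma DualQG.coef_mul (x y : DualQG Dᵒ) (γ : Phys q) (m n : γ) : coef _ γ m n (x * y) = ∑ᶠ c : Phys
    q × Phys q, ∑ a, ∑ a', ∑ b, ∑ b', D.phi c.1 c.2 γ (a, b) m * coef _ c.1 a a' x * coef _ c.2 b b'
    y * D.psi c.1 c.2 γ n (a', b') := by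
  classical
  have hg : ∀ (α β : Phys q) (i j : α) (k l : β), coef Dᵒ γ m n (g _ α i j * g _ β k l) = D.phi α β
    γ (i, k) m * D.psi α β γ n (j, l) := by
    intro α β i j k l
    rw [g_mul_g']
    simp only [map_sum, map_smul]
    by_cases h : γ ∈ fusionSet α β
    · rw [sum_eq_single_of_mem γ h]
      · simp [coef_g, sum_ite_eq, ite_and]
      · intro γ' _ hne
        simp [coef_g_ne _ hne.symm]
    · have h0 : fusion α β γ = 0 := by
        by_contra h0
        exact h ((mem_fusionSet).2 h0)
      rw [D.phi_eq_zero _ _ _ h0, mzero_apply, zero_mul]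
      refine sum_eq_zero fun γ' hγ' => ?_
      have hne : γ ≠ γ' := by rintro rfl; exact h hγ'
      simp [coef_g_ne _ hne]
  rw [finsum_eq_sum_of_support_subset (s := labels x ×ˢ labels y)]
  · conv_lhs => rw [eq_sum_coef x subset_rfl, eq_sum_coef y subset_rfl]
    rw [sum_mul_sum, Finset.sum_product]
    simp only [map_sum, sum_mul_sum, smul_mul_assoc, mul_smul_comm, map_smul, hg, smul_eq_mul]
    refine sum_congr rfl fun α _ => sum_congr rfl fun β _ => sum_congr rfl fun a _ => ?_
    rw [sum_comm]
    refine sum_congr rfl fun a' _ => sum_congr rfl fun b _ => sum_congr rfl fun b' _ => ?_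
    ring
  · intro c h
    by_contra h'
    refine h ?_
    simp only [Finset.coe_product, Set.mem_prod, not_and_or, Finset.mem_coe] at h'
    rcases h' with h' | h'
    · simp [coef_eq_zero h']
    · simp [coef_eq_zero h']

variable {n : ℕ} (w : Fin n → SLabel q)

lemma block_eq (D : QuantumData q s) (I J : Idx w) : ∀ (t : FreeMagma (Fin n)) (γ : Phys q), D.block
    w t γ I J = of fun m m' => coef Dᵒ γ m m' (idxG w D t I J)
  | .of k, γ => by
    ext m m'
    rw [CGMatrices.block, of_apply, of_apply]
    change _ = coef Dᵒ γ m m' (labG D (w k) (I k) (J k))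
    simp only [labG, lmul, rmul, map_sum, map_smul]
    split_ifs with h
    · subst h
      simp [coef_g, ite_and]
    · simp [coef_g_ne _ h]
  | .mul t₁ t₂, γ => by
    ext m m'
    rw [CGMatrices.block, of_apply, of_apply]
    change _ = coef Dᵒ γ m m' (idxG w D t₁ I J * idxG w D t₂ I J)
    simp only [coef_mul, block_eq D I J t₁, block_eq D I J t₂, of_apply]

lemma proj_eq (D : QuantumData q s) (t : FreeMagma (Fin n)) : D.proj w t = coproj (idxG w D t) := by
  ext I J
  rw [CGMatrices.proj, of_apply, coproj, of_apply, counit_eq]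
  simp only [block_eq w D, trace, Matrix.diag_apply, of_apply]

variable {w}

lemma theta_coact (D : QuantumData q s) {t t' : FreeMagma (Fin n)} (ht : leaves t = finRange n) (ht'
    : leaves t' = finRange n) : Coact (D.theta w t t') (idxG w D t) (idxG w D t') := by
  have h := (channels_idx (w := w) D ht).coact (channels_idx D ht') isIntertwiner_one
  rwa [mmul_one, ← proj_eq w, ← proj_eq w] at h

end Coefficients

/-! ### The braiding -/

/-- The coefficients of the universal `R`-matrix. -/
def rCoef (q : ℂ) (n : ℕ) : ℂ := q ^ (n * (n - 1) / 2) * (q - q⁻¹) ^ n / qFact q n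

lemma rCoef_zero : rCoef q 0 = 1 := by simp [rCoef, qFact]

lemma rCoef_succ {n : ℕ} (hn : qInt q (n + 1) ≠ 0) : rCoef q (n + 1) * (qInt q (n + 1) * q⁻¹ ^ n) =
    (q - q⁻¹) * rCoef q n := by
  have q0 := q0 (q := q)
  have e : (n + 1) * (n + 1 - 1) / 2 = n * (n - 1) / 2 + n := by
    have := Nat.triangle_succ n
    simpa using this
  rw [rCoef, rCoef, qFact, Finset.prod_range_succ, ← qFact, e, pow_add, pow_succ (q - q⁻¹), inv_pow]
  by_cases h : qFact q n = 0
  · simp [h]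
  · field_simp

lemma pow_mul_of_comm {A B : M[ι, ι]} {c : ℂ} (h : A * B = c • (B * A)) (n : ℕ) : A ^ n * B = c ^ n
    • (B * A ^ n) := by
  induction n with
  | zero => simp
  | succ n ih =>
    rw [pow_succ A n, mmul_assoc, h, mmul_smul, ← mmul_assoc, ih, smul_mul, smul_smul, mmul_assoc,
      pow_succ c n, mul_comm]

lemma kronecker_sub' (A : M[ι, ι]) (B C : M[κ, κ]) : A ⊗ₖ (B - C) = A ⊗ₖ B - A ⊗ₖ C := by
  ext ⟨i, j⟩ ⟨k, l⟩
  simp [mul_sub]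

lemma comm_E_F_pow (hY : Y.IsRep q) (n : ℕ) : (q - q⁻¹) • (Y.E * Y.F ^ (n + 1) - Y.F ^ (n + 1) *
    Y.E) = (qInt q (n + 1) * q⁻¹ ^ n) • (Y.F ^ n * Y.K q - Y.Kinv q * Y.F ^ n) := by
  have KF : Y.K q * Y.F = q⁻¹ ^ 2 • (Y.F * Y.K q) := by
    rw [hY.FK, smul_smul, ← mul_pow, inv_mul_cancel₀ q0, one_pow, one_smul]
  have FKi : ∀ m, Y.F ^ m * Y.Kinv q = (q⁻¹ ^ 2) ^ m • (Y.Kinv q * Y.F ^ m) := fun m => by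
    refine pow_mul_of_comm ?_ m
    rw [hY.KinvF, smul_smul, ← mul_pow, inv_mul_cancel₀ q0, one_pow, one_smul]
  induction n with
  | zero => simp [qInt_one, hY.comm]
  | succ n ih =>
    have e : Y.E * Y.F ^ (n + 1 + 1) - Y.F ^ (n + 1 + 1) * Y.E = (Y.E * Y.F ^ (n + 1) - Y.F ^ (n +
      1) * Y.E) * Y.F + Y.F ^ (n + 1) * (Y.E * Y.F - Y.F * Y.E) := by
      rw [pow_succ _ (n + 1)]; noncomm_ring
    rw [e, smul_add, ← smul_mul, ih, ← mmul_smul, hY.comm, mmul_sub, FKi, smul_mul, msub_mul,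
      mmul_assoc (Y.F ^ n), KF, mmul_smul, ← mmul_assoc, ← pow_succ, mmul_assoc, ← pow_succ,
      smul_sub, smul_sub, smul_smul]
    have h1 : qInt q (n + 1 + 1) = q ^ (n + 1) * 1 + q⁻¹ * qInt q (n + 1) := by
      rw [qInt_add (n + 1) 1, qInt_one, pow_one]
    have h2 : qInt q (n + 1 + 1) = q⁻¹ ^ (n + 1) * 1 + q * qInt q (n + 1) := by
      rw [qInt_add' (n + 1) 1, qInt_one, pow_one]
    have c1 : qInt q (n + 1 + 1) * q⁻¹ ^ (n + 1) = qInt q (n + 1) * q⁻¹ ^ n * q⁻¹ ^ 2 + 1 := by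
      rw [h1, add_mul, mul_one, ← mul_pow, mul_inv_cancel₀ q0, one_pow]; ring
    have c2 : qInt q (n + 1 + 1) * q⁻¹ ^ (n + 1) = qInt q (n + 1) * q⁻¹ ^ n + (q⁻¹ ^ 2) ^ (n +
      1) := by
      rw [h2, pow_succ q⁻¹ n, ← pow_mul]
      have : q⁻¹ * q = 1 := inv_mul_cancel₀ q0
      linear_combination (qInt q (n + 1) * q⁻¹ ^ n) * this
    rw [show (qInt q (n + 1 + 1) * q⁻¹ ^ (n + 1)) • (Y.F ^ (n + 1) * Y.K q) - (qInt q (n + 1 + 1) *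
      q⁻¹ ^ (n + 1)) • (Y.Kinv q * Y.F ^ (n + 1)) = (qInt q (n + 1) * q⁻¹ ^ n * q⁻¹ ^ 2 + 1) • (Y.F
      ^ (n + 1) * Y.K q) - (qInt q (n + 1) * q⁻¹ ^ n + (q⁻¹ ^ 2) ^ (n + 1)) • (Y.Kinv q * Y.F ^ (n +
      1)) by
      rw [← c1, ← c2], add_smul, add_smul, one_smul]
    abel

/-- The truncated sum in the universal `R`-matrix. -/
def rSum (q : ℂ) (X : WeightModule ι) (Y : WeightModule κ) (N : ℕ) : M[ι × κ, ι × κ] := ∑ n ∈ range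
  N, rCoef q n • ((X.E ^ n) ⊗ₖ (Y.F ^ n))

/-- The matrix `s^{H ⊗ H}`. -/
def rDiag (s : ℂ) (X : WeightModule ι) (Y : WeightModule κ) : M[ι × κ, ι × κ] := Matrix.diagonal fun
  p : ι × κ => s ^ (X.wt p.1 * Y.wt p.2)

lemma univR_eq : univR q s X Y = rDiag s X Y * rSum q X Y (card ι) := rfl

lemma rSum_E (hY : Y.IsRep q) {N : ℕ} (hE : X.E ^ N = 0) (hN : ∀ k, 0 < k → k < N → qInt q k ≠ 0) :
    rSum q X Y N * (X ⊠ Y).E = (X.E ⊗ₖ Y.Kinv q + I[ι] ⊗ₖ Y.E) * rSum q X Y N := by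
  have key : ∑ n ∈ range N, rCoef q n • ((X.E ^ n) ⊗ₖ (Y.E * Y.F ^ n - Y.F ^ n * Y.E)) = ∑ n ∈ range
    N, rCoef q n • ((X.E ^ (n + 1)) ⊗ₖ (Y.F ^ n * Y.K q - Y.Kinv q * Y.F ^ n)) := by
    cases N with
    | zero => simp
    | succ M =>
      rw [Finset.sum_range_succ', Finset.sum_range_succ, hE]
      simp only [pow_zero, mmul_one, mone_mul, sub_self, Matrix.kronecker_zero,
        Matrix.zero_kronecker, smul_zero, add_zero]
      refine sum_congr rfl fun n hn => ?_
      have h := comm_E_F_pow hY n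
      have h0 := hN (n + 1) (by omega) (by have := Finset.mem_range.1 hn; omega)
      have h2 : rCoef q (n + 1) • (Y.E * Y.F ^ (n + 1) - Y.F ^ (n + 1) * Y.E) = rCoef q n • (Y.F ^ n
        * Y.K q - Y.Kinv q * Y.F ^ n) := by
        have h3 := congrArg (fun M => rCoef q (n + 1) • M) h
        simp only [smul_smul, rCoef_succ h0] at h3
        rw [mul_comm (rCoef q (n + 1)), mul_smul, mul_smul] at h3
        exact smul_right_injective _ q_sub_ne_zero h3
      rw [← Matrix.kronecker_smul, h2, Matrix.kronecker_smul]
  rw [rSum, tensor, msum_mul, mmul_sum, ← sub_eq_zero, ← sum_sub_distrib]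
  have key' := sub_eq_zero.2 key
  rw [← sum_sub_distrib] at key'
  rw [← neg_eq_zero, ← Finset.sum_neg_distrib, ← key']
  refine sum_congr rfl fun n _ => ?_
  simp only [smul_mul, mmul_smul, mmul_add, madd_mul, ← mul_kronecker_mul, mmul_one, mone_mul, ←
    pow_succ, ← pow_succ', kronecker_sub', smul_sub, smul_add]
  abel

lemma rDiag_E (hs : s ^ 2 = q) (hX : X.IsRep q) : (X.E ⊗ₖ I[κ]) * rDiag s X Y = rDiag s X Y * (X.E
    ⊗ₖ Y.Kinv q) := by
  have hs0 : s ≠ 0 := by rintro rfl; exact q0 (q := q) (by rw [← hs]; simp)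
  ext ⟨i, j⟩ ⟨k, l⟩
  simp only [rDiag, mul_diagonal, diagonal_mul, kroneckerMap_apply, Kinv, diagonal_apply,
    mone_apply]
  by_cases hj : j = l
  · subst hj
    by_cases h : X.E i k = 0
    · simp [h]
    · rw [hX.gE i k h, if_pos rfl, if_pos rfl, add_mul, zpow_add₀ hs0, zpow_mul s 2,
        show s ^ (2 : ℤ) = q by rw [← hs]; norm_cast, zpow_neg]
      have : q ^ Y.wt j ≠ 0 := zpow_ne_zero _ q0
      field_simp
  · simp [hj]

lemma rDiag_E' (hs : s ^ 2 = q) (hY : Y.IsRep q) : (X.K q ⊗ₖ Y.E) * rDiag s X Y = rDiag s X Y *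
    (I[ι] ⊗ₖ Y.E) := by
  have hs0 : s ≠ 0 := by rintro rfl; exact q0 (q := q) (by rw [← hs]; simp)
  ext ⟨i, j⟩ ⟨k, l⟩
  simp only [rDiag, mul_diagonal, diagonal_mul, kroneckerMap_apply, K, diagonal_apply, mone_apply]
  by_cases hi : i = k
  · subst hi
    by_cases h : Y.E j l = 0
    · simp [h]
    · rw [hY.gE j l h, if_pos rfl, if_pos rfl, mul_add, mul_comm (X.wt i) 2, zpow_add₀ hs0,
        zpow_mul s 2, show s ^ (2 : ℤ) = q by rw [← hs]; norm_cast]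
      ring
  · simp [hi]

/-- Nilpotency of the generators, below the vanishing of the `q`-integers. -/
structure WeightModule.IsNil (q : ℂ) (X : WeightModule ι) : Prop where
  E_pow : X.E ^ card ι = 0
  F_pow : X.F ^ card ι = 0
  qInt_ne_zero : ∀ k, 0 < k → k < card ι → qInt q k ≠ 0

lemma WeightModule.IsNil.flip (h : X.IsNil q) : X.flip.IsNil q := ⟨h.2, h.1, h.3⟩

lemma rSum_eq (hX : X.IsNil q) (hY : Y.IsNil q) : rSum q X Y (card ι) = rSum q X Y (card κ) := by
  rcases le_total (card ι) (card κ) with h | h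
  · refine Finset.sum_subset (Finset.range_mono h) fun n _ hn => ?_
    rw [pow_eq_zero_of_le (by simpa using hn) hX.1, Matrix.zero_kronecker, smul_zero]
  · refine (Finset.sum_subset (Finset.range_mono h) fun n _ hn => ?_).symm
    rw [pow_eq_zero_of_le (by simpa using hn) hY.2, Matrix.kronecker_zero, smul_zero]

lemma univR_flip (hX : X.IsNil q) (hY : Y.IsNil q) : univR q s Y.flip X.flip = (univR q s X
    Y).submatrix swap swap := by
  have key : ∀ (A B : M[ι × κ, ι × κ]), (A * B).submatrix (swap : κ × ι → ι × κ) swap = A.submatrix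
    swap swap * B.submatrix swap swap := fun A B => (submatrix_mul_equiv A B _ (prodComm κ ι)
    _).symm
  rw [univR_eq, univR_eq, rSum_eq hX hY, key]
  congr 1
  · rw [rDiag, rDiag, Matrix.submatrix_diagonal _ _ Prod.swap_injective]
    congr 1
    funext p
    simp [WeightModule.flip, mul_comm]
  · ext ⟨i, j⟩ ⟨k, l⟩
    simp [rSum, msum_apply, WeightModule.flip, mul_comm]

lemma univR_E (hs : s ^ 2 = q) (hX : X.IsRep q) (hY : Y.IsRep q) (hXn : X.IsNil q) : univR q s X Y *
    (X ⊠ Y).E = (X.E ⊗ₖ I[κ] + X.K q ⊗ₖ Y.E) * univR q s X Y := by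
  rw [univR_eq, mmul_assoc, rSum_E hY hXn.1 hXn.3, ← mmul_assoc, mmul_add, ← rDiag_E hs hX, ←
    rDiag_E' hs hY, ← madd_mul, mmul_assoc]

lemma univR_K (hX : X.IsRep q) (hY : Y.IsRep q) : univR q s X Y * (X ⊠ Y).K q = (X ⊠ Y).K q * univR
    q s X Y := by
  have h1 : rDiag s X Y * (X ⊠ Y).K q = (X ⊠ Y).K q * rDiag s X Y := by
    simp [rDiag, K, Matrix.diagonal_mul_diagonal, mul_comm]
  have hE : ∀ n, X.E ^ n * X.K q = (q⁻¹ ^ 2) ^ n • (X.K q * X.E ^ n) := fun n => by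
    refine pow_mul_of_comm ?_ n
    rw [hX.KE, smul_smul, ← mul_pow, inv_mul_cancel₀ q0, one_pow, one_smul]
  have hF : ∀ n, Y.F ^ n * Y.K q = (q ^ 2) ^ n • (Y.K q * Y.F ^ n) := pow_mul_of_comm (hY.FK)
  have h2 : rSum q X Y (card ι) * (X ⊠ Y).K q = (X ⊠ Y).K q * rSum q X Y (card ι) := by
    rw [rSum, msum_mul, mmul_sum]
    refine sum_congr rfl fun n _ => ?_
    rw [tensor_K, smul_mul, mmul_smul, ← mul_kronecker_mul, ← mul_kronecker_mul, hE, hF,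
      Matrix.smul_kronecker, Matrix.kronecker_smul, smul_smul, smul_smul, mul_assoc, ← mul_pow, ←
      mul_pow, inv_mul_cancel₀ q0, one_pow, one_pow, mul_one]
  rw [univR_eq, mmul_assoc, h2, ← mmul_assoc, h1, mmul_assoc]

lemma univR_F (hs : s ^ 2 = q) (hX : X.IsRep q) (hY : Y.IsRep q) (hXn : X.IsNil q) (hYn : Y.IsNil q)
    : univR q s X Y * (X ⊠ Y).F = (X.F ⊗ₖ Y.Kinv q + I[ι] ⊗ₖ Y.F) * univR q s X Y := by
  have h := univR_E (s := s) hs hY.flip hX.flip hYn.flip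
  have key : ∀ (A B : M[κ × ι, κ × ι]), (A * B).submatrix (swap : ι × κ → κ × ι) swap = A.submatrix
    swap swap * B.submatrix swap swap := fun A B => (submatrix_mul_equiv A B _ (prodComm ι κ)
    _).symm
  have h' := congrArg (fun M => M.submatrix (swap : ι × κ → κ × ι) swap) h
  have ss : ((univR q s X Y).submatrix swap swap).submatrix (swap : ι × κ → κ × ι) swap = univR q s
    X Y := by
    ext ⟨i, j⟩ ⟨k, l⟩; rfl
  simp only [key, univR_flip hXn hYn, ss] at h'
  have e1 : (Y.flip ⊠ X.flip).E.submatrix (swap : ι × κ → κ × ι) swap = (X ⊠ Y).F := by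
    rw [tensor_flip]; ext ⟨i, j⟩ ⟨k, l⟩; rfl
  rw [e1, flip_K, submatrix_add, Pi.add_apply, Pi.add_apply, kronecker_submatrix_swap,
    kronecker_submatrix_swap] at h'
  rw [h', add_comm]
  rfl

/-- The braiding `X ⊗ Y → Y ⊗ X`. -/
def braidM (q s : ℂ) (X : WeightModule ι) (Y : WeightModule κ) : M[κ × ι, ι × κ] := (univR q s X
  Y).submatrix swap id

lemma braidM_isIntertwiner (hs : s ^ 2 = q) (hX : X.IsRep q) (hY : Y.IsRep q) (hXn : X.IsNil q) (hYn
    : Y.IsNil q) : IsHom (X ⊠ Y) (Y ⊠ X) (braidM q s X Y) := by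
  have key : ∀ (A : M[ι × κ, ι × κ]) (B : M[ι × κ, ι × κ]) (C : M[κ × ι, κ × ι]), C = B.submatrix
    swap swap → ∀ M, A * M = B * A → A.submatrix (swap : κ × ι → ι × κ) id * M = C * A.submatrix
    (swap : κ × ι → ι × κ) id := by
    rintro A B C rfl M h
    have h1 : B.submatrix (swap : κ × ι → ι × κ) swap * A.submatrix (swap : κ × ι → ι × κ) id = (B *
      A).submatrix swap id := submatrix_mul_equiv B A _ (prodComm κ ι) _
    rw [h1, ← h]
    rfl
  refine ⟨key _ _ _ ?_ _ (univR_E hs hX hY hXn), key _ _ _ ?_ _ (univR_F hs hX hY hXn hYn), key _ _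
    _ ?_ _ (univR_K hX hY)⟩
  · simp only [tensor, submatrix_add, Pi.add_apply, kronecker_submatrix_swap]
  · simp only [tensor, submatrix_add, Pi.add_apply, kronecker_submatrix_swap]
  · rw [tensor_K, tensor_K, kronecker_submatrix_swap]

lemma pow_col_zero {M : M[ι, ι]} {j : ι} (h : ∀ i, M i j = 0) {n : ℕ} (hn : n ≠ 0) (i : ι) : (M ^ n)
    i j = 0 := by
  obtain ⟨m, rfl⟩ := Nat.exists_eq_succ_of_ne_zero hn
  rw [pow_succ, mmul_apply]
  exact sum_eq_zero fun k _ => by rw [h k, mul_zero]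

lemma univR_apply_of_E {j : ι} (h : ∀ i, X.E i j = 0) (p : ι × κ) (y : κ) : univR q s X Y p (j, y) =
    if p = (j, y) then s ^ (X.wt j * Y.wt y) else 0 := by
  have hc : 0 < card ι := Fintype.card_pos_iff.2 ⟨j⟩
  rw [univR_eq, rDiag, diagonal_mul, rSum, msum_apply, sum_eq_single_of_mem 0 (Finset.mem_range.2
    hc)]
  · rw [rCoef_zero, one_smul, pow_zero, pow_zero, one_kronecker_one, mone_apply]
    split_ifs with e
    · rw [e, mul_one]
    · rw [mul_zero]
  · intro n _ hn
    rw [msmul_apply, kroneckerMap_apply, pow_col_zero h hn, zero_mul, smul_zero]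

lemma univR_apply_of_F {y : κ} (h : ∀ k, Y.F k y = 0) (p : ι × κ) (j : ι) : univR q s X Y p (j, y) =
    if p = (j, y) then s ^ (X.wt j * Y.wt y) else 0 := by
  have hc : 0 < card ι := Fintype.card_pos_iff.2 ⟨j⟩
  rw [univR_eq, rDiag, diagonal_mul, rSum, msum_apply, sum_eq_single_of_mem 0 (Finset.mem_range.2
    hc)]
  · rw [rCoef_zero, one_smul, pow_zero, pow_zero, one_kronecker_one, mone_apply]
    split_ifs with e
    · rw [e, mul_one]
    · rw [mul_zero]
  · intro n _ hn
    rw [msmul_apply, kroneckerMap_apply, pow_col_zero h hn, mul_zero, smul_zero]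

lemma assoc_isIntertwiner : IsHom (X ⊠ (Y ⊠ Z)) ((X ⊠ Y) ⊠ Z) (I[(ι × κ) × τ].submatrix id
  (prodAssoc ι κ τ).symm) := (isIntertwiner_assoc).2 isIntertwiner_one

lemma assoc_symm_isIntertwiner : IsHom ((X ⊠ Y) ⊠ Z) (X ⊠ (Y ⊠ Z)) (I[(ι × κ) × τ].submatrix
    (prodAssoc ι κ τ).symm id) := by
  refine (assoc_isIntertwiner (Z := Z)).inverse ?_ ?_
  · have := submatrix_mul_equiv I[(ι × κ) × τ] I[(ι × κ) × τ] id (prodAssoc ι κ τ).symm id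
    rw [this, mone_mul, Matrix.submatrix_id_id]
  · have := submatrix_mul_equiv I[(ι × κ) × τ] I[(ι × κ) × τ] (prodAssoc ι κ τ).symm (Equiv.refl _)
      (prodAssoc ι κ τ).symm
    rw [mone_mul, Matrix.submatrix_one_equiv] at this
    exact this

lemma WeightModule.IsRep.dual (hX : X.IsRep q) : (dual q X).IsRep q := by
  have hEF : X.E * X.Kinv q * (X.K q * X.F) = X.E * X.F := by
    rw [mmul_assoc, ← mmul_assoc (X.Kinv q), Kinv_mul_K, mone_mul]
  have hFE : X.K q * X.F * (X.E * X.Kinv q) = X.F * X.E := by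
    have h1 : X.K q * X.F * X.E = X.F * X.E * X.K q := by
      have h2 := congrArg (fun M => M * X.E) (hX.FK)
      simp only [smul_mul] at h2
      rw [mmul_assoc, hX.KE, mmul_smul, ← mmul_assoc] at h2
      exact (smul_right_injective _ (pow_ne_zero 2 q0) h2).symm
    rw [← mmul_assoc, h1, mmul_assoc, K_mul_Kinv, mmul_one]
  refine ⟨fun i j h => ?_, fun i j h => ?_, ?_⟩
  · have : X.E j i ≠ 0 := fun h' => h (by simp [WeightModule.dual, Kinv, h'])
    have := hX.gE _ _ this
    simp only [WeightModule.dual]; omega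
  · have : X.F j i ≠ 0 := fun h' => h (by simp [WeightModule.dual, K, h'])
    have := hX.gF _ _ this
    simp only [WeightModule.dual]; omega
  · rw [QGauge.dual_K, QGauge.dual_Kinv]
    simp only [WeightModule.dual, ← transpose_mul, neg_mul_neg]
    rw [hEF, hFE, ← Matrix.transpose_sub, ← transpose_smul, ← neg_sub (X.E * X.F), smul_neg,
      hX.comm, neg_sub, Matrix.transpose_sub, K_transpose, Kinv_transpose]

lemma WeightModule.IsRep.E_pow_apply (hX : X.IsRep q) (n : ℕ) : ∀ i j, (X.E ^ n) i j ≠ 0 → X.wt i =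
    X.wt j + 2 * n := by
  induction n with
  | zero =>
    intro i j h
    rw [pow_zero, mone_apply] at h
    have : i = j := by by_contra h'; simp [h'] at h
    simp [this]
  | succ n ih =>
    intro i j h
    rw [pow_succ, mmul_apply] at h
    obtain ⟨k, -, hk⟩ := Finset.exists_ne_zero_of_sum_ne_zero h
    have h1 := ih i k (left_ne_zero_of_mul hk)
    have h2 := hX.gE k j (right_ne_zero_of_mul hk)
    push_cast; omega

lemma WeightModule.IsRep.E_pow_eq_zero (hX : X.IsRep q) {n : ℕ} (h : ∀ i j, X.wt i - X.wt j < 2 * n)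
    : X.E ^ n = 0 := by
  ext i j
  by_contra h'
  have h1 := hX.E_pow_apply n i j h'
  have h2 := h i j
  omega

lemma WeightModule.IsRep.isNil (hX : X.IsRep q) (h : ∀ i j, X.wt i - X.wt j < 2 * card ι) (hc : ∀ k,
  0 < k → k < card ι → qInt q k ≠ 0) : X.IsNil q := ⟨hX.E_pow_eq_zero h, hX.flip.E_pow_eq_zero fun i
  j => by
    have := h j i
    simp only [WeightModule.flip]; omega, hc⟩

lemma SLabel.isRep (X : SLabel q) : X.rep.IsRep q := by
  obtain ⟨b, α⟩ := X
  cases b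
  · exact (spin_isRep α.1).dual
  · exact spin_isRep α.1

lemma SLabel.isNil (X : SLabel q) : X.rep.IsNil q := by
  refine (X.isRep).isNil (fun i j => ?_) fun k h0 h1 => ?_
  · obtain ⟨b, α⟩ := X
    rw [Fintype.card_fin]
    cases b
    · change -((α.1 : ℤ) - 2 * (i : ℕ)) - (-((α.1 : ℤ) - 2 * (j : ℕ))) < _
      have := i.2; have := j.2
      dsimp only [Phys.dim] at *
      push_cast; omega
    · change ((α.1 : ℤ) - 2 * (i : ℕ)) - ((α.1 : ℤ) - 2 * (j : ℕ)) < _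
      have := i.2; have := j.2
      dsimp only [Phys.dim] at *
      push_cast; omega
  · rw [Fintype.card_fin] at h1
    exact X.2.qInt_ne_zero k h0 h1.le

lemma SLabel.braid_isIntertwiner (hs : s ^ 2 = q) (X Y : SLabel q) : IsHom (X.rep ⊠ Y.rep) (Y.rep ⊠
  X.rep) (braidM q s X.rep Y.rep) := braidM_isIntertwiner hs (X.isRep) (Y.isRep) (X.isNil) (Y.isNil)

/-! ### Naturality of the braiding -/

lemma univR_natural_right {Y' : WeightModule κ} {J : M[κ, κ]} (hF : J * Y.F = Y'.F * J) (hJ : ∀ i j,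
    J i j ≠ 0 → Y'.wt i = Y.wt j) : univR q s X Y' * (I[ι] ⊗ₖ J) = (I[ι] ⊗ₖ J) * univR q s X Y := by
  have hp : ∀ n, Y'.F ^ n * J = J * Y.F ^ n := by
    intro n
    induction n with
    | zero => simp
    | succ n ih => rw [pow_succ', mmul_assoc, ih, ← mmul_assoc, ← hF, mmul_assoc, ← pow_succ']
  have hD : (I[ι] ⊗ₖ J) * rDiag s X Y = rDiag s X Y' * (I[ι] ⊗ₖ J) := by
    ext ⟨i, j⟩ ⟨k, l⟩
    simp only [rDiag, mul_diagonal, diagonal_mul, kroneckerMap_apply, mone_apply]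
    by_cases h : J j l = 0
    · simp [h]
    · by_cases hi : i = k
      · subst hi
        rw [hJ j l h, mul_comm]
      · simp [hi]
  rw [univR_eq, univR_eq, ← mmul_assoc, hD, mmul_assoc, mmul_assoc]
  congr 1
  rw [rSum, rSum, msum_mul, mmul_sum]
  refine sum_congr rfl fun n _ => ?_
  rw [smul_mul, mmul_smul, ← mul_kronecker_mul, ← mul_kronecker_mul, hp, mmul_one, mone_mul]

lemma univR_natural_left {X' : WeightModule ι} {J : M[ι, ι]} (hE : J * X.E = X'.E * J) (hJ : ∀ i j,
    J i j ≠ 0 → X'.wt i = X.wt j) : univR q s X' Y * (J ⊗ₖ I[κ]) = (J ⊗ₖ I[κ]) * univR q s X Y := by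
  have hp : ∀ n, X'.E ^ n * J = J * X.E ^ n := by
    intro n
    induction n with
    | zero => simp
    | succ n ih => rw [pow_succ', mmul_assoc, ih, ← mmul_assoc, ← hE, mmul_assoc, ← pow_succ']
  have hD : (J ⊗ₖ I[κ]) * rDiag s X Y = rDiag s X' Y * (J ⊗ₖ I[κ]) := by
    ext ⟨i, j⟩ ⟨k, l⟩
    simp only [rDiag, mul_diagonal, diagonal_mul, kroneckerMap_apply, mone_apply]
    by_cases h : J i k = 0
    · simp [h]
    · by_cases hj : j = l
      · subst hj
        rw [hJ i k h, mul_comm]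
      · simp [hj]
  rw [univR_eq, univR_eq, ← mmul_assoc, hD, mmul_assoc, mmul_assoc]
  congr 1
  rw [rSum, rSum, msum_mul, mmul_sum]
  refine sum_congr rfl fun n _ => ?_
  rw [smul_mul, mmul_smul, ← mul_kronecker_mul, ← mul_kronecker_mul, hp, mmul_one, mone_mul]

/-! ### Zigzags -/

lemma intertwiner_eq_zero_left {a : ℕ} {T : M[τ, Fin (a + 1) × ι]} (hT : IsHom (spin q a ⊠ X) Z T)
    (h0 : ∀ z x, T z (0, x) = 0) : T = 0 := by
  have hF : ∀ z i x, (T * (spin q a ⊠ X).F) z (i, x) = (Z.F * T) z (i, x) :=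
    fun z i x => by rw [hT.2.1]
  have main : ∀ n (hn : n < a + 1), ∀ z x, T z (⟨n, hn⟩, x) = 0 := by
    intro n
    induction n with
    | zero => exact fun _ => h0
    | succ n ih =>
      intro hn z x
      have h := hF z ⟨n, by omega⟩ x
      rw [mmul_apply, mmul_apply, sum_eq_zero (f := fun j => Z.F z j * _)] at h
      · simp only [tensor, madd_apply, kroneckerMap_apply, mul_add, sum_add_distrib, Kinv,
          diagonal_apply, sum_prod_type, mone_apply] at h
        rw [sum_eq_zero, zero_add, sum_eq_single (⟨n + 1, hn⟩ : Fin (a + 1)), sum_eq_single x] at h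
        · simpa [spin] using h
        · intro y _ hy; simp [hy]
        · simp
        · intro i _ hi
          refine sum_eq_zero fun y _ => ?_
          have : (i : ℕ) ≠ n + 1 := fun h => hi (Fin.ext h)
          simp [spin, this]
        · simp
        · intro i _
          refine sum_eq_zero fun y _ => ?_
          by_cases hi : i = ⟨n, by omega⟩
          · rw [hi, ih, zero_mul]
          · simp [hi]
      · intro j _
        rw [ih, mul_zero]
  ext z ⟨i, x⟩
  exact main i i.2 z x

lemma intertwiner_eq_zero_right {a : ℕ} (ha : ∀ k, 0 < k → k ≤ a → qInt q k ≠ 0) {T : M[τ, ι × Fin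
    (a + 1)]} (hT : IsHom (X ⊠ spin q a) Z T) (h0 : ∀ z x, T z (x, Fin.last a) = 0) : T = 0 := by
  have hE : ∀ z x i, (T * (X ⊠ spin q a).E) z (x, i) = (Z.E * T) z (x, i) :=
    fun z i x => by rw [hT.1]
  have main : ∀ n (hn : n < a + 1), ∀ z x, T z (x, ⟨a - n, by omega⟩) = 0 := by
    intro n
    induction n with
    | zero => exact fun _ => h0
    | succ n ih =>
      intro hn z x
      have h := hE z x ⟨a - n, by omega⟩
      rw [mmul_apply, mmul_apply, sum_eq_zero (f := fun j => Z.E z j * _)] at h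
      · simp only [tensor, madd_apply, kroneckerMap_apply, mul_add, sum_add_distrib, K,
          diagonal_apply, sum_prod_type, mone_apply] at h
        rw [add_comm, sum_eq_zero, zero_add, sum_eq_single x,
          sum_eq_single (⟨a - (n + 1), by omega⟩ : Fin (a + 1))] at h
        · have e1 : a - (n + 1) + 1 = a - n := by omega
          have e2 : a + 1 - (a - n) = n + 1 := by omega
          simp only [spin, of_apply, e1, e2, if_true, one_mul, mul_eq_zero] at h
          rcases h with h | h | h
          · exact h
          · exact absurd h (ha _ (by omega) (by omega))
          · exact absurd h (ha _ (by omega) (by omega))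
        · intro i _ hi
          have : (i : ℕ) + 1 ≠ a - n := fun h => hi (Fin.ext (by dsimp only; omega))
          simp [spin, this]
        · simp
        · intro y _ hy
          refine sum_eq_zero fun i _ => ?_
          simp [hy]
        · simp
        · intro y _
          refine sum_eq_zero fun i _ => ?_
          by_cases hi : i = ⟨a - n, by omega⟩
          · rw [hi, ih (by omega), zero_mul]
          · simp [hi]
      · intro j _
        rw [ih (by omega), mul_zero]
  ext z ⟨x, i⟩
  have := main (a - i) (by omega) z x
  have e : (⟨a - (a - i), by omega⟩ : Fin (a + 1)) = i := Fin.ext (by dsimp only; omega)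
  rwa [e] at this

/-- A functional on `X ⊗ Y` that is supported on total weight zero. -/
def Graded (X : WeightModule ι) (Y : WeightModule κ) (p : M[ι, κ]) : Prop := ∀ x y, p x y ≠ 0 → X.wt
  x + Y.wt y = 0

lemma zigzag_left (hs : s ^ 2 = q) (α : Phys q) (hX : X.IsRep q) (hXn : X.IsNil q) (hY : Y.IsRep q)
    (hYn : Y.IsNil q) {p : M[ι, κ]} (hp : IsHom (X ⊠ Y) (spin q 0) (rowM p)) (hg : Graded X Y p) (i
    j : α) (x : ι) (y : κ) : ∑ x', ∑ y', ∑ k, p x' y' * univR q s α.rep X (k, x') (i, x) * univR q s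
    α.rep Y (j, y') (k, y) = if j = i then p x y else 0 := by
  have hα : α.rep.IsRep q := spin_isRep α.1
  have hαn : α.rep.IsNil q := (posL α).isNil
  have c1 := braidM_isIntertwiner hs hα hX hαn hXn
  have c2 := braidM_isIntertwiner hs hα hY hαn hYn
  have u1 := isIntertwiner_snd (q := q) (spin q 0) α.rep spin_zero_E spin_zero_F (spin_zero_wt 0)
  have u2 := isIntertwiner_fst (q := q) α.rep (spin q 0) spin_zero_E spin_zero_F (spin_zero_wt 0)
  have t := (((((u1.comp (hp.kron (isIntertwiner_one (X := α.rep)))).comp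
    (assoc_isIntertwiner)).comp ((isIntertwiner_one (X := X)).kron c2)).comp
    (assoc_symm_isIntertwiner)).comp (c1.kron (isIntertwiner_one (X := Y)))).comp
    (assoc_isIntertwiner)
  have t' := u2.comp ((isIntertwiner_one (X := α.rep)).kron hp)
  have key : ∀ {a b c d : Type} [Fintype a] [DecidableEq a] [Fintype b] [DecidableEq b] [Fintype c]
    [DecidableEq c] (M : M[d, (a × b) × c]), M * I[(a × b) × c].submatrix id (prodAssoc a b c).symm
    = M.submatrix id (prodAssoc a b c).symm := fun M => Matrix.mul_submatrix_one (Equiv.refl _) _ M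
  have key' : ∀ {a b c d : Type} [Fintype a] [DecidableEq a] [Fintype b] [DecidableEq b] [Fintype c]
    [DecidableEq c] (M : M[d, a × (b × c)]), M * I[(a × b) × c].submatrix (prodAssoc a b c).symm id
    = M.submatrix id (prodAssoc a b c) := fun {a b c d} _ _ _ _ _ _ M => Matrix.mul_submatrix_one
    (prodAssoc a b c).symm _ M
  rw [key, key', key] at t
  have e : ∀ j i x y, ((((((of fun (i : α) (p : Fin 1 × α) => if p.2 = i then (1 : ℂ) else 0) *
    (rowM p ⊗ₖ I[α])).submatrix id (prodAssoc ι κ α).symm * (I[ι] ⊗ₖ braidM q s α.rep Y)).submatrix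
    id (prodAssoc ι α κ)) * (braidM q s α.rep X ⊗ₖ I[κ])).submatrix id (prodAssoc α ι κ).symm) j (i,
    x, y) = ∑ x', ∑ y', ∑ k, p x' y' * univR q s α.rep X (k, x') (i, x) * univR q s α.rep Y (j, y')
    (k, y) := by
    intro j i x y
    simp [mmul_apply, sum_prod_type, mone_apply, braidM, rowM, sum_mul]
    refine sum_congr rfl fun x' _ => ?_
    rw [sum_comm]
    refine sum_congr rfl fun y' _ => sum_congr rfl fun k _ => ?_
    ring
  have e' : ∀ j i x y, ((of fun (i : α) (p : α × Fin 1) => if p.1 = i then (1 : ℂ) else 0) * (I[α]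
    ⊗ₖ rowM p)) j (i, x, y) = if j = i then p x y else 0 := by
    intro j i x y
    simp [mmul_apply, sum_prod_type, mone_apply, rowM, eq_comm]
  have hz := intertwiner_eq_zero_left (t.sub t') ?_
  · have := congr_fun₂ hz j (i, x, y)
    rw [msub_apply, e, e', mzero_apply, sub_eq_zero] at this
    exact this
  · rintro j ⟨x, y⟩
    rw [msub_apply, e, e', sub_eq_zero]
    have hE0 : ∀ k, α.rep.E k 0 = 0 := fun k => by simp [spin]
    have hs0 : s ≠ 0 := by rintro rfl; exact q0 (q := q) (by rw [← hs]; simp)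
    simp only [univR_apply_of_E hE0, Prod.mk.injEq]
    refine (sum_eq_single x ?_ ?_).trans ((sum_eq_single y ?_ ?_).trans ((sum_eq_single (0 : α) ?_
      ?_).trans ?_))
    · intro x' _ hx; simp [hx]
    · simp
    · intro y' _ hy
      refine sum_eq_zero fun k _ => ?_
      by_cases hk : k = 0
      · simp [hk, univR_apply_of_E hE0, hy]
      · simp [hk]
    · simp
    · intro k _ hk; simp [hk]
    · simp
    · rw [univR_apply_of_E hE0]
      by_cases hj : j = 0
      · by_cases hpz : p x y = 0
        · simp [hpz]
        · simp only [hj, and_self, if_true, mul_assoc, ← zpow_add₀ hs0, ← mul_add, hg x y hpz,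
            mul_zero, zpow_zero, mul_one]
      · simp [hj]

lemma zigzag_right (hs : s ^ 2 = q) (α : Phys q) (hX : X.IsRep q) (hXn : X.IsNil q) (hY : Y.IsRep q)
    (hYn : Y.IsNil q) {p : M[ι, κ]} (hp : IsHom (X ⊠ Y) (spin q 0) (rowM p)) (hg : Graded X Y p) (i
    j : α) (x : ι) (y : κ) : ∑ x', ∑ y', ∑ k, p x' y' * univR q s Y α.rep (y', k) (y, i) * univR q s
    X α.rep (x', j) (x, k) = if j = i then p x y else 0 := by
  have hα : α.rep.IsRep q := spin_isRep α.1
  have hαn : α.rep.IsNil q := (posL α).isNil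
  have c1 := braidM_isIntertwiner hs hX hα hXn hαn
  have c2 := braidM_isIntertwiner hs hY hα hYn hαn
  have u1 := isIntertwiner_snd (q := q) (spin q 0) α.rep spin_zero_E spin_zero_F (spin_zero_wt 0)
  have u2 := isIntertwiner_fst (q := q) α.rep (spin q 0) spin_zero_E spin_zero_F (spin_zero_wt 0)
  have t := (((((u2.comp ((isIntertwiner_one (X := α.rep)).kron hp)).comp
    (assoc_symm_isIntertwiner)).comp (c1.kron (isIntertwiner_one (X := Y)))).comp
    (assoc_isIntertwiner)).comp ((isIntertwiner_one (X := X)).kron c2)).comp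
    (assoc_symm_isIntertwiner)
  have t' := u1.comp (hp.kron (isIntertwiner_one (X := α.rep)))
  have key : ∀ {a b c d : Type} [Fintype a] [DecidableEq a] [Fintype b] [DecidableEq b] [Fintype c]
    [DecidableEq c] (M : M[d, (a × b) × c]), M * I[(a × b) × c].submatrix id (prodAssoc a b c).symm
    = M.submatrix id (prodAssoc a b c).symm := fun M => Matrix.mul_submatrix_one (Equiv.refl _) _ M
  have key' : ∀ {a b c d : Type} [Fintype a] [DecidableEq a] [Fintype b] [DecidableEq b] [Fintype c]
    [DecidableEq c] (M : M[d, a × (b × c)]), M * I[(a × b) × c].submatrix (prodAssoc a b c).symm id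
    = M.submatrix id (prodAssoc a b c) := fun {a b c d} _ _ _ _ _ _ M => Matrix.mul_submatrix_one
    (prodAssoc a b c).symm _ M
  rw [key', key, key'] at t
  have e : ∀ j i x y, ((((((of fun (i : α) (p : α × Fin 1) => if p.1 = i then (1 : ℂ) else 0) *
    (I[α] ⊗ₖ rowM p)).submatrix id (prodAssoc α ι κ) * (braidM q s X α.rep ⊗ₖ I[κ])).submatrix id
    (prodAssoc ι α κ).symm) * (I[ι] ⊗ₖ braidM q s Y α.rep)).submatrix id (prodAssoc ι κ α)) j ((x,
    y), i) = ∑ x', ∑ y', ∑ k, p x' y' * univR q s Y α.rep (y', k) (y, i) * univR q s X α.rep (x', j)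
    (x, k) := by
    intro j i x y
    simp [mmul_apply, sum_prod_type, mone_apply, braidM, rowM, sum_mul]
    exact (sum_congr rfl fun k _ => sum_comm).trans (sum_comm.trans
      (sum_congr rfl fun x' _ => sum_comm.trans (sum_congr rfl fun y' _ =>
        sum_congr rfl fun k _ => by ring)))
  have e' : ∀ j i x y, ((of fun (i : α) (p : Fin 1 × α) => if p.2 = i then (1 : ℂ) else 0) * (rowM p
    ⊗ₖ I[α])) j ((x, y), i) = if j = i then p x y else 0 := by
    intro j i x y
    simp [mmul_apply, sum_prod_type, mone_apply, rowM, eq_comm]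
  have hz := intertwiner_eq_zero_right (fun k h0 h1 => α.qInt_ne_zero k h0 (Nat.le_succ_of_le h1))
    (t.sub t') ?_
  · have := congr_fun₂ hz j ((x, y), i)
    rw [msub_apply, e, e', mzero_apply, sub_eq_zero] at this
    exact this
  · rintro j ⟨x, y⟩
    rw [msub_apply, e, e', sub_eq_zero]
    have hF0 : ∀ k, α.rep.F k (Fin.last α.1) = 0 := fun k => by
      have := k.2
      simp only [spin, of_apply, Fin.val_last, ite_eq_right_iff, one_ne_zero, imp_false]
      dsimp only [Phys.dim] at this
      omega
    have hs0 : s ≠ 0 := by rintro rfl; exact q0 (q := q) (by rw [← hs]; simp)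
    simp only [univR_apply_of_F hF0, Prod.mk.injEq]
    refine (sum_eq_single x ?_ ?_).trans ((sum_eq_single y ?_ ?_).trans ((sum_eq_single (Fin.last
      α.1 : α) ?_ ?_).trans ?_))
    · intro x' _ hx
      refine sum_eq_zero fun y' _ => sum_eq_zero fun k _ => ?_
      by_cases hk : k = Fin.last α.1
      · simp [hk, univR_apply_of_F hF0, hx]
      · simp [hk]
    · simp
    · intro y' _ hy; simp [hy]
    · simp
    · intro k _ hk; simp [hk]
    · simp
    · rw [univR_apply_of_F hF0]
      by_cases hj : j = Fin.last α.1
      · by_cases hpz : p x y = 0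
        · simp [hpz]
        · simp only [hj, and_self, if_true, mul_assoc, ← zpow_add₀ hs0, ← add_mul, add_comm (Y.wt
            y), hg x y hpz, zero_mul, zpow_zero, mul_one]
      · simp [hj]

/-! ### Duality -/

lemma isIntertwiner_dual_iff {T : M[κ, ι]} : IsHom (dual q Y) (dual q X) T.transpose ↔ IsHom X Y
    T := by
  have kk : T * X.Kinv q = Y.Kinv q * T ↔ T * X.K q = Y.K q * T := by
    constructor
    · intro h
      calc T * X.K q = Y.K q * (Y.Kinv q * T) * X.K q := by rw [← mmul_assoc, K_mul_Kinv, mone_mul]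
        _ = Y.K q * T := by rw [← h, mmul_assoc, mmul_assoc, Kinv_mul_K, mmul_one]
    · intro h
      calc T * X.Kinv q = Y.Kinv q * (Y.K q * T) * X.Kinv q := by
            rw [← mmul_assoc, Kinv_mul_K, mone_mul]
        _ = Y.Kinv q * T := by rw [← h, mmul_assoc, mmul_assoc, K_mul_Kinv, mmul_one]
  unfold IsIntertwiner
  rw [dual_K, dual_K, ← Kinv_transpose Y, ← Kinv_transpose X, ← transpose_mul, ← transpose_mul,
    Matrix.transpose_inj, eq_comm (a := Y.Kinv q * T), kk]
  simp only [dual, ← transpose_mul, Matrix.transpose_inj, Matrix.neg_mul, Matrix.mul_neg, neg_inj]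
  constructor
  · rintro ⟨h1, h2, h3⟩
    refine ⟨?_, ?_, h3⟩
    · rw [mmul_assoc, ← kk.2 h3, ← mmul_assoc, ← mmul_assoc] at h1
      have := congrArg (fun M => M * X.K q) h1
      simp only [mmul_assoc, Kinv_mul_K, mmul_one] at this
      exact this.symm
    · rw [← mmul_assoc T, h3, mmul_assoc, mmul_assoc] at h2
      have := congrArg (fun M => Y.Kinv q * M) h2
      simp only [← mmul_assoc, Kinv_mul_K, mone_mul] at this
      exact this.symm
  · rintro ⟨h1, h2, h3⟩
    refine ⟨?_, ?_, h3⟩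
    · rw [mmul_assoc, ← kk.2 h3, ← mmul_assoc, ← h1, mmul_assoc]
    · rw [← mmul_assoc T, h3, mmul_assoc, mmul_assoc, h2]

lemma dual_tensor_pull (X : WeightModule ι) (Y : WeightModule κ) : (dual q (X ⊠ Y)).pull swap = dual
    q Y ⊠ dual q X := by
  have hE : (X ⊠ Y).E * (X ⊠ Y).Kinv q = X.Kinv q ⊗ₖ (Y.E * Y.Kinv q) + (X.E * X.Kinv q) ⊗ₖ
    I[κ] := by
    rw [tensor_Kinv]
    simp only [tensor, madd_mul, ← mul_kronecker_mul, mone_mul, K_mul_Kinv]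
  have hF : (X ⊠ Y).K q * (X ⊠ Y).F = I[ι] ⊗ₖ (Y.K q * Y.F) + (X.K q * X.F) ⊗ₖ Y.K q := by
    rw [tensor_K]
    simp only [tensor, mmul_add, ← mul_kronecker_mul, mmul_one, K_mul_Kinv]
  simp only [pull, dual]
  rw [hE, hF, tensor]
  congr 1
  · funext p
    simp [add_comm]
  · change _ = I[κ] ⊗ₖ _ + _ ⊗ₖ (dual q X).K q
    rw [dual_K]
    ext ⟨i, j⟩ ⟨k, l⟩
    simp only [submatrix_apply, transpose_apply, mneg_apply, madd_apply, kroneckerMap_apply,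
      Prod.swap_prod_mk, mone_apply, Kinv, diagonal_apply, eq_comm (a := l), eq_comm (a := k)]
    split_ifs with h1 h2 h2 <;> subst_vars <;> ring
  · change _ = (dual q Y).Kinv q ⊗ₖ _ + _ ⊗ₖ I[ι]
    rw [dual_Kinv]
    ext ⟨i, j⟩ ⟨k, l⟩
    simp only [submatrix_apply, transpose_apply, mneg_apply, madd_apply, kroneckerMap_apply,
      Prod.swap_prod_mk, mone_apply, K, diagonal_apply, eq_comm (a := l), eq_comm (a := k)]
    split_ifs with h1 h2 h2 <;> subst_vars <;> ring

lemma isIntertwiner_dual_tensor {f : M[ι × κ, τ]} : IsHom (dual q Y ⊠ dual q X) (dual q Z)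
    (f.transpose.submatrix id swap) ↔ IsHom Z (X ⊠ Y) f := by
  rw [← isIntertwiner_dual_iff (X := Z), ← dual_tensor_pull]
  refine ⟨fun h => ?_, fun h => h.pull_src swap_bijective⟩
  have := h.pull_src (e := (swap : ι × κ → κ × ι)) swap_bijective
  exact this

lemma isIntertwiner_dual_tensor' {g : M[τ, ι × κ]} : IsHom (dual q Z) (dual q Y ⊠ dual q X)
    (g.transpose.submatrix swap id) ↔ IsHom (X ⊠ Y) Z g := by
  rw [← isIntertwiner_dual_iff (Y := Z), ← dual_tensor_pull]
  refine ⟨fun h => ?_, fun h => h.pull_tgt swap_bijective⟩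
  have := h.pull_tgt (e := (swap : ι × κ → κ × ι)) swap_bijective
  exact this

lemma eq_rowM (p : M[Fin 1, ι × κ]) : p = rowM (of fun i j => p 0 (i, j)) := by
  ext i ⟨j, k⟩
  rw [Subsingleton.elim i 0]; rfl

lemma eq_colM (f : M[ι × κ, Fin 1]) : f = colM (of fun i j => f (i, j) 0) := by
  ext ⟨j, k⟩ i
  rw [Subsingleton.elim i 0]; rfl

/-! ### Functionals on a product of two labels -/

lemma fusion_self_zero (α : Phys q) : fusion α α (Phys.zero q) ≠ 0 := by
  obtain ⟨f, g, hf, hg, h⟩ := α.2.2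
  have hf' := ((isIntertwiner_one (X := α.rep)).kron (dualIsoInv_isIntertwiner α)).comp hf
  have hg' := hg.comp ((isIntertwiner_one (X := α.rep)).kron (dualIso_isIntertwiner α))
  rw [fusion_eq_one hf' hg' ?_]
  · exact one_ne_zero
  · have e : (I[α] ⊗ₖ dualIso α) * (I[α] ⊗ₖ dualIsoInv α) = 1 := by
      rw [← mul_kronecker_mul, dualIso_mul_inv, mone_mul, one_kronecker_one]
    refine fun h0 => h (Eq.trans (Eq.symm ?_) h0)
    exact (mmul_assoc g _ (_ * f)).trans (congrArg (g * ·) ((mmul_assoc _ _ f).symm.trans ((congrArg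
      (· * f) e).trans (mone_mul f))))

lemma functional_eq_zero (h : α ≠ β) {p : M[Fin 1, α × β]} (hp : IsHom (α.rep ⊠ β.rep) (spin q 0) p)
    : p = 0 := by
  have h1 := hp.comp ((isIntertwiner_one (X := α.rep)).kron (dualIsoInv_isIntertwiner β))
  rw [eq_rowM (p * _), isIntertwiner_rowM_dual_right] at h1
  have h2 := intertwiner_eq_zero_of_ne h h1
  have h3 : p * (I[α] ⊗ₖ dualIsoInv β) = 0 := by
    rw [eq_rowM (p * _)]
    have h4 := congrArg (fun M => (β.rep.K q * M).transpose) h2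
    simp only [← mmul_assoc, K_mul_Kinv, mone_mul, transpose_transpose, mmul_zero,
      Matrix.transpose_zero] at h4
    rw [h4]; rfl
  have h5 := congrArg (fun M => M * (I[α] ⊗ₖ dualIso β)) h3
  simpa only [mmul_assoc, ← mul_kronecker_mul, dualIsoInv_mul, mmul_one, one_kronecker_one,
    mzero_mul] using h5

lemma functional_unique {p p₀ : M[Fin 1, α × α]} (hp : IsHom (α.rep ⊠ α.rep) (spin q 0) p) (hp₀ :
    IsHom (α.rep ⊠ α.rep) (spin q 0) p₀) (h0 : p₀ ≠ 0) : ∃ x : ℂ, p = x • p₀ := by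
  have key : ∀ p : M[Fin 1, α × α], IsHom (α.rep ⊠ α.rep) (spin q 0) p → ∃ x : ℂ, p = x • (rowM
    (α.rep.K q) * (I[α] ⊗ₖ dualIso α)) := by
    intro p hp
    have h1 := hp.comp ((isIntertwiner_one (X := α.rep)).kron (dualIsoInv_isIntertwiner α))
    rw [eq_rowM (p * _), isIntertwiner_rowM_dual_right] at h1
    obtain ⟨x, h2⟩ := intertwiner_phys_scalar h1
    refine ⟨x, ?_⟩
    have h3 : p * (I[α] ⊗ₖ dualIsoInv α) = x • rowM (α.rep.K q) := by
      rw [eq_rowM (p * _)]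
      have h4 := congrArg (fun M => (α.rep.K q * M).transpose) h2
      simp only [← mmul_assoc, K_mul_Kinv, mone_mul, transpose_transpose, mmul_smul, mmul_one,
        transpose_smul, K_transpose] at h4
      rw [h4]; rfl
    have h5 := congrArg (fun M => M * (I[α] ⊗ₖ dualIso α)) h3
    simpa only [mmul_assoc, ← mul_kronecker_mul, dualIsoInv_mul, mmul_one, one_kronecker_one,
      smul_mul] using h5
  obtain ⟨x, rfl⟩ := key p hp
  obtain ⟨y, rfl⟩ := key p₀ hp₀
  have hy : y ≠ 0 := by rintro rfl; simp at h0
  exact ⟨x / y, by rw [smul_smul, div_mul_cancel₀ _ hy]⟩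

/-- The projection `α ⊗ α → 0`. -/
def QuantumData.psi₀ (D : QuantumData q s) (α : Phys q) : M[Fin 1, α × α] := D.psi α α (Phys.zero q)

lemma psi₀_intertwiner (D : QuantumData q s) (α : Phys q) : IsHom (α.rep ⊠ α.rep) (spin q 0) (D.psi₀
  α) := D.psi_intertwiner α α (Phys.zero q)

lemma psi₀_mul_cgProj (D : QuantumData q s) (α : Phys q) : D.psi₀ α * cgProj D α α = D.psi₀ α :=
    psi_mul_cgProj D α α (Phys.zero q)

lemma psi_zero_ne (D : QuantumData q s) (α : Phys q) : D.psi₀ α ≠ 0 := by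
  intro h
  change D.psi α α (Phys.zero q) = 0 at h
  have := D.psi_mul_phi α α (Phys.zero q) (fusion_self_zero α)
  rw [h, mzero_mul] at this
  exact zero_ne_one this

lemma functional_mul_cgProj (D : QuantumData q s) {p : M[Fin 1, α × β]} (hp : IsHom (α.rep ⊠ β.rep)
    (spin q 0) p) : p * cgProj D α β = p := by
  by_cases h : α = β
  · subst h
    obtain ⟨x, rfl⟩ := functional_unique hp (psi₀_intertwiner D α) (psi_zero_ne D α)
    rw [smul_mul, psi₀_mul_cgProj]
  · rw [functional_eq_zero h hp, mzero_mul]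

lemma functional_mul_pairProj (D : QuantumData q s) {X Y : SLabel q} {p : M[Fin 1, X.2 × Y.2]} (hp :
    IsHom (X.rep ⊠ Y.rep) (spin q 0) p) : p * D.pairProj X Y = p := by
  have h := functional_mul_cgProj D (hp.comp ((X.iso_isIntertwiner).kron (Y.iso_isIntertwiner)))
  rw [pairProj_eq, ← mmul_assoc, ← mmul_assoc, h, mmul_assoc, ← mul_kronecker_mul, X.iso_mul_inv,
    Y.iso_mul_inv, one_kronecker_one, mmul_one]

lemma cgProj_mul_vector (D : QuantumData q s) {f : M[α × β, Fin 1]} (hf : IsHom (spin q 0) (α.rep ⊠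
    β.rep) f) : cgProj D α β * f = f := by
  by_cases h : α = β
  · subst h
    obtain ⟨x, rfl⟩ := eq_smul_phi D (γ := Phys.zero q) (fusion_self_zero α) hf
    exact (mmul_smul _ x (D.phi α α (Phys.zero q))).trans (congrArg _ (cgProj_mul_phi D α α
      (Phys.zero q)))
  · have h1 := ((isIntertwiner_one (X := α.rep)).kron (dualIso_isIntertwiner β)).comp hf
    rw [eq_colM (_ * f), isIntertwiner_colM_dual_right] at h1
    have h2 := intertwiner_eq_zero_of_ne (Ne.symm h) h1
    have h3 : (I[α] ⊗ₖ dualIso β) * f = 0 := by rw [eq_colM (_ * f), h2]; rfl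
    have h5 := congrArg (fun M => (I[α] ⊗ₖ dualIsoInv β) * M) h3
    simp only [← mmul_assoc, ← mul_kronecker_mul, dualIsoInv_mul, mmul_one, one_kronecker_one,
      mmul_zero, mone_mul] at h5
    rw [h5, mmul_zero]

lemma pairProj_mul_vector (D : QuantumData q s) {X Y : SLabel q} {f : M[X.2 × Y.2, Fin 1]} (hf :
    IsHom (spin q 0) (X.rep ⊠ Y.rep) f) : D.pairProj X Y * f = f := by
  have h := cgProj_mul_vector D (((X.isoInv_isIntertwiner).kron (Y.isoInv_isIntertwiner)).comp hf)
  rw [pairProj_eq, mmul_assoc, mmul_assoc, h, ← mmul_assoc, ← mul_kronecker_mul, X.iso_mul_inv,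
    Y.iso_mul_inv, one_kronecker_one, mone_mul]

/-! ### The normalizations -/

/-- The scalar `A`. -/
def QuantumData.a (D : QuantumData q s) (α : Phys q) : ℂ := D.A α 0 0

/-- The scalar `B`. -/
def QuantumData.b (D : QuantumData q s) (α : Phys q) : ℂ := D.B α 0 0

lemma A_eq (D : QuantumData q s) (α : Phys q) : D.A α = D.a α • I[α] := by
  obtain ⟨c, hc⟩ := intertwiner_phys_scalar ((isIntertwiner_rowM_dual_left).1 (D.A_intertwiner α))
  rw [QuantumData.a, hc]
  simp

lemma B_eq (D : QuantumData q s) (α : Phys q) : D.B α = D.b α • I[α] := by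
  obtain ⟨c, hc⟩ := intertwiner_phys_scalar ((isIntertwiner_colM_dual_right).1 (D.B_intertwiner α))
  rw [QuantumData.b, hc]
  simp

lemma pairProj_pos (D : QuantumData q s) (α β : Phys q) : D.pairProj (posL α) (posL β) = cgProj D α
    β := by
  rw [pairProj_eq]
  simp [SLabel.iso, SLabel.isoInv]

lemma braid_mul_cgProj (D : QuantumData q s) (α β : Phys q) : braidM q s α.rep β.rep * cgProj D α β
    = ∑ γ ∈ fusionSet α β, (D.kappa α * D.kappa β / D.kappa γ) • (D.phi β α γ * D.psi α β γ) := by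
  have h := D.braiding α β
  rw [CGMatrices.truncR, pairProj_pos] at h
  refine Eq.trans ?_ (h.trans ?_)
  · rfl
  · ext I J
    rw [of_apply, finsum_fusion (α := α) (β := β), msum_apply]
    · rfl
    · intro γ h
      rw [D.psi_eq_zero _ _ _ h]
      simp

lemma braid_mul_phi (D : QuantumData q s) (h : fusion α β γ ≠ 0) : braidM q s α.rep β.rep * D.phi α
    β γ = (D.kappa α * D.kappa β / D.kappa γ) • D.phi β α γ := by
  have h1 := congrArg (fun M => M * D.phi α β γ) (braid_mul_cgProj D α β)
  simp only [mmul_assoc, cgProj_mul_phi] at h1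
  rw [h1, msum_mul, sum_eq_single_of_mem γ ((mem_fusionSet).2 h)]
  · rw [smul_mul, mmul_assoc, D.psi_mul_phi _ _ _ h, mmul_one]
  · intro γ' _ hne
    rw [smul_mul, mmul_assoc, psi_mul_phi_ne D hne, mmul_zero, smul_zero]

lemma kappa_zero_mul (D : QuantumData q s)
    (α : Phys q) : D.kappa α * D.kappa (Phys.zero q) / D.kappa α = 1 := by
  have hf : fusion α (Phys.zero q) α ≠ 0 := by
    intro h
    have h1 := D.phi_eq_zero _ _ _ h
    rw [D.phi_zero_right] at h1
    have h2 := congr_fun₂ h1 (0, 0) 0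
    simp at h2
  have h := braid_mul_phi D hf
  have h2 := congr_fun₂ h (0, 0) 0
  have hF : ∀ k y, (Phys.zero q).rep.F k y = 0 := fun k y => congr_fun₂ spin_zero_F k y
  have hw : (Phys.zero q).rep.wt 0 = 0 := by simp [Phys.zero, spin]
  have hsub : ∀ y : (Phys.zero q), y = 0 := fun y => Subsingleton.elim (α := Fin 1) y 0
  rw [D.phi_zero_left, D.phi_zero_right, mmul_apply,
    sum_eq_single ((0, 0) : α × (Phys.zero q))] at h2
  · simp only [braidM, submatrix_apply, id, msmul_apply, of_apply, if_true,
      mul_one, smul_eq_mul] at h2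
    rw [univR_apply_of_F (hF · _), hw, mul_zero, zpow_zero] at h2
    rw [← h2]
    exact if_pos rfl
  · rintro ⟨x, y⟩ _ hne
    rw [of_apply, if_neg, mul_zero]
    rintro rfl
    exact hne (Prod.ext rfl (hsub y))
  · simp

lemma kappa_ne_zero (D : QuantumData q s) (α : Phys q) : D.kappa α ≠ 0 := by
  intro h
  have := kappa_zero_mul D α
  rw [h] at this
  simp at this

lemma kappa_zero (D : QuantumData q s) : D.kappa (Phys.zero q) = 1 := by
  have := kappa_zero_mul D (Phys.zero q)
  rwa [mul_div_cancel_right₀ _ (kappa_ne_zero D _)] at this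

lemma functional_braid (D : QuantumData q s) {p : M[Fin 1, α × α]} (hs : s ^ 2 = q) (hp : IsHom
    (α.rep ⊠ α.rep) (spin q 0) p) : p * braidM q s α.rep α.rep = D.kappa α ^ 2 • p := by
  obtain ⟨x, rfl⟩ := functional_unique hp (psi₀_intertwiner D α) (psi_zero_ne D α)
  have hb := (posL α).braid_isIntertwiner hs (posL α)
  have h1 := functional_mul_cgProj D ((psi₀_intertwiner D α).comp hb)
  change D.psi₀ α * braidM q s α.rep α.rep * _ = D.psi₀ α * braidM q s α.rep α.rep at h1
  rw [smul_mul, smul_comm]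
  refine congrArg _ ?_
  rw [← h1, mmul_assoc]
  refine (congrArg (D.psi₀ α * ·) (braid_mul_cgProj D α α)).trans ?_
  change D.psi α α (Phys.zero q) * (∑ γ ∈ fusionSet α α, (D.kappa α * D.kappa α / D.kappa γ) •
    (D.phi α α γ * D.psi α α γ)) = _ • D.psi α α (Phys.zero q)
  rw [mmul_sum, sum_eq_single_of_mem (Phys.zero q) ((mem_fusionSet).2 (fusion_self_zero α))]
  · rw [mmul_smul, ← mmul_assoc, D.psi_mul_phi _ _ _ (fusion_self_zero α), mone_mul, kappa_zero,
      div_one, pow_two]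
    rfl
  · intro γ _ hne
    rw [mmul_smul, ← mmul_assoc, psi_mul_phi_ne D hne.symm, mzero_mul, smul_zero]

lemma dualIso_graded (α : Phys q) (i j : α) (h : dualIso α i j ≠ 0) : (dual q α.rep).wt i = α.rep.wt
    j := by
  have : (i : ℕ) + j = α.1 := by
    by_contra h'
    exact h (by simp [dualIso, h'])
  change -((α.1 : ℤ) - 2 * (i : ℕ)) = (α.1 : ℤ) - 2 * (j : ℕ)
  omega

lemma drinfeldU_eq (D : QuantumData q s) (hs : s ^ 2 = q) (α : Phys q) : (drinfeldU s α).transpose *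
    dualIso α = D.kappa α ^ 2 • (dualIso α).transpose := by
  have J := dualIso_isIntertwiner α
  have hp := (evM_isIntertwiner α.rep).comp (J.kron (isIntertwiner_one (X := α.rep)))
  have h1 := functional_braid D hs hp
  have h2 : (dualIso α ⊗ₖ I[α]) * braidM q s α.rep α.rep = braidM q s α.rep (dual q α.rep) * (I[α]
    ⊗ₖ dualIso α) := by
    have h3 := univR_natural_right (q := q) (X := α.rep) (s := s) J.2.1 (dualIso_graded α)
    have h4 := congrArg (fun M => M.submatrix (swap : α × α → _) id) h3
    refine Eq.trans ?_ h4.symm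
    rw [← kronecker_submatrix_swap]
    exact submatrix_mul_bijective swap_bijective _ _ _ _
  rw [mmul_assoc, h2, ← mmul_assoc] at h1
  have h5 : evM α * braidM q s α.rep (dual q α.rep) = rowM (drinfeldU s α).transpose := by
    ext x ⟨i, j⟩
    simp [evM, rowM, braidM, mmul_apply, sum_prod_type, mone_apply, drinfeldU]
  rw [h5, evM, rowM_mul_kron, rowM_mul_kron] at h1
  simpa using rowM_injective (h1.trans (show _ = rowM (D.kappa α ^ 2 • ((dualIso α).transpose * 1 * 1)) from rfl))

lemma mu_eq (D : QuantumData q s) (hs : s ^ 2 = q) (α : Phys q) : D.mu α = (-1 : ℂ) ^ α.1 • α.rep.K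
    q := by
  have q0 := q0 (q := q)
  have hk := pow_ne_zero 2 (kappa_ne_zero D α)
  have h := drinfeldU_eq D hs α
  have h1 : ((-1 : ℂ) ^ α.1 • α.rep.K q).transpose * dualIso α = (dualIso α).transpose := by
    rw [transpose_smul, K_transpose]
    ext i j
    rw [smul_mul, msmul_apply, spin_K_mul, transpose_apply]
    simp only [dualIso, of_apply, add_comm (j : ℕ) (i : ℕ)]
    split_ifs with h
    · generalize (i : ℕ) = x at h ⊢
      generalize (j : ℕ) = y at h ⊢
      generalize α.1 = a at h ⊢
      subst h
      have e1 : x + y - y = x := by omega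
      have e2 : x + y - x = y := by omega
      have e3 : ((x + y : ℕ) : ℤ) - 2 * x = (y : ℤ) - x := by push_cast; ring
      have e4 : y * (x + 1) = y * x + y := by ring
      have e5 : x * (y + 1) = y * x + x := by ring
      have e6 : ((-1 : ℂ) ^ y) * (-1) ^ y = 1 := by rw [← mul_pow]; simp
      rw [e1, e2, e3, e4, e5, zpow_sub₀ q0, zpow_natCast, zpow_natCast, inv_pow, inv_pow, pow_add q,
        pow_add q, pow_add (-1 : ℂ), smul_eq_mul]
      field_simp
      linear_combination e6
    · simp
  have h2 : (D.mu α).transpose * dualIso α = (dualIso α).transpose := by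
    rw [QuantumData.mu, transpose_smul, smul_mul, h, smul_smul, inv_mul_cancel₀ hk, one_smul]
  have h3 := congrArg (fun M => (M * dualIsoInv α).transpose) (h2.trans h1.symm)
  simpa only [mmul_assoc, dualIso_mul_inv, mmul_one, transpose_transpose] using h3

/-! ### Evaluations inside words -/

section Contractions

variable {Z : WeightModule κ'}

lemma spin_zero_wt_zero : (spin q 0).wt 0 = 0 := by simp [spin]

/-- `X ⊗ Y ⊗ Z → X` for a functional on `Y ⊗ Z`. -/
def contrR (ι : Type) [DecidableEq ι] (p : M[κ, κ']) : M[ι, (ι × κ) × κ'] := of fun i x => if x.1.1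
  = i then p x.1.2 x.2 else 0

/-- `Y ⊗ Z ⊗ X → X` for a functional on `Y ⊗ Z`. -/
def contrL (ι : Type) [DecidableEq ι] (p : M[κ, κ']) : M[ι, (κ × κ') × ι] := of fun i x => if x.2 =
  i then p x.1.1 x.1.2 else 0

/-- `X → Y ⊗ Z ⊗ X` for a vector in `Y ⊗ Z`. -/
def insL (ι : Type) [DecidableEq ι] (p : M[κ, κ']) : M[(κ × κ') × ι, ι] := of fun x i => if x.2 = i
  then p x.1.1 x.1.2 else 0

/-- `X → X ⊗ Y ⊗ Z` for a vector in `Y ⊗ Z`. -/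
def insR (ι : Type) [DecidableEq ι] (p : M[κ, κ']) : M[(ι × κ) × κ', ι] := of fun x i => if x.1.1 =
  i then p x.1.2 x.2 else 0

lemma contrL_isIntertwiner {p : M[κ, κ']} (hp : IsHom (Y ⊠ Z) (spin q 0) (rowM p)) : IsHom ((Y ⊠ Z)
    ⊠ X) X (contrL ι p) := by
  have h := (isIntertwiner_snd (q := q) (spin q 0) X spin_zero_E spin_zero_F spin_zero_wt_zero).comp
    (hp.kron (isIntertwiner_one (X := X)))
  convert h using 1
  ext i ⟨⟨a, b⟩, c⟩
  simp [contrL, mmul_apply, sum_prod_type, rowM, mone_apply, eq_comm]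

lemma insL_isIntertwiner {p : M[κ, κ']} (hp : IsHom (spin q 0) (Y ⊠ Z) (colM p)) : IsHom X ((Y ⊠ Z)
    ⊠ X) (insL ι p) := by
  have h := (hp.kron (isIntertwiner_one (X := X))).comp (isIntertwiner_snd_transpose (q := q) (spin
    q 0) X spin_zero_E spin_zero_F spin_zero_wt_zero)
  convert h using 1
  ext ⟨⟨a, b⟩, c⟩ i
  simp [insL, mmul_apply, sum_prod_type, colM, mone_apply, eq_comm]

lemma contrR_isIntertwiner {p : M[κ, κ']} (hp : IsHom (Y ⊠ Z) (spin q 0) (rowM p)) : IsHom ((X ⊠ Y)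
    ⊠ Z) X (contrR ι p) := by
  have h := ((isIntertwiner_fst (q := q) X (spin q 0) spin_zero_E spin_zero_F
    spin_zero_wt_zero).comp ((isIntertwiner_one (X := X)).kron hp)).comp (assoc_symm_isIntertwiner
    (X := X) (Y := Y) (Z := Z))
  convert h using 1
  ext i ⟨⟨a, b⟩, c⟩
  simp [contrR, mmul_apply, sum_prod_type, rowM, mone_apply, ite_and, Prod.ext_iff, eq_comm]

lemma insR_isIntertwiner {p : M[κ, κ']} (hp : IsHom (spin q 0) (Y ⊠ Z) (colM p)) : IsHom X ((X ⊠ Y)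
    ⊠ Z) (insR ι p) := by
  have h := (assoc_isIntertwiner (X := X) (Y := Y) (Z := Z)).comp (((isIntertwiner_one (X :=
    X)).kron hp).comp (isIntertwiner_fst_transpose (q := q) X (spin q 0) spin_zero_E spin_zero_F
    spin_zero_wt_zero))
  convert h using 1
  ext ⟨⟨a, b⟩, c⟩ i
  simp [insR, mmul_apply, sum_prod_type, colM, mone_apply, ite_and, Prod.ext_iff, eq_comm]

lemma contrR_mul (p : M[κ, κ']) (N : M[(ι × κ) × κ', τ]) (i : ι) (y : τ) : (contrR ι p * N) i y = ∑
    l, ∑ l', p l l' * N ((i, l), l') y := by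
  simp [contrR, mmul_apply, sum_prod_type, ite_mul, sum_ite_irrel]

lemma contrL_mul (p : M[κ, κ']) (N : M[(κ × κ') × ι, τ]) (i : ι) (y : τ) : (contrL ι p * N) i y = ∑
    l, ∑ l', p l l' * N ((l, l'), i) y := by
  simp [contrL, mmul_apply, sum_prod_type, ite_mul]

lemma mul_insL (p : M[κ, κ']) (N : M[τ, (κ × κ') × ι]) (x : τ) (i : ι) : (N * insL ι p) x i = ∑ l, ∑
    l', N x ((l, l'), i) * p l l' := by
  simp [insL, mmul_apply, sum_prod_type]

lemma mul_insR (p : M[κ, κ']) (N : M[τ, (ι × κ) × κ']) (x : τ) (i : ι) : (N * insR ι p) x i = ∑ l, ∑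
    l', N x ((i, l), l') * p l l' := by
  simp [insR, mmul_apply, sum_prod_type, sum_ite_irrel]

lemma zigzag_one : contrR ι I[ι] * insL ι I[ι] = 1 := by
  ext i j
  rw [contrR_mul, mone_apply]
  simp [insL, mone_apply, eq_comm]

end Contractions

/-! ### Associators -/

section Associators

lemma theta_isIntertwiner (D : QuantumData q s) {n : ℕ} {w : Fin n → SLabel q} {t t' : FreeMagma
    (Fin n)} (ht : leaves t = finRange n) (ht' : leaves t' = finRange n) : IsHom (idxMod w) (idxMod
    w) (D.theta w t t') := by
  rw [CGMatrices.theta, proj_eq w, proj_eq w]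
  exact (channels_idx D ht').coproj_isIntertwiner.comp (channels_idx D ht).coproj_isIntertwiner

lemma negligible_one_sub_theta (D : QuantumData q s) {n : ℕ} {w : Fin n → SLabel q} {t t' :
    FreeMagma (Fin n)} (ht : leaves t = finRange n) (ht' : leaves t' = finRange n) : Negligible q
    (idxMod w) (1 - D.theta w t t') := by
  rw [CGMatrices.theta, proj_eq w, proj_eq w]
  have h := (channels_idx (w := w) D ht').negligible.add ((channels_idx (w := w) D
    ht).negligible.mul_left (channels_idx (w := w) D ht').coproj_isIntertwiner)
  rwa [mul_sub, mul_one, sub_add_sub_cancel] at h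

/-- `idx3` on nested pairs. -/
def idx3e (X Y Z : SLabel q) (p : (X.2 × Y.2) × Z.2) : Idx (word3 X Y Z) := idx3 p.1.1 p.1.2 p.2

/-- `idx4` on nested pairs. -/
def idx4e (X Y Z W : SLabel q) (p : ((X.2 × Y.2) × Z.2) × W.2) : Idx (word4 X Y Z W) := idx4 p.1.1.1
    p.1.1.2 p.1.2 p.2

lemma idx3e_bijective (X Y Z : SLabel q) : Bijective (idx3e X Y Z) := by
  have h := TIx.restrict_bijective (d := wdim (word3 X Y Z)) (t := (.of 0 * .of 1) * .of 2) (by rfl)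
  refine (Function.Bijective.of_comp_iff' h _).1 ?_
  exact Function.bijective_id

lemma idx4e_bijective (X Y Z W : SLabel q) : Bijective (idx4e X Y Z W) := by
  have h := TIx.restrict_bijective (d := wdim (word4 X Y Z W))
    (t := ((.of 0 * .of 1) * .of 2) * .of 3) (by rfl)
  refine (Function.Bijective.of_comp_iff' h _).1 ?_
  exact Function.bijective_id

lemma idx3e_pull (X Y Z : SLabel q) : (idxMod (word3 X Y Z)).pull (idx3e X Y Z) = (X.rep ⊠ Y.rep) ⊠
    Z.rep := by
  rw [← idxMod_eq (t := (.of 0 * .of 1) * .of 2) (by rfl)]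
  rfl

lemma idx4e_pull (X Y Z W : SLabel q) : (idxMod (word4 X Y Z W)).pull (idx4e X Y Z W) = ((X.rep ⊠
    Y.rep) ⊠ Z.rep) ⊠ W.rep := by
  rw [← idxMod_eq (t := ((.of 0 * .of 1) * .of 2) * .of 3) (by rfl)]
  rfl

lemma WeightModule.IsIntertwiner.pull {T : M[ι, ι]} (hT : IsHom X X T) {e : κ → ι} (he : Bijective
    e) : IsHom (X.pull e) (X.pull e) (T.submatrix e e) := by
  have := (hT.pull_src he).pull_tgt he
  exact this

lemma one_sub_submatrix {e : κ → ι} (he : Bijective e) (T : M[ι, ι]) : (1 - T).submatrix e e = 1 -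
    T.submatrix e e := by
  rw [Matrix.submatrix_sub]
  exact congrArg (fun M => M - T.submatrix e e) (Matrix.submatrix_one e he.1)

/-- `assoc3` on nested pairs. -/
def QuantumData.assoc3P (D : QuantumData q s) (X Y Z : SLabel q) := (D.assoc3 X Y Z).submatrix
  (idx3e X Y Z) (idx3e X Y Z)

lemma assoc3P_apply (D : QuantumData q s) (X Y Z : SLabel q) (x x' : X.2) (y y' : Y.2) (z z' : Z.2)
    : D.assoc3P X Y Z ((x, y), z) ((x', y'), z') = D.assoc3 X Y Z (idx3 x y z) (idx3 x' y' z') :=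
    rfl

/-- `assoc4Inv` on nested pairs. -/
def QuantumData.assoc4P (D : QuantumData q s) (X Y Z W : SLabel q) := (D.assoc4Inv X Y Z
  W).submatrix (idx4e X Y Z W) (idx4e X Y Z W)

lemma assoc3P_isIntertwiner (D : QuantumData q s) (X Y Z : SLabel q) : IsHom ((X.rep ⊠ Y.rep) ⊠
    Z.rep) ((X.rep ⊠ Y.rep) ⊠ Z.rep) (D.assoc3P X Y Z) := by
  rw [← idx3e_pull]
  exact (theta_isIntertwiner D (by rfl) (by rfl)).pull (idx3e_bijective X Y Z)

lemma assoc4P_isIntertwiner (D : QuantumData q s) (X Y Z W : SLabel q) : IsHom (((X.rep ⊠ Y.rep) ⊠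
    Z.rep) ⊠ W.rep) (((X.rep ⊠ Y.rep) ⊠ Z.rep) ⊠ W.rep) (D.assoc4P X Y Z W) := by
  rw [← idx4e_pull]
  exact (theta_isIntertwiner D (by rfl) (by rfl)).pull (idx4e_bijective X Y Z W)

lemma negligible_one_sub_assoc3P (D : QuantumData q s) (X Y Z : SLabel q) : Negligible q ((X.rep ⊠
    Y.rep) ⊠ Z.rep) (1 - D.assoc3P X Y Z) := by
  rw [← idx3e_pull, QuantumData.assoc3P, ← one_sub_submatrix (idx3e_bijective X Y Z)]
  exact (negligible_one_sub_theta D (by rfl) (by rfl)).pull (idx3e_bijective X Y Z)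

lemma negligible_one_sub_assoc4P (D : QuantumData q s) (X Y Z W : SLabel q) : Negligible q (((X.rep
    ⊠ Y.rep) ⊠ Z.rep) ⊠ W.rep) (1 - D.assoc4P X Y Z W) := by
  rw [← idx4e_pull, QuantumData.assoc4P, ← one_sub_submatrix (idx4e_bijective X Y Z W)]
  exact (negligible_one_sub_theta D (by rfl) (by rfl)).pull (idx4e_bijective X Y Z W)

/-- Between physical representations, an intertwiner that is the identity up to negligible ones
can be dropped. -/
lemma mul_mul_of_negligible {P : M[ι, ι]} (hP : IsHom X X P) (hn : Negligible q X (1 - P)) {γ γ' :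
    Phys q} {f : M[ι, γ]} {g : M[γ', ι]} (hf : IsHom γ.rep X f) (hg : IsHom X γ'.rep g) : g * P * f
    = g * f := by
  have h := hn.between (isIntertwiner_one.sub hP) hf hg
  rw [mmul_sub, mmul_one, msub_mul, sub_eq_zero] at h
  exact h.symm

lemma kronecker_one_sub (T : M[ι, ι]) : (1 - T) ⊗ₖ I[κ] = 1 - T ⊗ₖ I[κ] := by
  ext p p'
  simp only [kroneckerMap_apply, msub_apply, sub_mul]
  exact congrArg (· - _) (congr_fun₂ one_kronecker_one p p')

lemma a_mul_b (D : QuantumData q s) (α : Phys q) : D.a α * D.b α = 1 := by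
  have h := mul_mul_of_negligible (assoc3P_isIntertwiner D (posL α) (negL α) (posL α))
    (negligible_one_sub_assoc3P D (posL α) (negL α) (posL α)) (insL_isIntertwiner (X := α.rep)
    (coevM_isIntertwiner α.rep)) (contrR_isIntertwiner (X := α.rep) (evM_isIntertwiner α.rep))
  have h1 := congr_fun₂ (D.isotopy α) 0 0
  have h2 := congr_fun₂ h 0 0
  rw [mmul_assoc, zigzag_one, one_apply_eq, contrR_mul] at h2
  rw [A_eq, B_eq, of_apply, one_apply_eq] at h1
  simp only [mul_insL, assoc3P_apply, mone_apply, ite_mul, one_mul, zero_mul, mul_ite, mul_one,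
    mul_zero, sum_ite_eq, mem_univ, if_true, msmul_apply, smul_eq_mul, sum_ite_irrel,
    sum_const_zero] at h1 h2
  rw [sum_comm] at h2
  simp only [mul_assoc, ← sum_mul, h2, one_mul] at h1
  rwa [mul_comm] at h1

lemma functional_dual_tensor {h : M[Fin 1, (κ × ι) × τ]} (hh : IsHom ((dual q Y ⊠ dual q X) ⊠ Z)
    (spin q 0) h) : IsHom Z (X ⊠ Y) (of fun p m => h 0 (p.swap, m)) := by
  have sw : IsHom (dual q (X ⊠ Y)) (dual q Y ⊠ dual q X) (I[ι × κ].submatrix swap id) := by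
    rw [← dual_tensor_pull]
    exact isIntertwiner_one.pull_tgt swap_bijective
  have h1 := hh.comp (sw.kron (isIntertwiner_one (X := Z)))
  rw [eq_rowM (h * _), isIntertwiner_rowM_dual_left] at h1
  convert h1 using 1
  ext ⟨i, k⟩ m
  simp [mmul_apply, sum_prod_type, mone_apply, Prod.ext_iff, ite_and]

lemma sum_rotate {A C₁ C₂ C₃ M : Type} [Fintype A] [Fintype C₁] [Fintype C₂] [Fintype C₃]
    [AddCommMonoid M] (F : A → C₁ → C₂ → C₃ → M) : ∑ r, ∑ c, ∑ d, ∑ e, F r c d e = ∑ c, ∑ d, ∑ e, ∑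
    r, F r c d e := by
  have h : ∀ K : C₁ → C₂ → C₃ → M, ∑ c, ∑ d, ∑ e, K c d e = ∑ x : C₁ × C₂ × C₃, K x.1 x.2.1 x.2.2 :=
    fun K => by
    simp only [sum_prod_type]
  simp only [h]
  exact sum_comm

lemma sum_permute {A B C₁ C₂ C₃ M : Type} [Fintype A] [Fintype B] [Fintype C₁] [Fintype C₂] [Fintype
    C₃] [AddCommMonoid M] (F : A → B → C₁ → C₂ → C₃ → M) : ∑ r, ∑ t, ∑ c, ∑ d, ∑ e, F r t c d e = ∑
    c, ∑ d, ∑ e, ∑ t, ∑ r, F r t c d e := by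
  rw [sum_comm]
  simp only [sum_rotate (A := A)]
  exact sum_rotate fun t c d e => ∑ r, F r t c d e

section TwistF

variable (D) (α β)

/-- The evaluation of `β̄ ⊗ ᾱ ⊗ α ⊗ β`. -/
def evTwo (α β : Phys q) : M[Fin 1, ((β × α) × α) × β] := evM β * (contrR β I[α] ⊗ₖ I[β])

lemma evTwo_apply (b : β) (a : α) (a' : α) (b' : β) : evTwo α β 0 (((b, a), a'), b') = if a = a' ∧ b
    = b' then 1 else 0 := by
  simp [evTwo, evM, rowM, contrR, mmul_apply, sum_prod_type, mone_apply, ite_and]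

lemma evTwo_isIntertwiner : IsHom (((dual q β.rep ⊠ dual q α.rep) ⊠ α.rep) ⊠ β.rep) (spin q 0)
  (evTwo α β) := (evM_isIntertwiner β.rep).comp ((contrR_isIntertwiner (evM_isIntertwiner
  α.rep)).kron isIntertwiner_one)

/-- The functional on `β̄ ⊗ ᾱ ⊗ α ⊗ β` underlying `gMat`. -/
def gFun (D : QuantumData q s) (α β : Phys q) : M[Fin 1, ((β × α) × α) × β] := evTwo α β *
  (D.assoc3P (negL β) (negL α) (posL α) ⊗ₖ I[β]) * D.assoc4P (negL β) (negL α) (posL α) (posL β)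

lemma gFun_isIntertwiner : IsHom (((dual q β.rep ⊠ dual q α.rep) ⊠ α.rep) ⊠ β.rep) (spin q 0) (gFun
  D α β) := ((evTwo_isIntertwiner α β).comp ((assoc3P_isIntertwiner D (negL β) (negL α) (posL
  α)).kron isIntertwiner_one)).comp (assoc4P_isIntertwiner D _ _ _ (posL β))

lemma gMat_eq (I J : α × β) : D.gMat D.A α β I J = D.a α * D.a β * gFun D α β 0 (((I.2, I.1), J.1),
    J.2) := by
  rw [CGMatrices.gMat, of_apply, gFun, mmul_apply, A_eq, A_eq]
  have h : ∀ c d e b', (evTwo α β * (D.assoc3P (negL β) (negL α) (posL α) ⊗ₖ I[β])) 0 (((c, d), e),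
    b') = ∑ r, D.assoc3 (negL β) (negL α) (posL α) (idx3 b' r r) (idx3 c d e) := by
    intro c d e b'
    simp only [mmul_apply, sum_prod_type, evTwo_apply, ite_and, ite_mul, one_mul, zero_mul,
      kroneckerMap_apply, mone_apply, mul_ite, mul_one, mul_zero, sum_ite_eq, Finset.sum_ite_eq',
      mem_univ, if_true, sum_ite_irrel, sum_const_zero]
    rfl
  simp only [sum_prod_type (α₁ := (β × α) × α), sum_prod_type (α₁ := β × α), sum_prod_type (α₁ :=
    β), h]
  simp only [msmul_apply, mone_apply, smul_eq_mul, mul_ite, ite_mul, mul_one, mul_zero, zero_mul,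
    sum_ite_irrel, sum_const_zero, sum_ite_eq, mem_univ, if_true]
  simp only [mul_sum, sum_mul]
  rw [sum_permute]
  simp only [mul_assoc]
  rfl

/-- Attaching `φ` and `ψ` to a functional on `β̄ ⊗ ᾱ ⊗ α ⊗ β`. -/
def attach (D : QuantumData q s) (α β γ : Phys q) : M[((β × α) × α) × β, (β × α) × γ] := I[((β × α)
  × α) × β].submatrix id (prodAssoc _ α β).symm * (I[β × α] ⊗ₖ D.phi α β γ)

lemma mul_attach (γ : Phys q) (T : M[Fin 1, ((β × α) × α) × β]) (p : β × α) (m : γ) : (T * attach D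
    α β γ) 0 (p, m) = ∑ J : α × β, T 0 ((p, J.1), J.2) * D.phi α β γ J m := by
  obtain ⟨b, a⟩ := p
  rw [attach, ← mmul_assoc]
  simp [mmul_apply, sum_prod_type, mone_apply, Prod.ext_iff, ite_and]

lemma attach_isIntertwiner (γ : Phys q) : IsHom ((dual q β.rep ⊠ dual q α.rep) ⊠ γ.rep) (((dual q
  β.rep ⊠ dual q α.rep) ⊠ α.rep) ⊠ β.rep) (attach D α β γ) := (assoc_isIntertwiner).comp
  (isIntertwiner_one.kron (D.phi_intertwiner α β γ))

lemma evTwo_attach (γ : Phys q) : evTwo α β * attach D α β γ = of fun _ p => D.phi α β γ (p.1.2,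
    p.1.1) p.2 := by
  ext z ⟨⟨b, a⟩, m⟩
  rw [Subsingleton.elim z 0, mul_attach]
  simp [sum_prod_type, evTwo_apply, ite_and]

lemma phi_dual_isIntertwiner (γ : Phys q) : IsHom ((dual q β.rep ⊠ dual q α.rep) ⊠ γ.rep) (spin q 0)
    (of fun _ p => D.phi α β γ (p.1.2, p.1.1) p.2) := by
  rw [← evTwo_attach]
  exact (evTwo_isIntertwiner α β).comp (attach_isIntertwiner D α β γ)

lemma psi_dual_isIntertwiner (γ : Phys q) : IsHom (dual q γ.rep) (dual q β.rep ⊠ dual q α.rep)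
  ((D.psi α β γ).transpose.submatrix swap id) := (isIntertwiner_dual_tensor').2 (D.psi_intertwiner α
  β γ)

lemma trace_Kinv_ne_zero (γ : Phys q) : (γ.rep.Kinv q).trace ≠ 0 := by
  have h := (posL γ).spherical 1 isIntertwiner_one
  rw [mmul_one, mmul_one] at h
  exact h ▸ Phys.trace_K_ne_zero γ

lemma gFun_attach (h : fusion α β γ ≠ 0) : gFun D α β * attach D α β γ = evTwo α β * attach D α β
    γ := by
  obtain ⟨x, hx⟩ := eq_smul_phi D h (functional_dual_tensor ((gFun_isIntertwiner D α β).comp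
    (attach_isIntertwiner D α β γ)))
  have hx' : gFun D α β * attach D α β γ = x • (evTwo α β * attach D α β γ) := by
    rw [evTwo_attach]
    ext z ⟨⟨b, a⟩, m⟩
    rw [Subsingleton.elim z 0]
    exact congr_fun₂ hx (a, b) m
  have hv := (attach_isIntertwiner D α β γ).comp (((psi_dual_isIntertwiner D α β γ).kron
    (isIntertwiner_one (X := γ.rep))).comp (colM_Kinv_isIntertwiner (spin_isRep γ.1)))
  set v := ((D.psi α β γ).transpose.submatrix swap id ⊗ₖ I[γ]) * colM (γ.rep.Kinv q) with hvdef
  have h3 := assoc3P_isIntertwiner D (negL β) (negL α) (posL α)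
  have n3 := (negligible_one_sub_assoc3P D (negL β) (negL α) (posL α)).kron_one (Y := β.rep)
  have h31 := h3.kron (isIntertwiner_one (X := β.rep))
  have e1 : gFun D α β * (attach D α β γ * v) = evTwo α β * (attach D α β γ * v) := by
    have e2 := mul_mul_of_negligible (assoc4P_isIntertwiner D (negL β) (negL α) (posL α) (posL β))
      (negligible_one_sub_assoc4P D (negL β) (negL α) (posL α) (posL β)) (γ := Phys.zero q) (γ' :=
      Phys.zero q) hv ((evTwo_isIntertwiner α β).comp h31)
    rw [kronecker_one_sub] at n3
    have e3 := mul_mul_of_negligible h31 n3 (γ := Phys.zero q) (γ' := Phys.zero q) hv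
      (evTwo_isIntertwiner α β)
    exact e2.trans e3
  have e4 : evTwo α β * attach D α β γ * v = (γ.rep.Kinv q).trace • 1 := by
    have : evTwo α β * attach D α β γ * ((D.psi α β γ).transpose.submatrix swap id ⊗ₖ I[γ]) = rowM
      1 := by
      ext z ⟨m, m'⟩
      have e5 := congr_fun₂ (D.psi_mul_phi α β γ h) m m'
      rw [evTwo_attach]
      rw [mmul_apply, sum_prod_type] at e5
      rw [rowM, of_apply, ← e5, sum_comm]
      simp [mmul_apply, sum_prod_type, mone_apply, mul_comm]
    rw [hvdef, ← mmul_assoc, this, rowM_mul_colM, transpose_one, mone_mul]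
  rw [← mmul_assoc (gFun D α β), ← mmul_assoc (evTwo α β), hx', smul_mul, e4] at e1
  have e6 := congr_fun₂ e1 0 0
  simp only [msmul_apply, one_apply_eq, smul_eq_mul, mul_one] at e6
  rw [hx', (mul_eq_right₀ (trace_Kinv_ne_zero γ)).1 e6, one_smul]

lemma gMat_mul_phi (h : fusion α β γ ≠ 0) : D.gMat D.A α β * D.phi α β γ = (D.a α * D.a β) • D.phi α
    β γ := by
  ext ⟨a, b⟩ m
  have h1 := congr_fun₂ (gFun_attach D α β h) 0 ((b, a), m)
  rw [evTwo_attach, mul_attach] at h1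
  simp only [mmul_apply, gMat_eq D α β, mul_assoc, ← mul_sum]
  rw [h1, msmul_apply, smul_eq_mul, mul_assoc]
  rfl

/-- The associator in `fMat`. -/
def fAssoc (D : QuantumData q s) (α β γ : Phys q) : M[((β × α) × γ) × γ, ((β × α) × γ) × γ] :=
  D.assoc4P (negL β) (negL α) (posL γ) (negL γ)

/-- `φ` as a functional on `(β̄ ⊗ ᾱ) ⊗ γ`. -/
def phiSwap (D : QuantumData q s) (α β γ : Phys q) : M[β × α, γ] := of fun p m => D.phi α β γ p.swap
  m

/-- The `γ` component of the twist. -/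
def twist (D : QuantumData q s) (α β γ : Phys q) : M[γ, β × α] := contrL γ (phiSwap D α β γ) *
  fAssoc D α β γ * insR (β × α) I[γ]

lemma twist_eq (h : fusion α β γ ≠ 0) : twist D α β γ = (D.phi α β γ).transpose.submatrix id
    swap := by
  have hL := contrL_isIntertwiner (X := dual q γ.rep) (p := phiSwap D α β γ) (phi_dual_isIntertwiner
    D α β γ)
  have hR := insR_isIntertwiner (X := dual q β.rep ⊠ dual q α.rep) (coevM_isIntertwiner (q := q)
    γ.rep)
  have h4 : IsHom (((dual q β.rep ⊠ dual q α.rep) ⊠ γ.rep) ⊠ dual q γ.rep) (((dual q β.rep ⊠ dual q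
    α.rep) ⊠ γ.rep) ⊠ dual q γ.rep) (fAssoc D α β γ) := assoc4P_isIntertwiner D (negL β) (negL α)
    (posL γ) (negL γ)
  have n4 : Negligible q (((dual q β.rep ⊠ dual q α.rep) ⊠ γ.rep) ⊠ dual q γ.rep) (1 - fAssoc D α β
    γ) := negligible_one_sub_assoc4P D (negL β) (negL α) (posL γ) (negL γ)
  have hF : IsHom (dual q β.rep ⊠ dual q α.rep) (dual q γ.rep) (twist D α β γ) := (hL.comp h4).comp
    hR
  have e0 : twist D α β γ = (of fun p m => twist D α β γ m (swap p)).transpose.submatrix id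
    swap := by
    ext; rfl
  rw [e0, isIntertwiner_dual_tensor] at hF
  obtain ⟨y, hy⟩ := eq_smul_phi D h hF
  have hy' : twist D α β γ = y • (D.phi α β γ).transpose.submatrix id swap := by rw [e0, hy]; rfl
  have hψ := (psi_dual_isIntertwiner D α β γ).comp (dualIso_isIntertwiner γ)
  have e1 := mul_mul_of_negligible h4 n4 (hR.comp hψ) ((dualIsoInv_isIntertwiner γ).comp hL)
  have e2 : contrL γ (phiSwap D α β γ) * insR (β × α) I[γ] = (D.phi α β γ).transpose.submatrix id
    swap := by
    ext m p
    rw [contrL_mul]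
    simp [insR, phiSwap, mone_apply]
  have e3 : (D.phi α β γ).transpose.submatrix id swap * (D.psi α β γ).transpose.submatrix swap id =
    1 := by
    rw [submatrix_mul_bijective swap_bijective, ← transpose_mul, D.psi_mul_phi _ _ _ h]
    simp
  have e4 : dualIsoInv γ * twist D α β γ * ((D.psi α β γ).transpose.submatrix swap id * dualIso γ) =
    1 := by
    rw [twist]
    simp only [mmul_assoc] at e1 ⊢
    rw [e1, ← mmul_assoc (contrL _ _), e2, ← mmul_assoc (Matrix.submatrix _ _ _), e3, mone_mul,
      dualIsoInv_mul]
  rw [hy', mmul_smul, smul_mul, mmul_assoc, ← mmul_assoc (Matrix.submatrix _ _ _), e3, mone_mul,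
    dualIsoInv_mul] at e4
  have e5 := congr_fun₂ e4 0 0
  rw [msmul_apply, one_apply_eq, smul_eq_mul, mul_one] at e5
  rw [hy', e5, one_smul]

lemma fMat_eq : D.fMat D.A D.B α β = ∑ γ ∈ fusionSet α β, (D.a α * D.a β * D.b γ) • (D.phi α β γ *
    D.psi α β γ) := by
  ext I J
  rw [CGMatrices.fMat, of_apply, finsum_fusion, msum_apply]
  · refine sum_congr rfl fun γ hγ => ?_
    rw [mem_fusionSet] at hγ
    have h1 : ∀ r, D.phi α β γ I r = ∑ b, ∑ a, ∑ m, ∑ n, D.assoc4Inv (negL β) (negL α) (posL γ)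
      (negL γ) (idx4 b a m r) (idx4 I.2 I.1 n n) * D.phi α β γ (a, b) m := by
      intro r
      have h2 := congr_fun₂ (twist_eq D α β hγ) r I.swap
      refine Eq.trans (Eq.trans rfl h2.symm) ?_
      rw [twist, mul_insR]
      simp only [contrL_mul, mone_apply, mul_ite, mul_one, mul_zero, sum_ite_eq, mem_univ, if_true,
        sum_prod_type]
      rw [sum_rotate]
      exact sum_congr rfl fun _ _ => sum_congr rfl fun _ _ => sum_congr rfl fun _ _ => sum_congr rfl
        fun _ _ => mul_comm _ _
    rw [gMat_mul_phi D α β hγ, B_eq, msmul_apply, mmul_apply, smul_eq_mul, mul_sum]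
    simp only [h1, msmul_apply, mone_apply, smul_eq_mul, mul_ite, ite_mul, mul_one, mul_zero,
      zero_mul, sum_ite_irrel, sum_const_zero, sum_ite_eq, mem_univ, if_true, mul_sum, sum_mul]
    rw [sum_rotate (A := γ)]
    refine sum_congr rfl fun _ _ => sum_congr rfl fun _ _ => sum_congr rfl fun _ _ => ?_
    rw [sum_comm]
    refine sum_congr rfl fun _ _ => sum_congr rfl fun _ _ => ?_
    ring
  · intro γ h
    simp [D.psi_eq_zero _ _ _ h]

lemma psi_mul_fInv (γ : Phys q) : D.psi α β γ * D.fInv α β = (D.a γ / (D.a α * D.a β)) • D.psi α β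
    γ := by
  by_cases h : fusion α β γ = 0
  · rw [D.psi_eq_zero _ _ _ h]; simp
  have h1 := congrArg (D.psi α β γ * ·) (D.mul_fInv α β)
  simp only [pairProj_pos] at h1
  rw [fMat_eq D α β, ← mmul_assoc, mmul_sum, sum_eq_single_of_mem γ ((mem_fusionSet).2 h),
    mmul_smul, ← mmul_assoc, D.psi_mul_phi _ _ _ h, mone_mul, smul_mul] at h1
  · have a0 : ∀ δ, D.a δ ≠ 0 := fun δ h0 => by
      have := a_mul_b D δ
      rw [h0, zero_mul] at this
      exact zero_ne_one this
    have h2 := congrArg ((D.a γ / (D.a α * D.a β)) • ·) h1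
    simp only [smul_smul] at h2
    rw [show D.a γ / (D.a α * D.a β) * (D.a α * D.a β * D.b γ) = D.a γ * D.b γ by
      field_simp [a0 α, a0 β], a_mul_b, one_smul] at h2
    rw [h2]
    exact congrArg _ (psi_mul_cgProj D α β γ)
  · intro γ' _ hne
    rw [mmul_smul, ← mmul_assoc, psi_mul_phi_ne D hne.symm, mzero_mul, smul_zero]

end TwistF

end Associators

/-! ### Exchange matrices -/

/-- The matrix that exchanges `α` and `β̄`, in terms of the braiding `β̄ ⊗ α → α ⊗ β̄` or of the
inverse of the braiding `α ⊗ β̄ → β̄ ⊗ α`. -/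
def exchL (q s : ℂ) (b : Bool) (α β : Phys q) : M[α × β, β × α] := if b then braidM q s (dual q
  β.rep) α.rep else of fun x y => univR q s α.rep β.rep (x.1, y.1) (y.2, x.2)

/-- The matrix that exchanges `ᾱ` and `β`, in terms of the braiding `β ⊗ ᾱ → ᾱ ⊗ β` or of the
inverse of the braiding `ᾱ ⊗ β → β ⊗ ᾱ`. -/
def exchR (q s : ℂ) (b : Bool) (α β : Phys q) : M[α × β, β × α] := if b then braidM q s β.rep (dual
  q α.rep) else of fun x y => q ^ (α.rep.wt y.2 - α.rep.wt x.1) * univR q s α.rep β.rep (y.2, x.2)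
  (x.1, y.1)

lemma graded_one {n : ℕ} (X : WeightModule (Fin n)) (q : ℂ) : Graded (dual q X) X I[Fin n] := by
  intro x y h
  obtain rfl : x = y := by
    by_contra hne
    exact h (Matrix.one_apply_ne hne)
  exact neg_add_cancel _

lemma graded_K {n : ℕ} (X : WeightModule (Fin n)) (q : ℂ) : Graded X (dual q X) (X.K q) := by
  intro x y h
  obtain rfl : x = y := by
    by_contra hne
    exact h (Matrix.diagonal_apply_ne _ hne)
  exact add_neg_cancel _

lemma exchL_mul_braid (hs : s ^ 2 = q) (α β : Phys q) : exchL q s false α β * braidM q s α.rep (dual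
    q β.rep) = 1 := by
  ext ⟨k, j'⟩ ⟨i, x⟩
  have h := zigzag_left hs α ((negL β).isRep) ((negL β).isNil) ((posL β).isRep) ((posL β).isNil)
    (evM_isIntertwiner β.rep) (graded_one β.rep q) i k x j'
  simp only [mone_apply, ite_mul, one_mul, zero_mul, sum_ite_irrel, sum_const_zero, sum_ite_eq,
    mem_univ, if_true] at h
  rw [mmul_apply, sum_prod_type, mone_apply]
  simp only [exchL, braidM, Bool.false_eq_true, if_false, of_apply, submatrix_apply,
    Prod.swap_prod_mk, id, Prod.mk.injEq, ite_and, eq_comm (a := j')]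
  rw [← h]
  exact sum_congr rfl fun _ _ => sum_congr rfl fun _ _ => mul_comm _ _

lemma exchR_mul_braid (hs : s ^ 2 = q) (α β : Phys q) : exchR q s false α β * braidM q s (dual q
    α.rep) β.rep = 1 := by
  ext ⟨l, i'⟩ ⟨y, i⟩
  have h := zigzag_right hs β ((posL α).isRep) ((posL α).isNil) ((negL α).isRep) ((negL α).isNil)
    (rowM_K_isIntertwiner α.rep) (graded_K α.rep q) i i' l y
  simp only [K, diagonal_apply, ite_mul, zero_mul, sum_ite_irrel, sum_const_zero, sum_ite_eq,
    mem_univ, if_true] at h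
  rw [mmul_apply, sum_prod_type, sum_comm, mone_apply]
  simp only [exchR, braidM, Bool.false_eq_true, if_false, of_apply, submatrix_apply,
    Prod.swap_prod_mk, id, Prod.mk.injEq]
  have hK : q ^ α.rep.wt l ≠ 0 := zpow_ne_zero _ q0
  have h2 : ∑ x, ∑ z, q ^ (α.rep.wt x - α.rep.wt l) * univR q s α.rep β.rep (x, i') (l, z) * univR q
    s (dual q α.rep) β.rep (x, z) (y, i) = (q ^ α.rep.wt l)⁻¹ * (if i' = i then if l = y then q ^
    α.rep.wt l else 0 else 0) := by
    rw [← show _ = (if i' = i then if l = y then q ^ α.rep.wt l else 0 else 0) from h, mul_sum]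
    refine sum_congr rfl fun x _ => ?_
    rw [mul_sum]
    refine sum_congr rfl fun z _ => ?_
    rw [zpow_sub₀ q0]
    change _ = _ * (q ^ α.rep.wt x * univR q s (dual q α.rep) β.rep (x, z) (y, i) * univR q s α.rep
      β.rep (x, i') (l, z))
    ring
  refine h2.trans ?_
  by_cases h1 : i' = i <;> by_cases h3 : l = y <;> simp [h1, h3]
  subst h3
  exact inv_mul_cancel₀ hK

lemma mul_eq_one_comm' {A : M[ι × κ, κ × ι]} {B : M[κ × ι, ι × κ]} : A * B = 1 ↔ B * A = 1 :=
  Matrix.mul_eq_one_comm_of_equiv (prodComm _ _)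

lemma exchL_isIntertwiner (hs : s ^ 2 = q) (b : Bool) (α β : Phys q) : IsHom (dual q β.rep ⊠ α.rep)
    (α.rep ⊠ dual q β.rep) (exchL q s b α β) := by
  cases b
  · have h := exchL_mul_braid hs α β
    exact ((posL α).braid_isIntertwiner hs (negL β)).inverse (mul_eq_one_comm'.1 h) h
  · exact (negL β).braid_isIntertwiner hs (posL α)

lemma exchR_isIntertwiner (hs : s ^ 2 = q) (b : Bool) (α β : Phys q) : IsHom (β.rep ⊠ dual q α.rep)
    (dual q α.rep ⊠ β.rep) (exchR q s b α β) := by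
  cases b
  · have h := exchR_mul_braid hs α β
    exact ((negL α).braid_isIntertwiner hs (posL β)).inverse (mul_eq_one_comm'.1 h) h
  · exact (posL β).braid_isIntertwiner hs (negL α)

lemma exists_braid_inv (hs : s ^ 2 = q) (α β : Phys q) : ∃ N : M[α × β, β × α], N * braidM q s α.rep
    β.rep = 1 := by
  refine ⟨of fun x y => univR q s (dual q α.rep) β.rep (y.2, x.2) (x.1, y.1), ?_⟩
  ext ⟨x, j⟩ ⟨y, i⟩
  have h := zigzag_right hs β ((negL α).isRep) ((negL α).isNil) ((posL α).isRep) ((posL α).isNil)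
    (evM_isIntertwiner α.rep) (graded_one α.rep q) i j x y
  simp only [mone_apply, ite_mul, one_mul, zero_mul, sum_ite_irrel, sum_const_zero, sum_ite_eq,
    mem_univ, if_true] at h
  rw [mmul_apply, sum_prod_type, sum_comm, mone_apply]
  simp only [braidM, of_apply, submatrix_apply, Prod.swap_prod_mk, id, Prod.mk.injEq]
  refine Eq.trans ?_ (h.trans ?_)
  · exact sum_congr rfl fun _ _ => sum_congr rfl fun _ _ => mul_comm _ _
  · by_cases h1 : j = i <;> by_cases h3 : x = y <;> simp [h1, h3]

lemma fusion_symm (hs : s ^ 2 = q) (D : QuantumData q s) (h : fusion α β γ ≠ 0) : fusion β α γ ≠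
    0 := by
  intro h0
  obtain ⟨N, hN⟩ := exists_braid_inv hs α β
  have h1 := congrArg (N * ·) (braid_mul_phi D h)
  simp only [← mmul_assoc, hN, mone_mul, D.phi_eq_zero _ _ _ h0, smul_zero, mmul_zero] at h1
  have h2 := D.psi_mul_phi _ _ _ h
  rw [h1, mmul_zero] at h2
  exact zero_ne_one h2

/-- The factor of an exchange. -/
def lam (D : QuantumData q s) (b : Bool) (α β γ : Phys q) : ℂ := if b then D.kappa γ / (D.kappa α *
  D.kappa β) else D.kappa α * D.kappa β / D.kappa γ

lemma phi_eq_braid (hs : s ^ 2 = q) (D : QuantumData q s) (h : fusion α β γ ≠ 0) (x : α) (y : β) (c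
    : γ) : D.phi α β γ (x, y) c = lam D true α β γ * ∑ p, univR q s β.rep α.rep (y, x) p * D.phi β α
    γ p c := by
  have h1 := congr_fun₂ (braid_mul_phi D (fusion_symm hs D h)) (x, y) c
  have k := kappa_ne_zero D
  rw [mmul_apply, msmul_apply, smul_eq_mul] at h1
  change ∑ p, univR q s β.rep α.rep (y, x) p * D.phi β α γ p c = _ at h1
  rw [h1, lam, if_pos rfl, ← mul_assoc]
  have : D.kappa γ / (D.kappa α * D.kappa β) * (D.kappa β * D.kappa α / D.kappa γ) = 1 := by
    field_simp [k α, k β, k γ]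
  rw [this, one_mul]

lemma exchL_phi (hs : s ^ 2 = q) (D : QuantumData q s) (b : Bool) (h : fusion α β γ ≠ 0) (j : α)
    (j'' : β) (c : γ) : ∑ k'', ∑ k', exchL q s b α β (j, k') (j'', k'') * D.phi α β γ (k'', k') c =
    lam D b α β γ * D.phi β α γ (j'', j) c := by
  cases b
  · have h1 := congr_fun₂ (braid_mul_phi D h) (j'', j) c
    rw [mmul_apply, sum_prod_type, msmul_apply, smul_eq_mul] at h1
    exact h1
  · simp only [phi_eq_braid hs D h]
    have hz : ∀ (y : β) (i : α), ∑ k'', ∑ k', univR q s (dual q β.rep) α.rep (k', j) (j'', k'') *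
      univR q s β.rep α.rep (k', k'') (y, i) = if j = i then if j'' = y then 1 else 0 else 0 := by
      intro y i
      have h := zigzag_right hs α ((negL β).isRep) ((negL β).isNil) ((posL β).isRep) ((posL
        β).isNil) (evM_isIntertwiner β.rep) (graded_one β.rep q) i j j'' y
      simp only [mone_apply, ite_mul, one_mul, zero_mul, sum_ite_irrel, sum_const_zero, sum_ite_eq,
        mem_univ, if_true] at h
      rw [sum_comm]
      refine Eq.trans ?_ h
      exact sum_congr rfl fun _ _ => sum_congr rfl fun _ _ => mul_comm _ _
    have e : ∀ (k'' : α) (k' : β), exchL q s true α β (j, k') (j'', k'') * (lam D true α β γ * ∑ p,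
      univR q s β.rep α.rep (k', k'') p * D.phi β α γ p c) = ∑ p, (univR q s (dual q β.rep) α.rep
      (k', j) (j'', k'') * univR q s β.rep α.rep (k', k'') p) * (lam D true α β γ * D.phi β α γ p
      c) := by
      intro k'' k'
      rw [mul_sum, mul_sum]
      refine sum_congr rfl fun p _ => ?_
      change univR q s (dual q β.rep) α.rep (k', j) (j'', k'') * _ = _
      ring
    simp only [e]
    simp only [sum_comm (s := Finset.univ (α := β)) (t := Finset.univ (α := β × α))]
    rw [sum_comm, sum_prod_type]
    simp only [← sum_mul, hz]
    simp

lemma exchR_phi (hs : s ^ 2 = q) (D : QuantumData q s) (b : Bool) (h : fusion α β γ ≠ 0) (i' : β)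
    (l'' : α) (c : γ) : ∑ i, ∑ i'', q ^ α.rep.wt i * exchR q s b α β (i, i') (i'', l'') * D.phi α β
    γ (i, i'') c = lam D b α β γ * q ^ α.rep.wt l'' * D.phi β α γ (i', l'') c := by
  have q0 := q0 (q := q)
  cases b
  · have h1 := congr_fun₂ (braid_mul_phi D h) (i', l'') c
    rw [mmul_apply, sum_prod_type, msmul_apply, smul_eq_mul] at h1
    have h2 := congrArg (q ^ α.rep.wt l'' * ·) h1
    rw [mul_comm (lam _ _ _ _ _), mul_assoc]
    refine Eq.trans ?_ h2
    simp only [mul_sum]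
    refine sum_congr rfl fun i _ => sum_congr rfl fun i'' _ => ?_
    simp only [exchR, Bool.false_eq_true, if_false, of_apply, braidM, submatrix_apply,
      Prod.swap_prod_mk, id]
    rw [zpow_sub₀ q0]
    field_simp
  · simp only [phi_eq_braid hs D h]
    have hz : ∀ (k : β) (x : α), ∑ i, ∑ i'', (q ^ α.rep.wt i * univR q s β.rep (dual q α.rep) (i',
      i) (i'', l'')) * univR q s β.rep α.rep (i'', i) (k, x) = if i' = k then if x = l'' then q ^
      α.rep.wt x else 0 else 0 := by
      intro k x
      have h := zigzag_left hs β ((posL α).isRep) ((posL α).isNil) ((negL α).isRep) ((negL α).isNil)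
        (rowM_K_isIntertwiner α.rep) (graded_K α.rep q) k i' x l''
      simp only [K, diagonal_apply, ite_mul, zero_mul, sum_ite_irrel, sum_const_zero, sum_ite_eq,
        mem_univ, if_true] at h
      refine Eq.trans ?_ h
      refine sum_congr rfl fun i _ => sum_congr rfl fun i'' _ => ?_
      exact mul_right_comm _ _ _
    have e : ∀ (i : α) (i'' : β), q ^ α.rep.wt i * exchR q s true α β (i, i') (i'', l'') * (lam D
      true α β γ * ∑ p, univR q s β.rep α.rep (i'', i) p * D.phi β α γ p c) = ∑ p, (q ^ α.rep.wt i *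
      univR q s β.rep (dual q α.rep) (i', i) (i'', l'') * univR q s β.rep α.rep (i'', i) p) * (lam D
      true α β γ * D.phi β α γ p c) := by
      intro i i''
      rw [mul_sum, mul_sum]
      refine sum_congr rfl fun p _ => ?_
      change q ^ α.rep.wt i * univR q s β.rep (dual q α.rep) (i', i) (i'', l'') * _ = _
      ring
    simp only [e]
    simp only [sum_comm (s := Finset.univ (α := β)) (t := Finset.univ (α := β × α))]
    rw [sum_comm, sum_prod_type]
    simp only [← sum_mul, hz]
    simp
    ring

lemma sign_mul_sign (a : ℕ) : (-1 : ℂ) ^ a * (-1) ^ a = 1 := by rw [← mul_pow]; simp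

/-- The factor of an exchange under an evaluation. -/
def evFactor (D : QuantumData q s) (b : Bool) (α : Phys q) : ℂ := if b then D.kappa α ^ 2 * (-1) ^
  α.1 else (D.kappa α ^ 2 * (-1) ^ α.1)⁻¹

lemma evFactor_ne_zero (D : QuantumData q s) (b : Bool) (α : Phys q) : evFactor D b α ≠ 0 := by
  have h : D.kappa α ^ 2 * (-1) ^ α.1 ≠ 0 :=
    mul_ne_zero (pow_ne_zero _ (kappa_ne_zero D α)) (pow_ne_zero _ (by simp))
  cases b
  · exact inv_ne_zero h
  · exact h

lemma ev_mul_braid (hs : s ^ 2 = q) (D : QuantumData q s) (α : Phys q) : evM α * braidM q s α.rep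
    (dual q α.rep) = evFactor D true α • rowM (α.rep.K q) := by
  have h5 : evM α * braidM q s α.rep (dual q α.rep) = rowM (drinfeldU s α).transpose := by
    ext x ⟨i, j⟩
    simp [evM, rowM, braidM, mmul_apply, sum_prod_type, mone_apply, drinfeldU]
  have hk := pow_ne_zero 2 (kappa_ne_zero D α)
  have h6 : drinfeldU s α = (D.kappa α ^ 2 * (-1) ^ α.1) • α.rep.K q := by
    have h := congrArg (D.kappa α ^ 2 • ·) (mu_eq D hs α)
    simp only [QuantumData.mu, smul_smul] at h
    rwa [mul_inv_cancel₀ hk, one_smul] at h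
  rw [h5, h6, transpose_smul, K_transpose]
  rfl

lemma K_mul_braid (hs : s ^ 2 = q) (D : QuantumData q s) (α : Phys q) : rowM (α.rep.K q) * braidM q
    s (dual q α.rep) α.rep = evFactor D true α • evM α := by
  have J := dualIso_isIntertwiner α
  have hk := pow_ne_zero 2 (kappa_ne_zero D α)
  have hJ : α.rep.K q * dualIso α = (-1 : ℂ) ^ α.1 • (dualIso α).transpose := by
    have h1 : (D.mu α).transpose * dualIso α = (dualIso α).transpose := by
      rw [QuantumData.mu, transpose_smul, smul_mul, drinfeldU_eq D hs, smul_smul, inv_mul_cancel₀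
        hk, one_smul]
    rw [← h1, mu_eq D hs, transpose_smul, K_transpose, smul_mul, smul_smul, sign_mul_sign, one_smul]
  have hp := (rowM_K_isIntertwiner α.rep).comp ((isIntertwiner_one (X := α.rep)).kron J)
  have h1 := functional_braid D hs hp
  have h2 : (I[α] ⊗ₖ dualIso α) * braidM q s α.rep α.rep = braidM q s (dual q α.rep) α.rep *
    (dualIso α ⊗ₖ I[α]) := by
    have h3 := univR_natural_left (q := q) (Y := α.rep) (s := s) J.1 (dualIso_graded α)
    have h4 := congrArg (fun M => M.submatrix (swap : α × α → _) id) h3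
    refine Eq.trans ?_ h4.symm
    rw [← kronecker_submatrix_swap]
    exact submatrix_mul_bijective swap_bijective _ _ _ _
  rw [mmul_assoc, h2, ← mmul_assoc, rowM_mul_kron, transpose_one, mone_mul, hJ] at h1
  have h3 : rowM ((-1 : ℂ) ^ α.1 • (dualIso α).transpose) = (-1 : ℂ) ^ α.1 • (evM α * (dualIso α ⊗ₖ
    I[α])) := by
    rw [evM, rowM_mul_kron, mmul_one, mmul_one]
    rfl
  rw [h3, smul_smul, ← smul_mul] at h1
  have h4 := congrArg (fun M => M * (dualIsoInv α ⊗ₖ I[α])) h1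
  simp only [mmul_assoc, ← mul_kronecker_mul, dualIso_mul_inv, one_kronecker_one, mmul_one] at h4
  exact h4

lemma K_mul_exchL (hs : s ^ 2 = q) (D : QuantumData q s) (b : Bool) (α : Phys q) : rowM (α.rep.K q)
    * exchL q s b α α = evFactor D b α • evM α := by
  cases b
  · have h := mul_eq_one_comm'.1 (exchL_mul_braid hs α α)
    have h1 := congrArg (· * exchL q s false α α) (ev_mul_braid hs D α)
    simp only [mmul_assoc, h, mmul_one, smul_mul] at h1
    rw [h1, smul_smul, evFactor, evFactor, if_neg (by simp), if_pos rfl, inv_mul_cancel₀, one_smul]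
    exact evFactor_ne_zero D true α
  · exact K_mul_braid hs D α

lemma ev_mul_exchR (hs : s ^ 2 = q) (D : QuantumData q s) (b : Bool) (α : Phys q) : evM α * exchR q
    s b α α = evFactor D b α • rowM (α.rep.K q) := by
  cases b
  · have h := mul_eq_one_comm'.1 (exchR_mul_braid hs α α)
    have h1 := congrArg (· * exchR q s false α α) (K_mul_braid hs D α)
    simp only [mmul_assoc, h, mmul_one, smul_mul] at h1
    rw [h1, smul_smul, evFactor, evFactor, if_neg (by simp), if_pos rfl, inv_mul_cancel₀, one_smul]
    exact evFactor_ne_zero D true α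
  · exact ev_mul_braid hs D α

/-! ### The dual quantum group -/

section Gamma

lemma fusion_zero_left (D : QuantumData q s) (h : α ≠ γ) : D.psi (Phys.zero q) α γ = 0 := by
  have h1 := (D.psi_intertwiner (Phys.zero q) α γ).comp (D.phi_intertwiner (Phys.zero q) α α)
  have h2 := intertwiner_eq_zero_of_ne h h1
  rw [D.phi_zero_left] at h2
  ext m ⟨z, i⟩
  have h3 := congr_fun₂ h2 m i
  have hz : z = 0 := Subsingleton.elim (α := Fin 1) z 0
  subst hz
  rw [mmul_apply, sum_eq_single ((0, i) : (Phys.zero q) × α)] at h3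
  · simpa using h3
  · rintro ⟨z, k⟩ _ hne
    rw [of_apply, if_neg, mul_zero]
    rintro rfl
    exact hne (Prod.ext (Subsingleton.elim (α := Fin 1) z 0) rfl)
  · simp

lemma fusion_zero_right (D : QuantumData q s) (h : α ≠ γ) : D.psi α (Phys.zero q) γ = 0 := by
  have h1 := (D.psi_intertwiner α (Phys.zero q) γ).comp (D.phi_intertwiner α (Phys.zero q) α)
  have h2 := intertwiner_eq_zero_of_ne h h1
  rw [D.phi_zero_right] at h2
  ext m ⟨i, z⟩
  have h3 := congr_fun₂ h2 m i
  have hz : z = 0 := Subsingleton.elim (α := Fin 1) z 0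
  subst hz
  rw [mmul_apply, sum_eq_single ((i, 0) : α × (Phys.zero q))] at h3
  · simpa using h3
  · rintro ⟨k, z⟩ _ hne
    rw [of_apply, if_neg, mul_zero]
    rintro rfl
    exact hne (Prod.ext rfl (Subsingleton.elim (α := Fin 1) z 0))
  · simp

lemma unit_mul_g (D : QuantumData q s) (α : Phys q) (i j : α) : unit Dᵒ * g Dᵒ α i j = g Dᵒ α i
    j := by
  rw [unit, g_mul_g, finsum_eq_single _ α]
  · simp [D.phi_zero_left, D.psi_zero_left]
  · intro γ h
    simp [fusion_zero_left D h.symm]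

lemma g_mul_unit (D : QuantumData q s) (α : Phys q) (i j : α) : g Dᵒ α i j * unit Dᵒ = g Dᵒ α i
    j := by
  rw [unit, g_mul_g, finsum_eq_single _ α]
  · simp [D.phi_zero_right, D.psi_zero_right]
  · intro γ h
    simp [fusion_zero_right D h.symm]

lemma unit_mul (D : QuantumData q s) (x : DualQG Dᵒ) : unit Dᵒ * x = x := by
  have h : mulMap Dᵒ (unit Dᵒ) = LinearMap.id := linearMap_ext _ fun α i j => unit_mul_g D α i j
  exact LinearMap.congr_fun h x

lemma mul_unit (D : QuantumData q s) (x : DualQG Dᵒ) : x * unit Dᵒ = x := by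
  have h : (mulMap Dᵒ).flip (unit Dᵒ) = LinearMap.id := linearMap_ext _ fun α i j => g_mul_unit D α
    i j
  exact LinearMap.congr_fun h x

lemma counit_unit (D : QuantumData q s) : counit Dᵒ (unit Dᵒ) = 1 := by
  rw [unit, counit_g, if_pos rfl]

lemma labG_pos (D : QuantumData q s) (α : Phys q) : labG D (posL α) = g Dᵒ α := by
  rw [labG, SLabel.iso, SLabel.isoInv, if_pos rfl, if_pos rfl, lmul_one, rmul_one]

lemma antipodeG_eq (D : QuantumData q s) (α : Phys q) (i j : α) : antipodeG Dᵒ α i j = labG D (negL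
    α) j i := by
  simp only [labG, lmul, rmul, SLabel.iso, SLabel.isoInv, Bool.false_eq_true, if_false, antipodeG,
    smul_sum, smul_smul]

lemma counit_labG (D : QuantumData q s) (X : SLabel q) : coproj (labG D X) = 1 := by
  rw [labG, coproj_lmul, coproj_rmul, coproj_g, mone_mul, X.iso_mul_inv]

section Coactions

variable {G : ι → ι → DualQG Dᵒ} {H : κ → κ → DualQG Dᵒ}

lemma Coact.mul_coproj {A : M[κ, ι]} (h : Coact A G H) : A * coproj G = coproj H * A := by
  have h1 := congrArg coproj h
  rwa [coproj_lmul, coproj_rmul] at h1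

/-- The trivial coaction. -/
def unitG (D : QuantumData q s) : Fin 1 → Fin 1 → DualQG Dᵒ := fun _ _ => unit Dᵒ

lemma channels_unit (D : QuantumData q s) : Channels D (spin q 0) (unitG D) := by
  have h := channels_phys D (Phys.zero q)
  have e : DualQG.g Dᵒ (Phys.zero q) = unitG D := by
    funext i j
    rw [Subsingleton.elim (α := Fin 1) i 0, Subsingleton.elim (α := Fin 1) j 0]
    rfl
  rw [e] at h
  exact h

lemma coproj_unit (D : QuantumData q s) : coproj (unitG D) = 1 := by
  ext i j
  rw [Subsingleton.elim i j, one_apply_eq]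
  exact counit_unit D

lemma coproj_tmul_lab (D : QuantumData q s) (X Y : SLabel q) : coproj (tmul (labG D X) (labG D Y)) =
    D.pairProj X Y := by
  have h : tmul (labG D X) (labG D Y) = lmul (X.iso ⊗ₖ Y.iso) (rmul (tmul (DualQG.g Dᵒ X.2)
    (DualQG.g Dᵒ Y.2)) (X.isoInv ⊗ₖ Y.isoInv)) := by
    funext p p'
    have h1 := tmul_lmul X.iso Y.iso (rmul (DualQG.g Dᵒ X.2) X.isoInv) (rmul (DualQG.g Dᵒ Y.2)
      Y.isoInv) p p'
    refine h1.trans ?_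
    congr 1
    funext p p'
    exact tmul_rmul X.isoInv Y.isoInv (DualQG.g Dᵒ X.2) (DualQG.g Dᵒ Y.2) p p'
  rw [h, coproj_lmul, coproj_rmul, tmul_g, coproj_sum, pairProj_eq, cgProj, mmul_assoc]
  simp only [coproj_lmul, coproj_rmul, coproj_g, mone_mul]

lemma coact_functional (D : QuantumData q s) {X Y : SLabel q} {p : M[Fin 1, X.2 × Y.2]} (hp : IsHom
    (X.rep ⊠ Y.rep) (spin q 0) p) : Coact p (tmul (labG D X) (labG D Y)) (unitG D) := by
  have h := ((channels_label D X).tensor (channels_label D Y)).coact (channels_unit D) hp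
  rwa [coproj_unit, mone_mul, coproj_tmul_lab, functional_mul_pairProj D hp] at h

lemma coact_vector (D : QuantumData q s) {X Y : SLabel q} {p : M[X.2 × Y.2, Fin 1]} (hp : IsHom
    (spin q 0) (X.rep ⊠ Y.rep) p) : Coact p (unitG D) (tmul (labG D X) (labG D Y)) := by
  have h := (channels_unit D).coact ((channels_label D X).tensor (channels_label D Y)) hp
  rwa [coproj_unit, mmul_one, coproj_tmul_lab, pairProj_mul_vector D hp] at h

/-- Negligible endomorphisms drop out between a product of two labels and the trivial
representation. -/
lemma functional_mul_mul (D : QuantumData q s) {A B : SLabel q} {P : M[ι, ι]} (hP : IsHom X X P) (hn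
    : Negligible q X (1 - P)) {f : M[ι, A.2 × B.2]} (hf : IsHom (A.rep ⊠ B.rep) X f) {g : M[Fin 1,
    ι]} (hg : IsHom X (spin q 0) g) : g * P * f = g * f := by
  have hJ := (A.iso_isIntertwiner).kron (B.iso_isIntertwiner)
  have h0 := hg.comp ((isIntertwiner_one.sub hP).comp hf)
  have h1 := functional_mul_pairProj D h0
  have h2 : g * ((1 - P) * f) = 0 := by
    rw [← h1, pairProj_eq, cgProj, mmul_sum, msum_mul, mmul_sum]
    refine sum_eq_zero fun γ _ => ?_
    have h3 := hn.between (isIntertwiner_one.sub hP) (γ' := Phys.zero q) ((hf.comp hJ).comp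
      (D.phi_intertwiner A.2 B.2 γ)) hg
    have h4 : g * ((1 - P) * f) * ((A.iso ⊗ₖ B.iso) * (D.phi A.2 B.2 γ * D.psi A.2 B.2 γ) *
      (A.isoInv ⊗ₖ B.isoInv)) = (g * (1 - P) * (f * (A.iso ⊗ₖ B.iso) * D.phi A.2 B.2 γ)) * (D.psi
      A.2 B.2 γ * (A.isoInv ⊗ₖ B.isoInv)) := by
      simp only [mmul_assoc]
    rw [h4]
    exact (congrArg (· * _) h3).trans (mzero_mul _)
  rw [msub_mul, mone_mul, mmul_sub, sub_eq_zero] at h2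
  rw [mmul_assoc, ← h2]

end Coactions

end Gamma

/-! ### Absorbing projectors -/

lemma pairProj_mul_of_fusion (D : QuantumData q s) {X Y Z : SLabel q} (h : fusion X.2 Y.2 Z.2 ≠ 0)
    {f : M[X.2 × Y.2, Z.2]} (hf : IsHom Z.rep (X.rep ⊠ Y.rep) f) : D.pairProj X Y * f = f := by
  obtain ⟨x, hx⟩ := eq_smul_phi D h ((((X.isoInv_isIntertwiner).kron (Y.isoInv_isIntertwiner)).comp
    hf).comp (Z.iso_isIntertwiner))
  have h1 := congrArg (fun M => cgProj D X.2 Y.2 * M * Z.isoInv) hx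
  have h2 := congrArg (fun M => M * Z.isoInv) hx
  simp only [mmul_smul, cgProj_mul_phi] at h1
  rw [← h2] at h1
  simp only [mmul_assoc, Z.iso_mul_inv, mmul_one] at h1
  have h3 := congrArg (fun M => (X.iso ⊗ₖ Y.iso) * M) h1
  simp only [← mmul_assoc, ← mul_kronecker_mul, X.iso_mul_inv, Y.iso_mul_inv, one_kronecker_one,
    mone_mul] at h3
  rw [pairProj_eq]
  simpa only [mmul_assoc] using h3

lemma coact_of_fusion (D : QuantumData q s) {X Y Z : SLabel q} (h : fusion X.2 Y.2 Z.2 ≠ 0) {f :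
    M[X.2 × Y.2, Z.2]} (hf : IsHom Z.rep (X.rep ⊠ Y.rep) f) : Coact f (labG D Z) (tmul (labG D X)
    (labG D Y)) := by
  have h1 := (channels_label D Z).coact ((channels_label D X).tensor (channels_label D Y)) hf
  rwa [coproj_tmul_lab, pairProj_mul_of_fusion D h hf, counit_labG, mmul_one] at h1

lemma coact_braid (hs : s ^ 2 = q) (D : QuantumData q s) (X Y : SLabel q) : Coact (braidM q s X.rep
    Y.rep * D.pairProj X Y) (tmul (labG D X) (labG D Y)) (tmul (labG D Y) (labG D X)) := by
  have h1 := ((channels_label D X).tensor (channels_label D Y)).coact ((channels_label D Y).tensor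
    (channels_label D X)) (X.braid_isIntertwiner hs Y)
  rw [coproj_tmul_lab, coproj_tmul_lab] at h1
  have h2 : D.pairProj Y X * (braidM q s X.rep Y.rep * D.pairProj X Y) = braidM q s X.rep Y.rep *
    D.pairProj X Y := by
    rw [pairProj_eq D X Y, cgProj, mmul_sum, msum_mul, mmul_sum, mmul_sum]
    refine sum_congr rfl fun γ hγ => ?_
    have hJ := (X.iso_isIntertwiner).kron (Y.iso_isIntertwiner)
    have h3 := pairProj_mul_of_fusion D (X := Y) (Y := X) (Z := posL γ) (fusion_symm hs D
      ((mem_fusionSet).1 hγ)) (((X.braid_isIntertwiner hs Y).comp hJ).comp (D.phi_intertwiner X.2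
      Y.2 γ))
    have h4 := congrArg (fun M => M * (D.psi X.2 Y.2 γ * (X.isoInv ⊗ₖ Y.isoInv))) h3
    simp only [mmul_assoc] at h4 ⊢
    exact h4
  rwa [mmul_assoc, h2] at h1

lemma rtt (hs : s ^ 2 = q) (D : QuantumData q s) (X Y : SLabel q) (i i₀ : X.2) (k k₀ : Y.2) : ∑ i',
    ∑ k', D.truncR s X Y (i, k) (i', k') • (labG D X i' i₀ * labG D Y k' k₀) = ∑ i', ∑ k', D.truncR
    s X Y (i', k') (i₀, k₀) • (labG D Y k k' * labG D X i i') := by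
  have h := congr_fun₂ (coact_braid hs D X Y) (k, i) (i₀, k₀)
  simp only [lmul, rmul, sum_prod_type] at h
  refine h.trans ?_
  rw [sum_comm]
  rfl

/-! ### The symmetry algebra -/

section Symmetry

variable (D)

/-- Elementary tensors of `⨂ Γ_z`. -/
abbrev pure (F : V → DualQG Dᵒ) : GaugeSym V Dᵒ := PiTensorProduct.tprod ℂ F

/-- Elementary tensors, as functions of the factor at one vertex. -/
def pureAt (F : V → DualQG Dᵒ) (x : V) : DualQG Dᵒ →ₗ[ℂ] GaugeSym V Dᵒ := (PiTensorProduct.tprod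
  ℂ).toLinearMap F x

lemma pureAt_apply (F : V → DualQG Dᵒ) (x : V) (a : DualQG Dᵒ) : pureAt D F x a = pure D
    (Function.update F x a) := rfl

lemma pure_mul (F F' : V → DualQG Dᵒ) : pure D F * pure D F' = pure D fun v => F v * F' v :=
    PiTensorProduct.tprod_mul_tprod _ _

lemma symUnit_mul (x : GaugeSym V Dᵒ) : symUnit D * x = x := by
  induction x using PiTensorProduct.induction_on with
  | smul_tprod c F =>
    rw [mul_smul_comm]
    refine congrArg (c • ·) ((pure_mul D _ _).trans ?_)
    simp only [unit_mul]
  | add x y hx hy => rw [mul_add, hx, hy]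

lemma mul_symUnit (x : GaugeSym V Dᵒ) : x * symUnit D = x := by
  induction x using PiTensorProduct.induction_on with
  | smul_tprod c F =>
    rw [smul_mul_assoc]
    refine congrArg (c • ·) ((pure_mul D _ _).trans ?_)
    simp only [mul_unit]
  | add x y hx hy => rw [add_mul, hx, hy]

lemma atVertices_mul (x y : V) (a b a' b' : DualQG Dᵒ) : atVertices D x y a b * atVertices D x y a'
    b' = atVertices D x y (a * a') (b * b') := by
  refine (pure_mul D _ _).trans (congrArg (pure D) (funext fun v => ?_))
  split_ifs <;> simp only [unit_mul]

lemma atVertices_unit (x y : V) : atVertices D x y (unit Dᵒ) (unit Dᵒ) = symUnit D :=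
  congrArg (pure D) (funext fun v => by simp only [ite_self])

lemma sum_atVertices_left (x y : V) {I : Type} [Fintype I] (f : I → ℂ) (a : I → DualQG Dᵒ) (b :
    DualQG Dᵒ) : ∑ i, f i • atVertices D x y (a i) b = atVertices D x y (∑ i, f i • a i) b := by
  have e : ∀ a, atVertices D x y a b = pureAt D (fun z => if z = y then b else unit Dᵒ) x a := by
    intro a
    rw [pureAt_apply]
    refine congrArg (pure D) (funext fun v => ?_)
    by_cases hv : v = x
    · subst hv; simp
    · simp [hv]
  simp only [e, map_sum, map_smul]

lemma sum_atVertices_right {x y : V} (h : x ≠ y) {I : Type} [Fintype I] (f : I → ℂ) (b : I → DualQG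
    Dᵒ) (a : DualQG Dᵒ) : ∑ i, f i • atVertices D x y a (b i) = atVertices D x y a (∑ i, f i • b
    i) := by
  have e : ∀ a b, atVertices D x y a b = atVertices D y x b a := by
    intro a b
    refine congrArg (pure D) (funext fun v => ?_)
    by_cases hv : v = x
    · subst hv; simp [h]
    · simp [hv]
  simp only [e a, sum_atVertices_left]

lemma sum_atVertices {x y : V} (h : x ≠ y) {I J : Type} [Fintype I] [Fintype J] (f : I → ℂ) (f' : J
    → ℂ) (a : I → DualQG Dᵒ) (b : J → DualQG Dᵒ) : ∑ i, ∑ j, (f i * f' j) • atVertices D x y (a i)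
    (b j) = atVertices D x y (∑ i, f i • a i) (∑ j, f' j • b j) := by
  simp only [← sum_atVertices_left, ← sum_atVertices_right D h, smul_sum, smul_smul]
  exact sum_comm.trans (sum_congr rfl fun _ _ => sum_congr rfl fun _ _ => by rw [mul_comm])

/-- The counit of `⨂ Γ_z`. -/
def symCounit : GaugeSym V Dᵒ →ₗ[ℂ] ℂ := PiTensorProduct.lift ((MultilinearMap.mkPiAlgebra ℂ V
  ℂ).compLinearMap fun _ => counit Dᵒ)

lemma symCounit_pure (F : V → DualQG Dᵒ) : symCounit D (pure D F) = ∏ v, counit Dᵒ (F v) := by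
  simp [symCounit]

/-- The matrix elements of a link with end points `x` and `y`, where the sign of the label at `x`
is given. -/
def edgeF (x y : V) (σ : Bool) (α : Phys q) (p p' : α × α) (v : V) : DualQG Dᵒ := if v = x then labG
  D (σ, α) p.1 p'.1 else if v = y then labG D (!σ, α) p.2 p'.2 else unit Dᵒ

lemma edgeF_left (x y : V) (σ : Bool) (α : Phys q) (p p' : α × α) : edgeF D x y σ α p p' x = labG D
    (σ, α) p.1 p'.1 := if_pos rfl

lemma edgeF_right {x y : V} (h : x ≠ y) (σ : Bool) (α : Phys q) (p p' : α × α) : edgeF D x y σ α p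
    p' y = labG D (!σ, α) p.2 p'.2 := by
  rw [edgeF, if_neg h.symm, if_pos rfl]

lemma edgeF_ne {x y v : V} (h : v ≠ x) (h' : v ≠ y) (σ : Bool) (α : Phys q) (p p' : α × α) : edgeF D
    x y σ α p p' v = unit Dᵒ := by
  rw [edgeF, if_neg h, if_neg h']

lemma edgeF_swap {x y : V} (h : x ≠ y) (α : Phys q) (p p' : α × α) : edgeF D y x false α p p' =
    edgeF D x y true α p.swap p'.swap := by
  funext v
  by_cases hx : v = x
  · subst hx; rw [edgeF_left, edgeF_right D h.symm]; rfl
  · by_cases hy : v = y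
    · subst hy; rw [edgeF_left, edgeF_right D h]; rfl
    · rw [edgeF_ne D hx hy, edgeF_ne D hy hx]

end Symmetry

/-! ### Covariant families -/

section Covariant

variable {A Λ : Type} [NonUnitalNonAssocSemiring A] [Module ℂ A] [NonUnitalNonAssocSemiring Λ]
  [Module ℂ Λ] [IsScalarTower ℂ Λ Λ] [SMulCommClass ℂ Λ Λ] (Ω : A →ₗ[ℂ] Λ ⊗[ℂ] GaugeSym V Dᵒ)
  (π : A →ₗ[ℂ] Λ)

/-- The family `a` transforms with the matrix elements `F`. -/
def Cov {I : Type} [Fintype I] (a : I → A) (F : I → I → V → DualQG Dᵒ) : Prop := ∀ i, Ω (a i) = ∑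
  i', π (a i') ⊗ₜ[ℂ] pure D (F i i')

variable {Ω π} {I J : Type} [Fintype I] [Fintype J] {a : I → A} {b : J → A}
  {F : I → I → V → DualQG Dᵒ} {F' : J → J → V → DualQG Dᵒ}

lemma Cov.mul (hΩ : ∀ x y, Ω (x * y) = Ω x * Ω y) (hπ : ∀ x y, π (x * y) = π x * π y) (ha : Cov Ω π
    a F) (hb : Cov Ω π b F') : Cov Ω π (fun p : I × J => a p.1 * b p.2) fun p p' v => F p.1 p'.1 v *
    F' p.2 p'.2 v := by
  intro p
  rw [hΩ, ha, hb, sum_prod_type]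
  refine (sum_mul_sum (R := Λ ⊗[ℂ] GaugeSym V Dᵒ) _ _ _ _).trans ?_
  refine sum_congr rfl fun i _ => sum_congr rfl fun j _ => ?_
  rw [Algebra.TensorProduct.tmul_mul_tmul, pure_mul, hπ]

lemma Cov.linear (ha : Cov Ω π a F) (M : J → I → ℂ) (h : ∀ j i', ∑ i, M j i • pure D (F i i') = ∑
    j', M j' i' • pure D (F' j j')) : Cov Ω π (fun j => ∑ i, M j i • a i) F' := by
  intro j
  rw [map_sum]
  simp only [map_smul, ha _, smul_sum, map_sum, sum_tmul]
  rw [sum_comm]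
  have e : ∀ i' : I, ∑ i, M j i • (π (a i') ⊗ₜ[ℂ] pure D (F i i')) = ∑ j', (M j' i' • π (a i'))
    ⊗ₜ[ℂ] pure D (F' j j') := by
    intro i'
    simp only [← tmul_smul, ← tmul_sum, h, TensorProduct.smul_tmul]
  simp only [e]
  exact sum_comm

lemma Cov.sum {C : Type} (S : Finset C) {b : C → I → A} (hb : ∀ c ∈ S, Cov Ω π (b c) F) : Cov Ω π
    (fun i => ∑ c ∈ S, b c i) F := by
  intro i
  rw [map_sum, sum_congr rfl fun c hc => hb c hc i, sum_comm]
  simp only [map_sum, sum_tmul]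

lemma Cov.ext (ha : Cov Ω π a F) {a' : I → A} (ha' : Cov Ω π a' F) (h : ∀ i, π (a i) = π (a' i)) (i
    : I) : Ω (a i) = Ω (a' i) := by
  rw [ha, ha']
  simp only [h]

lemma Cov.congr (ha : Cov Ω π a F) {a' : I → A} {F₁ : I → I → V → DualQG Dᵒ} (h : ∀ i, a i = a' i)
    (h' : ∀ i i', F i i' = F₁ i i') : Cov Ω π a' F₁ := by
  obtain rfl : a = a' := funext h
  obtain rfl : F = F₁ := funext fun i => funext (h' i)
  exact ha

lemma Cov.reindex (ha : Cov Ω π a F) (e : J → I) (he : Bijective e) : Cov Ω π (fun j => a (e j)) fun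
    j j' => F (e j) (e j') := by
  intro j
  rw [ha]
  exact (sum_bijective e he _ _ fun _ => rfl).symm

end Covariant

section

/-! ### The coaction on the free algebra -/

lemma CiliatedSurface.link_ne {x y : V} (h : T.link x y) : x ≠ y := by
  obtain ⟨c, h | h⟩ := T.link_edge h
  · exact T.face_ne h
  · exact (T.face_ne h).symm

variable (T) (D)

/-- The quotient map. -/
def toGauge : FreeGauge T q →ₗ[ℂ] GaugeAlg T D where
  toFun x := (x : (ringConGen (GaugeRel T D)).Quotient)
  map_add' _ _ := rfl
  map_smul' _ _ := rfl

lemma toGauge_mul (x y : FreeGauge T q) : toGauge T D (x * y) = toGauge T D x * toGauge T D y :=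
  rfl

lemma toGauge_one : toGauge T D 1 = 1 := rfl

lemma toGauge_rel {x y : FreeGauge T q} (h : GaugeRel T D x y) :
    toGauge T D x = toGauge T D y :=
  (RingCon.eq (c := ringConGen (GaugeRel T D))).2 (RingConGen.Rel.of _ _ h)

/-- The coaction on generators. -/
def genCoaction (x : Gen T q) : GaugeAlg T D ⊗[ℂ] GaugeSym V Dᵒ := ∑ p : x.lab × x.lab, uEl T D
  x.link x.lab p.1 p.2 ⊗ₜ[ℂ] pure D (edgeF D x.link.tgt x.link.src true x.lab (x.row, x.col) p)

section

variable {Λ : Type} [NonAssocSemiring Λ] [Module ℂ Λ] [IsScalarTower ℂ Λ Λ] [SMulCommClass ℂ Λ Λ]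
  (w : Λ ⊗[ℂ] GaugeSym V Dᵒ)

lemma one_tmul_symUnit_mul : ((1 : Λ) ⊗ₜ[ℂ] symUnit D) * w = w := by
  induction w using TensorProduct.induction_on with
  | zero => exact map_zero (Algebra.TensorProduct.mul (R := ℂ) (A := Λ) (B := GaugeSym V Dᵒ) _)
  | tmul a b => rw [Algebra.TensorProduct.tmul_mul_tmul, one_mul, symUnit_mul]
  | add a b ha hb => exact (map_add (Algebra.TensorProduct.mul (R := ℂ) (A := Λ) (B := GaugeSym V Dᵒ) _) a b).trans (congrArg₂ _ ha hb)

lemma mul_one_tmul_symUnit : w * ((1 : Λ) ⊗ₜ[ℂ] symUnit D) = w := by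
  induction w using TensorProduct.induction_on with
  | zero => exact LinearMap.map_zero₂ (Algebra.TensorProduct.mul (R := ℂ) (A := Λ) (B := GaugeSym V Dᵒ)) _
  | tmul a b => rw [Algebra.TensorProduct.tmul_mul_tmul, mul_one, mul_symUnit]
  | add a b ha hb =>
    exact (LinearMap.map_add₂ (Algebra.TensorProduct.mul (R := ℂ) (A := Λ) (B := GaugeSym V Dᵒ)) a b _).trans (congrArg₂ _ ha hb)

end

/-- The coaction on monomials. -/
def monCoaction : WithOne (FreeMagma (Gen T q)) →ₙ* GaugeAlg T D ⊗[ℂ] GaugeSym V Dᵒ where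
  toFun := WithOne.recOneCoe ((1 : GaugeAlg T D) ⊗ₜ[ℂ] symUnit D) (FreeMagma.lift (genCoaction T D))
  map_mul' x y := by
    refine WithOne.cases_on x ?_ fun x => WithOne.cases_on y ?_ fun y => map_mul (FreeMagma.lift
      (genCoaction T D)) x y
    · rw [one_mul]; exact (one_tmul_symUnit_mul D _).symm
    · rw [mul_one]; exact (mul_one_tmul_symUnit D _).symm

/-- The coaction on the free algebra. -/
def freeCoaction : FreeGauge T q →ₙₐ[ℂ] GaugeAlg T D ⊗[ℂ] GaugeSym V Dᵒ := MonoidAlgebra.liftMagma ℂ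
  (monCoaction T D)

lemma freeCoaction_of (m : WithOne (FreeMagma (Gen T q))) : freeCoaction T D (MonoidAlgebra.of ℂ _
    m) = monCoaction T D m := by
  have h := DFunLike.congr_fun ((MonoidAlgebra.liftMagma ℂ (A := GaugeAlg T D ⊗[ℂ] GaugeSym V
    Dᵒ)).symm_apply_apply (monCoaction T D)) m
  rw [MonoidAlgebra.liftMagma_symm_apply] at h
  exact h

lemma freeCoaction_one : freeCoaction T D 1 = (1 : GaugeAlg T D) ⊗ₜ[ℂ] symUnit D := freeCoaction_of
  T D 1

lemma freeCoaction_gen (l : Link T) (α : Phys q) (i j : α) : freeCoaction T D (gen l α i j) =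
  genCoaction T D ⟨l, α, i, j⟩ := freeCoaction_of T D _

/-- The coaction on the free algebra, as a linear map. -/
def freeCoactionLin : FreeGauge T q →ₗ[ℂ] GaugeAlg T D ⊗[ℂ] GaugeSym V Dᵒ where
  toFun := freeCoaction T D
  map_add' := map_add (freeCoaction T D)
  map_smul' := map_smul (freeCoaction T D)

/-- Covariance in the free algebra. -/
abbrev FreeCov {I : Type} [Fintype I] (a : I → FreeGauge T q) (F : I → I → V → DualQG Dᵒ) : Prop :=
  Cov (freeCoactionLin T D) (toGauge T D) a F

variable {T D}

lemma freeCov_gen (l : Link T) (α : Phys q) :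
    FreeCov T D (fun p : α × α => gen l α p.1 p.2)
      (edgeF D l.tgt l.src true α) :=
  fun p => freeCoaction_gen T D l α p.1 p.2

lemma FreeCov.mul {I J : Type} [Fintype I] [Fintype J] {a : I → FreeGauge T q} {b : J → FreeGauge T
  q} {F : I → I → V → DualQG Dᵒ} {F' : J → J → V → DualQG Dᵒ} (ha : FreeCov T D a F) (hb : FreeCov T
  D b F') : FreeCov T D (fun p : I × J => a p.1 * b p.2) fun p p' v => F p.1 p'.1 v * F' p.2 p'.2
  v := Cov.mul (fun x y => map_mul (freeCoaction T D) x y) (toGauge_mul T D) ha hb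

/-- The end points of a link, in the order given by a sign. -/
def Link.near (l : Link T) : Bool → V
  | true => l.tgt
  | false => l.src

/-- The symbols `u^α(l)`, with the indices in the order given by a sign. -/
def slotGen (l : Link T) (σ : Bool) (α : Phys q) (p : α × α) : FreeGauge T q := match σ with
  | true => gen l α p.1 p.2
  | false => gen l α p.2 p.1

lemma Link.near_ne (l : Link T) (σ : Bool) : l.near σ ≠ l.near !σ := by
  cases σ
  · exact (CiliatedSurface.link_ne l.isLink).symm
  · exact CiliatedSurface.link_ne l.isLink

lemma freeCov_slotGen (l : Link T) (σ : Bool) (α : Phys q) : FreeCov T D (slotGen l σ α) (edgeF D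
    (l.near σ) (l.near !σ) σ α) := by
  cases σ
  · refine Cov.congr ((freeCov_gen l α).reindex swap swap_bijective) (fun _ => rfl) fun p p' =>
      (edgeF_swap D (CiliatedSurface.link_ne l.isLink) α p p').symm
  · exact freeCov_gen l α

/-! ### The relations are respected -/

lemma toGauge_exchange (l l' : Link T) (σ τ : Bool) (α β : Phys q) (hx : l.near σ = l'.near τ) (hc :
    T.cil (l.near σ) (l.near !σ) (l'.near !τ)) (p : α × α) (r : β × β) : toGauge T D (slotGen l' τ β
    r * slotGen l σ α p) = toGauge T D (∑ i, ∑ k, D.truncR s (σ, α) (τ, β) (p.1, r.1) (i, k) •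
    (slotGen l σ α (i, p.2) * slotGen l' τ β (k, r.2))) := by
  refine toGauge_rel T D ?_
  cases σ <;> cases τ
  · exact .exchange_start_start l l' α β _ _ _ _ hx hc
  · exact .exchange_start_end l l' α β _ _ _ _ hx hc
  · exact .exchange_end_start l l' α β _ _ _ _ hx hc
  · exact .exchange_end_end l l' α β _ _ _ _ hx hc

lemma freeCoaction_exchange (hs : s ^ 2 = q) (l l' : Link T) (σ τ : Bool) (α β : Phys q) (hx :
    l.near σ = l'.near τ) (hc : T.cil (l.near σ) (l.near !σ) (l'.near !τ)) (p : α × α) (r : β × β) :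
    freeCoaction T D (slotGen l' τ β r * slotGen l σ α p) = freeCoaction T D (∑ i, ∑ k, D.truncR s
    (σ, α) (τ, β) (p.1, r.1) (i, k) • (slotGen l σ α (i, p.2) * slotGen l' τ β (k, r.2))) := by
  have h1 := (freeCov_slotGen (D := D) l' τ β).mul (freeCov_slotGen (D := D) l σ α)
  have h2 := (freeCov_slotGen (D := D) l σ α).mul (freeCov_slotGen (D := D) l' τ β)
  have n1 := l.near_ne σ
  have n2 := l'.near_ne τ
  have n3 : l.near (!σ) ≠ l'.near !τ := fun h => T.cil_irrefl _ _ (h ▸ hc)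
  rw [← hx] at n2
  have h3 := h2.linear (J := (β × β) × (α × α)) (F' := fun p p' v => edgeF D (l'.near τ) (l'.near
    !τ) τ β p.1 p'.1 v * edgeF D (l.near σ) (l.near !σ) σ α p.2 p'.2 v) (fun a b => if b.1.2 = a.2.2
    then if b.2.2 = a.1.2 then
      D.truncR s (σ, α) (τ, β) (a.2.1, a.1.1) (b.1.1, b.2.1) else 0 else 0) (by
    rintro ⟨⟨r1, r2⟩, ⟨p1, p2⟩⟩ ⟨⟨p1', p2'⟩, ⟨r1', r2'⟩⟩
    set G : V → DualQG Dᵒ := fun v => if v = l.near !σ then labG D (!σ, α) p2 p2' else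
        if v = l'.near !τ then labG D (!τ, β) r2 r2' else unit Dᵒ with hG
    have e1 : ∀ i k, (pure D fun v => edgeF D (l.near σ) (l.near !σ) σ α (i, p2) (p1', p2') v *
      edgeF D (l'.near τ) (l'.near !τ) τ β (k, r2) (r1', r2') v) = pureAt D G (l.near σ) (labG D (σ,
      α) i p1' * labG D (τ, β) k r1') := by
      intro i k
      rw [pureAt_apply, ← hx]
      refine congrArg (pure D) (funext fun v => ?_)
      by_cases hv : v = l.near σ
      · subst hv; simp [edgeF]
      · by_cases hy : v = l.near !σ
        · subst hy; simp [edgeF, hG, n3, hv, mul_unit]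
        · by_cases hz : v = l'.near !τ
          · subst hz; simp [edgeF, hG, n3.symm, hv, unit_mul]
          · simp [edgeF, hG, hv, hy, hz, unit_mul]
    have e2 : ∀ i k, (pure D fun v => edgeF D (l'.near τ) (l'.near !τ) τ β (r1, r2) (k, r2') v *
      edgeF D (l.near σ) (l.near !σ) σ α (p1, p2) (i, p2') v) = pureAt D G (l.near σ) (labG D (τ, β)
      r1 k * labG D (σ, α) p1 i) := by
      intro i k
      rw [pureAt_apply, ← hx]
      refine congrArg (pure D) (funext fun v => ?_)
      by_cases hv : v = l.near σ
      · subst hv; simp [edgeF]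
      · by_cases hy : v = l.near !σ
        · subst hy; simp [edgeF, hG, n3, hv, unit_mul]
        · by_cases hz : v = l'.near !τ
          · subst hz; simp [edgeF, hG, n3.symm, hv, mul_unit]
          · simp [edgeF, hG, hv, hy, hz, unit_mul]
    have h := congrArg (pureAt D G (l.near σ)) (rtt hs D (σ, α) (τ, β) p1 p1' r1 r1')
    simp only [map_sum, map_smul, ← e1, ← e2] at h
    simpa [sum_prod_type, ite_smul, sum_ite_irrel] using h.trans sum_comm)
  refine Cov.ext (a := fun p : (β × β) × (α × α) => slotGen l' τ β p.1 * slotGen l σ α p.2) h1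
    (a' := fun p => ∑ i, ∑ k, D.truncR s (σ, α) (τ, β) (p.2.1, p.1.1) (i, k) • (slotGen l σ α (i,
    p.2.2) * slotGen l' τ β (k, p.1.2))) (h3.congr ?_ fun _ _ => rfl) (fun i => toGauge_exchange l
    l' σ τ α β hx hc i.2 i.1) (r, p)
  rintro ⟨⟨r1, r2⟩, ⟨p1, p2⟩⟩
  simp [sum_prod_type, ite_smul, sum_ite_irrel]

end

lemma Cov.at {Λ A : Type} [NonUnitalNonAssocSemiring A] [Module ℂ A] [NonUnitalNonAssocSemiring Λ]
  [Module ℂ Λ] [IsScalarTower ℂ Λ Λ] [SMulCommClass ℂ Λ Λ] {Ω : A →ₗ[ℂ] Λ ⊗[ℂ] GaugeSym V Dᵒ} {π : A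
  →ₗ[ℂ] Λ} {I : Type} [Fintype I] {a : I → A} {F F' : I → I → V → DualQG Dᵒ} (h : Cov Ω π a F) (hF :
  ∀ i i', F i i' = F' i i') : Cov Ω π a F' := h.congr (fun _ => rfl) hF

lemma freeCoaction_disjoint (l l' : Link T) (α β : Phys q) (h1 : l.tgt ≠ l'.tgt) (h2 : l.tgt ≠
    l'.src) (h3 : l.src ≠ l'.tgt) (h4 : l.src ≠ l'.src) (p : α × α) (r : β × β) : freeCoaction T D
    (gen l α p.1 p.2 * gen l' β r.1 r.2) = freeCoaction T D (gen l' β r.1 r.2 * gen l α p.1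
    p.2) := by
  have e1 := (freeCov_gen (D := D) l α).mul (freeCov_gen (D := D) l' β)
  have e2 := ((freeCov_gen (D := D) l' β).mul (freeCov_gen (D := D) l α)).reindex swap
    swap_bijective
  refine Cov.ext e1 (e2.at fun x x' => funext fun v => ?_) (fun x => toGauge_rel T D (.disjoint l l'
    α β _ _ _ _ h1 h2 h3 h4)) (p, r)
  simp only [Prod.fst_swap, Prod.snd_swap, edgeF]
  split_ifs with c1 c2 c3 c4 <;> simp_all [unit_mul, mul_unit]

lemma sum_dim_zero {M : Type} [AddCommMonoid M] (f : (Phys.zero q) → M) : ∑ i, f i = f 0 :=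
  Fintype.sum_eq_single 0 fun x hx => (hx (Subsingleton.elim (α := Fin 1) x 0)).elim

lemma labG_zero (D : QuantumData q s) (σ : Bool) (i j : (Phys.zero q)) : labG D (σ, Phys.zero q) i j
    = unit Dᵒ := by
  obtain rfl : i = 0 := Subsingleton.elim (α := Fin 1) i 0
  obtain rfl : j = 0 := Subsingleton.elim (α := Fin 1) j 0
  cases σ
  · rw [← antipodeG_eq, antipodeG, sum_dim_zero, sum_dim_zero]
    refine Eq.trans ?_ (one_smul ℂ _)
    refine congrArg (· • _) ?_
    simp [dualIso, dualIsoInv, Phys.zero]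
    exact mul_one 1
  · rw [labG_pos]; rfl

lemma freeCoaction_trivial (l : Link T) : freeCoaction T D (gen l (Phys.zero q) 0 0) = freeCoaction
    T D 1 := by
  rw [freeCoaction_gen, freeCoaction_one, genCoaction]
  refine (sum_prod_type _).trans ((sum_dim_zero _).trans ((sum_dim_zero _).trans ?_))
  refine congrArg₂ (· ⊗ₜ[ℂ] ·) (toGauge_rel T D (.trivial l)) (congrArg (pure D) (funext fun v =>
    ?_))
  simp only [edgeF, labG_zero, ite_self]

lemma atVertices_smul_left (x y : V) (c : ℂ) (a b : DualQG Dᵒ) : atVertices D x y (c • a) b = c •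
    atVertices D x y a b := by
  simpa using (sum_atVertices_left D x y (fun _ : Unit => c) (fun _ => a) b).symm

lemma atVertices_smul_right {x y : V} (h : x ≠ y) (c : ℂ) (a b : DualQG Dᵒ) : atVertices D x y a (c
    • b) = c • atVertices D x y a b := by
  simpa using (sum_atVertices_right D h (fun _ : Unit => c) (fun _ => b) a).symm

lemma pure_edgeF_mul (x y : V) (σ τ : Bool) (p p' : α × α) (r r' : β × β) : (pure D fun v => edgeF D
    x y σ α p p' v * edgeF D x y τ β r r' v) = atVertices D x y (labG D (σ, α) p.1 p'.1 * labG D (τ,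
    β) r.1 r'.1) (labG D (!σ, α) p.2 p'.2 * labG D (!τ, β) r.2 r'.2) := by
  rw [← atVertices_mul]
  exact (pure_mul D _ _).symm

lemma atVertices_swap {x y : V} (h : x ≠ y) (a b : DualQG Dᵒ) : atVertices D x y a b = atVertices D
    y x b a := by
  refine congrArg (pure D) (funext fun v => ?_)
  by_cases hv : v = x
  · subst hv; simp [h]
  · simp [hv]

lemma pure_edgeF_mul_swap {x y : V} (h : x ≠ y) (σ τ : Bool) (p p' : α × α) (r r' : β × β) : (pure D
    fun v => edgeF D x y σ α p p' v * edgeF D y x τ β r r' v) = atVertices D x y (labG D (σ, α) p.1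
    p'.1 * labG D (!τ, β) r.2 r'.2) (labG D (!σ, α) p.2 p'.2 * labG D (τ, β) r.1 r'.1) := by
  rw [← atVertices_mul, atVertices_swap h (labG D (!τ, β) r.2 r'.2)]
  exact (pure_mul D _ _).symm

lemma freeCov_inverse (l l' : Link T) (α : Phys q) (ht : l'.tgt = l.src) (hs' : l'.src = l.tgt) :
    FreeCov T D (fun x : α × α => ∑ k, ∑ k', D.A α k k' • (gen l α x.1 k * gen l' α k' x.2)) fun x
    x' v => if v = l.tgt then labG D (posL α) x.1 x'.1 * labG D (negL α) x.2 x'.2 else if v = l.src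
    then unit Dᵒ else unit Dᵒ := by
  have n := CiliatedSurface.link_ne l.isLink
  refine (((freeCov_gen (D := D) l α).mul (freeCov_gen (D := D) l' α)).linear (J := α × α) (fun x p
    => if x.1 = p.1.1 then if x.2 = p.2.2 then
      D.A α p.1.2 p.2.1 else 0 else 0) ?_).congr ?_ fun _ _ => rfl
  · rintro ⟨i, j⟩ ⟨⟨i', k⟩, ⟨k', j'⟩⟩
    rw [ht, hs']
    have h := congr_fun₂ (coact_functional D (X := negL α) (Y := posL α) (D.A_intertwiner α)) 0 (k,
      k')
    simp only [lmul, rmul, univ_unique, sum_singleton, tmul, unitG, sum_prod_type, of_apply] at h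
    have h1 := congrArg (atVertices D l.tgt l.src (labG D (posL α) i i' * labG D (negL α) j j')) h
    rw [← Fintype.sum_prod_type', ← sum_atVertices_right D n, sum_prod_type] at h1
    rw [atVertices_smul_right n] at h1
    simp only [pure_edgeF_mul_swap n]
    simp [sum_prod_type, ite_smul, sum_ite_irrel, atVertices, pure] at h1 ⊢
    exact h1
  · rintro ⟨i, j⟩
    simp [sum_prod_type, ite_smul, sum_ite_irrel]

lemma freeCoaction_inverse (l l' : Link T) (α : Phys q) (ht : l'.tgt = l.src) (hs' : l'.src = l.tgt)
    (i j : α) : freeCoaction T D (∑ k, ∑ k', D.A α k k' • (gen l α i k * gen l' α k' j)) =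
    freeCoaction T D (D.B α i j • 1) := by
  refine (freeCov_inverse l l' α ht hs' (i, j)).trans ?_
  simp only [fun x : α × α => toGauge_rel T D (.inverse l l' α x.1 x.2 ht hs'), map_smul,
    toGauge_one, TensorProduct.smul_tmul, ← tmul_sum]
  rw [freeCoaction_one, ← tmul_smul]
  refine congrArg ((1 : GaugeAlg T D) ⊗ₜ[ℂ] ·) ?_
  have h3 := congr_fun₂ (coact_vector D (X := posL α) (Y := negL α) (D.B_intertwiner α)) (i, j) 0
  simp only [lmul, rmul, univ_unique, sum_singleton, tmul, unitG, of_apply] at h3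
  refine (sum_atVertices_left D l.tgt l.src (fun x : α × α => D.B α x.1 x.2) (fun x => labG D (posL
    α) i x.1 * labG D (negL α) j x.2) (unit Dᵒ)).trans ?_
  rw [← h3]
  rw [atVertices_smul_left, atVertices_unit]

lemma freeCoaction_decomposition (l : Link T) (α β : Phys q) (i j : α) (k m : β) : freeCoaction T D
    (gen l α i j * gen l β k m) = freeCoaction T D (∑ᶠ γ : Phys q, ∑ a, ∑ b, (D.phi α β γ (i, k) a *
    (D.psi β α γ * D.fInv β α) b (m, j)) • gen l γ a b) := by
  have n := CiliatedSurface.link_ne l.isLink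
  have fin : ∀ x : (α × α) × (β × β), (∑ᶠ γ : Phys q, ∑ a, ∑ b, (D.phi α β γ (x.1.1, x.2.1) a *
    (D.psi β α γ * D.fInv β α) b (x.2.2, x.1.2)) • gen l γ a b : FreeGauge T q) = ∑ γ ∈ fusionSet α
    β, ∑ p : γ × γ, (D.phi α β γ (x.1.1, x.2.1) p.1 * (D.psi β α γ * D.fInv β α) p.2 (x.2.2, x.1.2))
    • gen l γ p.1 p.2 := by
    intro x
    simp only [sum_prod_type]
    exact finsum_fusion _ fun γ h => by simp [D.phi_eq_zero _ _ _ h]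
  have h1 : FreeCov T D (fun x : (α × α) × (β × β) => ∑ γ ∈ fusionSet α β, ∑ p : γ × γ, (D.phi α β γ
    (x.1.1, x.2.1) p.1 * (D.psi β α γ * D.fInv β α) p.2 (x.2.2, x.1.2)) • gen l γ p.1 p.2) fun p p'
    v => edgeF D l.tgt l.src true α p.1 p'.1 v * edgeF D l.tgt l.src true β p.2 p'.2 v := by
    refine Cov.sum _ fun γ hγ => (freeCov_gen l γ).linear _ ?_
    have hf := (mem_fusionSet).1 hγ
    rintro ⟨⟨i, j⟩, ⟨k, m⟩⟩ ⟨a, b⟩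
    have e1 := congr_fun₂ (coact_of_fusion D (X := posL α) (Y := posL β) (Z := posL γ) hf
      (D.phi_intertwiner α β γ)) (i, k) a
    have hi : IsHom (dual q γ.rep) (dual q α.rep ⊠ dual q β.rep) ((D.psi β α γ * D.fInv β
      α).transpose.submatrix swap id) := by
      rw [isIntertwiner_dual_tensor', psi_mul_fInv D β α]
      exact (D.psi_intertwiner β α γ).smul _
    have e2 := congr_fun₂ (coact_of_fusion D (X := negL α) (Y := negL β) (Z := negL γ) hf hi) (j, m)
      b
    simp only [lmul, rmul, tmul, submatrix_apply, transpose_apply, id] at e1 e2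
    have h := congrArg₂ (atVertices D l.tgt l.src) e1 e2
    rw [← sum_atVertices D n, ← sum_atVertices D n] at h
    simp only [pure_edgeF_mul]
    simp only [sum_prod_type] at h ⊢
    refine h.trans ?_
    refine sum_congr rfl fun i' _ => ?_
    exact sum_comm
  refine Cov.ext ((freeCov_gen (D := D) l α).mul (freeCov_gen (D := D) l β)) (a' := fun x => ∑ᶠ γ :
    Phys q, ∑ a, ∑ b, (D.phi α β γ (x.1.1, x.2.1) a * (D.psi β α γ * D.fInv β α) b (x.2.2, x.1.2)) •
    gen l γ a b) (h1.congr (fun x => (fin x).symm) fun _ _ => rfl) (fun x => toGauge_rel T D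
    (.decomposition l α β _ _ _ _)) ((i, j), (k, m))

/-! ### Monomials -/

lemma labG_cast {X : SLabel q} {σ : Bool} (h : X = (σ, α)) (i i' : α) (e : α.dim = X.2.dim) : labG D
    X (Fin.cast e i) (Fin.cast e i') = labG D (σ, α) i i' := by
  subst h; rfl

lemma labG_eq_unit {X : SLabel q} (h : X = posL (Phys.zero q)) (i i' : X.2) : labG D X i i' = unit
    Dᵒ := by
  subst h; exact labG_zero D true i i'

lemma labG_vertexLabel (v : V) (l : Link T) (α : Phys q) (p p' : α × α) : labG D (vertexLabel v l α)
    (vertexIndex v l α p.1 p.2) (vertexIndex v l α p'.1 p'.2) = edgeF D l.tgt l.src true α p p'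
    v := by
  unfold vertexIndex edgeF
  split_ifs with h1 h2
  · exact labG_cast (by simp [vertexLabel, h1]) _ _ _
  · exact labG_cast (by rw [vertexLabel, if_neg h1, if_pos h2]; rfl) _ _ _
  · exact labG_eq_unit (by rw [vertexLabel, if_neg h1, if_neg h2]) _ _

lemma vertexIndex_bijective (l : Link T) (α : Phys q) : Bijective fun (p : α × α) (v : V) =>
    vertexIndex v l α p.1 p.2 := by
  have n := CiliatedSurface.link_ne l.isLink
  have h1 : vertexLabel l.tgt l α = posL α := if_pos rfl
  have h2 : vertexLabel l.src l α = negL α := by rw [vertexLabel, if_neg n.symm, if_pos rfl]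
  have e1 : ∀ p : α × α, vertexIndex l.tgt l α p.1 p.2 =
      Fin.cast (by rw [h1]) p.1 := fun p => dif_pos rfl
  have e2 : ∀ p : α × α, vertexIndex l.src l α p.1 p.2 =
      Fin.cast (by rw [h2]) p.2 := fun p => by rw [vertexIndex, dif_neg n.symm, dif_pos rfl]
  refine ⟨fun p p' h => Prod.ext ?_ ?_, fun x => ⟨(Fin.cast (by rw [h1]) (x l.tgt),
    Fin.cast (by rw [h2]) (x l.src)), funext fun v => ?_⟩⟩
  · have := congrFun h l.tgt
    simp only [e1] at this
    exact Fin.cast_injective _ this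
  · have := congrFun h l.src
    simp only [e2] at this
    exact Fin.cast_injective _ this
  · by_cases c1 : v = l.tgt
    · subst c1; exact (e1 _).trans (by simp)
    · by_cases c2 : v = l.src
      · subst c2; exact (e2 _).trans (by simp)
      · have : Subsingleton (Fin (vertexLabel v l α).2.dim) := by
          rw [show vertexLabel v l α = posL (Phys.zero q) by rw [vertexLabel, if_neg c1, if_neg c2]]
          exact inferInstanceAs (Subsingleton (Fin 1))
        exact Subsingleton.elim _ _

section Trees

variable {n : ℕ} (l : Fin n → Link T) (α : Fin n → Phys q)

/-- The dimensions of the letters. -/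
abbrev letterDim (k : Fin n) : ℕ := (α k).dim

/-- The labels of the letters at a vertex. -/
abbrev labelAt (v : V) (k : Fin n) : SLabel q := vertexLabel v (l k) (α k)

/-- The indices of the letters at a vertex. -/
def indexAt (v : V) (p : (∀ k, (α k)) × (∀ k, (α k))) : Idx (labelAt l α v) := fun k => vertexIndex
  v (l k) (α k) (p.1 k) (p.2 k)

lemma indexAt_bijective : Bijective fun p (v : V) => indexAt l α v p := by
  constructor
  · intro p p' h
    have e : ∀ k, (p.1 k, p.2 k) = (p'.1 k, p'.2 k) := fun k => (vertexIndex_bijective (l k) (α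
      k)).1 (funext fun v => congr_fun₂ h v k)
    exact Prod.ext (funext fun k => congrArg Prod.fst (e k)) (funext fun k => congrArg Prod.snd (e k))
  · intro x
    choose f hf using fun k => (vertexIndex_bijective (l k) (α k)).2 fun v => x v k
    exact ⟨(fun k => (f k).1, fun k => (f k).2), funext fun v => funext fun k => congrFun (hf k) v⟩

/-- Monomials along a parenthesized word. -/
def treeMon : ∀ t : FreeMagma (Fin n), TIx (letterDim α) t × TIx (letterDim α) t → FreeGauge T q
  | .of k => fun p => gen (l k) (α k) p.1 p.2
  | .mul t₁ t₂ => fun p => treeMon t₁ (p.1.1, p.2.1) * treeMon t₂ (p.1.2, p.2.2)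

/-- The indices at a vertex of the letters of a parenthesized word. -/
def treeIdx (v : V) : ∀ t : FreeMagma (Fin n), TIx (letterDim α) t × TIx (letterDim α) t → TIx (wdim
    (labelAt l α v)) t
  | .of k => fun p => vertexIndex v (l k) (α k) p.1 p.2
  | .mul t₁ t₂ => fun p => (treeIdx v t₁ (p.1.1, p.2.1), treeIdx v t₂ (p.1.2, p.2.2))

/-- The matrix elements with which a parenthesized word transforms at a vertex. -/
def treeF (D : QuantumData q s) (t : FreeMagma (Fin n)) (p p' : TIx (letterDim α) t × TIx (letterDim
  α) t) (v : V) : DualQG Dᵒ := treeG (labelAt l α v) D t (treeIdx l α v t p) (treeIdx l α v t p')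

lemma freeCov_tree : ∀ t : FreeMagma (Fin n), FreeCov T D (treeMon l α t) (treeF l α D t)
  | .of k => (freeCov_gen (l k) (α k)).at fun p p' => funext fun v =>
    (labG_vertexLabel v (l k) (α k) p p').symm
  | .mul t₁ t₂ => by
    have h := ((freeCov_tree t₁).mul (freeCov_tree t₂)).reindex (J := (TIx (letterDim α) t₁ × TIx
      (letterDim α) t₂) × (TIx (letterDim α) t₁ × TIx (letterDim α) t₂)) (Equiv.prodProdProdComm _ _
      _ _) (Equiv.bijective _)
    exact h

variable {l α}

/-- Restriction of a pair of multi-indices. -/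
def restrictPair (t : FreeMagma (Fin n)) (p : (∀ k, (α k)) × (∀ k, (α k))) : TIx (letterDim α) t ×
  TIx (letterDim α) t := (TIx.restrict (d := letterDim α) p.1 t, TIx.restrict (d := letterDim α) p.2
  t)

lemma restrictPair_bijective {t : FreeMagma (Fin n)} (ht : leaves t = finRange n) : Bijective
  (restrictPair (α := α) t) := (TIx.restrict_bijective (d := letterDim α) ht).prodMap
  (TIx.restrict_bijective ht)

lemma treeMon_restrict (p : (∀ k, (α k)) × (∀ k, (α k))) : ∀ t, treeMon l α t (restrictPair t p) =
    monomial l α t p.1 p.2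
  | .of _ => rfl
  | .mul t₁ t₂ => congrArg₂ (· * ·) (treeMon_restrict p t₁) (treeMon_restrict p t₂)

lemma treeIdx_restrict (v : V) (p : (∀ k, (α k)) × (∀ k, (α k))) : ∀ t, treeIdx l α v t
    (restrictPair t p) = TIx.restrict (indexAt l α v p) t
  | .of _ => rfl
  | .mul t₁ t₂ => Prod.ext (treeIdx_restrict v p t₁) (treeIdx_restrict v p t₂)

lemma freeCov_monomial {t : FreeMagma (Fin n)} (ht : leaves t = finRange n) : FreeCov T D (fun p =>
  monomial l α t p.1 p.2) fun p p' v => idxG (labelAt l α v) D t (indexAt l α v p) (indexAt l α v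
  p') := ((freeCov_tree l α t).reindex _ (restrictPair_bijective ht)).congr (fun p =>
  treeMon_restrict p t) fun p p' => funext fun v => by
      rw [treeF, treeIdx_restrict, treeIdx_restrict, idxG]

/-- Sums over the indices of the letters of products over the vertices. -/
lemma sum_pure (x : ∀ v, Idx (labelAt l α v) → ℂ) (G : ∀ v, Idx (labelAt l α v) → DualQG Dᵒ) : ∑ p,
    (∏ v, x v (indexAt l α v p)) • pure D (fun v => G v (indexAt l α v p)) = pure D fun v => ∑ I, x
    v I • G v I := by
  have h : (pure D fun v => ∑ I, x v I • G v I) = ∑ r : ∀ v, Idx (labelAt l α v), pure D fun v => x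
    v (r v) • G v (r v) := MultilinearMap.map_sum (PiTensorProduct.tprod ℂ) _
  rw [h]
  refine sum_bijective _ (indexAt_bijective l α) _ _ fun p => ?_
  exact (MultilinearMap.map_smul_univ (PiTensorProduct.tprod ℂ) _ _).symm

lemma freeCoaction_quasiAssoc {t t' : FreeMagma (Fin n)} (ht : leaves t = finRange n) (ht' : leaves
    t' = finRange n) (i j : ∀ k, (α k)) : freeCoaction T D (∑ i' : ∀ k, (α k), ∑ j' : ∀ k, (α k), (∏
    x : V, D.theta (fun k => vertexLabel x (l k) (α k)) t t' (fun k => vertexIndex x (l k) (α k) (i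
    k) (j k)) (fun k => vertexIndex x (l k) (α k) (i' k) (j' k))) • monomial l α t i' j') =
    freeCoaction T D (monomial l α t' i j) := by
  have h1 := (freeCov_monomial (l := l) (α := α) (D := D) ht).linear (J := (∀ k, (α k)) × (∀ k, (α
    k))) (F' := fun p p' v => idxG (labelAt l α v) D t' (indexAt l α v p) (indexAt l α v p')) (fun p
    p' => ∏ v : V, D.theta (labelAt l α v) t t' (indexAt l α v p) (indexAt l α v p')) (by
    intro p p'
    refine (sum_pure (fun v I => D.theta (labelAt l α v) t t' (indexAt l α v p) I) fun v I => idxG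
      (labelAt l α v) D t I (indexAt l α v p')).trans ?_
    refine Eq.trans ?_ (sum_pure (fun v I => D.theta (labelAt l α v) t t' I (indexAt l α v p')) fun
      v I => idxG (labelAt l α v) D t' (indexAt l α v p) I).symm
    exact congrArg (pure D) (funext fun v => congr_fun₂ (theta_coact D ht ht') _ _))
  refine Cov.ext (a := fun p => ∑ i' : ∀ k, (α k), ∑ j' : ∀ k, (α k), (∏ x : V, D.theta (labelAt l α
    x) t t' (indexAt l α x p) (indexAt l α x (i', j'))) • monomial l α t i' j') (h1.congr (fun p =>
    sum_prod_type _) fun _ _ => rfl) (freeCov_monomial ht') (fun p => toGauge_rel T D (.quasiAssoc l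
    α t t' p.1 p.2 ht ht')) (i, j)

end Trees

/-! ### The gauge coaction -/

lemma freeCoaction_rel (hs : s ^ 2 = q) {x y : FreeGauge T q} (h : GaugeRel T D x y) : freeCoaction
    T D x = freeCoaction T D y := by
  cases h with
  | exchange_end_end l l' α β i j k m h hc =>
    exact freeCoaction_exchange hs l l' true true α β h hc (i, j) (k, m)
  | exchange_start_end l l' α β i j k m h hc =>
    exact freeCoaction_exchange hs l l' false true α β h hc (j, i) (k, m)
  | exchange_end_start l l' α β i j k m h hc =>
    exact freeCoaction_exchange hs l l' true false α β h hc (i, j) (m, k)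
  | exchange_start_start l l' α β i j k m h hc =>
    exact freeCoaction_exchange hs l l' false false α β h hc (j, i) (m, k)
  | inverse l l' α i j h h' => exact freeCoaction_inverse l l' α h h' i j
  | disjoint l l' α β i j k m h1 h2 h3 h4 =>
    exact freeCoaction_disjoint l l' α β h1 h2 h3 h4 (i, j) (k, m)
  | decomposition l α β i j k m => exact freeCoaction_decomposition l α β i j k m
  | trivial l => exact freeCoaction_trivial l
  | quasiAssoc l α t t' i j ht ht' => exact freeCoaction_quasiAssoc ht ht' i j

/-- The equations that hold after the coaction. -/
def coactionCon (T : CiliatedSurface V) (D : QuantumData q s) : RingCon (FreeGauge T q) where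
  r x y := freeCoaction T D x = freeCoaction T D y
  iseqv := ⟨fun _ => rfl, fun h => h.symm, fun h h' => h.trans h'⟩
  mul' h h' := (map_mul (freeCoaction T D) _ _).trans
    ((congrArg₂ (· * ·) h h').trans (map_mul (freeCoaction T D) _ _).symm)
  add' h h' := (map_add (freeCoaction T D) _ _).trans
    ((congrArg₂ (· + ·) h h').trans (map_add (freeCoaction T D) _ _).symm)

lemma freeCoaction_congr (hs : s ^ 2 = q) {x y : FreeGauge T q} (h : ringConGen (GaugeRel T D) x y)
  : freeCoaction T D x = freeCoaction T D y := (RingCon.ringConGen_le (c := coactionCon T D)).2 (fun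
  _ _ h => freeCoaction_rel hs h) h

/-- The gauge coaction. -/
def gaugeCoaction (hs : s ^ 2 = q) :
    GaugeAlg T D →ₙₐ[ℂ] GaugeAlg T D ⊗[ℂ] GaugeSym V Dᵒ where
  toFun := Quotient.lift (freeCoaction T D) fun _ _ h => freeCoaction_congr hs h
  map_smul' c x := by
    induction x using Quotient.inductionOn with
    | h x => exact map_smul (freeCoaction T D) c x
  map_zero' := map_zero (freeCoaction T D)
  map_add' x y := by
    induction x using Quotient.inductionOn with
    | h x =>
      induction y using Quotient.inductionOn with
      | h y => exact map_add (freeCoaction T D) x y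
  map_mul' x y := by
    induction x using Quotient.inductionOn with
    | h x =>
      induction y using Quotient.inductionOn with
      | h y => exact map_mul (freeCoaction T D) x y

lemma gaugeCoaction_isGaugeCoaction (hs : s ^ 2 = q) : IsGaugeCoaction T D (gaugeCoaction hs) := by
  refine ⟨freeCoaction_one T D, fun l α i j => ?_⟩
  refine (freeCoaction_gen T D l α i j).trans ((sum_prod_type _).trans ?_)
  refine sum_congr rfl fun k _ => sum_congr rfl fun m _ => ?_
  rw [antipodeG_eq, ← labG_pos]
  rfl

/-- The algebra of gauge fields is spanned by the monomials. -/
lemma gauge_induction {p : GaugeAlg T D → Prop} (mon : ∀ x : FreeMagma (Gen T q), p (FreeMagma.lift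
    (fun c => uEl T D c.link c.lab c.row c.col) x)) (add : ∀ x y, p x → p y → p (x + y)) (smul : ∀
    (c : ℂ) x, p x → p (c • x)) (x : GaugeAlg T D) : p x := by
  obtain ⟨v⟩ := T.nonempty
  obtain ⟨l⟩ : Nonempty (Link T) := by
    obtain ⟨y, z, h⟩ := T.vertex_mem v
    by_cases h' : ∃ d, T.face y v d
    · exact ⟨v, y, T.link_interior h h'.choose_spec⟩
    · by_cases h2 : T.link v y
      · exact ⟨v, y, h2⟩
      · by_contra h3
        exact h2 ((T.link_boundary h fun d hd => h' ⟨d, hd⟩).2 fun h4 => h3 ⟨y, v, h4⟩)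
  have one : p 1 := by
    have h := mon (.of ⟨l, Phys.zero q, 0, 0⟩)
    rwa [← toGauge_one, ← toGauge_rel T D (.trivial l)]
  have key : ∀ y : FreeGauge T q, p (toGauge T D y) := by
    intro y
    have mono : ∀ m : WithOne (FreeMagma (Gen T q)), p (toGauge T D (MonoidAlgebra.of ℂ _ m)) := by
      intro m
      refine WithOne.cases_on m one fun m => ?_
      have e : toGauge T D (MonoidAlgebra.of ℂ _ (m : WithOne (FreeMagma (Gen T q)))) =
        FreeMagma.lift (fun c => uEl T D c.link c.lab c.row c.col) m := by
        induction m using recOnMul with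
        | ih1 c => rfl
        | ih2 a b ha hb => rw [map_mul, ← ha, ← hb, WithOne.coe_mul, map_mul, toGauge_mul]
      rw [e]
      exact mon m
    induction y using MonoidAlgebra.induction_linear with
    | zero => rw [map_zero, ← zero_smul ℂ (1 : GaugeAlg T D)]; exact smul _ _ one
    | add a b ha hb => rw [map_add]; exact add _ _ ha hb
    | single m c =>
      rw [← mul_one c, ← smul_eq_mul, ← MonoidAlgebra.smul_single, map_smul]
      exact smul _ _ (mono m)
  induction x using Quotient.inductionOn with
  | h x => exact key x

lemma gaugeCoaction_unique {Ω Ω' : GaugeAlg T D →ₙₐ[ℂ] GaugeAlg T D ⊗[ℂ] GaugeSym V Dᵒ} (h :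
    IsGaugeCoaction T D Ω) (h' : IsGaugeCoaction T D Ω') : Ω = Ω' := by
  ext x
  refine gauge_induction (p := fun x => Ω x = Ω' x) (fun x => ?_) (fun x y hx hy => ?_) (fun c x hx
    => ?_) x
  · induction x using recOnMul with
    | ih1 c => exact (h.2 _ _ _ _).trans (h'.2 _ _ _ _).symm
    | ih2 a b ha hb => rw [map_mul, map_mul, map_mul, ha, hb]
  · rw [map_add, map_add, hx, hy]
  · rw [map_smul, map_smul, hx]

/-! ### Bracketings of four factors -/

section Bracket

variable {B : Type} [NonUnitalNonAssocSemiring B]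

/-- The products `(xy)(zw)` and `(x(yz))w`. -/
def bracket {M : Type} [Mul M] (b : Bool) (x y z w : M) : M := match b with
  | true => x * y * (z * w)
  | false => x * (y * z) * w

variable [Module ℂ B] [SMulCommClass ℂ B B] [IsScalarTower ℂ B B]

/-- The linear map of a bracketing. -/
def bracketMap (B : Type) [NonUnitalNonAssocSemiring B] [Module ℂ B] [SMulCommClass ℂ B B]
  [IsScalarTower ℂ B B] (b : Bool) : (B ⊗[ℂ] B) ⊗[ℂ] (B ⊗[ℂ] B) →ₗ[ℂ] B := match b with
  | true => LinearMap.mul' ℂ B ∘ₗ TensorProduct.map (LinearMap.mul' ℂ B) (LinearMap.mul' ℂ B)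
  | false => LinearMap.mul' ℂ B ∘ₗ (LinearMap.mul' ℂ B).rTensor B ∘ₗ
      (TensorProduct.assoc ℂ B B B).symm.toLinearMap ∘ₗ (((LinearMap.mul' ℂ B).rTensor B ∘ₗ
        (TensorProduct.assoc ℂ B B B).symm.toLinearMap).lTensor B) ∘ₗ
      (TensorProduct.assoc ℂ B B (B ⊗[ℂ] B)).toLinearMap

lemma bracketMap_tmul (b : Bool) (x y z w : B) : bracketMap B b ((x ⊗ₜ y) ⊗ₜ (z ⊗ₜ w)) = bracket b x
    y z w := by
  cases b <;> simp [bracketMap, bracket]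

end Bracket

section Sweedler

variable (D) (Λ : Type) [NonUnitalNonAssocSemiring Λ] [Module ℂ Λ] [IsScalarTower ℂ Λ Λ]
  [SMulCommClass ℂ Λ Λ]

/-- The map `(x γ, y δ, z ζ, w η) ↦ ε([γ δ ζ η]_{b'}) [x y z w]_b`. -/
def sweedler (b b' : Bool) :
    let W := Λ ⊗[ℂ] GaugeSym V Dᵒ
    (W ⊗[ℂ] W) ⊗[ℂ] (W ⊗[ℂ] W) →ₗ[ℂ] Λ :=
  (TensorProduct.rid ℂ Λ).toLinearMap ∘ₗ
    TensorProduct.map (bracketMap Λ b)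
      (symCounit D ∘ₗ bracketMap (GaugeSym V Dᵒ) b') ∘ₗ
    (TensorProduct.tensorTensorTensorComm ℂ _ _ _ _).toLinearMap ∘ₗ
    TensorProduct.map (TensorProduct.tensorTensorTensorComm ℂ _ _ _ _).toLinearMap
      (TensorProduct.tensorTensorTensorComm ℂ _ _ _ _).toLinearMap

lemma sweedler_tmul (b b' : Bool) (x y z w : Λ) (γ δ ζ η : GaugeSym V Dᵒ) :
    sweedler D Λ b b' (((x ⊗ₜ γ) ⊗ₜ (y ⊗ₜ δ)) ⊗ₜ ((z ⊗ₜ ζ) ⊗ₜ (w ⊗ₜ η))) =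
      symCounit D (bracket b' γ δ ζ η) • bracket b x y z w := by
  simp [sweedler, bracketMap_tmul]

lemma bracket_pure (b : Bool) (F₁ F₂ F₃ F₄ : V → DualQG Dᵒ) : bracket b (pure D F₁) (pure D F₂)
    (pure D F₃) (pure D F₄) = pure D fun v => bracket b (F₁ v) (F₂ v) (F₃ v) (F₄ v) := by
  cases b <;> simp only [bracket, pure_mul]

end Sweedler

/-- The gauge coaction as a linear map. -/
def gaugeLin (hs : s ^ 2 = q) : GaugeAlg T D →ₗ[ℂ] GaugeAlg T D ⊗[ℂ] GaugeSym V Dᵒ where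
  toFun := gaugeCoaction hs
  map_add' := map_add (gaugeCoaction hs)
  map_smul' := map_smul (gaugeCoaction hs)

/-- Covariance in the algebra of gauge fields. -/
abbrev GCov (hs : s ^ 2 = q) {I : Type} [Fintype I] (a : I → GaugeAlg T D) (F : I → I → V → DualQG
  Dᵒ) : Prop := Cov (gaugeLin hs) LinearMap.id a F

lemma FreeCov.toGCov (hs : s ^ 2 = q) {I : Type} [Fintype I] {a : I → FreeGauge T q} {F : I → I → V
    → DualQG Dᵒ} (h : FreeCov T D a F) : GCov hs (fun i => toGauge T D (a i)) F := fun i => h i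

lemma GCov.mul {I J : Type} [Fintype I] [Fintype J] {a : I → GaugeAlg T D} {b : J → GaugeAlg T D} {F
  : I → I → V → DualQG Dᵒ} {F' : J → J → V → DualQG Dᵒ} (ha : GCov hs a F) (hb : GCov hs b F') :
  GCov hs (fun p : I × J => a p.1 * b p.2) fun p p' v => F p.1 p'.1 v * F' p.2 p'.2 v := Cov.mul
  (fun x y => map_mul (gaugeCoaction hs) x y) (fun _ _ => rfl) ha hb

/-! ### Words and trees -/

lemma exists_numbering {X : Type} (x : FreeMagma X) : ∃ (n : ℕ) (c : Fin n → X) (t : FreeMagma (Fin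
    n)), leaves t = finRange n ∧ FreeMagma.map c t = x := by
  have lm : ∀ {m n : ℕ} (f : Fin m → Fin n) (t : FreeMagma (Fin m)), leaves (FreeMagma.map f t) =
    (leaves t).map f := by
    intro m n f t
    induction t using recOnMul with
    | ih1 k => rfl
    | ih2 a b ha hb => exact (congrArg₂ (· ++ ·) ha hb).trans List.map_append.symm
  have mm : ∀ {m n : ℕ} (f : Fin m → Fin n) (g : Fin n → X) (t : FreeMagma (Fin m)), FreeMagma.map g
    (FreeMagma.map f t) = FreeMagma.map (g ∘ f) t := by
    intro m n f g t
    induction t using recOnMul with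
    | ih1 k => rfl
    | ih2 a b ha hb => rw [map_mul, map_mul, map_mul, ha, hb]
  induction x using recOnMul with
  | ih1 x => exact ⟨1, fun _ => x, .of 0, rfl, rfl⟩
  | ih2 x y hx hy =>
    obtain ⟨m, c, t, ht, hc⟩ := hx
    obtain ⟨n, d, t', ht', hd⟩ := hy
    refine ⟨m + n, Fin.append c d, FreeMagma.map (Fin.castAdd n) t * FreeMagma.map (Fin.natAdd m)
      t', ?_, ?_⟩
    · change leaves _ ++ leaves _ = _
      rw [lm, lm, ht, ht']
      refine List.ext_getElem (by simp) fun i h1 h2 => ?_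
      simp only [List.length_append, List.length_map, List.length_finRange] at h1
      rw [List.getElem_append]
      split_ifs with h
      · ext; simp
      · simp only [List.length_map, List.length_finRange, not_lt] at h
        ext; simp [h]
    · rw [map_mul, mm, mm, ← hc, ← hd]
      congr 2
      · congr 1; funext i; simp
      · congr 1; funext i; simp

section Words

variable {n : ℕ} {l : Fin n → Link T} {α : Fin n → Phys q}

lemma sum_prod_index (x : ∀ v, Idx (labelAt l α v) → ℂ) : ∑ p, ∏ v, x v (indexAt l α v p) = ∏ v, ∑
    I, x v I := by
  rw [Fintype.prod_sum]
  exact sum_bijective _ (indexAt_bijective l α) _ _ fun p => rfl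

lemma toGauge_theta {t t' : FreeMagma (Fin n)} (ht : leaves t = finRange n) (ht' : leaves t' =
    finRange n) (p) : toGauge T D (monomial l α t' p.1 p.2) = ∑ p', (∏ v, D.theta (labelAt l α v) t
    t' (indexAt l α v p) (indexAt l α v p')) • toGauge T D (monomial l α t p'.1 p'.2) := by
  refine (toGauge_rel T D (.quasiAssoc l α t t' p.1 p.2 ht ht')).symm.trans ?_
  simp only [map_sum, map_smul, sum_prod_type]
  rfl

lemma toGauge_proj {t t' : FreeMagma (Fin n)} (ht : leaves t = finRange n) (ht' : leaves t' =
    finRange n) (p) : toGauge T D (monomial l α t' p.1 p.2) = ∑ p', (∏ v, D.proj (labelAt l α v) t'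
    (indexAt l α v p) (indexAt l α v p')) • toGauge T D (monomial l α t p'.1 p'.2) := by
  have e : ∀ p, toGauge T D (monomial l α t p.1 p.2) = ∑ p', (∏ v, D.proj (labelAt l α v) t (indexAt
    l α v p) (indexAt l α v p')) • toGauge T D (monomial l α t p'.1 p'.2) := by
    intro p
    refine (toGauge_theta ht ht p).trans ?_
    simp only [CGMatrices.theta, proj_eq _, (channels_idx D ht).coproj_idem]
  rw [toGauge_theta ht ht' p, sum_congr rfl fun p' _ => congrArg ((∏ v, D.proj (labelAt l α v) t'
    (indexAt l α v p) (indexAt l α v p')) • ·) (e p')]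
  simp only [smul_sum, smul_smul, ← Finset.prod_mul_distrib]
  rw [sum_comm]
  simp only [← sum_smul]
  refine sum_congr rfl fun p' _ => congrArg (· • _) ?_
  refine Eq.trans ?_ (sum_prod_index (l := l) (α := α) fun v I => D.proj (labelAt l α v) t' (indexAt
    l α v p) I * D.proj (labelAt l α v) t I (indexAt l α v p')).symm
  simp only [CGMatrices.theta, mmul_apply]

lemma toGauge_treeMon {t t' : FreeMagma (Fin n)} (ht : leaves t = finRange n) (ht' : leaves t' =
    finRange n) (p) : toGauge T D (treeMon l α t' (restrictPair t' p)) = ∑ p', symCounit D (pure D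
    (treeF l α D t' (restrictPair t' p) (restrictPair t' p'))) • toGauge T D (treeMon l α t
    (restrictPair t p')) := by
  simp only [treeMon_restrict, toGauge_proj ht ht' p, symCounit_pure, treeF, treeIdx_restrict,
    proj_eq _]
  rfl

end Words

/-! ### Changing the bracketing of covariant families -/

lemma exists_of_map_mul {X Y : Type} {c : X → Y} {t : FreeMagma X} {x y : FreeMagma Y} (h :
    FreeMagma.map c t = x * y) : ∃ t₁ t₂, t = t₁ * t₂ ∧ FreeMagma.map c t₁ = x ∧ FreeMagma.map c t₂
    = y := by
  cases t with
  | of k => cases (h : FreeMagma.of (c k) = FreeMagma.mul x y)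
  | mul t₁ t₂ =>
    injection (h : FreeMagma.mul (FreeMagma.map c t₁) (FreeMagma.map c t₂) = FreeMagma.mul x y)
      with h1 h2
    exact ⟨t₁, t₂, rfl, h1, h2⟩

lemma exists_of_map_bracket {X Y : Type} {c : X → Y} {t : FreeMagma X} {b : Bool} {x y z w :
    FreeMagma Y} (h : FreeMagma.map c t = bracket b x y z w) : ∃ t₁ t₂ t₃ t₄, t = bracket b t₁ t₂ t₃
    t₄ ∧ FreeMagma.map c t₁ = x ∧ FreeMagma.map c t₂ = y ∧ FreeMagma.map c t₃ = z ∧ FreeMagma.map c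
    t₄ = w := by
  cases b
  · obtain ⟨s₁, t₄, rfl, h1, h2⟩ := exists_of_map_mul h
    obtain ⟨t₁, s₂, rfl, h3, h4⟩ := exists_of_map_mul h1
    obtain ⟨t₂, t₃, rfl, h5, h6⟩ := exists_of_map_mul h4
    exact ⟨t₁, t₂, t₃, t₄, rfl, h3, h5, h6, h2⟩
  · obtain ⟨s₁, s₂, rfl, h1, h2⟩ := exists_of_map_mul h
    obtain ⟨t₁, t₂, rfl, h3, h4⟩ := exists_of_map_mul h1
    obtain ⟨t₃, t₄, rfl, h5, h6⟩ := exists_of_map_mul h2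
    exact ⟨t₁, t₂, t₃, t₄, rfl, h3, h4, h5, h6⟩

lemma leaves_bracket {n : ℕ} (b : Bool) (t₁ t₂ t₃ t₄ : FreeMagma (Fin n)) : leaves (bracket b t₁ t₂
    t₃ t₄) = leaves t₁ ++ leaves t₂ ++ (leaves t₃ ++ leaves t₄) := by
  cases b
  · change (leaves t₁ ++ (leaves t₂ ++ leaves t₃)) ++ leaves t₄ = _
    simp only [List.append_assoc]
  · rfl

lemma restrictPair_bracket_bijective {n : ℕ} {α : Fin n → Phys q} {t₁ t₂ t₃ t₄ : FreeMagma (Fin n)}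
  (h : leaves t₁ ++ leaves t₂ ++ (leaves t₃ ++ leaves t₄) = finRange n) : Bijective fun p : (∀ k, (α
  k)) × (∀ k, (α k)) => ((restrictPair t₁ p, restrictPair t₂ p), (restrictPair t₃ p, restrictPair t₄
  p)) := Function.Bijective.comp (((Equiv.prodProdProdComm _ _ _ _).trans (Equiv.prodCongr
  (Equiv.prodProdProdComm _ _ _ _) (Equiv.prodProdProdComm _ _ _ _))).bijective)
  (restrictPair_bijective (t := bracket true t₁ t₂ t₃ t₄) h)

lemma sum_reverse {M I J K L : Type} [AddCommMonoid M] [Fintype I] [Fintype J] [Fintype K] [Fintype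
    L] (f : I → J → K → L → M) : ∑ l, ∑ k, ∑ j, ∑ i, f i j k l = ∑ i, ∑ j, ∑ k, ∑ l, f i j k l := by
  rw [sum_congr rfl fun l _ => (sum_congr rfl fun k _ => sum_comm).trans (sum_comm.trans (sum_congr
    rfl fun i _ => sum_comm)), sum_comm]
  refine sum_congr rfl fun i _ => sum_comm.trans (sum_congr rfl fun j _ => sum_comm)

lemma Cov.sweedler {Λ : Type} [NonUnitalNonAssocSemiring Λ] [Module ℂ Λ] [IsScalarTower ℂ Λ Λ]
    [SMulCommClass ℂ Λ Λ] {Ω : Λ →ₗ[ℂ] Λ ⊗[ℂ] GaugeSym V Dᵒ} {I J K L : Type} [Fintype I] [Fintype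
    J] [Fintype K] [Fintype L] {x : I → Λ} {y : J → Λ} {z : K → Λ} {w : L → Λ} {X : I → I → V →
    DualQG Dᵒ} {Y : J → J → V → DualQG Dᵒ} {Z : K → K → V → DualQG Dᵒ} {W : L → L → V → DualQG Dᵒ}
    (hx : Cov Ω LinearMap.id x X) (hy : Cov Ω LinearMap.id y Y) (hz : Cov Ω LinearMap.id z Z) (hw :
    Cov Ω LinearMap.id w W) (b b' : Bool) (i : I) (j : J) (k : K) (l : L) : QGauge.sweedler D Λ b b'
    ((Ω (x i) ⊗ₜ Ω (y j)) ⊗ₜ (Ω (z k) ⊗ₜ Ω (w l))) = ∑ p : (I × J) × (K × L), (∏ v, counit Dᵒ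
    (bracket b' (X i p.1.1 v) (Y j p.1.2 v) (Z k p.2.1 v) (W l p.2.2 v))) • bracket b (x p.1.1) (y
    p.1.2) (z p.2.1) (w p.2.2) := by
  rw [hx, hy, hz, hw]
  simp only [sum_tmul, tmul_sum, map_sum, sweedler_tmul, bracket_pure, symCounit_pure,
    LinearMap.id_apply, sum_prod_type]
  exact sum_reverse _

lemma sweedler_gauge (hs : s ^ 2 = q) (b b' : Bool) (x y z w : GaugeAlg T D) : sweedler D (GaugeAlg
    T D) b b' ((gaugeLin hs x ⊗ₜ gaugeLin hs y) ⊗ₜ (gaugeLin hs z ⊗ₜ gaugeLin hs w)) = bracket b' x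
    y z w := by
  have lin : ∀ x y z w : GaugeAlg T D, bracket b' x y z w = bracketMap (GaugeAlg T D) b' ((x ⊗ₜ y)
    ⊗ₜ (z ⊗ₜ w)) := fun x y z w => (bracketMap_tmul b' x y z w).symm
  rw [lin]
  induction x using gauge_induction with
  | add x₁ x₂ h₁ h₂ => simp only [map_add, add_tmul, h₁, h₂]
  | smul c x h => simp only [map_smul, ← TensorProduct.smul_tmul', h]
  | mon x =>
  induction y using gauge_induction with
  | add x₁ x₂ h₁ h₂ => simp only [map_add, add_tmul, tmul_add, h₁, h₂]
  | smul c x h => simp only [map_smul, ← TensorProduct.smul_tmul', tmul_smul, h]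
  | mon y =>
  induction z using gauge_induction with
  | add x₁ x₂ h₁ h₂ => simp only [map_add, add_tmul, tmul_add, h₁, h₂]
  | smul c x h => simp only [map_smul, ← TensorProduct.smul_tmul', tmul_smul, h]
  | mon z =>
  induction w using gauge_induction with
  | add x₁ x₂ h₁ h₂ => simp only [map_add, tmul_add, h₁, h₂]
  | smul c x h => simp only [map_smul, tmul_smul, h]
  | mon w =>
  rw [← lin]
  obtain ⟨n, c, t, ht, hc⟩ := exists_numbering (bracket b x y z w)
  obtain ⟨t₁, t₂, t₃, t₄, rfl, rfl, rfl, rfl, rfl⟩ := exists_of_map_bracket hc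
  have ht0 := (leaves_bracket b t₁ t₂ t₃ t₄).symm.trans ht
  have ht' := (leaves_bracket b' t₁ t₂ t₃ t₄).trans ht0
  set l := fun k => (c k).link
  set α := fun k => (c k).lab
  set p : (∀ k, (α k)) × (∀ k, (α k)) := (fun k => (c k).row, fun k => (c k).col)
  have e : ∀ t, FreeMagma.lift (fun c => uEl T D c.link c.lab c.row c.col) (FreeMagma.map c t) =
    toGauge T D (treeMon l α t (restrictPair t p)) := by
    intro t
    induction t using recOnMul with
    | ih1 k => rfl
    | ih2 a b ha hb =>
      rw [map_mul, map_mul, ha, hb]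
      rfl
  have cov := fun t => (freeCov_tree (D := D) l α t).toGCov hs
  simp only [e]
  refine ((cov t₁).sweedler (cov t₂) (cov t₃) (cov t₄) b b' _ _ _ _).trans ?_
  have h := toGauge_treeMon (D := D) (l := l) ht ht' p
  have e1 : ∀ p, toGauge T D (treeMon l α (bracket b t₁ t₂ t₃ t₄) (restrictPair (bracket b t₁ t₂ t₃
    t₄) p)) = bracket b (toGauge T D (treeMon l α t₁ (restrictPair t₁ p))) (toGauge T D (treeMon l α
    t₂ (restrictPair t₂ p))) (toGauge T D (treeMon l α t₃ (restrictPair t₃ p))) (toGauge T D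
    (treeMon l α t₄ (restrictPair t₄ p))) := by
    intro p; cases b <;> rfl
  have e2 : toGauge T D (treeMon l α (bracket b' t₁ t₂ t₃ t₄) (restrictPair (bracket b' t₁ t₂ t₃ t₄)
    p)) = bracket b' (toGauge T D (treeMon l α t₁ (restrictPair t₁ p))) (toGauge T D (treeMon l α t₂
    (restrictPair t₂ p))) (toGauge T D (treeMon l α t₃ (restrictPair t₃ p))) (toGauge T D (treeMon l
    α t₄ (restrictPair t₄ p))) := by
    cases b' <;> rfl
  have e3 : ∀ p' v, treeF l α D (bracket b' t₁ t₂ t₃ t₄) (restrictPair (bracket b' t₁ t₂ t₃ t₄) p)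
    (restrictPair (bracket b' t₁ t₂ t₃ t₄) p') v = bracket b' (treeF l α D t₁ (restrictPair t₁ p)
    (restrictPair t₁ p') v) (treeF l α D t₂ (restrictPair t₂ p) (restrictPair t₂ p') v) (treeF l α D
    t₃ (restrictPair t₃ p) (restrictPair t₃ p') v) (treeF l α D t₄ (restrictPair t₄ p) (restrictPair
    t₄ p') v) := by
    intro p' v; cases b' <;> rfl
  simp only [e1, e2, symCounit_pure, e3] at h
  rw [h]
  exact (sum_bijective _ (restrictPair_bracket_bijective ht0) _ _ fun p' => rfl).symm

section Families

variable {I J K L : Type} [Fintype I] [Fintype J] [Fintype K] [Fintype L] {x : I → GaugeAlg T D}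
  {y : J → GaugeAlg T D} {z : K → GaugeAlg T D} {w : L → GaugeAlg T D} {X : I → I → V → DualQG Dᵒ}
  {Y : J → J → V → DualQG Dᵒ} {Z : K → K → V → DualQG Dᵒ} {W : L → L → V → DualQG Dᵒ}

lemma GCov.bracket (hx : GCov hs x X) (hy : GCov hs y Y) (hz : GCov hs z Z) (hw : GCov hs w W) (b b'
  : Bool) (i : I) (j : J) (k : K) (l : L) : bracket b' (x i) (y j) (z k) (w l) = ∑ p : (I × J) × (K
  × L), (∏ v, counit Dᵒ (bracket b' (X i p.1.1 v) (Y j p.1.2 v) (Z k p.2.1 v) (W l p.2.2 v))) •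
  bracket b (x p.1.1) (y p.1.2) (z p.2.1) (w p.2.2) := (sweedler_gauge hs b b' _ _ _ _).symm.trans
  (hx.sweedler hy hz hw b b' i j k l)

lemma gCov_one : GCov hs (fun _ : Unit => (1 : GaugeAlg T D)) fun _ _ _ => unit Dᵒ := fun _ =>
  (freeCoaction_one T D).trans (by rw [Fintype.sum_unique]; rfl)

lemma GCov.mul_assoc (hx : GCov hs x X) (hy : GCov hs y Y) (hz : GCov hs z Z) (h : ∀ i i' j j' k k'
    v, X i i' v * Y j j' v * Z k k' v = X i i' v * (Y j j' v * Z k k' v)) (i : I) (j : J) (k : K) :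
    x i * y j * z k = x i * (y j * z k) := by
  have h1 := hx.bracket hy hz gCov_one true true i j k ()
  have h2 := hx.bracket hy hz gCov_one true false i j k ()
  simp only [QGauge.bracket, mul_one, mul_unit, h] at h1 h2
  exact h1.trans h2.symm

end Families

/-! ### Functionals at a vertex -/

section Vertex

variable {X Y Z W : SLabel q}

/-- The trees of the two bracketings. -/
def tree4 (b : Bool) : FreeMagma (Fin 4) := bracket b (.of 0) (.of 1) (.of 2) (.of 3)

lemma leaves_tree4 (b : Bool) : leaves (tree4 b) = finRange 4 := by cases b <;> rfl

lemma idxG_tree4 (w : Fin 4 → SLabel q) (b : Bool) (I J : Idx w) : idxG w D (tree4 b) I J = bracket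
    b (labG D (w 0) (I 0) (J 0)) (labG D (w 1) (I 1) (J 1)) (labG D (w 2) (I 2) (J 2)) (labG D (w 3)
    (I 3) (J 3)) := by
  cases b <;> rfl

lemma sum_idx4 {M : Type} [AddCommMonoid M] (f : Idx (word4 X Y Z W) → M) : ∑ I, f I = ∑ x, ∑ y, ∑
    z, ∑ w, f (idx4 x y z w) := by
  rw [← sum_bijective _ (idx4e_bijective X Y Z W) (fun p => f (idx4e X Y Z W p)) f fun _ => rfl]
  simp only [sum_prod_type]
  rfl

lemma vecMul_proj_true {p : M[X.2, Y.2]} {p' : M[Z.2, W.2]} (hp : IsHom (X.rep ⊠ Y.rep) (spin q 0)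
    (rowM p)) (hp' : IsHom (Z.rep ⊠ W.rep) (spin q 0) (rowM p')) : vecMul (fun I : Idx (word4 X Y Z
    W) => p (I 0) (I 1) * p' (I 2) (I 3)) (D.proj (word4 X Y Z W) (tree4 true)) = fun I => p (I 0)
    (I 1) * p' (I 2) (I 3) := by
  have h := ((coact_functional D hp).kron (coact_functional D hp')).mul_coproj
  funext J
  have h1 := congr_fun₂ h (0, 0) ((J 0, J 1), (J 2, J 3))
  simp only [mmul_apply, sum_prod_type, univ_unique, sum_singleton] at h1
  refine Eq.trans ?_ (h1.trans ?_)
  · rw [proj_eq _, vecMul, dotProduct, sum_idx4]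
    rfl
  · change counit Dᵒ (unit Dᵒ * unit Dᵒ) * _ = _
    rw [unit_mul, counit_unit, one_mul]
    rfl

/-- The exchange of the two middle factors. -/
def exchMid (E : M[Y.2 × Z.2, Z.2 × Y.2]) : M[Idx (word4 X Y Z W), Idx (word4 X Z Y W)] := of fun I
  J => I[X.2] (I 0) (J 0) * E (I 1, I 2) (J 1, J 2) * I[W.2] (I 3) (J 3)

lemma vecMul_exchMid {r : Idx (word4 X Y Z W) → ℂ} (E : M[Y.2 × Z.2, Z.2 × Y.2]) (J : Idx (word4 X Z
    Y W)) : vecMul r (exchMid E) J = ∑ y, ∑ z, r (idx4 (J 0) y z (J 3)) * E (y, z) (J 1, J 2) := by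
  rw [vecMul, dotProduct, sum_idx4]
  have h : ∀ (x₀ : X.2) (w₀ : W.2) (e : Z.2 × Y.2), ∑ x, ∑ y, ∑ z, ∑ w, r (idx4 x y z w) * (I[_] x
    x₀ * E (y, z) e * I[_] w w₀) = ∑ y, ∑ z, r (idx4 x₀ y z w₀) * E (y, z) e := by
    intro x₀ w₀ e
    simp [mone_apply, ite_mul, sum_ite_irrel]
  exact h _ _ _

/-- Pairs of matrices as a matrix on four factors. -/
def pairMid {γ δ : ℕ} (f : M[X.2 × Y.2, Fin γ]) (g : M[Z.2 × W.2, Fin δ]) : M[Idx (word4 X Y Z W),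
  Fin γ × Fin δ] := of fun I p => f (I 0, I 1) p.1 * g (I 2, I 3) p.2

lemma vecMul_pairMid {γ δ : ℕ} (r : Idx (word4 X Y Z W) → ℂ) (f : M[X.2 × Y.2, Fin γ]) (g : M[Z.2 ×
  W.2, Fin δ]) (p : Fin γ × Fin δ) : vecMul r (pairMid f g) p = ∑ x, ∑ y, ∑ z, ∑ w, r (idx4 x y z w)
  * (f (x, y) p.1 * g (z, w) p.2) := sum_idx4 _

lemma vecMul_proj_false {p : M[X.2, Y.2]} {p' : M[Z.2, W.2]}
    {E : M[Y.2 × Z.2, Z.2 × Y.2]} {A B : SLabel q} (hp : IsHom (X.rep ⊠ Y.rep) (spin q 0) (rowM p))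
    (hp' : IsHom (Z.rep ⊠ W.rep) (spin q 0) (rowM p'))
    (hE : IsHom (Z.rep ⊠ Y.rep) (Y.rep ⊠ Z.rep) E) {f : M[X.2 × Z.2, A.2]} {g : M[Y.2 × W.2, B.2]}
    (hf : IsHom A.rep (X.rep ⊠ Z.rep) f) (hg : IsHom B.rep (Y.rep ⊠ W.rep) g) :
    let r := vecMul (fun I : Idx (word4 X Y Z W) => p (I 0) (I 1) * p' (I 2) (I 3)) (exchMid E)
    vecMul (vecMul r (D.proj (word4 X Z Y W) (tree4 false))) (pairMid f g) =
      vecMul r (pairMid f g) := by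
  intro r
  have l1 := leaves_tree4 false
  have l2 := leaves_tree4 true
  have hc := channels_idx (w := word4 X Z Y W) D l1
  have h1 : IsHom (A.rep ⊠ B.rep) (idxMod (word4 X Z Y W)) (pairMid f g) := by
    rw [← idxMod_eq l2]
    exact (hf.kron hg).pull_tgt (TIx.restrict_bijective (d := wdim (word4 X Z Y W)) l2)
  have h2 : IsHom (idxMod (word4 X Z Y W)) (spin q 0) (of fun _ => r) := by
    have h3 := hp'.comp (((contrL_isIntertwiner (X := Z.rep) hp).comp ((assoc_isIntertwiner).comp
      ((isIntertwiner_one (X := X.rep)).kron hE))).kron (isIntertwiner_one (X := W.rep)))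
    rw [← idxMod_eq l1]
    have h4 := h3.pull_src (TIx.restrict_bijective (d := wdim (word4 X Z Y W)) l1)
    refine (congrArg (IsHom _ _) (funext fun i => funext fun J => ?_)).mp h4
    refine Eq.trans ?_ (vecMul_exchMid E J).symm
    rw [Matrix.one_submatrix_mul, rowM_mul_kron, mmul_one]
    refine (mmul_apply (M := Matrix.transpose _) (N := p')).trans ?_
    simp only [transpose_apply, contrL_mul]
    have e : ∀ (x₀ : X.2) (w₀ : W.2) (e : Z.2 × Y.2),
        ∑ z, (∑ y, ∑ y', p y y' * (I[_] ⊗ₖ E) (y, (y', z)) (x₀, e)) * p' z w₀ =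
        ∑ y, ∑ z, p x₀ y * p' z w₀ * E (y, z) e := by
      intro x₀ w₀ e
      simp only [kroneckerMap_apply, mone_apply, ite_mul, one_mul, zero_mul, mul_ite,
        mul_zero, sum_ite_irrel, sum_const_zero, Finset.sum_ite_eq', mem_univ, if_true, sum_mul]
      rw [sum_comm]
      exact sum_congr rfl fun _ _ => sum_congr rfl fun _ _ => by ring
    exact e _ _ _
  have h := functional_mul_mul D hc.coproj_isIntertwiner hc.negligible h1 h2
  rw [← proj_eq _] at h
  exact congrFun h 0

end Vertex

/-! ### Exchange and fusion in products of four factors -/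

section App

variable {M S Y S' Y' : Type} [AddCommGroup M] [Module ℂ M] [Fintype S] [Fintype Y] [Fintype S']
  [Fintype Y']

/-- The contraction of a family with two functionals. -/
def app (r : S → ℂ) (e : Y → ℂ) (X : S → Y → M) : M := ∑ p : S × Y, (r p.1 * e p.2) • X p.1 p.2

lemma app_eq (r : S → ℂ) (e : Y → ℂ) {X : S → Y → M} {X' : S' → Y' → M} {Q : M[S, S']} {P : M[Y,
    Y']} (h : ∀ s y, X s y = ∑ p : S' × Y', (Q s p.1 * P y p.2) • X' p.1 p.2) : app r e X = app
    (vecMul r Q) (vecMul e P) X' := by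
  simp only [app, h, smul_sum, smul_smul]
  rw [sum_comm]
  simp only [← sum_smul, vecMul, dotProduct, sum_mul_sum, sum_prod_type, mul_mul_mul_comm]

lemma app_sum {ι : Type} (r : S → ℂ) (e : Y → ℂ) {c : Finset ι} {S' Y' : ι → ι → Type} [∀ i j,
    Fintype (S' i j)] [∀ i j, Fintype (Y' i j)] {X : S → Y → M} (Q : ∀ i j, M[S, S' i j]) (P : ∀ i
    j, M[Y, Y' i j]) (Z : ∀ i j, S' i j → Y' i j → M) (h : ∀ s y, X s y = ∑ i ∈ c, ∑ j ∈ c, ∑ p : S'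
    i j × Y' i j, (Q i j s p.1 * P i j y p.2) • Z i j p.1 p.2) : app r e X = ∑ i ∈ c, ∑ j ∈ c, app
    (vecMul r (Q i j)) (vecMul e (P i j)) (Z i j) := by
  simp only [← app_eq r e fun _ _ => rfl]
  simp only [app, h, smul_sum]
  rw [sum_comm]
  exact sum_congr rfl fun _ _ => sum_comm

end App

/-- The matrix elements of a label at the vertex `x`. -/
def atF (D : QuantumData q s) (x : V) (X : SLabel q) (i i' : X.2) (v : V) : DualQG Dᵒ := if v = x
    then labG D X i i' else unit Dᵒ

/-- The coefficients of the change of bracketing at the vertices other than `y`. -/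
def outer (D : QuantumData q s) (y x₀ x₁ x₂ x₃ : V) (w : Fin 4 → SLabel q) (b : Bool) : M[Idx w, Idx
  w] := of fun I J => ∏ v ∈ Finset.univ.erase y, counit Dᵒ (bracket b (atF D x₀ (w 0) (I 0) (J 0) v)
  (atF D x₁ (w 1) (I 1) (J 1) v) (atF D x₂ (w 2) (I 2) (J 2) v) (atF D x₃ (w 3) (I 3) (J 3) v))

section Brak

variable {w w' : Fin 4 → SLabel q} (a₀ : Matrix (Fin (w 0).2.dim) (Fin (w' 0).2.dim) (GaugeAlg T D))
  (a₁ : Matrix (Fin (w 1).2.dim) (Fin (w' 1).2.dim) (GaugeAlg T D))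
  (a₂ : Matrix (Fin (w 2).2.dim) (Fin (w' 2).2.dim) (GaugeAlg T D))
  (a₃ : Matrix (Fin (w 3).2.dim) (Fin (w' 3).2.dim) (GaugeAlg T D))

/-- The bracketing of four matrices. -/
def brak (b : Bool) (I : Idx w) (J : Idx w') : GaugeAlg T D := bracket b (a₀ (I 0) (J 0)) (a₁ (I 1)
  (J 1)) (a₂ (I 2) (J 2)) (a₃ (I 3) (J 3))

/-- The matrix `a` transforms with the label `X` at `x` and the label `Y` at `y`. -/
def Slot (hs : s ^ 2 = q) (y x : V) (X Y : SLabel q) (a : Matrix X.2 Y.2 (GaugeAlg T D)) : Prop :=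
  GCov hs (fun p : X.2 × Y.2 => a p.1 p.2) fun p p' v => if v = y then labG D Y p.2 p'.2 else atF D
  x X p.1 p'.1 v

lemma brak_eq {y x₀ x₁ x₂ x₃ : V} (h₀ : Slot hs y x₀ (w 0) (w' 0) a₀) (h₁ : Slot hs y x₁ (w 1) (w'
    1) a₁) (h₂ : Slot hs y x₂ (w 2) (w' 2) a₂) (h₃ : Slot hs y x₃ (w 3) (w' 3) a₃) (b b' : Bool) (I
    : Idx w) (J : Idx w') : brak a₀ a₁ a₂ a₃ b' I J = ∑ p : Idx w × Idx w', (outer D y x₀ x₁ x₂ x₃ w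
    b' I p.1 * D.proj w' (tree4 b') J p.2) • brak a₀ a₁ a₂ a₃ b p.1 p.2 := by
  refine (GCov.bracket h₀ h₁ h₂ h₃ b b' (I 0, J 0) (I 1, J 1) (I 2, J 2) (I 3, J 3)).trans
    (sum_bijective (fun p : Idx w × Idx w' => (((p.1 0, p.2 0), (p.1 1, p.2 1)), ((p.1 2, p.2 2),
    (p.1 3, p.2 3)))) ⟨?_, ?_⟩ _ _ ?_).symm
  · rintro ⟨a, b⟩ ⟨a', b'⟩ h
    simp only [Prod.mk.injEq] at h
    refine Prod.ext (funext fun k => ?_) (funext fun k => ?_) <;> fin_cases k <;> tauto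
  · rintro ⟨⟨⟨a, a'⟩, ⟨b, b'⟩⟩, ⟨⟨c, c'⟩, ⟨d, d'⟩⟩⟩
    exact ⟨(fun | 0 => a | 1 => b | 2 => c | 3 => d, fun | 0 => a' | 1 => b' | 2 => c' | 3 => d'),
      rfl⟩
  · intro p
    refine congrArg (· • _) ?_
    rw [← Finset.mul_prod_erase _ _ (mem_univ y), mul_comm, outer, proj_eq _]
    refine congrArg₂ (· * ·) ?_ (Finset.prod_congr rfl fun v hv => ?_)
    · simp only [if_true, ← idxG_tree4]
      rfl
    · simp only [if_neg (Finset.ne_of_mem_erase hv)]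

end Brak

/-- `C` is a matrix which transforms like the holonomy of a path from `z` to `y`. -/
def IsHol (hs : s ^ 2 = q) (α : Phys q) (y z : V) (C : Matrix α α (GaugeAlg T D)) : Prop := GCov hs
  (fun p => C p.1 p.2) (edgeF D y z true α)

/-- The matrix `ψ_{βα}^γ f⁻¹ P₁₂`, transposed. -/
def chi (D : QuantumData q s) (α β γ : Phys q) : M[α × β, γ] := (D.psi β α γ * D.fInv β
  α).transpose.submatrix swap id

/-- The fusion of two families of matrices. -/
def Fuses (α β : Phys q) (U : ∀ γ : Phys q, Matrix γ γ (GaugeAlg T D)) : Prop := ∀ i j k m, U α i j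
  * U β k m = ∑ γ ∈ fusionSet α β, ∑ p : γ × γ, (D.phi α β γ (i, k) p.1 * chi D α β γ (j, m) p.2) •
  U γ p.1 p.2

lemma chi_isIntertwiner (D : QuantumData q s) (α β γ : Phys q) : IsHom (dual q γ.rep) (dual q α.rep
    ⊠ dual q β.rep) (chi D α β γ) := by
  rw [chi, isIntertwiner_dual_tensor', psi_mul_fInv D β α]
  exact (D.psi_intertwiner β α γ).smul _

/-- The scalar by which holonomies that meet at a vertex fuse. -/
def fuseC (D : QuantumData q s) (b : Bool) (α β γ : Phys q) : ℂ := lam D b α β γ * (D.a γ / (D.a β *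
  D.a α))

/-- The contraction of the indices at the common vertex. -/
def evW (α β : Phys q) : Idx (word4 (negL α) (posL α) (negL β) (posL β)) → ℂ := fun I => I[α] (I 0)
  (I 1) * I[β] (I 2) (I 3)

lemma evW_proj (D : QuantumData q s) (α β : Phys q) : vecMul (evW α β) (D.proj _ (tree4 true)) = evW
  α β := vecMul_proj_true (X := negL α) (Y := posL α) (Z := negL β) (W := posL β) (evM_isIntertwiner
  α.rep) (evM_isIntertwiner β.rep)

lemma evW_mul (hs : s ^ 2 = q) (b : Bool) (h : fusion α β δ ≠ 0) (p : γ × δ) : vecMul (vecMul (evW α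
    β) (exchMid (exchL q s b α β))) (pairMid (X := negL α) (Y := negL β) (Z := posL α) (W := posL β)
    (chi D α β γ) (D.phi α β δ)) p = lam D b α β δ * (D.psi β α γ * D.fInv β α * D.phi β α δ) p.1
    p.2 := by
  have h1 : ∀ x y z w, vecMul (evW α β) (exchMid (exchL q s b α β)) (idx4 x y z w) = exchL q s b α β
    (x, w) (y, z) := by
    intro x y z w
    refine (vecMul_exchMid _ _).trans ?_
    have e : ∀ (x : α) (w : β) (v : β × α), ∑ y, ∑ z, I[α] x y * I[β] z w * exchL q s b α β (y, z) v
      = exchL q s b α β (x, w) v := by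
      simp [mone_apply, ite_mul]
    exact e _ _ _
  rw [vecMul_pairMid, mmul_apply, sum_prod_type, mul_sum, sum_comm]
  refine sum_congr rfl fun y _ => ?_
  rw [mul_sum]
  refine sum_congr rfl fun x _ => ?_
  have h2 := exchL_phi hs D b h x y p.2
  simp only [h1]
  rw [mul_left_comm, ← h2, mul_sum]
  refine sum_congr rfl fun z _ => ?_
  rw [mul_sum]
  exact sum_congr rfl fun w _ => mul_left_comm _ _ _

lemma evW_fuse (hs : s ^ 2 = q) (b : Bool) (h : fusion α β δ ≠ 0) (p : γ × δ) : vecMul (vecMul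
    (vecMul (evW α β) (exchMid (exchL q s b α β))) (D.proj (word4 (negL α) (negL β) (posL α) (posL
    β)) (tree4 false))) (pairMid (X := negL α) (Y := negL β) (Z := posL α) (W := posL β) (chi D α β
    γ) (D.phi α β δ)) p = if γ.1 = δ.1 then fuseC D b α β δ * if p.1.1 = p.2.1 then 1 else 0 else
    0 := by
  have h1 := vecMul_proj_false (D := D) (X := negL α) (Y := posL α) (Z := negL β) (W := posL β)
    (A := negL γ) (B := posL δ) (evM_isIntertwiner α.rep) (evM_isIntertwiner β.rep)
    (exchL_isIntertwiner hs b α β) (chi_isIntertwiner D α β γ) (D.phi_intertwiner α β δ)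
  refine (congrFun h1 p).trans ((evW_mul hs b h p).trans ?_)
  have h2 := fusion_symm hs D h
  rw [psi_mul_fInv D β α, smul_mul, msmul_apply]
  split_ifs with h3 h4
  · obtain rfl := Subtype.ext h3
    rw [D.psi_mul_phi _ _ _ h2, Fin.ext h4, one_apply_eq, fuseC]
    simp
  · obtain rfl := Subtype.ext h3
    rw [D.psi_mul_phi _ _ _ h2, Matrix.one_apply_ne fun e => h4 (congrArg _ e)]
    simp
  · rw [psi_mul_phi_ne D fun e => h3 (congrArg _ e)]
    simp

section Fuse

variable {x y z : V}

lemma IsHol.fst (hxy : x ≠ y) {U : Matrix α α (GaugeAlg T D)} (h : IsHol hs α x y U) : Slot hs y x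
    (posL α) (negL α) U := by
  refine Cov.at h fun p p' => funext fun v => ?_
  by_cases hv : v = y
  · subst hv; rw [if_pos rfl, edgeF_right D hxy]; rfl
  · rw [if_neg hv, edgeF, if_neg hv, atF]

lemma IsHol.snd {C : Matrix α α (GaugeAlg T D)} (h : IsHol hs α y z C) : Slot hs y z (negL α) (posL
  α) C.transpose := Cov.reindex h swap swap_bijective

lemma sum_exchMid {M : Type} [AddCommGroup M] [Module ℂ M] {X Y Z W : SLabel q} (E : M[Y.2 × Z.2,
    Z.2 × Y.2]) (I : Idx (word4 X Y Z W)) (F : Idx (word4 X Z Y W) → M) : ∑ J, exchMid E I J • F J =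
    ∑ p, E (I 1, I 2) p • F (idx4 (I 0) p.1 p.2 (I 3)) := by
  have h : ∀ (x₀ : X.2) (w₀ : W.2) (e : Y.2 × Z.2), ∑ x, ∑ z, ∑ y, ∑ w, (I[_] x₀ x * E e (z, y) *
    I[_] w₀ w) • F (idx4 x z y w) = ∑ p, E e p • F (idx4 x₀ p.1 p.2 w₀) := by
    intro x₀ w₀ e
    simp [mone_apply, ite_mul, ite_smul, sum_ite_irrel, sum_prod_type]
  rw [sum_idx4]
  exact h _ _ _

section Steps

variable (U C : ∀ γ : Phys q, Matrix γ γ (GaugeAlg T D))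

/-- The product of `U C` with itself. -/
abbrev brakA (α β : Phys q) := brak (w := word4 (posL α) (negL α) (posL β) (negL β)) (w' := word4
  (negL α) (posL α) (negL β) (posL β)) (U α) (C α).transpose (U β) (C β).transpose

/-- The product after the exchange. -/
abbrev brakB (α β : Phys q) := brak (w := word4 (posL α) (posL β) (negL α) (negL β)) (w' := word4
  (negL α) (negL β) (posL α) (posL β)) (U α) (U β) (C α).transpose (C β).transpose

variable {U C}

lemma sum_brakA (r : Idx (word4 (posL α) (negL α) (posL β) (negL β)) → ℂ) : ∑ I, r I • ((U α * C α)
    (I 0) (I 1) * (U β * C β) (I 2) (I 3)) = app r (evW α β) (brakA U C α β true) := by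
  rw [app, sum_prod_type]
  refine sum_congr rfl fun I _ => ?_
  simp only [mul_smul, ← smul_sum]
  refine congrArg _ ?_
  rw [sum_idx4]
  have h : ∀ i l i' l', (U α * C α) i l * (U β * C β) i' l' = ∑ j, ∑ k, ∑ j', ∑ k', (I[α] j k * I[β]
    j' k') • (U α i j * C α k l * (U β i' j' * C β k' l')) := by
    simp [mone_apply, ite_smul, sum_ite_irrel, mmul_apply, sum_mul_sum]
  exact h _ _ _ _

lemma brakA_exchange {b : Bool} {L : M[α × β, β × α]} (ex : ∀ k l i j, C α k l * U β i j = ∑ p : (β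
    × α) × (β × α), (L (l, i) p.1 * exchL q s b α β (k, j) p.2) • (U β p.1.1 p.2.1 * C α p.2.2
    p.1.2)) (I J) : brakA U C α β false I J = ∑ p : Idx _ × Idx _, (exchMid L I p.1 * exchMid (exchL
    q s b α β) J p.2) • brakB U C α β false p.1 p.2 := by
  simp only [sum_prod_type, mul_smul, ← smul_sum]
  rw [sum_exchMid]
  simp only [sum_exchMid]
  have h := ex (J 1) (I 1) (I 2) (J 2)
  simp only [sum_prod_type (α₁ := _ × _), mul_smul, ← smul_sum] at h
  refine (congrArg (U α (I 0) (J 0) * · * C β (J 3) (I 3)) h).trans ?_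
  simp only [mul_sum, sum_mul, mul_smul_comm, smul_mul_assoc]
  exact sum_congr rfl fun p _ => congrArg (_ • ·) (sum_exchMid (X := negL α) (Y := posL α) (Z :=
    negL β) (W := posL β) (exchL q s b α β) J fun K => brakB U C α β false (idx4 (I 0) p.1 p.2 (I
    3)) K).symm

lemma brakB_fuse (fU : Fuses α β U) (fC : Fuses α β C) (I J) : brakB U C α β true I J = ∑ γ ∈
    fusionSet α β, ∑ δ ∈ fusionSet α β, ∑ p : (γ × δ) × (γ × δ), (pairMid (D.phi α β γ) (chi D α β
    δ) I p.1 * pairMid (X := negL α) (Y := negL β) (Z := posL α) (W := posL β) (chi D α β γ) (D.phi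
    α β δ) J p.2) • (U γ p.1.1 p.2.1 * C δ p.2.2 p.1.2) := by
  refine (congrArg₂ (· * ·) (fU (I 0) (J 0) (I 1) (J 1)) (fC (J 2) (I 2) (J 3) (I 3))).trans ?_
  rw [sum_mul_sum]
  refine sum_congr rfl fun γ _ => sum_congr rfl fun δ _ => ?_
  simp only [sum_mul_sum, sum_prod_type, smul_mul_smul_comm]
  refine sum_congr rfl fun a _ => ?_
  refine (sum_congr rfl fun b _ => sum_comm).trans (sum_comm.trans ?_)
  refine sum_congr rfl fun d _ => sum_comm.trans <| sum_congr rfl fun b _ => sum_congr rfl fun c _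
    => congrArg (· • _) ?_
  simp only [pairMid, of_apply]
  ring

lemma app_brakB (hs : s ^ 2 = q) (fU : Fuses α β U) (fC : Fuses α β C) (r : Idx (word4 (posL α)
    (posL β) (negL α) (negL β)) → ℂ) {b : Bool} : app r (vecMul (vecMul (evW α β) (exchMid (exchL q
    s b α β))) (D.proj (word4 (negL α) (negL β) (posL α) (posL β)) (tree4 false))) (brakB U C α β
    true) = ∑ γ ∈ fusionSet α β, ∑ p : γ × γ, (fuseC D b α β γ * vecMul r (pairMid (D.phi α β γ)
    (chi D α β γ)) p) • (U γ * C γ) p.1 p.2 := by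
  refine (app_sum (S' := fun γ δ => γ × δ) (Y' := fun γ δ => γ × δ) _ _ (fun γ δ => pairMid (X :=
    posL α) (Y := posL β) (Z := negL α) (W := negL β) (D.phi α β γ) (chi D α β δ)) (fun γ δ =>
    pairMid (X := negL α) (Y := negL β) (Z := posL α) (W := posL β) (chi D α β γ) (D.phi α β δ))
    (fun γ δ p p' => U γ p.1 p'.1 * C δ p'.2 p.2) fun I J => brakB_fuse fU fC I J).trans ?_
  refine sum_congr rfl fun γ hγ => ?_
  have hf := (mem_fusionSet).1 hγ
  rw [sum_eq_single_of_mem γ hγ]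
  · simp only [app, evW_fuse hs b hf, if_true, sum_prod_type, Fin.val_inj, mul_ite, mul_one,
      mul_zero, ite_smul, zero_smul, sum_ite_eq, mem_univ, mmul_apply, smul_sum]
    exact sum_congr rfl fun a _ => sum_congr rfl fun d _ => sum_congr rfl fun k _ => congrArg (· •
      _) (mul_comm _ _)
  · intro δ hδ hne
    have e : γ.1 ≠ δ.1 := fun e => hne (Subtype.ext e.symm)
    simp only [app, evW_fuse hs b ((mem_fusionSet).1 hδ), if_neg e, mul_zero, zero_smul, sum_const_zero]

end Steps

/-- Exchange and fusion of the products `U C` at the vertex `y`. -/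
lemma fuse (b : Bool) (hxy : x ≠ y) {U C : ∀ γ : Phys q, Matrix γ γ (GaugeAlg T D)} (hU : ∀ γ, IsHol
    hs γ x y (U γ)) (hC : ∀ γ, IsHol hs γ y z (C γ)) (fU : Fuses α β U) (fC : Fuses α β C) {L : M[α
    × β, β × α]} (ex : ∀ k l i j, C α k l * U β i j = ∑ p : (β × α) × (β × α), (L (l, i) p.1 * exchL
    q s b α β (k, j) p.2) • (U β p.1.1 p.2.1 * C α p.2.2 p.1.2)) {r : Idx (word4 (posL α) (negL α)
    (posL β) (negL β)) → ℂ} (h1 : vecMul (vecMul r (outer D y x z x z _ true)) (outer D y x z x z _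
    false) = vecMul r (outer D y x z x z _ false)) (h2 : ∀ γ, fusion α β γ ≠ 0 → vecMul (vecMul
    (vecMul r (exchMid L)) (outer D y x x z z _ false)) (pairMid (D.phi α β γ) (chi D α β γ)) =
    vecMul (vecMul r (exchMid L)) (pairMid (D.phi α β γ) (chi D α β γ))) : ∑ I, r I • ((U α * C α)
    (I 0) (I 1) * (U β * C β) (I 2) (I 3)) = ∑ γ ∈ fusionSet α β, ∑ p : γ × γ, (fuseC D b α β γ *
    vecMul (vecMul r (exchMid L)) (pairMid (D.phi α β γ) (chi D α β γ)) p) • (U γ * C γ) p.1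
    p.2 := by
  have g := brak_eq (w := word4 (posL α) (negL α) (posL β) (negL β)) (w' := word4 (negL α) (posL α)
    (negL β) (posL β)) _ _ _ _ (IsHol.fst hxy (hU α)) (IsHol.snd (hC α)) (IsHol.fst hxy (hU β))
    (IsHol.snd (hC β))
  have g' := brak_eq (w := word4 (posL α) (posL β) (negL α) (negL β)) (w' := word4 (negL α) (negL β)
    (posL α) (posL β)) _ _ _ _ (IsHol.fst hxy (hU α)) (IsHol.fst hxy (hU β)) (IsHol.snd (hC α))
    (IsHol.snd (hC β))
  rw [sum_brakA, app_eq r (evW α β) (g false true), evW_proj, app_eq _ _ (g true false), h1, ←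
    app_eq r (evW α β) (g true false), app_eq _ _ (brakA_exchange ex), app_eq _ _ (g' true false),
    app_brakB hs fU fC]
  exact sum_congr rfl fun γ hγ => by rw [h2 γ ((mem_fusionSet).1 hγ)]

end Fuse

/-! ### Coefficients at the outer vertices -/

section Outer

variable {w : Fin 4 → SLabel q} {x y z : V}

lemma counit_lab_mul (X Y : SLabel q) (i i' : X.2) (j j' : Y.2) : counit Dᵒ (labG D X i i' * labG D
    Y j j') = D.pairProj X Y (i, j) (i', j') := by
  rw [← coproj_tmul_lab]
  rfl

lemma outer_loop (h : x ≠ y) (b : Bool) : outer D y x x x x w b = D.proj w (tree4 b) := by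
  ext I J
  rw [proj_eq _, outer, of_apply, Finset.prod_eq_single_of_mem x (Finset.mem_erase.2 ⟨h, mem_univ
    _⟩)]
  · simp only [atF, if_true, ← idxG_tree4]
    rfl
  · intro v _ hv
    cases b <;> simp [atF, hv, QGauge.bracket, unit_mul, counit_unit]

lemma outer_path (hxy : x ≠ y) (hzy : z ≠ y) (hxz : x ≠ z) (b : Bool) : outer D y x z x z w b = of
    fun I J => D.pairProj (w 0) (w 2) (I 0, I 2) (J 0, J 2) * D.pairProj (w 1) (w 3) (I 1, I 3) (J
    1, J 3) := by
  ext I J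
  rw [outer, of_apply, Finset.prod_eq_mul_of_mem x z (Finset.mem_erase.2 ⟨hxy, mem_univ _⟩)
    (Finset.mem_erase.2 ⟨hzy, mem_univ _⟩) hxz]
  · cases b <;> simp [atF, hxz, hxz.symm, QGauge.bracket, unit_mul, mul_unit, counit_lab_mul]
  · intro v _ hv
    cases b <;> simp [atF, hv.1, hv.2, QGauge.bracket, unit_mul, counit_unit]

lemma outer_path' (hxy : x ≠ y) (hzy : z ≠ y) (hxz : x ≠ z) (b : Bool) : outer D y x x z z w b = of
    fun I J => D.pairProj (w 0) (w 1) (I 0, I 1) (J 0, J 1) * D.pairProj (w 2) (w 3) (I 2, I 3) (J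
    2, J 3) := by
  ext I J
  rw [outer, of_apply, Finset.prod_eq_mul_of_mem x z (Finset.mem_erase.2 ⟨hxy, mem_univ _⟩)
    (Finset.mem_erase.2 ⟨hzy, mem_univ _⟩) hxz]
  · cases b <;> simp [atF, hxz, hxz.symm, QGauge.bracket, unit_mul, mul_unit, counit_lab_mul]
  · intro v _ hv
    cases b <;> simp [atF, hv.1, hv.2, QGauge.bracket, unit_mul, counit_unit]

lemma pairProj_mul_self (D : QuantumData q s) (X Y : SLabel q) : D.pairProj X Y * D.pairProj X Y =
    D.pairProj X Y := by
  rw [← coproj_tmul_lab]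
  exact ((channels_label D X).tensor (channels_label D Y)).coproj_idem

lemma outer_path_mul_self (hxy : x ≠ y) (hzy : z ≠ y) (hxz : x ≠ z) (X Y Z W : SLabel q) : outer D y
    x z x z (word4 X Y Z W) true * outer D y x z x z (word4 X Y Z W) false = outer D y x z x z
    (word4 X Y Z W) false := by
  simp only [outer_path hxy hzy hxz]
  ext I J
  rw [mmul_apply, sum_idx4, of_apply]
  have h : ∀ (p p' : X.2 × Z.2) (r r' : Y.2 × W.2), ∑ x, ∑ y, ∑ z, ∑ w, D.pairProj X Z p (x, z) *
    D.pairProj Y W r (y, w) * (D.pairProj X Z (x, z) p' * D.pairProj Y W (y, w) r') = D.pairProj X Z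
    p p' * D.pairProj Y W r r' := by
    intro p p' r r'
    refine Eq.trans ?_ (congrArg₂ (· * ·) (congr_fun₂ (pairProj_mul_self D X Z) p p') (congr_fun₂
      (pairProj_mul_self D Y W) r r'))
    simp only [mmul_apply, sum_mul_sum, sum_prod_type]
    exact sum_congr rfl fun x _ => sum_congr rfl fun z _ => sum_congr rfl fun y _ => sum_congr rfl
      fun w _ => mul_mul_mul_comm _ _ _ _
  exact h _ _ _ _

lemma outer_mul_pairMid (hxy : x ≠ y) (hzy : z ≠ y) (hxz : x ≠ z) (X Y Z W : SLabel q) {γ δ : ℕ} (f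
    : M[X.2 × Y.2, Fin γ]) (g : M[Z.2 × W.2, Fin δ]) : outer D y x x z z (word4 X Y Z W) false *
    pairMid f g = pairMid (D.pairProj X Y * f) (D.pairProj Z W * g) := by
  rw [outer_path' hxy hzy hxz]
  ext I p
  refine (sum_idx4 _).trans ?_
  have h : ∀ (r : X.2 × Y.2) (r' : Z.2 × W.2), ∑ x, ∑ y, ∑ z, ∑ w, D.pairProj X Y r (x, y) *
    D.pairProj Z W r' (z, w) * (f (x, y) p.1 * g (z, w) p.2) = (D.pairProj X Y * f) r p.1 *
    (D.pairProj Z W * g) r' p.2 := by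
    intro r r'
    simp only [mmul_apply, sum_mul_sum, sum_prod_type]
    exact sum_congr rfl fun x _ => sum_comm.trans <| sum_congr rfl fun y _ => sum_congr rfl fun z _
      => sum_congr rfl fun w _ => mul_mul_mul_comm _ _ _ _
  exact h _ _

end Outer

/-! ### Composition of holonomies -/

section Hol

variable {x y z t : V}

lemma IsHol.comp (hxy : x ≠ y) (hyz : y ≠ z) (hxz : x ≠ z) {U C : Matrix α α (GaugeAlg T D)} (hU :
    IsHol hs α x y U) (hC : IsHol hs α y z C) : IsHol hs α x z (U * C) := by
  refine ((hU.mul hC).linear (J := α × α) (F' := edgeF D x z true α) (fun p r => if p.1 = r.1.1 then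
    if r.1.2 = r.2.1 then if p.2 = r.2.2 then 1 else 0 else 0 else 0) ?_).congr ?_ fun _ _ => rfl
  · rintro ⟨i, l⟩ ⟨⟨i', j'⟩, ⟨k', l'⟩⟩
    have e : ∀ j, (pure D fun v => edgeF D x y true α (i, j) (i', j') v * edgeF D y z true α (j, l)
      (k', l') v) = pureAt D (edgeF D x z true α (i, l) (i', l')) y (labG D (negL α) j j' * labG D
      (posL α) j k') := by
      intro j
      refine congrArg (pure D) (funext fun v => ?_)
      by_cases h1 : v = x
      · subst h1; simp [edgeF, hxy, hxz, mul_unit]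
      by_cases h2 : v = y
      · subst h2; simp [edgeF, h1]; rfl
      · by_cases h3 : v = z <;> simp [edgeF, h1, h2, h3, unit_mul, hyz.symm, hxz.symm]
    have h := congr_fun₂ (coact_functional D (X := negL α) (Y := posL α) (evM_isIntertwiner α.rep))
      0 (j', k')
    simp only [lmul, rmul, univ_unique, sum_singleton, tmul, unitG, sum_prod_type, evM, rowM,
      of_apply] at h
    have h1 := congrArg (pureAt D (edgeF D x z true α (i, l) (i', l')) y) h
    have e' : pureAt D (edgeF D x z true α (i, l) (i', l')) y (unit Dᵒ) = pure D (edgeF D x z true α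
      (i, l) (i', l')) := by
      rw [pureAt_apply, ← edgeF_ne D hxy.symm hyz true α (i, l) (i', l'), Function.update_eq_self]
    simp only [map_sum, map_smul, e'] at h1
    simpa [sum_prod_type, ite_smul, sum_ite_irrel, e, mone_apply] using h1
  · rintro ⟨i, l⟩
    simp [sum_prod_type, ite_smul, sum_ite_irrel, mmul_apply]

lemma IsHol.assoc {x' y' z' : V} {U : Matrix α α (GaugeAlg T D)} {C : Matrix β β (GaugeAlg T D)} {W
    : Matrix γ γ (GaugeAlg T D)} (hU : IsHol hs α x x' U) (hC : IsHol hs β y y' C) (hW : IsHol hs γ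
    z z' W) (h : ∀ v, (v ≠ x ∧ v ≠ x') ∨ (v ≠ y ∧ v ≠ y') ∨ (v ≠ z ∧ v ≠ z')) (i j k l m n) : U i j
    * C k l * W m n = U i j * (C k l * W m n) := by
  refine GCov.mul_assoc hU hC hW (fun i i' j j' k k' v => ?_) (i, j) (k, l) (m, n)
  obtain ⟨h1, h2⟩ | ⟨h1, h2⟩ | ⟨h1, h2⟩ := h v <;> simp only [edgeF_ne D h1 h2, unit_mul, mul_unit]

end Hol

section

/-! ### Exchange of holonomies -/

/-- `C` and `U` are exchanged by `L` in the column index of `C` and the row index of `U`, and by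
`P` in the row index of `C` and the column index of `U`. -/
def Ex (L P : M[α × β, β × α]) (C : Matrix α α (GaugeAlg T D)) (U : Matrix β β (GaugeAlg T D)) :
  Prop := ∀ k l i j, C k l * U i j = ∑ p : (β × α) × (β × α), (L (l, i) p.1 * P (k, j) p.2) • (U
  p.1.1 p.2.1 * C p.2.2 p.1.2)

/-- The permutation. -/
def flip (α β : Phys q) : M[α × β, β × α] := I[β × α].submatrix swap id

variable {L P : M[α × β, β × α]} {C W : Matrix α α (GaugeAlg T D)}
  {U : Matrix β β (GaugeAlg T D)}

lemma ex_right : Ex L (flip α β) C U ↔ ∀ k l i j, C k l * U i j = ∑ p, L (l, i) p • (U p.1 j * C k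
    p.2) := by
  refine forall₄_congr fun k l i j => ?_
  rw [sum_prod_type (α₁ := _ × _)]
  simp [flip, mone_apply, ite_smul]

lemma ex_left : Ex (flip α β) P C U ↔ ∀ k l i j, C k l * U i j = ∑ p, P (k, j) p • (U i p.1 * C p.2
    l) := by
  refine forall₄_congr fun k l i j => ?_
  rw [sum_prod_type (α₁ := _ × _), sum_comm]
  simp [flip, mone_apply, ite_smul]

lemma ex_flip (h : ∀ k l i j, C k l * U i j = U i j * C k l) : Ex (flip α β) (flip α β) C U := by
  refine ex_left.2 fun k l i j => (h k l i j).trans ?_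
  simp [flip, mone_apply, ite_smul]

lemma Ex.mul (h : Ex (flip α β) P W U) (h' : Ex L (flip α β) C U) {x y y' z w : V} (hU : IsHol hs β
    x y U) (hW : IsHol hs α y' w W) (hC : IsHol hs α w z C) (hv : ∀ v, (v ≠ x ∧ v ≠ y) ∨ (v ≠ y' ∧ v
    ≠ w) ∨ (v ≠ w ∧ v ≠ z)) : Ex L P (W * C) U := by
  intro k l i j
  rw [ex_left] at h
  rw [ex_right] at h'
  have a1 := hW.assoc hC hU fun v => by have := hv v; tauto
  have a2 := hW.assoc hU hC fun v => by have := hv v; tauto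
  have a3 := hU.assoc hW hC fun v => by have := hv v; tauto
  simp only [mmul_apply, sum_mul, mul_sum, smul_sum, a1, h', mul_smul_comm, ← a2, h, smul_mul_assoc,
    a3, smul_smul, sum_prod_type (α₁ := _ × _)]
  rw [sum_comm]
  exact sum_congr rfl fun _ _ => sum_comm

/-! ### Links -/

/-- The edge `va` precedes the edge `vc`, or conversely. -/
def ord (T : CiliatedSurface V) (b : Bool) (v a c : V) : Prop := if b then T.cil v a c else T.cil v c a

lemma link_edge' {x y : V} (h : T.link x y) : (∃ c, T.face x y c ∨ T.face y x c) ∧ ∃ c, T.face y x c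
    ∨ T.face x y c := by
  obtain ⟨c, h⟩ := T.link_edge h
  exact ⟨⟨c, h⟩, ⟨c, h.symm⟩⟩

lemma exists_ord {v a c : V} (h : T.link a v) (h' : T.link v c) (ne : a ≠ c) : ∃ b, ord T b v a
    c := by
  obtain h | h := T.cil_total (link_edge' h).2 (link_edge' h').1 ne
  · exact ⟨true, h⟩
  · exact ⟨false, h⟩

lemma sgn_eq_of_ord {b : Bool} {v a c : V} (h : ord T b v a c) : sgn T c v a = (if b then 1 else -1)
    ∧ sgn T a v c = if b then -1 else 1 := by
  cases b
  · exact ⟨if_pos h, if_neg fun h' => T.cil_irrefl _ _ (T.cil_trans h h')⟩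
  · exact ⟨if_neg fun h' => T.cil_irrefl _ _ (T.cil_trans h h'), if_pos h⟩

section Slots

variable {l l' : Link T} {σ τ : Bool}

lemma slot_absorb (hs : s ^ 2 = q) (hx : l.near σ = l'.near τ) (hne : l.near (!σ) ≠ l'.near !τ) (p :
    α × α) (r : β × β) : toGauge T D (slotGen l σ α p * slotGen l' τ β r) = ∑ y, D.pairProj (σ, α)
    (τ, β) (p.1, r.1) y • toGauge T D (slotGen l σ α (y.1, p.2) * slotGen l' τ β (y.2, r.2)) := by
  have h := ((freeCov_slotGen (D := D) l σ α).toGCov hs).bracket ((freeCov_slotGen (D := D) l' τ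
    β).toGCov hs) gCov_one gCov_one true true p r () ()
  have n1 := l.near_ne σ
  have n2 := l'.near_ne τ
  rw [← hx] at h n2
  have e : ∀ (p' : α × α) (r' : β × β), ∏ v, counit Dᵒ (edgeF D (l.near σ) (l.near !σ) σ α p p' v *
    edgeF D (l.near σ) (l'.near !τ) τ β r r' v) = D.pairProj (σ, α) (τ, β) (p.1, r.1) (p'.1, r'.1) *
    (I[_] p.2 p'.2 * I[_] r.2 r'.2) := by
    intro p' r'
    rw [← Finset.mul_prod_erase _ _ (mem_univ (l.near σ)), Finset.prod_eq_mul_of_mem _ _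
      (Finset.mem_erase.2 ⟨n1.symm, mem_univ _⟩) (Finset.mem_erase.2 ⟨n2.symm, mem_univ _⟩) hne]
    · rw [edgeF_left, edgeF_left, counit_lab_mul, edgeF_right D n1, edgeF_right D n2, edgeF_ne D
        n1.symm hne, edgeF_ne D n2.symm hne.symm, unit_mul, mul_unit, ← counit_labG D (!σ, α), ←
        counit_labG D (!τ, β)]
      rfl
    · intro v hv h
      rw [edgeF_ne D (Finset.ne_of_mem_erase hv) h.1, edgeF_ne D (Finset.ne_of_mem_erase hv) h.2,
        unit_mul, counit_unit]
  simp only [QGauge.bracket, mul_one, mul_unit, e] at h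
  refine (toGauge_mul T D _ _).trans (h.trans ?_)
  simp [sum_prod_type, mone_apply, ite_smul, sum_ite_irrel, toGauge_mul]

lemma slot_braid (hs : s ^ 2 = q) (hx : l.near σ = l'.near τ) (hc : T.cil (l.near σ) (l.near !σ)
    (l'.near !τ)) (p : α × α) (r : β × β) : toGauge T D (slotGen l' τ β r * slotGen l σ α p) = ∑ y,
    braidM q s (SLabel.rep (σ, α)) (SLabel.rep (τ, β)) (r.1, p.1) y • toGauge T D (slotGen l σ α
    (y.1, p.2) * slotGen l' τ β (y.2, r.2)) := by
  have hne : l.near (!σ) ≠ l'.near !τ := fun h => T.cil_irrefl _ _ (h ▸ hc)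
  rw [toGauge_exchange l l' σ τ α β hx hc]
  simp only [map_sum, map_smul]
  refine (Fintype.sum_prod_type' fun i k => D.truncR s (σ, α) (τ, β) (p.1, r.1) (i, k) • toGauge T D
    (slotGen l σ α (i, p.2) * slotGen l' τ β (k, r.2))).symm.trans ?_
  have ab := fun x : α × β => slot_absorb hs (D := D) hx hne (x.1, p.2) (x.2, r.2)
  refine Eq.trans ?_ (sum_congr rfl fun x _ => congrArg (_ • ·) (ab x)).symm
  simp only [smul_sum, smul_smul]
  rw [sum_comm]
  simp only [← sum_smul, CGMatrices.truncR, mmul_apply]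
  rfl

lemma slot_exchange (hs : s ^ 2 = q) (hx : l.near σ = l'.near τ) {b : Bool} (ho : ord T b (l.near σ)
    (l'.near !τ) (l.near !σ)) (hP : if b then P = braidM q s (SLabel.rep (τ, β)) (SLabel.rep (σ, α))
    else
      P * braidM q s (SLabel.rep (σ, α)) (SLabel.rep (τ, β)) = 1) (p : α × α) (r : β × β) : toGauge
    T D (slotGen l σ α p * slotGen l' τ β r) = ∑ y, P (p.1, r.1) y • toGauge T D (slotGen l' τ β
    (y.1, r.2) * slotGen l σ α (y.2, p.2)) := by
  cases b
  · simp only [slot_braid hs hx ho, smul_sum, smul_smul]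
    rw [sum_comm]
    simp only [← sum_smul]
    rw [if_neg Bool.false_ne_true] at hP
    refine Eq.trans ?_ (sum_congr rfl fun x _ => congrArg (· • _) ((congr_fun₂ hP (p.1, r.1)
      x).symm.trans (mmul_apply ..)))
    simp [mone_apply, ite_smul]
  · obtain rfl := hP
    exact slot_braid hs hx.symm (hx ▸ ho) r p

end Slots

end

/-! ### Holonomies along paths -/

section Link

variable {x y z w : V}

lemma uMat_apply (h : T.link x y) (α : Phys q) (i j : α) : uMat T D α x y i j = toGauge T D (gen ⟨x,
    y, h⟩ α i j) := dif_pos h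

lemma uMat_isHol (h : T.link x y) (α : Phys q) : IsHol hs α x y (uMat T D α x y) := ((freeCov_gen
  ⟨x, y, h⟩ α).toGCov hs).congr (fun _ => (uMat_apply h α _ _).symm) fun _ _ => rfl

lemma uMat_ex_left (hs : s ^ 2 = q) (h : T.link y z) (h' : T.link x y) {b : Bool} (ho : ord T b y x
    z) : Ex (flip α β) (exchL q s b α β) (uMat T D α y z) (uMat T D β x y) := by
  refine ex_left.2 fun k l i j => ?_
  simp only [uMat_apply h, uMat_apply h', ← toGauge_mul]
  refine slot_exchange hs (l := ⟨y, z, h⟩) (l' := ⟨x, y, h'⟩) (σ := true) (τ := false) rfl ho ?_ (k,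
    l) (j, i)
  cases b
  · exact exchL_mul_braid hs α β
  · rfl

lemma uMat_ex_right (hs : s ^ 2 = q) (h : T.link w x) (h' : T.link x y) {b : Bool} (ho : ord T b x y
    w) : Ex (exchR q s b α β) (flip α β) (uMat T D α w x) (uMat T D β x y) := by
  refine ex_right.2 fun k l i j => ?_
  simp only [uMat_apply h, uMat_apply h', ← toGauge_mul]
  refine slot_exchange hs (l := ⟨w, x, h⟩) (l' := ⟨x, y, h'⟩) (σ := false) (τ := true) rfl ho ?_ (l,
    k) (i, j)
  cases b
  · exact exchR_mul_braid hs α β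
  · rfl

lemma uMat_ex_flip (h : T.link w z) (h' : T.link x y) (h1 : w ≠ x) (h2 : w ≠ y) (h3 : z ≠ x) (h4 : z
    ≠ y) : Ex (flip α β) (flip α β) (uMat T D α w z) (uMat T D β x y) := by
  refine ex_flip fun k l i j => ?_
  simp only [uMat_apply h, uMat_apply h', ← toGauge_mul]
  exact toGauge_rel T D (.disjoint _ _ α β _ _ _ _ h1 h2 h3 h4)

lemma uMat_fuses (h : T.link x y) (α β : Phys q) : Fuses α β fun γ => uMat T D γ x y := by
  intro i j k m
  simp only [uMat_apply h, ← toGauge_mul]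
  rw [toGauge_rel T D (.decomposition _ α β _ _ _ _), finsum_fusion]
  · simp only [map_sum, map_smul, sum_prod_type]
    rfl
  · intro γ hγ
    simp [D.phi_eq_zero _ _ _ hγ]

end Link

lemma IsHol.smul {x y : V} {C : Matrix α α (GaugeAlg T D)} (h : IsHol hs α x y C) (c : ℂ) : IsHol hs
    α x y (c • C) := by
  intro p
  refine ((gaugeLin hs).map_smul c _).trans ((congrArg (c • ·) (h p)).trans ?_)
  rw [smul_sum]
  rfl

lemma Ex.smul {L P : M[α × β, β × α]} {C : Matrix α α (GaugeAlg T D)} {U : Matrix β β (GaugeAlg T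
    D)} (h : Ex L P C U) (c : ℂ) : Ex L P (c • C) U := by
  intro k l i j
  simp only [msmul_apply, smul_mul_assoc, mul_smul_comm, h k l i j, smul_sum, smul_comm c]

lemma chain_succ (α : Phys q) (x : ℕ → V) (n : ℕ) : chain T D α x (n + 1) = D.a α • (uMat T D α (x
    (n + 2)) (x (n + 1)) * chain T D α x n) := by
  rw [chain, A_eq]
  ext i j
  simp [mmul_apply, scalMul, mone_apply, ite_smul, smul_sum]
  exact sum_congr rfl fun _ _ => mul_smul_comm _ _ _

section Path

variable {x : ℕ → V} {n : ℕ}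

lemma IsSimplePath.pred (h : IsSimplePath T (n + 1) x) : IsSimplePath T n x :=
  ⟨fun i hi => h.1 i (by omega), h.2.mono (Set.Iic_subset_Iic.2 (by omega))⟩

lemma IsSimplePath.ne (h : IsSimplePath T n x) {i j : ℕ} (hi : i ≤ n + 1) (hj : j ≤ n + 1) (hij : i
    ≠ j) : x i ≠ x j := fun e => hij (h.2 hi hj e)

lemma chain_isHol (h : IsSimplePath T n x) (α : Phys q) : IsHol hs α (x (n + 1)) (x 0) (chain T D α
    x n) := by
  induction n with
  | zero => exact uMat_isHol (h.1 0 le_rfl) α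
  | succ n ih =>
    rw [chain_succ]
    exact ((uMat_isHol (h.1 _ le_rfl) α).comp (h.ne (by omega) (by omega) (by omega))
      (h.ne (by omega) (by omega) (by omega)) (h.ne (by omega) (by omega) (by omega))
      (ih h.pred)).smul _

lemma chain_ex (hs : s ^ 2 = q) (h : IsSimplePath T (n + 1) x) {y z : V} (hl : T.link y z) {L P :
    M[α × β, β × α]} (hW : Ex (flip α β) P (uMat T D α (x (n + 2)) (x (n + 1))) (uMat T D β y z))
    (hC : Ex L (flip α β) (chain T D α x n) (uMat T D β y z)) (hy : (y ≠ x (n + 2) ∧ y ≠ x (n + 1))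
    ∨ (y ≠ x (n + 1) ∧ y ≠ x 0)) (hz : (z ≠ x (n + 2) ∧ z ≠ x (n + 1)) ∨ (z ≠ x (n + 1) ∧ z ≠ x 0))
    : Ex L P (chain T D α x (n + 1)) (uMat T D β y z) := by
  rw [chain_succ]
  refine (hW.mul hC (uMat_isHol (hs := hs) hl β) (uMat_isHol (h.1 _ le_rfl) α) (chain_isHol h.pred
    α) fun v => ?_).smul _
  by_cases h1 : v = y
  · exact Or.inr (h1 ▸ hy)
  by_cases h2 : v = z
  · exact Or.inr (h2 ▸ hz)
  · exact Or.inl ⟨h1, h2⟩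

lemma chain_ex_flip (hs : s ^ 2 = q) (h : IsSimplePath T n x) {y z : V} (hl : T.link y z) (hy : ∀ i
    ≤ n + 1, x i ≠ y) (hz : ∀ i ≤ n + 1, x i ≠ z) : Ex (flip α β) (flip α β) (chain T D α x n) (uMat
    T D β y z) := by
  induction n with
  | zero =>
    exact uMat_ex_flip (h.1 0 le_rfl) hl (hy 1 (by omega)) (hz 1 (by omega)) (hy 0 (by omega))
      (hz 0 (by omega))
  | succ n ih =>
    exact chain_ex hs h hl (uMat_ex_flip (h.1 _ le_rfl) hl (hy _ le_rfl) (hz _ le_rfl)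
      (hy _ (by omega)) (hz _ (by omega))) (ih h.pred (fun i hi => hy i (by omega))
      fun i hi => hz i (by omega)) (Or.inl ⟨(hy _ le_rfl).symm, (hy _ (by omega)).symm⟩)
      (Or.inl ⟨(hz _ le_rfl).symm, (hz _ (by omega)).symm⟩)

lemma chain_ex_right (hs : s ^ 2 = q) (h : IsSimplePath T n x) {y : V} (hl : T.link (x 0) y) (hy : ∀
    i ≤ n + 1, x i ≠ y) {b : Bool} (ho : ord T b (x 0) y (x 1)) : Ex (exchR q s b α β) (flip α β)
    (chain T D α x n) (uMat T D β (x 0) y) := by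
  induction n with
  | zero => exact uMat_ex_right hs (h.1 0 le_rfl) hl ho
  | succ n ih =>
    have h1 := h.ne (i := n + 2) (j := 0) (by omega) (by omega) (by omega)
    have h2 := h.ne (i := n + 1) (j := 0) (by omega) (by omega) (by omega)
    exact chain_ex hs h hl (uMat_ex_flip (h.1 _ le_rfl) hl h1 (hy _ le_rfl) h2
      (hy _ (by omega))) (ih h.pred fun i hi => hy i (by omega)) (Or.inl ⟨h1.symm, h2.symm⟩)
      (Or.inl ⟨(hy _ le_rfl).symm, (hy _ (by omega)).symm⟩)

/-- The exchange of a path with the link that closes it. -/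
lemma chain_ex_loop (hs : s ^ 2 = q) (h : IsSimplePath T (n + 1) x) (hl : T.link (x 0) (x (n + 2)))
    {b b' : Bool} (ho : ord T b (x (n + 2)) (x 0) (x (n + 1))) (ho' : ord T b' (x 0) (x (n + 2)) (x
    1)) : Ex (exchR q s b' α β) (exchL q s b α β) (chain T D α x (n + 1)) (uMat T D β (x 0) (x (n +
    2))) := by
  have h1 := h.ne (i := n + 2) (j := 0) (by omega) (by omega) (by omega)
  have h2 := h.ne (i := n + 1) (j := 0) (by omega) (by omega) (by omega)
  have h3 := h.ne (i := n + 1) (j := n + 2) (by omega) (by omega) (by omega)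
  exact chain_ex hs h hl (uMat_ex_left hs (h.1 _ le_rfl) hl ho) (chain_ex_right hs h.pred hl
    (fun i hi => h.ne (by omega) (by omega) (by omega)) ho') (Or.inl ⟨h1.symm, h2.symm⟩)
    (Or.inr ⟨h3.symm, h1⟩)

lemma chain_ex_top (hs : s ^ 2 = q) (h : IsSimplePath T (n + 1) x) {b : Bool} (ho : ord T b (x (n +
    1)) (x (n + 2)) (x n)) : Ex (flip α β) (exchL q s b α β) (chain T D α x n) (uMat T D β (x (n +
    2)) (x (n + 1))) := by
  have hl := h.1 (n + 1) le_rfl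
  cases n with
  | zero => exact uMat_ex_left hs (h.1 0 (by omega)) hl ho
  | succ n =>
    exact chain_ex hs h.pred hl (uMat_ex_left hs (h.1 _ (by omega)) hl ho)
      (chain_ex_flip hs h.pred.pred hl (fun i hi => h.ne (by omega) (by omega) (by omega))
        fun i hi => h.ne (by omega) (by omega) (by omega))
      (Or.inr ⟨h.ne (by omega) (by omega) (by omega), h.ne (by omega) (by omega) (by omega)⟩)
      (Or.inr ⟨h.ne (by omega) (by omega) (by omega), h.ne (by omega) (by omega) (by omega)⟩)

end Path

/-! ### Decomposition of the holonomies along open paths -/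

/-- The contribution of a vertex to the normalization of a holonomy. -/
def kap (D : QuantumData q s) (b : Bool) (α : Phys q) : ℂ := D.kappa α ^ (if b then 1 else -1 : ℤ)

lemma kap_mul_lam (D : QuantumData q s) (b : Bool) (α β γ : Phys q) : kap D b α * D.a α * (kap D b β
    * D.a β) * fuseC D b α β γ = kap D b γ * D.a γ := by
  have h := kappa_ne_zero D
  have h' := fun δ => left_ne_zero_of_mul_eq_one (a_mul_b D δ)
  have := h α; have := h β; have := h γ; have := h' α; have := h' β
  cases b <;> simp [kap, fuseC, lam] <;> field_simp

section Path

variable {x : ℕ → V} {n : ℕ}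

lemma pathHol_succ {b : Bool} (h : ord T b (x (n + 1)) (x (n + 2)) (x n)) (γ : Phys q) : pathHol T D
    γ (n + 1) x = (kap D b γ * D.a γ) • (uMat T D γ (x (n + 2)) (x (n + 1)) * pathHol T D γ n
    x) := by
  rw [pathHol, pathHol, chain_succ, Finset.sum_range_succ, zpow_add₀ (kappa_ne_zero D γ),
    (sgn_eq_of_ord h).1, mmul_smul, smul_smul, smul_smul]
  congr 1
  simp only [kap]
  ring

lemma pathHol_isHol (h : IsSimplePath T n x) (α : Phys q) : IsHol hs α (x (n + 1)) (x 0) (pathHol T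
    D α n x) := (chain_isHol h α).smul _

lemma Fuses.step (hs : s ^ 2 = q) {b : Bool} {y z v : V} (hy : y ≠ v) (hz : z ≠ v) (hyz : y ≠ z) {U
    C : ∀ γ : Phys q, Matrix γ γ (GaugeAlg T D)} (hU : ∀ γ, IsHol hs γ y v (U γ)) (hC : ∀ γ, IsHol
    hs γ v z (C γ)) (fU : Fuses α β U) (fC : Fuses α β C) (ex : Ex (flip α β) (exchL q s b α β) (C
    α) (U β)) : Fuses α β fun γ => (kap D b γ * D.a γ) • (U γ * C γ) := by
  intro i l i' l'
  have hf := fuse b hy hU hC fU fC ex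
    (r := Pi.single (idx4 (X := posL α) (Y := negL α) (Z := posL β) (W := negL β) i l i' l') 1)
    (by rw [Matrix.vecMul_vecMul, outer_path_mul_self hy hz hyz]) fun γ h => by
      rw [Matrix.vecMul_vecMul, outer_mul_pairMid hy hz hyz (posL α) (posL β) (negL α) (negL β),
        pairProj_mul_of_fusion D (X := posL α) (Y := posL β) (Z := posL γ) h (D.phi_intertwiner α β
        γ), pairProj_mul_of_fusion D (X := negL α) (Y := negL β) (Z := negL γ) h (chi_isIntertwiner
        D α β γ)]
  have e : ∀ (γ : Phys q) (p : γ × γ), vecMul (vecMul (Pi.single (idx4 (X := posL α) (Y := negL α)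
    (Z := posL β) (W := negL β) i l i' l') 1) (exchMid (flip α β))) (pairMid (D.phi α β γ) (chi D α
    β γ)) p = D.phi α β γ (i, i') p.1 * chi D α β γ (l, l') p.2 := by
    intro γ p
    rw [Matrix.single_one_vecMul]
    refine (vecMul_pairMid (X := posL α) (Y := posL β) (Z := negL α) (W := negL β) _ _ _ _).trans ?_
    have : ∀ (x : α) (y : β) (z : α) (w : β), exchMid (X := posL α) (Y := negL α) (Z := posL β)
      (W := negL β) (flip α β) (idx4 i l i' l') (idx4 x y z w) = if i = x then if i' = y then if l =
      z then if l' = w then 1 else 0 else 0 else 0 else 0 := by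
      intro x y z w
      change I[α] i x * flip α β (l, i') (y, z) * I[β] l' w = _
      simp [flip, mone_apply, ← ite_and]
      exact if_congr (by tauto) rfl rfl
    refine (sum_congr rfl fun x _ => sum_congr rfl fun y _ => sum_congr rfl fun z _ => sum_congr rfl
      fun w _ => congrArg (· * _) (this x y z w)).trans ?_
    simp [ite_mul]
  simp only [e, Pi.single_apply, ite_smul, Finset.sum_ite_eq', mem_univ, if_true, one_smul,
    zero_smul] at hf
  change ((kap D b α * D.a α) • (U α * C α) i l) * ((kap D b β * D.a β) • (U β * C β) i' l') = _
  rw [smul_mul_smul_comm]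
  refine (congrArg _ hf).trans ?_
  simp only [smul_sum, smul_smul, msmul_apply]
  refine sum_congr rfl fun γ _ => sum_congr rfl fun p _ => ?_
  rw [← kap_mul_lam D b α β γ]
  congr 1
  ring

lemma pathHol_fuses (hs : s ^ 2 = q) (h : IsSimplePath T n x) (α β : Phys q) : Fuses α β fun γ =>
    pathHol T D γ n x := by
  induction n with
  | zero =>
    simp only [pathHol, Finset.range_zero, Finset.sum_empty, zpow_zero, one_smul]
    exact uMat_fuses (h.1 0 le_rfl) α β
  | succ n ih =>
    obtain ⟨b, ho⟩ := exists_ord (T := T) (h.1 (n + 1) le_rfl) (h.1 n (by omega))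
      (h.ne (by omega) (by omega) (by omega))
    simp only [pathHol_succ ho]
    exact Fuses.step hs (h.ne (by omega) (by omega) (by omega)) (h.ne (by omega) (by omega)
      (by omega)) (h.ne (by omega) (by omega) (by omega))
      (fun γ => uMat_isHol (hs := hs) (h.1 _ le_rfl) γ) (fun γ => pathHol_isHol h.pred γ)
      (uMat_fuses (h.1 _ le_rfl) α β) (ih h.pred) ((chain_ex_top hs h ho).smul _)

lemma pathHol_mul (hs : s ^ 2 = q) (h : IsSimplePath T n x) (i j : α) (k m : β) : pathHol T D α n x
    i j * pathHol T D β n x k m = ∑ᶠ γ : Phys q, ∑ a, ∑ b, (D.phi α β γ (i, k) a * (D.psi β α γ *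
    D.fInv β α) b (m, j)) • pathHol T D γ n x a b := by
  rw [pathHol_fuses hs h α β, finsum_fusion]
  · simp only [sum_prod_type]
    rfl
  · intro γ hγ
    simp [D.phi_eq_zero _ _ _ hγ]

end Path

section

/-! ### Wilson loops -/

/-- The quantum trace. -/
def trK (M : Matrix α α (GaugeAlg T D)) : GaugeAlg T D := ∑ p : α × α, α.rep.K q p.1 p.2 • M p.1 p.2

lemma trK_smul (c : ℂ) (M : Matrix α α (GaugeAlg T D)) : trK (c • M) = c • trK M := by
  simp only [trK, msmul_apply, smul_sum, smul_comm c]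

/-- The normalization of a Wilson loop. -/
def wilsonC (D : QuantumData q s) (b b' : Bool) (α : Phys q) : ℂ := kap D b α * kap D b' α * D.a α ^
  2 * (-1) ^ α.1

variable {x : ℕ → V} {n : ℕ}

lemma IsSimpleLoop.path (h : IsSimpleLoop T (n + 2) x) : IsSimplePath T (n + 1) x := ⟨fun i _ =>
  h.2.2.1 i, h.2.2.2⟩

lemma IsSimpleLoop.closed (h : IsSimpleLoop T (n + 2) x) : x (n + 3) = x 0 := by simpa using h.2.1 0

lemma IsSimpleLoop.link (h : IsSimpleLoop T (n + 2) x) : T.link (x 0) (x (n + 2)) := h.closed ▸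
  h.2.2.1 (n + 2)

lemma IsSimpleLoop.exists_ord (h : IsSimpleLoop T (n + 2) x) : ∃ b b', ord T b (x (n + 2)) (x 0) (x
    (n + 1)) ∧ ord T b' (x 0) (x (n + 2)) (x 1) := by
  obtain ⟨b, hb⟩ := QGauge.exists_ord (T := T) h.link (h.path.1 (n + 1) le_rfl)
    (h.path.ne (by omega) (by omega) (by omega))
  obtain ⟨b', hb'⟩ := QGauge.exists_ord (T := T) (h.path.1 0 (by omega)) h.link
    (h.path.ne (by omega) (by omega) (by omega))
  exact ⟨b, !b', hb, by cases b' <;> exact hb'⟩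

lemma wilson_eq (hs : s ^ 2 = q) (h : IsSimpleLoop T (n + 2) x) {b b' : Bool} (ho : ord T b (x (n +
    2)) (x 0) (x (n + 1))) (ho' : ord T b' (x 0) (x (n + 2)) (x 1)) (α : Phys q) : wilson T D α (n +
    2) x = wilsonC D b b' α • trK (uMat T D α (x 0) (x (n + 2)) * pathHol T D α (n + 1) x) := by
  have e : antipode α (D.A α) * D.mu α = (D.a α * (-1) ^ α.1) • α.rep.K q := by
    have h1 : dualIso α * (D.a α • I[α]) * dualIsoInv α = D.a α • I[α] := by
      rw [mmul_smul, smul_mul, mmul_one, dualIso_mul_inv]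
    rw [A_eq, mu_eq D hs, antipode, h1, transpose_smul, transpose_one, smul_mul_smul_comm, mone_mul]
  have e' : loopHol T D α (n + 2) x = (kap D b α * kap D b' α * D.a α) • (uMat T D α (x 0) (x (n +
    2)) * pathHol T D α (n + 1) x) := by
    rw [loopHol, Finset.sum_range_succ, h.closed, (sgn_eq_of_ord ho).1, (sgn_eq_of_ord ho').2,
      chain_succ, h.closed, pathHol, mmul_smul, smul_smul, smul_smul, sub_eq_add_neg, zpow_add₀
      (kappa_ne_zero D α), zpow_add₀ (kappa_ne_zero D α)]
    congr 1
    have : -(if b' = true then -1 else 1 : ℤ) = if b' then 1 else -1 := by cases b' <;> rfl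
    rw [this]
    simp only [kap]
    ring
  have e'' : ∀ M : Matrix α α (GaugeAlg T D), ∀ c : ℂ, (scalMul T D (c • α.rep.K q) M).trace = c •
    trK M := by
    intro M c
    simp [trace, scalMul, trK, K, diagonal_apply, sum_prod_type, ite_smul, smul_sum, smul_smul]
  rw [wilson, e, e', e'', trK_smul, smul_smul, wilsonC]
  congr 1
  ring

lemma wilsonC_mul (D : QuantumData q s) (b b' : Bool) (h : (-1 : ℂ) ^ γ.1 = (-1) ^ α.1 * (-1) ^ β.1)
    : wilsonC D b b' α * wilsonC D b b' β * (fuseC D b α β γ * fuseC D b' α β γ) = wilsonC D b b'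
    γ := by
  have h1 := kap_mul_lam D b α β γ
  have h2 := kap_mul_lam D b' α β γ
  calc _ = (kap D b α * D.a α * (kap D b β * D.a β) * fuseC D b α β γ) *
      (kap D b' α * D.a α * (kap D b' β * D.a β) * fuseC D b' α β γ) *
      ((-1) ^ α.1 * (-1) ^ β.1) := by simp only [wilsonC]; ring
    _ = _ := by rw [h1, h2, ← h, wilsonC]; ring

lemma loop_mid (hs : s ^ 2 = q) (D : QuantumData q s) (b : Bool) (h : fusion α β γ ≠ 0) (p : γ × γ)
    : vecMul (vecMul (fun I : Idx (word4 (posL α) (negL α) (posL β) (negL β)) => α.rep.K q (I 0) (I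
    1) * β.rep.K q (I 2) (I 3)) (exchMid (exchR q s b α β))) (pairMid (D.phi α β γ) (chi D α β γ)) p
    = fuseC D b α β γ * γ.rep.K q p.1 p.2 := by
  refine (vecMul_pairMid (X := posL α) (Y := posL β) (Z := negL α) (W := negL β) _ _ _ _).trans ?_
  have h1 : ∀ (x : α) (y : β) (z : α) (w : β), vecMul (fun I : Idx (word4 (posL α) (negL α) (posL β)
    (negL β)) => α.rep.K q (I 0) (I 1) * β.rep.K q (I 2) (I 3)) (exchMid (exchR q s b α β)) (idx4 x
    y z w) = q ^ α.rep.wt x * exchR q s b α β (x, w) (y, z) * q ^ β.rep.wt w := by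
    intro x y z w
    refine (vecMul_exchMid (X := posL α) (Y := negL α) (Z := posL β) (W := negL β) _ _).trans ?_
    change ∑ y', ∑ z', α.rep.K q x y' * β.rep.K q z' w * exchR q s b α β (y', z') (y, z) = _
    simp [K, diagonal_apply, ite_mul, mul_right_comm]
  have h2 := (D.phi_intertwiner β α γ).2.2
  rw [tensor_K] at h2
  have h3 : γ.rep.K q = D.psi β α γ * ((β.rep.K q ⊗ₖ α.rep.K q) * D.phi β α γ) := by
    rw [← h2, ← mmul_assoc, D.psi_mul_phi _ _ _ (fusion_symm hs D h), mone_mul]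
  have h4 : γ.rep.K q p.1 p.2 = ∑ w, ∑ z, D.psi β α γ p.2 (w, z) * (q ^ β.rep.wt w * q ^ α.rep.wt z
    * D.phi β α γ (w, z) p.1) := by
    refine (congr_fun₂ (K_transpose γ.rep) p.2 p.1).trans ?_
    refine (congr_fun₂ h3 p.2 p.1).trans ?_
    rw [mmul_apply, sum_prod_type]
    simp only [K, Matrix.diagonal_kronecker_diagonal, diagonal_mul]
  have h5 : ∀ z w, chi D α β γ (z, w) p.2 = D.a γ / (D.a β * D.a α) * D.psi β α γ p.2 (w, z) := fun
    z w => congr_fun₂ (psi_mul_fInv D β α γ) p.2 (w, z)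
  calc _ = ∑ w, ∑ z, q ^ β.rep.wt w * chi D α β γ (z, w) p.2 * ∑ x, ∑ y,
        q ^ α.rep.wt x * exchR q s b α β (x, w) (y, z) * D.phi α β γ (x, y) p.1 := by
        refine (sum_congr rfl fun x _ => sum_congr rfl fun y _ => (sum_congr rfl fun z _ =>
          sum_congr rfl fun w _ => congrArg (· * _) (h1 x y z w)).trans sum_comm).trans ?_
        simp only [mul_sum]
        refine (sum_congr rfl fun x _ => sum_comm.trans (sum_congr rfl fun w _ => sum_comm)).trans
          (sum_comm.trans (sum_congr rfl fun w _ => sum_comm.trans (sum_congr rfl fun z _ =>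
          sum_congr rfl fun x _ => sum_congr rfl fun y _ => ?_)))
        ring
    _ = _ := by
        simp only [exchR_phi hs D b h, h5, h4, fuseC, mul_sum]
        refine sum_congr rfl fun w _ => sum_congr rfl fun z _ => ?_
        ring

lemma trK_mul_trK (M : Matrix α α (GaugeAlg T D)) (N : Matrix β β (GaugeAlg T D)) : trK M * trK N =
    ∑ I : Idx (word4 (posL α) (negL α) (posL β) (negL β)), (α.rep.K q (I 0) (I 1) * β.rep.K q (I 2)
    (I 3)) • (M (I 0) (I 1) * N (I 2) (I 3)) := by
  refine Eq.trans ?_ (sum_idx4 _).symm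
  simp only [trK, sum_mul_sum, smul_mul_smul_comm, sum_prod_type]
  exact sum_congr rfl fun _ _ => sum_comm

lemma wilson_mul (hs : s ^ 2 = q) (h : IsSimpleLoop T n x) (α β : Phys q) :
    wilson T D α n x * wilson T D β n x =
      ∑ᶠ γ : Phys q, (fusion α β γ : ℂ) • wilson T D γ n x := by
  obtain ⟨n, rfl⟩ : ∃ m, n = m + 2 := ⟨n - 2, (Nat.sub_add_cancel h.1).symm⟩
  obtain ⟨b, b', ho, ho'⟩ := h.exists_ord
  have h1 := h.path.ne (i := 0) (j := n + 2) (by omega) (by omega) (by omega)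
  have k1 := rowM_K_isIntertwiner (q := q) α.rep
  have k2 := rowM_K_isIntertwiner (q := q) β.rep
  have hf := fuse (D := D) b h1 (fun γ => uMat_isHol (hs := hs) h.link γ)
    (fun γ => pathHol_isHol h.path γ) (uMat_fuses h.link α β) (pathHol_fuses hs h.path α β)
    ((chain_ex_loop hs h.path h.link ho ho').smul _)
    (r := fun I => α.rep.K q (I 0) (I 1) * β.rep.K q (I 2) (I 3))
    (by simp only [outer_loop h1]
        exact congrArg (vecMul · _) (vecMul_proj_true (X := posL α) (Y := negL α) (Z := posL β) (W := negL β) k1 k2))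
    fun γ _ => by
      simp only [outer_loop h1]
      exact vecMul_proj_false (X := posL α) (Y := negL α) (Z := posL β) (W := negL β)
        (A := posL γ) (B := negL γ) k1 k2 (exchR_isIntertwiner hs b' α β)
        (D.phi_intertwiner α β γ) (chi_isIntertwiner D α β γ)
  rw [finsum_fusion (α := α) (β := β) _ fun γ hγ => by simp [hγ]]
  simp only [wilson_eq hs h ho ho', smul_mul_smul_comm]
  rw [trK_mul_trK, hf, smul_sum]
  refine sum_congr rfl fun γ hγ => ?_
  have hγ := (mem_fusionSet).1 hγ
  have e1 : fusion α β γ = 1 := le_antisymm (fusion_le_one α β γ) (Nat.one_le_iff_ne_zero.2 hγ)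
  have e2 := (hom_grading (D.phi_intertwiner α β γ) fun h0 => by
    have := D.psi_mul_phi α β γ hγ
    rw [h0, mmul_zero] at this
    have := congr_fun₂ this 0 0
    simp at this).2
  rw [e1, Nat.cast_one, one_smul, ← wilsonC_mul D b b' e2, trK, smul_sum, smul_sum]
  refine sum_congr rfl fun p _ => ?_
  rw [loop_mid hs D b' hγ, smul_smul, smul_smul]
  congr 1
  ring

/-! ### Gauge invariance of Wilson loops -/

lemma trK_invariant {x y : V} (h : x ≠ y) {U C : Matrix α α (GaugeAlg T D)} (hU : IsHol hs α x y U)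
    (hC : IsHol hs α y x C) : gaugeCoaction hs (trK (U * C)) = trK (U * C) ⊗ₜ[ℂ] symUnit D := by
  have h1 := (hU.mul hC).linear (J := Unit) (F' := fun _ _ _ => unit Dᵒ) (fun _ p => α.rep.K q p.1.1
    p.2.2 * if p.1.2 = p.2.1 then 1 else 0) (by
      rintro - ⟨⟨i, j⟩, ⟨k, l⟩⟩
      simp only [pure_edgeF_mul_swap h]
      have e1 := congr_fun₂ (coact_functional D (X := negL α) (Y := posL α) (evM_isIntertwiner
        α.rep)) 0 (j, k)
      have e2 := congr_fun₂ (coact_functional D (X := posL α) (Y := negL α) (rowM_K_isIntertwiner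
        α.rep)) 0 (i, l)
      simp only [lmul, rmul, univ_unique, sum_singleton, tmul, unitG, evM, rowM, of_apply] at e1 e2
      have e3 := (sum_atVertices D h _ _ _ _).trans (congrArg₂ (atVertices D x y) e2 e1)
      rw [atVertices_smul_left, atVertices_smul_right h, atVertices_unit, smul_smul] at e3
      refine Eq.trans ?_ (e3.trans (by simp [mone_apply]; rfl))
      simp only [sum_prod_type]
      exact sum_congr rfl fun _ _ => (sum_congr rfl fun _ _ => sum_comm).trans sum_comm)
  have e : ∑ p : (α × α) × (α × α), (α.rep.K q p.1.1 p.2.2 * if p.1.2 = p.2.1 then 1 else 0 : ℂ) •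
    (U p.1.1 p.1.2 * C p.2.1 p.2.2) = trK (U * C) := by
    simp [trK, sum_prod_type, mmul_apply, smul_sum, ite_smul]
    exact sum_congr rfl fun _ _ => sum_comm
  refine (congrArg (gaugeCoaction hs) e.symm).trans ((h1 ()).trans ?_)
  rw [univ_unique, sum_singleton]
  exact congrArg (· ⊗ₜ[ℂ] symUnit D) e

lemma wilson_invariant (hs : s ^ 2 = q) (h : IsSimpleLoop T n x) (α : Phys q) : gaugeCoaction hs
    (wilson T D α n x) = wilson T D α n x ⊗ₜ[ℂ] symUnit D := by
  obtain ⟨n, rfl⟩ : ∃ m, n = m + 2 := ⟨n - 2, (Nat.sub_add_cancel h.1).symm⟩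
  obtain ⟨b, b', ho, ho'⟩ := h.exists_ord
  rw [wilson_eq hs h ho ho', map_smul, trK_invariant (h.path.ne (i := 0) (j := n + 2)
    (by omega) (by omega) (by omega)) (uMat_isHol h.link α) (pathHol_isHol h.path α)]
  rfl

end

section

/-! ### Cyclicity of Wilson loops -/

lemma trK_cycle (hs : s ^ 2 = q) {b b' : Bool} {P Q : Matrix α α (GaugeAlg T D)} (h : Ex (exchR q s
    b' α α) (exchL q s b α α) P Q) : trK (P * Q) = (evFactor D b' α * evFactor D b α) • trK (Q *
    P) := by
  have e1 : ∀ p, ∑ l, exchR q s b' α α (l, l) p = evFactor D b' α * α.rep.K q p.1 p.2 := by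
    intro p
    have := congr_fun₂ (ev_mul_exchR hs D b' α) 0 p
    simpa [mmul_apply, evM, rowM, sum_prod_type, mone_apply] using this
  have e2 : ∀ p, ∑ k, ∑ j, α.rep.K q k j * exchL q s b α α (k, j) p = evFactor D b α * I[α] p.1
    p.2 := by
    intro p
    have := congr_fun₂ (K_mul_exchL hs D b α) 0 p
    simpa [mmul_apply, evM, rowM, sum_prod_type] using this
  calc trK (P * Q) = ∑ p : (α × α) × (α × α),
        ((∑ l, exchR q s b' α α (l, l) p.1) * ∑ k, ∑ j, α.rep.K q k j *
          exchL q s b α α (k, j) p.2) • (Q p.1.1 p.2.1 * P p.2.2 p.1.2) := by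
        rw [trK, sum_prod_type]
        simp only [mmul_apply, h _ _ _ _, smul_sum, sum_mul, mul_sum, sum_smul, smul_smul]
        refine (sum_congr rfl fun k _ => (sum_congr rfl fun j _ => sum_comm).trans sum_comm).trans
          (sum_comm.trans (sum_congr rfl fun p _ => sum_congr rfl fun k _ => sum_congr rfl fun j _
          => sum_congr rfl fun l _ => ?_))
        rw [mul_left_comm]
    _ = _ := by
        simp only [e1, e2]
        rw [sum_prod_type (α₁ := _ × _), trK, smul_sum]
        refine sum_congr rfl fun p _ => ?_
        simp only [mone_apply, sum_prod_type, mmul_apply, smul_sum, mul_ite, ite_smul, mul_one,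
          mul_zero, zero_smul, sum_ite_eq, mem_univ, if_true, smul_smul, mul_right_comm]

lemma IsHol.matrix_assoc {x x' y y' z z' : V} {U C W : Matrix α α (GaugeAlg T D)} (hU : IsHol hs α x
    x' U) (hC : IsHol hs α y y' C) (hW : IsHol hs α z z' W) (h : ∀ v, (v ≠ x ∧ v ≠ x') ∨ (v ≠ y ∧ v
    ≠ y') ∨ (v ≠ z ∧ v ≠ z')) : U * C * W = U * (C * W) := by
  ext i j
  simp only [mmul_apply, sum_mul, mul_sum, hU.assoc hC hW h]
  exact sum_comm

variable {x : ℕ → V} {n : ℕ}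

lemma IsSimplePath.shift (h : IsSimplePath T (n + 1) x) : IsSimplePath T n fun i => x (i + 1) :=
  ⟨fun i hi => h.1 (i + 1) (by omega), fun i hi j hj e => by
    have := h.2 (Set.mem_Iic.2 (Nat.succ_le_succ hi)) (Set.mem_Iic.2 (Nat.succ_le_succ hj)) e
    omega⟩

lemma IsSimpleLoop.shift (h : IsSimpleLoop T n x) : IsSimpleLoop T n fun i => x (i + 1) := by
  refine ⟨h.1, fun i => (congrArg x (by ring)).trans (h.2.1 (i + 1)), fun i => h.2.2.1 (i + 1),
    fun i hi j hj e => ?_⟩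
  have hc : x (n + 1) = x 0 := by simpa using h.2.1 0
  simp only [Set.mem_Iic] at hi hj
  have key : ∀ i ≤ n, ∃ k ≤ n, x (i + 1) = x k ∧ (k = i + 1 ∨ k = 0 ∧ i = n) := fun i hi => by
    obtain hi | rfl := Nat.lt_or_eq_of_le hi
    · exact ⟨i + 1, hi, rfl, .inl rfl⟩
    · exact ⟨0, by omega, hc, .inr ⟨rfl, rfl⟩⟩
  obtain ⟨k, hk, e1, h1⟩ := key i hi
  obtain ⟨m, hm, e2, h2⟩ := key j hj
  have := h.2.2.2 (Set.mem_Iic.2 hk) (Set.mem_Iic.2 hm) (e1.symm.trans (e.trans e2))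
  omega

lemma pathHol_succ_right (hs : s ^ 2 = q) (h : IsSimplePath T (n + 1) x) {b : Bool} (ho : ord T b (x
    1) (x 2) (x 0)) (α : Phys q) : pathHol T D α (n + 1) x = (kap D b α * D.a α) • (pathHol T D α n
    (fun i => x (i + 1)) * uMat T D α (x 1) (x 0)) := by
  induction n with
  | zero =>
    rw [pathHol_succ ho]
    simp [pathHol, chain]
  | succ n ih =>
    obtain ⟨d, hd⟩ := exists_ord (T := T) (h.1 (n + 2) le_rfl) (h.1 (n + 1) (by omega))
      (h.ne (by omega) (by omega) (by omega))
    have n1 := h.ne (i := n + 3) (j := 0) (by omega) (by omega) (by omega)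
    have n2 := h.ne (i := n + 3) (j := 1) (by omega) (by omega) (by omega)
    have n3 := h.ne (i := n + 2) (j := 0) (by omega) (by omega) (by omega)
    have n4 := h.ne (i := n + 2) (j := 1) (by omega) (by omega) (by omega)
    rw [pathHol_succ hd, ih h.pred, pathHol_succ (x := fun i => x (i + 1)) hd, mmul_smul,
      smul_mul, smul_comm, IsHol.matrix_assoc (uMat_isHol (hs := hs)
        (h.1 (n + 2) le_rfl) α) (pathHol_isHol h.pred.shift α) (uMat_isHol (h.1 0 (by omega)) α)]
    intro v
    by_cases h1 : v = x 1
    · exact .inl (by subst h1; exact ⟨n2.symm, n4.symm⟩)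
    by_cases h0 : v = x 0
    · exact .inl (by subst h0; exact ⟨n1.symm, n3.symm⟩)
    · exact .inr (.inr ⟨h1, h0⟩)

lemma kap_mul_evFactor (D : QuantumData q s) (b : Bool) (α : Phys q) : kap D b α * evFactor D (!b) α
    = (-1) ^ α.1 * kap D (!b) α := by
  have := kappa_ne_zero D α
  have e : ((-1 : ℂ) ^ α.1)⁻¹ = (-1) ^ α.1 := by rw [← inv_pow]; norm_num
  cases b <;> simp [kap, evFactor, e] <;> field_simp

lemma ord_not {b : Bool} {v a c : V} (h : ord T b v a c) : ord T (!b) v c a := by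
  cases b <;> exact h

lemma trK_loop (hs : s ^ 2 = q) (h : IsSimpleLoop T (n + 2) x) {b b' : Bool} (ho : ord T b (x (n +
  2)) (x 0) (x (n + 1))) (ho' : ord T b' (x 0) (x (n + 2)) (x 1)) (α : Phys q) : trK (pathHol T D α
  (n + 1) x * uMat T D α (x 0) (x (n + 2))) = (evFactor D b' α * evFactor D b α) • trK (uMat T D α
  (x 0) (x (n + 2)) * pathHol T D α (n + 1) x) := trK_cycle hs ((chain_ex_loop hs h.path h.link ho
  ho').smul _)

lemma IsSimpleLoop.matrix_assoc (hs : s ^ 2 = q) (h : IsSimpleLoop T (n + 2) x) (α : Phys q) : uMat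
    T D α (x 0) (x (n + 2)) * pathHol T D α n (fun i => x (i + 1)) * uMat T D α (x 1) (x 0) = uMat T
    D α (x 0) (x (n + 2)) * (pathHol T D α n (fun i => x (i + 1)) * uMat T D α (x 1) (x 0)) := by
  have n1 := h.path.ne (i := 1) (j := 0) (by omega) (by omega) (by omega)
  have n2 := h.path.ne (i := n + 2) (j := 0) (by omega) (by omega) (by omega)
  have n3 := h.path.ne (i := n + 2) (j := 1) (by omega) (by omega) (by omega)
  refine IsHol.matrix_assoc (uMat_isHol (hs := hs) h.link α)
    (pathHol_isHol h.path.shift α) (uMat_isHol (h.path.1 0 (by omega)) α) fun v => ?_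
  by_cases h1 : v = x 1
  · exact .inl (by subst h1; exact ⟨n1, n3.symm⟩)
  by_cases h0 : v = x 0
  · exact .inr (.inl (by subst h0; exact ⟨n2.symm, n1.symm⟩))
  · exact .inr (.inr ⟨h1, h0⟩)

lemma wilsonC_shift (D : QuantumData q s) (b b' c : Bool) (α : Phys q) : wilsonC D b b' α * (kap D c
    α * D.a α) * (evFactor D (!c) α * evFactor D (!b') α) = wilsonC D (!b') (!c) α * (kap D b α *
    D.a α) := by
  have h1 := kap_mul_evFactor D b' α
  have h2 := kap_mul_evFactor D c α
  have h3 : ((-1 : ℂ) ^ α.1) * (-1) ^ α.1 = 1 := by rw [← mul_pow]; norm_num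
  calc _ = kap D b α * D.a α ^ 3 * (-1) ^ α.1 * (kap D b' α * evFactor D (!b') α) *
      (kap D c α * evFactor D (!c) α) := by rw [wilsonC]; ring
    _ = (kap D (!b') α * kap D (!c) α * D.a α ^ 2 * (-1) ^ α.1) * (kap D b α * D.a α) *
      ((-1) ^ α.1 * (-1) ^ α.1) := by rw [h1, h2]; ring
    _ = _ := by rw [h3, mul_one, wilsonC]

lemma wilson_shift (hs : s ^ 2 = q) (h : IsSimpleLoop T (n + 2) x) (α : Phys q) : wilson T D α (n +
    2) (fun i => x (i + 1)) = wilson T D α (n + 2) x := by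
  obtain ⟨b, b', ho, ho'⟩ := h.exists_ord
  obtain ⟨c, hc⟩ := exists_ord (T := T) (h.path.1 1 (by omega)) (h.path.1 0 (by omega))
    (h.path.ne (by omega) (by omega) (by omega))
  have hcl := h.closed
  have o1 : ord T (!b') (x (n + 3)) (x 1) (x (n + 2)) := hcl.symm ▸ ord_not ho'
  have o2 : ord T (!c) (x 1) (x (n + 3)) (x 2) := hcl.symm ▸ ord_not hc
  have o3 : ord T b (x (n + 2)) (x (n + 3)) (x (n + 1)) := hcl.symm ▸ ho
  have h1 : trK (pathHol T D α (n + 1) (fun i => x (i + 1)) * uMat T D α (x 1) (x (n + 3))) =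
    (evFactor D (!c) α * evFactor D (!b') α) • trK (uMat T D α (x 1) (x (n + 3)) * pathHol T D α (n
    + 1) fun i => x (i + 1)) := trK_loop (x := fun i => x (i + 1)) hs h.shift o1 o2 α
  have h2 : pathHol T D α (n + 1) (fun i => x (i + 1)) = (kap D b α * D.a α) • (uMat T D α (x (n +
    3)) (x (n + 2)) * pathHol T D α n fun i => x (i + 1)) := pathHol_succ (x := fun i => x (i + 1))
    o3 α
  have h3 : wilson T D α (n + 2) (fun i => x (i + 1)) = wilsonC D (!b') (!c) α • trK (uMat T D α (x
    1) (x (n + 3)) * pathHol T D α (n + 1) fun i => x (i + 1)) := wilson_eq (x := fun i => x (i +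
    1)) hs h.shift o1 o2 α
  have h4 : kap D b α * D.a α ≠ 0 := mul_ne_zero (zpow_ne_zero _ (kappa_ne_zero D α))
    (left_ne_zero_of_mul_eq_one (a_mul_b D α))
  rw [hcl] at h1 h2 h3
  have h5 := h1
  rw [h2, smul_mul, trK_smul, ← h2] at h5
  rw [h3, wilson_eq hs h ho ho', pathHol_succ_right hs h.path hc, mmul_smul, trK_smul, smul_smul, ←
    h.matrix_assoc hs]
  refine smul_right_injective _ h4 ?_
  simp only
  rw [smul_comm _ (wilsonC D b b' α * _), h5, smul_smul, smul_smul, wilsonC_shift, mul_comm]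

lemma wilson_shift_iterate (hs : s ^ 2 = q) (h : IsSimpleLoop T (n + 2) x) (α : Phys q) (k : ℕ) :
    wilson T D α (n + 2) (fun i => x (i + k)) = wilson T D α (n + 2) x := by
  induction k generalizing x with
  | zero => rfl
  | succ k ih => exact (ih h.shift).trans (wilson_shift hs h α)

end

end QGauge

end

theorem mainTheorem6 {V : Type} [Fintype V] [DecidableEq V] (T : QGauge.CiliatedSurface V)
    (q s : ℂ) (hs : s ^ 2 = q) (hq0 : q ≠ 0) (hq1 : q ≠ 1) (hq2 : q ≠ -1)
    (D : QGauge.QuantumData q s) :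
    -- gauge invariance
    ((∃! Ω, QGauge.IsGaugeCoaction T D Ω) ∧
      ∀ Ω, QGauge.IsGaugeCoaction T D Ω →
        ∀ (α : QGauge.Phys q) (n : ℕ) (x : ℕ → V), QGauge.IsSimpleLoop T n x →
          Ω (QGauge.wilson T D α n x) = QGauge.wilson T D α n x ⊗ₜ[ℂ] QGauge.symUnit D) ∧
    -- independence of the departure point
    (∀ (α : QGauge.Phys q) (n : ℕ) (x : ℕ → V), QGauge.IsSimpleLoop T n x →
      ∀ k : ℕ, QGauge.wilson T D α n (fun i => x (i + k)) = QGauge.wilson T D α n x) ∧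
    -- fusion
    (∀ (α β : QGauge.Phys q) (n : ℕ) (x : ℕ → V), QGauge.IsSimpleLoop T n x →
      {γ : QGauge.Phys q | QGauge.fusion α β γ ≠ 0}.Finite ∧
      QGauge.wilson T D α n x * QGauge.wilson T D β n x =
        ∑ᶠ γ : QGauge.Phys q, (QGauge.fusion α β γ : ℂ) • QGauge.wilson T D γ n x) ∧
    -- decomposition of holonomies along simple open paths
    (∀ (α β : QGauge.Phys q) (n : ℕ) (x : ℕ → V), QGauge.IsSimplePath T n x →
      ∀ (i j : Fin α.dim) (k m : Fin β.dim),
        QGauge.pathHol T D α n x i j * QGauge.pathHol T D β n x k m =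
          ∑ᶠ γ : QGauge.Phys q, ∑ a, ∑ b,
            (D.phi α β γ (i, k) a * (D.psi β α γ * D.fInv β α) b (m, j)) •
              QGauge.pathHol T D γ n x a b) := by
  have := QGauge.admissible_of_ne hq0 hq1 hq2
  have hΩ := QGauge.gaugeCoaction_isGaugeCoaction (T := T) (D := D) hs
  refine ⟨⟨⟨_, hΩ, fun Ω h => QGauge.gaugeCoaction_unique h hΩ⟩, fun Ω h α n x hx => ?_⟩,
    fun α n x hx k => ?_, fun α β n x hx => ⟨QGauge.fusion_finite α β,
      QGauge.wilson_mul hs hx α β⟩, fun α β n x hx i j k m => QGauge.pathHol_mul hs hx i j k m⟩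
  · rw [QGauge.gaugeCoaction_unique h hΩ]
    exact QGauge.wilson_invariant hs hx α
  · obtain ⟨n, rfl⟩ : ∃ m, n = m + 2 := ⟨n - 2, (Nat.sub_add_cancel hx.1).symm⟩
    exact QGauge.wilson_shift_iterate hs hx α k
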